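/- Let $k$ be an algebraically closed field of characteristic $0$, let $G$ be a finite group and let $\alpha:G^3\to k^*$ be a normalised 3-cocycle, $\alpha(g,h,l)\,\alpha(f,gh,l)\,\alpha(f,g,h)=\alpha(fg,h,l)\,\alpha(f,g,hl)$. Let $\mathcal V=\mathcal V(G,\alpha)$ be the monoidal category of finite-dimensional $G$-graded vector spaces with associativity constraint $v\otimes(u\otimes w)\mapsto\alpha(f,g,h)\,(v\otimes u)\otimes w$ for $v\in V_f,\ u\in U_g,\ w\in W_h$, and let $\mathcal Z=\mathcal Z(G,\alpha)$ be its monoidal (Drinfeld) centre. Put $$\alpha(f,g|h)=\frac{\alpha(f,ghg^{-1},g)}{\alpha(f,g,h)\,\alpha((fg)h(fg)^{-1},f,g)},\qquad \alpha(f|g,h)=\frac{\alpha(f,g,h)\,\alpha(fgf^{-1},fhf^{-1},f)}{\alpha(fgf^{-1},f,h)}.$$ A graded space $X$ with linear automorphisms $x\mapsto f.x$ $(f\in G)$ such that $f.X_g=X_{fgf^{-1}}$ and $(fg).x=\alpha(f,g|h)\,f.(g.x)$ for $x\in X_h$ is regarded as an object of $\mathcal Z$ via the half-braidings $z_U:U\otimes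 X\to X\otimes U$, $u\otimes x\mapsto f.x\otimes u$ $(u\in U_f)$. **Algebras and modules.** Algebras and modules are associative and unital. An algebra $A$ in $\mathcal V$ is *separable* if the bilinear form $(a,b)\mapsto\tau(ab)$ is non-degenerate, where $\tau(a)$ is the trace of $b\mapsto ab$; an algebra in $\mathcal Z$ is separable if its underlying algebra in $\mathcal V$ is. An algebra is *indecomposable* if it is non-zero and is not a direct sum of two non-zero algebras. An algebra $L$ in $\mathcal Z$ is *Lagrangian* if it is commutative, separable and indecomposable and every local right $L$-module (one whose action is unchanged by the double braiding) is a finite direct sum of copies of $L$. The category $\mathcal V_A$ of right modules over an algebra $A$ in $\mathcal V$ is a left $\mathcal V$-module category. **Full centre.** For an algebra $A$ in $\mathcal V$ call a morphism $\xi:Y\to A$ in $\mathcal V$, with $Y\in\mathcal Z$, central if $\mu(1_A\otimes\xi)=\mu(\xi\otimes1_A)z_A$, where $\mu$ is the multiplication of $A$ and $z_A:A\otimes Y\to Y\otimes A$ the half-braiding of $Y$. A full centre of $A$ is an algebra $Z$ in $\mathcal Z$ with a central homomorphism of algebras $\zeta:Z\to A$ such that every central $\xi:Y\to A$ is $\zeta\circ\varphi$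 for a unique morphism $\varphi:Y\to Z$ of $\mathcal Z$. **The algebras $k[H,\gamma]$ and $L(H,\gamma)$.** Let $H\subseteq G$ be a subgroup and $\gamma:H^2\to k^*$ a map with $d\gamma=\alpha|_H$, that is, $\gamma(g,h)\gamma(f,gh)=\alpha(f,g,h)\gamma(f,g)\gamma(fg,h)$. Then $k[H,\gamma]$ is the algebra in $\mathcal V$ with basis $e_h$ $(h\in H)$, $e_h$ of degree $h$, and product $e_fe_g=\gamma(f,g)e_{fg}$. Put $\varepsilon_f(g)=\gamma(f,g)/\gamma(fgf^{-1},f)$ and $h.e_t=\varepsilon_h(t)e_{hth^{-1}}$. The homogeneous elements of degree $f\in G$ of $L(H,\gamma)$ are the maps $a:G\to k[H,\gamma]$ such that $a(x)$ has degree $x^{-1}fx$ (so $a(x)=0$ if $x^{-1}fx\notin H$) and $$a(xh)=\alpha(h^{-1},x^{-1}|f)\;h^{-1}.a(x)\qquad(x\in G,\ h\in H);$$ for $a$ of degree $f$ and $b$ of degree $f'$ put $(g.a)(x)=\alpha(x^{-1},g|f)^{-1}a(g^{-1}x)$ and $(ab)(x)=\alpha(x^{-1}|f,f')\,a(x)b(x)$.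 This makes $L(H,\gamma)$ an algebra in $\mathcal Z$, and $\zeta(a)=a(1)$ is a homomorphism of algebras $L(H,\gamma)\to k[H,\gamma]$ in $\mathcal V$. **Theorem.** 1. For all $H$ and $\gamma$ as above, $k[H,\gamma]$ is a separable indecomposable algebra in $\mathcal V$, $L(H,\gamma)$ is a Lagrangian algebra in $\mathcal Z$, and $(L(H,\gamma),\zeta)$ is the full centre of $k[H,\gamma]$. 2. Every separable indecomposable algebra $A$ in $\mathcal V$ has a full centre. 3. An algebra in $\mathcal Z$ is Lagrangian if and only if it is the full centre of some separable indecomposable algebra in $\mathcal V$. 4. Every Lagrangian algebra in $\mathcal Z$ is isomorphic to $L(H,\gamma)$ for some $H$ and $\gamma$. 5. Let $L$ and $L'$ be full centres of separable indecomposable algebras $A$ and $A'$ in $\mathcal V$. Then $L\cong L'$ as algebras in $\mathcal Z$ if and only if $\mathcal V_A$ and $\mathcal V_{A'}$ are equivalent as left $\mathcal V$-module categories. Thus $A\mapsto Z(A)$ induces a bijection between the module categories $\mathcal V_A$ of separable indecomposable algebras $A$, up to equivalence, and the Lagrangian algebras in $\mathcal Z(G,\alpha)$, up to isomorphism. -/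

import Mathlib

open CategoryTheory MonoidalCategory
open scoped TensorProduct

universe v u

set_option linter.unusedSimpArgs false

noncomputable section

/-! ### Algebras, modules and full centres in monoidal categories -/

namespace CatAlg

open Limits MonObj

variable {C : Type u} [Category.{v} C] [MonoidalCategory C]

/-- An algebra is indecomposable if it is non-zero and is not the direct sum (the product of the
underlying objects, with both projections algebra homomorphisms) of two non-zero algebras. -/
def IsIndecomposable (A : Mon C) : Prop :=
  ¬ IsZero A.X ∧ ∀ (B₁ B₂ : Mon C) (p₁ : A ⟶ B₁) (p₂ : A ⟶ B₂),
    Nonempty (IsLimit (BinaryFan.mk p₁.hom p₂.hom)) → IsZero B₁.X ∨ IsZero B₂.X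

/-- A right module over the algebra `A`. -/
structure RMod (A : Mon C) where
  X : C
  act : X ⊗ A.X ⟶ X
  act_assoc : act ▷ A.X ≫ act = (α_ X A.X A.X).hom ≫ X ◁ μ[A.X] ≫ act
  act_one : X ◁ η[A.X] ≫ act = (ρ_ X).hom

namespace RMod

variable {A : Mon C}

/-- Morphisms of right modules. -/
@[ext]
structure Hom (M N : RMod A) where
  hom : M.X ⟶ N.X
  comm : M.act ≫ hom = hom ▷ A.X ≫ N.act

instance : Category (RMod A) where
  Hom := Hom
  id M := ⟨𝟙 M.X, by simp⟩
  comp f g := ⟨f.hom ≫ g.hom, by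
    rw [← Category.assoc, f.comm, Category.assoc, g.comm, comp_whiskerRight, Category.assoc]⟩

@[ext]
theorem hom_ext {M N : RMod A} {f g : M ⟶ N} (h : f.hom = g.hom) : f = g := Hom.ext h

@[simp] theorem id_hom (M : RMod A) : Hom.hom (𝟙 M) = 𝟙 M.X := rfl
@[simp] theorem comp_hom {M N P : RMod A} (f : M ⟶ N) (g : N ⟶ P) :
    Hom.hom (f ≫ g) = f.hom ≫ g.hom := rfl

/-- Isomorphisms of modules from isomorphisms of the underlying objects. -/
def isoMk {M N : RMod A} (e : M.X ≅ N.X) (h : M.act ≫ e.hom = e.hom ▷ A.X ≫ N.act) : M ≅ N where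
  hom := ⟨e.hom, h⟩
  inv := ⟨e.inv, by
    rw [← cancel_mono e.hom, Category.assoc, Category.assoc, h, e.inv_hom_id, Category.comp_id,
      ← Category.assoc, ← comp_whiskerRight, e.inv_hom_id, id_whiskerRight, Category.id_comp]⟩
  hom_inv_id := by ext; simp
  inv_hom_id := by ext; simp

@[simp] theorem isoMk_hom_hom {M N : RMod A} (e : M.X ≅ N.X) (h) :
    Hom.hom (isoMk (M := M) (N := N) e h).hom = e.hom := rfl
@[simp] theorem isoMk_inv_hom {M N : RMod A} (e : M.X ≅ N.X) (h) :
    Hom.hom (isoMk (M := M) (N := N) e h).inv = e.inv := rfl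

/-- The regular module. -/
def regular (A : Mon C) : RMod A where
  X := A.X
  act := μ[A.X]
  act_assoc := MonObj.mul_assoc A.X
  act_one := MonObj.mul_one A.X

/-- The module `c ⊗ M` for an object `c` and a right module `M`. -/
def tensorLeft (c : C) (M : RMod A) : RMod A where
  X := c ⊗ M.X
  act := (α_ c M.X A.X).hom ≫ c ◁ M.act
  act_assoc := by
    have := congrArg (fun t => c ◁ t) M.act_assoc
    simp only [MonoidalCategory.whiskerLeft_comp] at this
    simp [this]
  act_one := by
    have := congrArg (fun t => c ◁ t) M.act_one
    simp only [MonoidalCategory.whiskerLeft_comp] at this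
    simp [this]

/-- Right `A`-modules form a left `C`-module category. -/
instance : MonoidalLeftAction C (RMod A) where
  actionObj c M := tensorLeft c M
  actionHomLeft f M := ⟨f ▷ M.X, by simp [tensorLeft, whisker_exchange]⟩
  actionHomRight c _ _ f := ⟨c ◁ f.hom, by
    have := congrArg (fun t => c ◁ t) f.comm
    simp only [MonoidalCategory.whiskerLeft_comp] at this
    simp [tensorLeft, this]⟩
  actionAssocIso c c' M := isoMk (α_ c c' M.X) (by simp [tensorLeft])
  actionUnitIso M := isoMk (λ_ M.X) (by simp [tensorLeft])
  actionHom_def _ _ := rfl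
  actionHomRight_id c M := by ext; simp [tensorLeft]
  id_actionHomLeft c M := by ext; simp [tensorLeft]
  actionHom_comp f₁ f₂ g₁ g₂ := by ext; simp [tensorLeft, whisker_exchange_assoc]
  actionAssocIso_hom_naturality f g h := by
    ext; simp [tensorLeft, isoMk, MonoidalCategory.tensorHom_def]
  actionUnitIso_hom_naturality f := by ext; simp [tensorLeft, isoMk]
  whiskerLeft_actionHomLeft c _ _ f M := by ext; simp [tensorLeft, isoMk]
  whiskerRight_actionHomLeft c f M := by ext; simp [tensorLeft, isoMk]
  associator_actionHom c₁ c₂ c₃ M := by ext; simp [tensorLeft, isoMk]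
  leftUnitor_actionHom c M := by ext; simp [tensorLeft, isoMk]
  rightUnitor_actionHom c M := by ext; simp [tensorLeft, isoMk]

end RMod

/-- The left `C`-module categories of right modules over `A` and over `B` are equivalent. -/
def ModuleCategoriesEquivalent (A B : Mon C) : Prop :=
  ∃ F : RMod A ⥤ RMod B, F.IsEquivalence ∧ Nonempty (F.LeftLinear C)

/-- A morphism `ζ : Z ⟶ A` from an object of the monoidal centre is central if
`μ ∘ (A ⊗ ζ) = μ ∘ (ζ ⊗ A) ∘ z_A`, where `z_A : A ⊗ Z ⟶ Z ⊗ A` is the half-braiding of `Z`.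
(The half-braiding of `Center C` is stored as `Z ⊗ U ≅ U ⊗ Z`.) -/
def IsCentral (A : Mon C) (Z : Center C) (ζ : (Center.forget C).obj Z ⟶ A.X) : Prop :=
  A.X ◁ ζ ≫ μ[A.X] = (Z.2.β A.X).inv ≫ ζ ▷ A.X ≫ μ[A.X]

/-- `(Z, ζ)` is the full centre of the algebra `A`: it is terminal among all pairs consisting of
an object of the monoidal centre and a central morphism to `A`, and `ζ` is a homomorphism
of algebras (this pins down the algebra structure of `Z`). -/
def IsFullCentre (A : Mon C) (Z : Mon (Center C)) (ζ : (Center.forget C).mapMon.obj Z ⟶ A) :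
    Prop :=
  IsCentral A Z.X ζ.hom ∧
    ∀ (Y : Center C) (ξ : (Center.forget C).obj Y ⟶ A.X), IsCentral A Y ξ →
      ∃! φ : Y ⟶ Z.X, (Center.forget C).map φ ≫ ζ.hom = ξ

section Braided

variable [BraidedCategory C]

/-- A right module is local if its action is invariant under the double braiding. -/
def RMod.IsLocal {A : Mon C} (M : RMod A) : Prop :=
  (β_ M.X A.X).hom ≫ (β_ A.X M.X).hom ≫ M.act = M.act

/-- Every local module is a (finite) direct sum of copies of the regular module. -/
def LocalModulesFree (A : Mon C) : Prop :=
  ∀ M : RMod A, M.IsLocal → ∃ (n : ℕ) (i : Fin n → (RMod.regular A ⟶ M)),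
    Nonempty (IsColimit (Cofan.mk M i))

end Braided

end CatAlg

/-! ### Cocycles -/

/-- A normalised 3-cocycle of the group `G` with values in `kˣ`. -/
structure Cocycle₃ (k G : Type u) [Field k] [Group G] where
  toFun : G → G → G → kˣ
  cocycle : ∀ f g h l, toFun g h l * toFun f (g * h) l * toFun f g h =
    toFun (f * g) h l * toFun f g (h * l)
  one_left : ∀ g h, toFun 1 g h = 1
  one_mid : ∀ f h, toFun f 1 h = 1
  one_right : ∀ f g, toFun f g 1 = 1

namespace Cocycle₃

variable {k G : Type u} [Field k] [Group G] (α : Cocycle₃ k G)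

/-- `α(f, g | h) = α(f, g, h)⁻¹ α(f, ghg⁻¹, g) α((fg)h(fg)⁻¹, f, g)⁻¹`. -/
def two (f g h : G) : kˣ :=
  (α.toFun f g h)⁻¹ * α.toFun f (g * h * g⁻¹) g * (α.toFun (f * g * h * (f * g)⁻¹) f g)⁻¹

/-- `α(f | g, h) = α(f, g, h) α(fgf⁻¹, f, h)⁻¹ α(fgf⁻¹, fhf⁻¹, f)`. -/
def one (f g h : G) : kˣ :=
  α.toFun f g h * (α.toFun (f * g * f⁻¹) f h)⁻¹ * α.toFun (f * g * f⁻¹) (f * h * f⁻¹) f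

theorem add_cocycle (f g h l : G) :
    Additive.ofMul (α.toFun g h l) + Additive.ofMul (α.toFun f (g * h) l)
      + Additive.ofMul (α.toFun f g h) =
    Additive.ofMul (α.toFun (f * g) h l) + Additive.ofMul (α.toFun f g (h * l)) :=
  congrArg Additive.ofMul (α.cocycle f g h l)

theorem two_cocycle (f g h u : G) :
    α.two f (g * h) u * α.two g h u = α.two (f * g) h u * α.two f g (h * u * h⁻¹) := by
  apply Additive.ofMul.injective
  have h1 := α.add_cocycle f g h u
  have h2 := α.add_cocycle f g (h * u * h⁻¹) h
  have h3 := α.add_cocycle f (g * h * u * (g * h)⁻¹) g h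
  have h4 := α.add_cocycle (f * g * h * u * (f * g * h)⁻¹) f g h
  simp only [two, ofMul_mul, ofMul_inv]
  simp only [mul_assoc, mul_inv_rev, inv_mul_cancel_left, mul_inv_cancel_left, inv_mul_cancel,
    mul_inv_cancel, mul_one, one_mul] at h1 h2 h3 h4 ⊢
  linear_combination (norm := abel) -h1 + h2 - h3 + h4

theorem two_one (f g u v : G) :
    α.one (f * g) u v * α.two f g u * α.two f g v =
      α.two f g (u * v) * α.one g u v * α.one f (g * u * g⁻¹) (g * v * g⁻¹) := by
  apply Additive.ofMul.injective
  have h1 := α.add_cocycle f g u v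
  have h2 := α.add_cocycle f (g * u * g⁻¹) g v
  have h3 := α.add_cocycle f (g * u * g⁻¹) (g * v * g⁻¹) g
  have h4 := α.add_cocycle (f * g * u * (f * g)⁻¹) f g v
  have h5 := α.add_cocycle (f * g * u * (f * g)⁻¹) f (g * v * g⁻¹) g
  have h6 := α.add_cocycle (f * g * u * (f * g)⁻¹) (f * g * v * (f * g)⁻¹) f g
  simp only [two, one, ofMul_mul, ofMul_inv]
  simp only [mul_assoc, mul_inv_rev, inv_mul_cancel_left, mul_inv_cancel_left, inv_mul_cancel,
    mul_inv_cancel, mul_one, one_mul] at h1 h2 h3 h4 h5 h6 ⊢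
  linear_combination (norm := abel) -h1 + h2 - h3 - h4 + h5 - h6

theorem one_assoc (f g h u : G) :
    α.toFun g h u * α.one f (g * h) u * α.one f g h =
      α.one f g (h * u) * α.one f h u *
        α.toFun (f * g * f⁻¹) (f * h * f⁻¹) (f * u * f⁻¹) := by
  apply Additive.ofMul.injective
  have h1 := α.add_cocycle f g h u
  have h2 := α.add_cocycle (f * g * f⁻¹) f h u
  have h3 := α.add_cocycle (f * g * f⁻¹) (f * h * f⁻¹) f u
  have h4 := α.add_cocycle (f * g * f⁻¹) (f * h * f⁻¹) (f * u * f⁻¹) f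
  simp only [one, ofMul_mul, ofMul_inv]
  simp only [mul_assoc, mul_inv_rev, inv_mul_cancel_left, mul_inv_cancel_left, inv_mul_cancel,
    mul_inv_cancel, mul_one, one_mul] at h1 h2 h3 h4 ⊢
  linear_combination (norm := abel) h1 - h2 + h3 - h4

@[simp] theorem two_one_left (g h : G) : α.two 1 g h = 1 := by
  simp [two, α.one_left, α.one_mid]
@[simp] theorem two_one_mid (g h : G) : α.two g 1 h = 1 := by
  simp [two, α.one_right, α.one_mid]
@[simp] theorem two_one_right (f g : G) : α.two f g 1 = 1 := by
  simp [two, α.one_left, α.one_mid, α.one_right]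
@[simp] theorem one_one_left (g h : G) : α.one 1 g h = 1 := by
  simp [one, α.one_left, α.one_mid, α.one_right]
@[simp] theorem one_one_mid (f h : G) : α.one f 1 h = 1 := by
  simp [one, α.one_left, α.one_mid]
@[simp] theorem one_one_right (f g : G) : α.one f g 1 = 1 := by
  simp [one, α.one_mid, α.one_right]

end Cocycle₃

/-! ### The category `𝒱(G, α)` of graded vector spaces -/

/-- A finite-dimensional `G`-graded vector space, considered as an object of `𝒱(G, α)`.
The decomposition `V = ⨁ g, V_g` is given by the family of its projections `proj g`
onto `V_g = {v | proj g v = v}`. -/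
structure GrVec {k G : Type u} [Field k] [Group G] [Fintype G] (α : Cocycle₃ k G) where
  carrier : Type u
  [addCommGroup : AddCommGroup carrier]
  [module : Module k carrier]
  [finite : FiniteDimensional k carrier]
  proj : G → carrier →ₗ[k] carrier
  proj_self : ∀ g v, proj g (proj g v) = proj g v
  proj_ne : ∀ g h v, g ≠ h → proj g (proj h v) = 0
  sum_proj : ∀ v, ∑ g, proj g v = v

attribute [instance] GrVec.addCommGroup GrVec.module GrVec.finite

namespace GrVec

variable {k G : Type u} [Field k] [Group G] [Fintype G] {α : Cocycle₃ k G}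

instance : CoeSort (GrVec α) (Type u) := ⟨GrVec.carrier⟩

/-- `v` is homogeneous of degree `g`. -/
def HasDeg (V : GrVec α) (g : G) (v : V) : Prop := V.proj g v = v

theorem hasDeg_proj (V : GrVec α) (g : G) (v : V) : V.HasDeg g (V.proj g v) := V.proj_self g v

theorem HasDeg.proj_eq_zero {V : GrVec α} {g : G} {v : V} (h : V.HasDeg g v) {g' : G}
    (hne : g' ≠ g) : V.proj g' v = 0 := by
  rw [← h, V.proj_ne _ _ _ hne]

theorem HasDeg.smul {V : GrVec α} {g : G} {v : V} (h : V.HasDeg g v) (c : k) :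
    V.HasDeg g (c • v) := by
  unfold HasDeg; rw [map_smul, h]

/-- Grading preserving linear maps. -/
@[ext]
structure Hom (V W : GrVec α) where
  lin : V →ₗ[k] W
  comm : ∀ g v, lin (V.proj g v) = W.proj g (lin v)

instance : Category (GrVec α) where
  Hom := Hom
  id V := ⟨LinearMap.id, fun _ _ => rfl⟩
  comp f g := ⟨g.lin ∘ₗ f.lin, fun a v => by simp [f.comm, g.comm]⟩

@[ext]
theorem hom_ext {V W : GrVec α} {f g : V ⟶ W} (h : f.lin = g.lin) : f = g := Hom.ext h

@[simp] theorem id_lin (V : GrVec α) : Hom.lin (𝟙 V) = LinearMap.id := rfl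
@[simp] theorem comp_lin {U V W : GrVec α} (f : U ⟶ V) (g : V ⟶ W) :
    Hom.lin (f ≫ g) = g.lin ∘ₗ f.lin := rfl

theorem Hom.hasDeg {V W : GrVec α} (f : V ⟶ W) {g : G} {v : V} (h : V.HasDeg g v) :
    W.HasDeg g (f.lin v) := by
  unfold HasDeg; rw [← f.comm, h]

/-- A linear map that respects degrees of homogeneous elements is grading preserving. -/
theorem comm_of_hasDeg {V W : GrVec α} (φ : V →ₗ[k] W)
    (h : ∀ g v, V.HasDeg g v → W.HasDeg g (φ v)) (g : G) (v : V) :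
    φ (V.proj g v) = W.proj g (φ v) := by
  conv_rhs => rw [← V.sum_proj v, map_sum, map_sum]
  rw [Finset.sum_eq_single g]
  · exact (h _ _ (V.hasDeg_proj g v)).symm
  · intro b _ hb
    exact (h _ _ (V.hasDeg_proj b v)).proj_eq_zero hb.symm
  · simp

/-- Isomorphisms from linear equivalences that respect degrees. -/
def mkIso {V W : GrVec α} (e : V ≃ₗ[k] W) (h : ∀ g v, V.HasDeg g v → W.HasDeg g (e v)) :
    V ≅ W where
  hom := ⟨e.toLinearMap, comm_of_hasDeg _ h⟩
  inv := ⟨e.symm.toLinearMap, fun g w => by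
    apply e.injective
    have := comm_of_hasDeg e.toLinearMap h g (e.symm w)
    simp only [LinearEquiv.coe_coe, LinearEquiv.apply_symm_apply] at this ⊢
    exact this.symm⟩
  hom_inv_id := by ext; simp
  inv_hom_id := by ext; simp

@[simp] theorem mkIso_hom_lin {V W : GrVec α} (e : V ≃ₗ[k] W) (h) :
    Hom.lin (mkIso (V := V) (W := W) e h).hom = e.toLinearMap := rfl
@[simp] theorem mkIso_inv_lin {V W : GrVec α} (e : V ≃ₗ[k] W) (h) :
    Hom.lin (mkIso (V := V) (W := W) e h).inv = e.symm.toLinearMap := rfl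

/-- Linear maps on a graded space agree if they agree on homogeneous elements. -/
theorem ext_hom {V : GrVec α} {P : Type*} [AddCommGroup P] [Module k P] {φ ψ : V →ₗ[k] P}
    (h : ∀ g v, V.HasDeg g v → φ v = ψ v) : φ = ψ := by
  ext v
  rw [← V.sum_proj v, map_sum, map_sum]
  exact Finset.sum_congr rfl fun g _ => h g _ (V.hasDeg_proj g v)

/-- The tensor product, `(V ⊗ W)_f = ⨁_{gh = f} V_g ⊗ W_h`. -/
def tensor (V W : GrVec α) : GrVec α where
  carrier := (V : Type u) ⊗[k] (W : Type u)
  proj f := ∑ g, TensorProduct.map (V.proj g) (W.proj (g⁻¹ * f))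
  proj_self f v := by
    induction v using TensorProduct.induction_on with
    | zero => simp
    | add x y hx hy => simp only [map_add, hx, hy]
    | tmul x y =>
      simp only [LinearMap.sum_apply, TensorProduct.map_tmul, map_sum]
      refine Finset.sum_congr rfl fun g _ => ?_
      rw [Finset.sum_eq_single g]
      · simp [V.proj_self, W.proj_self]
      · intro b _ hb; simp [V.proj_ne _ _ _ hb]
      · simp
  proj_ne f f' v hne := by
    induction v using TensorProduct.induction_on with
    | zero => simp
    | add x y hx hy => simp only [map_add, hx, hy, add_zero]
    | tmul x y =>
      simp only [LinearMap.sum_apply, TensorProduct.map_tmul, map_sum]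
      refine Finset.sum_eq_zero fun g _ => Finset.sum_eq_zero fun g' _ => ?_
      by_cases hg : g' = g
      · subst hg
        rw [W.proj_ne _ _ _ (by simpa using hne), TensorProduct.tmul_zero]
      · rw [V.proj_ne _ _ _ hg, TensorProduct.zero_tmul]
  sum_proj v := by
    induction v using TensorProduct.induction_on with
    | zero => simp
    | add x y hx hy => simp only [map_add, Finset.sum_add_distrib, hx, hy]
    | tmul x y =>
      simp only [LinearMap.sum_apply, TensorProduct.map_tmul]
      rw [Finset.sum_comm]
      have : ∀ g, ∑ f, V.proj g x ⊗ₜ[k] W.proj (g⁻¹ * f) y = V.proj g x ⊗ₜ[k] y := fun g => by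
        rw [← TensorProduct.tmul_sum]
        congr 1
        exact (Fintype.sum_equiv (Equiv.mulLeft g⁻¹) _ (fun f => W.proj f y) fun _ => rfl).trans
          (W.sum_proj y)
      simp only [this]
      rw [← TensorProduct.sum_tmul, V.sum_proj]

/-- The pure tensor `v ⊗ w`. -/
def tm {V W : GrVec α} (v : V) (w : W) : tensor V W := TensorProduct.tmul k v w

/-- The bilinear map underlying a linear map on a tensor product. -/
def curry {V W : GrVec α} {P : Type*} [AddCommGroup P] [Module k P] (φ : tensor V W →ₗ[k] P) :
    V →ₗ[k] W →ₗ[k] P := TensorProduct.curry φ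

@[simp] theorem curry_apply {V W : GrVec α} {P : Type*} [AddCommGroup P] [Module k P]
    (φ : tensor V W →ₗ[k] P) (v : V) (w : W) : curry φ v w = φ (tm v w) := rfl

theorem curry_injective {V W : GrVec α} {P : Type*} [AddCommGroup P] [Module k P]
    {φ ψ : tensor V W →ₗ[k] P} (h : curry φ = curry ψ) : φ = ψ :=
  TensorProduct.curry_injective h

/-- The linear map on a tensor product defined by a bilinear map. -/
def uncurry {V W : GrVec α} {P : Type*} [AddCommGroup P] [Module k P] (φ : V →ₗ[k] W →ₗ[k] P) :
    tensor V W →ₗ[k] P := TensorProduct.lift φ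

@[simp] theorem uncurry_tm {V W : GrVec α} {P : Type*} [AddCommGroup P] [Module k P]
    (φ : V →ₗ[k] W →ₗ[k] P) (v : V) (w : W) : uncurry φ (tm v w) = φ v w :=
  TensorProduct.lift.tmul v w

theorem tm_smul {V W : GrVec α} (c : k) (v : V) (w : W) : tm v (c • w) = c • tm v w :=
  TensorProduct.tmul_smul c v w
theorem smul_tm {V W : GrVec α} (c : k) (v : V) (w : W) : tm (c • v) w = c • tm v w :=
  TensorProduct.smul_tmul' c v w
theorem tm_zero {V W : GrVec α} (v : V) : tm v (0 : W) = 0 := TensorProduct.tmul_zero _ v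
theorem zero_tm {V W : GrVec α} (w : W) : tm (0 : V) w = 0 := TensorProduct.zero_tmul _ w

theorem ext_tm {V W : GrVec α} {P : Type*} [AddCommGroup P] [Module k P]
    {φ ψ : tensor V W →ₗ[k] P} (h : ∀ v w, φ (tm v w) = ψ (tm v w)) : φ = ψ :=
  TensorProduct.ext' h

/-- Linear maps on a tensor product agree if they agree on tensors of homogeneous elements. -/
theorem ext_hom₂ {V W : GrVec α} {P : Type*} [AddCommGroup P] [Module k P]
    {φ ψ : tensor V W →ₗ[k] P}
    (h : ∀ f g v w, V.HasDeg f v → W.HasDeg g w → φ (tm v w) = ψ (tm v w)) : φ = ψ :=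
  curry_injective <| ext_hom fun f v hv => ext_hom fun g w hw => h f g v w hv hw

theorem ext_hom₃ {U V W : GrVec α} {P : Type*} [AddCommGroup P] [Module k P]
    {φ ψ : tensor (tensor U V) W →ₗ[k] P}
    (h : ∀ f g l u v w, U.HasDeg f u → V.HasDeg g v → W.HasDeg l w →
      φ (tm (tm u v) w) = ψ (tm (tm u v) w)) : φ = ψ :=
  curry_injective <| ext_hom₂ fun f g u v hu hv => ext_hom fun l w hw => h f g l u v w hu hv hw

theorem ext_hom₃' {U V W : GrVec α} {P : Type*} [AddCommGroup P] [Module k P]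
    {φ ψ : tensor U (tensor V W) →ₗ[k] P}
    (h : ∀ f g l u v w, U.HasDeg f u → V.HasDeg g v → W.HasDeg l w →
      φ (tm u (tm v w)) = ψ (tm u (tm v w))) : φ = ψ :=
  curry_injective <| ext_hom fun f u hu => ext_hom₂ fun g l v w hv hw => h f g l u v w hu hv hw

theorem ext_hom₄ {T U V W : GrVec α} {P : Type*} [AddCommGroup P] [Module k P]
    {φ ψ : tensor (tensor (tensor T U) V) W →ₗ[k] P}
    (h : ∀ e f g l t u v w, T.HasDeg e t → U.HasDeg f u → V.HasDeg g v → W.HasDeg l w →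
      φ (tm (tm (tm t u) v) w) = ψ (tm (tm (tm t u) v) w)) : φ = ψ :=
  curry_injective <| ext_hom₃ fun e f g t u v ht hu hv =>
    ext_hom fun l w hw => h e f g l t u v w ht hu hv hw

theorem HasDeg.tm {V W : GrVec α} {f g : G} {v : V} {w : W} (hv : V.HasDeg f v)
    (hw : W.HasDeg g w) : (tensor V W).HasDeg (f * g) (GrVec.tm v w) := by
  change (∑ b, TensorProduct.map (V.proj b) (W.proj (b⁻¹ * (f * g)))) (v ⊗ₜ[k] w) = v ⊗ₜ[k] w
  simp only [LinearMap.sum_apply, TensorProduct.map_tmul]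
  rw [Finset.sum_eq_single f]
  · rw [inv_mul_cancel_left, hv, hw]
  · intro b _ hb
    rw [hv.proj_eq_zero hb, TensorProduct.zero_tmul]
  · simp

theorem tensor_comm {V W X : GrVec α} (φ : tensor V W →ₗ[k] X)
    (h : ∀ f g v w, V.HasDeg f v → W.HasDeg g w → X.HasDeg (f * g) (φ (tm v w))) (a : G)
    (x : tensor V W) : φ ((tensor V W).proj a x) = X.proj a (φ x) := by
  suffices hs : φ ∘ₗ (tensor V W).proj a = X.proj a ∘ₗ φ from LinearMap.congr_fun hs x
  apply ext_hom₂
  intro f g v w hv hw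
  have h1 := hv.tm hw
  simp only [LinearMap.comp_apply]
  by_cases ha : a = f * g
  · subst ha
    rw [h1, h _ _ _ _ hv hw]
  · rw [h1.proj_eq_zero ha, (h _ _ _ _ hv hw).proj_eq_zero ha, map_zero]

open scoped Classical in
/-- The monoidal unit: the field `k` in degree `1`. -/
def unit (α : Cocycle₃ k G) : GrVec α where
  carrier := k
  proj g := if g = 1 then LinearMap.id else 0
  proj_self g v := by split <;> simp
  proj_ne g h v hne := by
    by_cases hg : g = 1
    · subst hg; simp [hne.symm]
    · simp [hg]
  sum_proj v := by
    rw [Finset.sum_eq_single 1] <;> simp +contextual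

theorem unit_hasDeg (c : unit α) : (unit α).HasDeg 1 c := by
  have : (unit α).proj 1 = LinearMap.id := if_pos rfl
  simp [HasDeg, this]

/-- The tensor product of morphisms. -/
def tensorMap {V W V' W' : GrVec α} (f : V ⟶ V') (g : W ⟶ W') : tensor V W ⟶ tensor V' W' where
  lin := TensorProduct.map f.lin g.lin
  comm := tensor_comm (X := tensor V' W') _ fun _ _ _ _ hv hw =>
    (f.hasDeg hv).tm (g.hasDeg hw)

@[simp] theorem tensorMap_tm {V W V' W' : GrVec α} (f : V ⟶ V') (g : W ⟶ W') (v : V) (w : W) :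
    (tensorMap f g).lin (tm v w) = tm (f.lin v) (g.lin w) := rfl

/-- The diagonal rescaling of `(U ⊗ V) ⊗ W` by a function of the degrees. -/
def scale (c : G → G → G → kˣ) (U V W : GrVec α) :
    tensor (tensor U V) W →ₗ[k] tensor (tensor U V) W :=
  ∑ f, ∑ g, ∑ h, (c f g h : k) •
    (TensorProduct.map (TensorProduct.map (U.proj f) (V.proj g)) (W.proj h) :
      (U ⊗[k] V) ⊗[k] W →ₗ[k] (U ⊗[k] V) ⊗[k] W)

theorem scale_tm (c : G → G → G → kˣ) {U V W : GrVec α} {f g h : G} {u : U} {v : V} {w : W}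
    (hu : U.HasDeg f u) (hv : V.HasDeg g v) (hw : W.HasDeg h w) :
    scale c U V W (tm (tm u v) w) = (c f g h : k) • tm (tm u v) w := by
  change (∑ f, ∑ g, ∑ h, (c f g h : k) •
    (TensorProduct.map (TensorProduct.map (U.proj f) (V.proj g)) (W.proj h) :
      (U ⊗[k] V) ⊗[k] W →ₗ[k] (U ⊗[k] V) ⊗[k] W)) ((u ⊗ₜ[k] v) ⊗ₜ[k] w) =
    (c f g h : k) • ((u ⊗ₜ[k] v) ⊗ₜ[k] w)
  simp only [LinearMap.sum_apply, LinearMap.smul_apply, TensorProduct.map_tmul]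
  rw [Finset.sum_eq_single f, Finset.sum_eq_single g, Finset.sum_eq_single h, hu, hv, hw]
  · intro b _ hb; simp [hw.proj_eq_zero hb]
  · simp
  · intro b _ hb; simp [hv.proj_eq_zero hb]
  · simp
  · intro b _ hb; simp [hu.proj_eq_zero hb]
  · simp

/-- The untwisted associativity isomorphism. -/
def assoc₀ (U V W : GrVec α) : tensor (tensor U V) W ≃ₗ[k] tensor U (tensor V W) :=
  TensorProduct.assoc k U V W

@[simp] theorem assoc₀_tm {U V W : GrVec α} (u : U) (v : V) (w : W) :
    assoc₀ U V W (tm (tm u v) w) = tm u (tm v w) := rfl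

/-- The associator, whose inverse is `u ⊗ (v ⊗ w) ↦ α(f, g, h) (u ⊗ v) ⊗ w`
for `u ∈ U_f`, `v ∈ V_g`, `w ∈ W_h`. -/
def assocEquiv (U V W : GrVec α) : tensor (tensor U V) W ≃ₗ[k] tensor U (tensor V W) :=
  LinearEquiv.trans (LinearEquiv.ofLinearMap (scale (fun f g h => (α.toFun f g h)⁻¹) U V W)
    (scale α.toFun U V W)
    (by
      apply ext_hom₃
      intro f g l u v w hu hv hw
      simp [scale_tm _ hu hv hw, smul_smul])
    (by
      apply ext_hom₃
      intro f g l u v w hu hv hw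
      simp [scale_tm _ hu hv hw, smul_smul]) :
    tensor (tensor U V) W ≃ₗ[k] tensor (tensor U V) W) (assoc₀ U V W)

theorem assocEquiv_tm {U V W : GrVec α} {f g h : G} {u : U} {v : V} {w : W}
    (hu : U.HasDeg f u) (hv : V.HasDeg g v) (hw : W.HasDeg h w) :
    assocEquiv U V W (tm (tm u v) w) = ((α.toFun f g h)⁻¹ : kˣ).val • tm u (tm v w) := by
  change assoc₀ U V W (scale (fun f g h => (α.toFun f g h)⁻¹) U V W (tm (tm u v) w)) = _
  rw [scale_tm _ hu hv hw, map_smul, assoc₀_tm]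

theorem assocEquiv_symm_tm {U V W : GrVec α} {f g h : G} {u : U} {v : V} {w : W}
    (hu : U.HasDeg f u) (hv : V.HasDeg g v) (hw : W.HasDeg h w) :
    (assocEquiv U V W).symm (tm u (tm v w)) = (α.toFun f g h).val • tm (tm u v) w := by
  rw [LinearEquiv.symm_apply_eq, map_smul, assocEquiv_tm hu hv hw, smul_smul]
  simp

theorem assocEquiv_hasDeg (U V W : GrVec α) (a : G) (x : tensor (tensor U V) W)
    (hx : (tensor (tensor U V) W).HasDeg a x) :
    (tensor U (tensor V W)).HasDeg a (assocEquiv U V W x) := by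
  have : (assocEquiv U V W).toLinearMap ∘ₗ (tensor (tensor U V) W).proj a =
      (tensor U (tensor V W)).proj a ∘ₗ (assocEquiv U V W).toLinearMap := by
    apply ext_hom₃
    intro f g l u v w hu hv hw
    have h1 := (hu.tm hv).tm hw
    have h2 := hu.tm (hv.tm hw)
    rw [← mul_assoc] at h2
    simp only [LinearMap.comp_apply, LinearEquiv.coe_coe, assocEquiv_tm hu hv hw, map_smul]
    by_cases ha : a = f * g * l
    · subst ha
      rw [h1, h2, assocEquiv_tm hu hv hw]
    · rw [h1.proj_eq_zero ha, h2.proj_eq_zero ha, map_zero, smul_zero]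
  have h := LinearMap.congr_fun this x
  simp only [LinearMap.comp_apply, LinearEquiv.coe_coe] at h
  unfold HasDeg at hx ⊢
  rw [← h, hx]

/-- The left unit isomorphism `k ⊗ V ≃ V`. -/
def lid (V : GrVec α) : tensor (unit α) V ≃ₗ[k] V := TensorProduct.lid k V
/-- The right unit isomorphism `V ⊗ k ≃ V`. -/
def rid (V : GrVec α) : tensor V (unit α) ≃ₗ[k] V := TensorProduct.rid k V

/-- The element of the field underlying an element of the unit object. -/
def unitVal (c : unit α) : k := c

/-- The unit element of the unit object. -/
def unitOne : unit α := (1 : k)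

@[simp] theorem unitVal_unitOne : unitVal (unitOne : unit α) = 1 := rfl

@[simp] theorem lid_tm (V : GrVec α) (c : unit α) (v : V) : lid V (tm c v) = unitVal c • v := rfl
@[simp] theorem rid_tm (V : GrVec α) (c : unit α) (v : V) : rid V (tm v c) = unitVal c • v := rfl

theorem unitVal_eq_zero {f : G} (hf : f ≠ 1) {c : unit α} (hc : (unit α).HasDeg f c) :
    c = 0 := by
  rw [← hc, (unit_hasDeg c).proj_eq_zero hf]

theorem lid_hasDeg (V : GrVec α) (a : G) (x : tensor (unit α) V)
    (hx : (tensor (unit α) V).HasDeg a x) : V.HasDeg a (lid V x) := by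
  have := tensor_comm (X := V) (lid V).toLinearMap
    (fun f g v w hv hw => by
      by_cases hf : f = 1
      · subst hf
        rw [one_mul]
        exact hw.smul _
      · rw [unitVal_eq_zero hf hv, zero_tm, map_zero]
        exact map_zero _) a x
  rw [hx] at this
  exact this.symm

theorem rid_hasDeg (V : GrVec α) (a : G) (x : tensor V (unit α))
    (hx : (tensor V (unit α)).HasDeg a x) : V.HasDeg a (rid V x) := by
  have := tensor_comm (X := V) (rid V).toLinearMap
    (fun f g v w hv hw => by
      by_cases hf : g = 1
      · subst hf
        rw [mul_one]
        exact hv.smul _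
      · rw [unitVal_eq_zero hf hw, tm_zero, map_zero]
        exact map_zero _) a x
  rw [hx] at this
  exact this.symm

/-- The associativity constraint. -/
def assocIso (U V W : GrVec α) : tensor (tensor U V) W ≅ tensor U (tensor V W) :=
  mkIso (assocEquiv U V W) (assocEquiv_hasDeg U V W)
/-- The left unit constraint. -/
def leftIso (V : GrVec α) : tensor (unit α) V ≅ V := mkIso (lid V) (lid_hasDeg V)
/-- The right unit constraint. -/
def rightIso (V : GrVec α) : tensor V (unit α) ≅ V := mkIso (rid V) (rid_hasDeg V)

@[simp] theorem assocIso_hom_lin (U V W : GrVec α) :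
    Hom.lin (assocIso U V W).hom = (assocEquiv U V W).toLinearMap := rfl
@[simp] theorem leftIso_hom_lin (V : GrVec α) : Hom.lin (leftIso V).hom = (lid V).toLinearMap := rfl
@[simp] theorem rightIso_hom_lin (V : GrVec α) :
    Hom.lin (rightIso V).hom = (rid V).toLinearMap := rfl

theorem assocIso_naturality {U V W U' V' W' : GrVec α} (f : U ⟶ U') (g : V ⟶ V') (h : W ⟶ W') :
    tensorMap (tensorMap f g) h ≫ (assocIso U' V' W').hom =
      (assocIso U V W).hom ≫ tensorMap f (tensorMap g h) := by
  ext1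
  apply ext_hom₃
  intro a b c u v w hu hv hw
  simp only [comp_lin, assocIso_hom_lin, LinearMap.comp_apply,
    tensorMap_tm, LinearEquiv.coe_coe, map_smul, assocEquiv_tm hu hv hw,
    assocEquiv_tm (f.hasDeg hu) (g.hasDeg hv) (h.hasDeg hw)]

theorem assocIso_pentagon (T U V W : GrVec α) :
    tensorMap (assocIso T U V).hom (𝟙 W) ≫ (assocIso T (tensor U V) W).hom ≫
      tensorMap (𝟙 T) (assocIso U V W).hom =
      (assocIso (tensor T U) V W).hom ≫ (assocIso T U (tensor V W)).hom := by
  ext1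
  apply ext_hom₄
  intro e f g l t u v w ht hu hv hw
  simp only [comp_lin, assocIso_hom_lin, LinearMap.comp_apply,
    tensorMap_tm, LinearEquiv.coe_coe, map_smul, id_lin, LinearMap.id_apply, smul_tm, tm_smul,
    assocEquiv_tm ht hu hv, assocEquiv_tm (ht.tm hu) hv hw, assocEquiv_tm ht (hu.tm hv) hw,
    assocEquiv_tm ht hu (hv.tm hw), assocEquiv_tm hu hv hw, smul_smul]
  rw [← Units.val_mul, ← Units.val_mul, ← Units.val_mul, ← mul_inv, ← mul_inv, ← mul_inv]
  congr 3
  rw [mul_comm (α.toFun (e * f) g l), mul_comm (α.toFun e f _), mul_comm (α.toFun e f _),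
    ← α.cocycle e f g l]
  ac_rfl

theorem assocIso_triangle (U V : GrVec α) :
    (assocIso U (unit α) V).hom ≫ tensorMap (𝟙 U) (leftIso V).hom =
      tensorMap (rightIso U).hom (𝟙 V) := by
  ext1
  apply ext_hom₃
  intro f g l u c v hu hc hv
  simp only [comp_lin, assocIso_hom_lin, LinearMap.comp_apply,
    tensorMap_tm, LinearEquiv.coe_coe, map_smul, id_lin, LinearMap.id_apply,
    assocEquiv_tm hu (unit_hasDeg c) hv, α.one_mid, inv_one, Units.val_one, one_smul,
    leftIso_hom_lin, rightIso_hom_lin, lid_tm, rid_tm, tm_smul, smul_tm]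

instance : MonoidalCategoryStruct (GrVec α) where
  tensorObj := tensor
  whiskerLeft V _ _ f := tensorMap (𝟙 V) f
  whiskerRight f W := tensorMap f (𝟙 W)
  tensorHom := tensorMap
  tensorUnit := unit α
  associator := assocIso
  leftUnitor := leftIso
  rightUnitor := rightIso

/-- The monoidal category `𝒱(G, α)`. -/
instance : MonoidalCategory (GrVec α) :=
  MonoidalCategory.ofTensorHom
    (id_tensorHom_id := fun V W => by
      ext1; apply ext_tm; intro v w; rfl)
    (tensorHom_comp_tensorHom := fun f₁ f₂ g₁ g₂ => by
      ext1; apply ext_tm; intro v w; rfl)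
    (associator_naturality := assocIso_naturality)
    (leftUnitor_naturality := fun {V W} f => by
      ext1
      apply ext_tm; intro c v
      exact (f.lin.map_smul c v).symm)
    (rightUnitor_naturality := fun {V W} f => by
      ext1
      apply ext_tm; intro v c
      exact (f.lin.map_smul c v).symm)
    (pentagon := assocIso_pentagon)
    (triangle := assocIso_triangle)

end GrVec

/-! ### The monoidal centre of `𝒱(G, α)` and `α`-projective actions -/

namespace CatAlg

variable {C : Type u} [Category.{v} C] [MonoidalCategory C]

/-- A half-braiding `z_U : U ⊗ X ≅ X ⊗ U`, in the form used by `Center`. -/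
def halfBraidingOfInv {X : C} (z : ∀ U, U ⊗ X ≅ X ⊗ U)
    (hmon : ∀ U U', (z (U ⊗ U')).hom = (α_ U U' X).hom ≫ U ◁ (z U').hom ≫ (α_ U X U').inv ≫
      (z U).hom ▷ U' ≫ (α_ X U U').hom)
    (hnat : ∀ {U U'} (f : U ⟶ U'), f ▷ X ≫ (z U').hom = (z U).hom ≫ X ◁ f) :
    HalfBraiding X where
  β U := (z U).symm
  monoidal U U' := by
    simp only [Iso.symm_hom]
    rw [Iso.inv_eq_inv (z (U ⊗ U'))
      (α_ U U' X ≪≫ whiskerLeftIso U (z U') ≪≫ (α_ U X U').symm ≪≫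
        whiskerRightIso (z U) U' ≪≫ α_ X U U') |>.mpr (by simp [hmon])]
    simp
  naturality {U U'} f := by
    simp only [Iso.symm_hom]
    rw [Iso.eq_inv_comp, ← Category.assoc, Iso.comp_inv_eq, hnat]

/-- Compatibility with half-braidings may be checked on the inverses. -/
theorem center_comm_of_inv {X Y : Center C} (f : X.1 ⟶ Y.1)
    (h : ∀ U, U ◁ f ≫ (Y.2.β U).inv = (X.2.β U).inv ≫ f ▷ U) (U : C) :
    f ▷ U ≫ (Y.2.β U).hom = (X.2.β U).hom ≫ U ◁ f := by
  rw [← Iso.inv_comp_eq, ← Category.assoc, ← h U, Category.assoc, Iso.inv_hom_id,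
    Category.comp_id]

end CatAlg

/-- An object of `𝒵(G, α)`: a `G`-graded vector space with an `α`-projective `G`-action, that is,
with maps `f : X → X` such that `f(X_g) ⊆ X_{fgf⁻¹}` and `(fg).x = α(f, g | h) f.(g.x)` for
`x ∈ X_h`. (All these maps are invertible if and only if `1 ∈ G` acts as the identity.) -/
structure ProjGrVec {k G : Type u} [Field k] [Group G] [Fintype G] (α : Cocycle₃ k G) where
  X : GrVec α
  act : G → X →ₗ[k] X
  act_deg : ∀ f g x, X.HasDeg g x → X.HasDeg (f * g * f⁻¹) (act f x)
  act_one : ∀ x, act 1 x = x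
  act_mul : ∀ f g h x, X.HasDeg h x → act (f * g) x = (α.two f g h).val • act f (act g x)

namespace ProjGrVec

open GrVec

variable {k G : Type u} [Field k] [Group G] [Fintype G] {α : Cocycle₃ k G} (Z : ProjGrVec α)

theorem act_injective (f : G) : Function.Injective (Z.act f) := by
  rw [injective_iff_map_eq_zero]
  intro x hx
  have key : ∀ h, Z.X.proj h x = 0 := by
    intro h
    have h1 : Z.act f (Z.X.proj h x) = Z.X.proj (f * h * f⁻¹) (Z.act f x) := by
      conv_rhs => rw [← Z.X.sum_proj x, map_sum, map_sum]
      rw [Finset.sum_eq_single h]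
      · exact (Z.act_deg f h _ (Z.X.hasDeg_proj h x)).symm
      · intro b _ hb
        exact (Z.act_deg f b _ (Z.X.hasDeg_proj b x)).proj_eq_zero (by simpa using hb.symm)
      · simp
    have h2 := Z.act_mul f⁻¹ f h _ (Z.X.hasDeg_proj h x)
    rw [inv_mul_cancel, Z.act_one, h1, hx, map_zero, map_zero, smul_zero] at h2
    exact h2
  rw [← Z.X.sum_proj x]
  exact Finset.sum_eq_zero fun h _ => key h

/-- The action of an element of `G` as an automorphism. -/
def actEquiv (f : G) : Z.X ≃ₗ[k] Z.X := LinearEquiv.ofInjectiveEndo (Z.act f) (Z.act_injective f)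

@[simp] theorem actEquiv_apply (f : G) (x : Z.X) : Z.actEquiv f x = Z.act f x := rfl

/-- The linear map `u ⊗ x ↦ f.x ⊗ u`, `u ∈ U_f`. -/
def zLin (U : GrVec α) : tensor U Z.X →ₗ[k] tensor Z.X U :=
  uncurry (LinearMap.mk₂ k (fun u x => ∑ f, tm (Z.act f x) (U.proj f u))
    (fun u u' x => by
      rw [← Finset.sum_add_distrib]
      refine Finset.sum_congr rfl fun f _ => ?_
      rw [map_add]; exact TensorProduct.tmul_add _ _ _)
    (fun c u x => by
      rw [Finset.smul_sum]
      refine Finset.sum_congr rfl fun f _ => ?_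
      rw [map_smul, tm_smul])
    (fun u x x' => by
      rw [← Finset.sum_add_distrib]
      refine Finset.sum_congr rfl fun f _ => ?_
      rw [map_add]; exact TensorProduct.add_tmul _ _ _)
    (fun c u x => by
      rw [Finset.smul_sum]
      refine Finset.sum_congr rfl fun f _ => ?_
      rw [map_smul, smul_tm]))

theorem zLin_tm {U : GrVec α} {f : G} {u : U} (hu : U.HasDeg f u) (x : Z.X) :
    Z.zLin U (tm u x) = tm (Z.act f x) u := by
  rw [zLin, uncurry_tm, LinearMap.mk₂_apply, Finset.sum_eq_single f, hu]
  · intro b _ hb; rw [hu.proj_eq_zero hb, tm_zero]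
  · simp

/-- The linear map `x ⊗ u ↦ u ⊗ f⁻¹(x)`, `u ∈ U_f`, where `f⁻¹` is the inverse of the
automorphism `f`. -/
def zInvLin (U : GrVec α) : tensor Z.X U →ₗ[k] tensor U Z.X :=
  uncurry (LinearMap.mk₂ k (fun x u => ∑ f, tm (U.proj f u) ((Z.actEquiv f).symm x))
    (fun x x' u => by
      rw [← Finset.sum_add_distrib]
      refine Finset.sum_congr rfl fun f _ => ?_
      rw [map_add]; exact TensorProduct.tmul_add _ _ _)
    (fun c x u => by
      rw [Finset.smul_sum]
      refine Finset.sum_congr rfl fun f _ => ?_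
      rw [map_smul, tm_smul])
    (fun x u u' => by
      rw [← Finset.sum_add_distrib]
      refine Finset.sum_congr rfl fun f _ => ?_
      rw [map_add]; exact TensorProduct.add_tmul _ _ _)
    (fun c x u => by
      rw [Finset.smul_sum]
      refine Finset.sum_congr rfl fun f _ => ?_
      rw [map_smul, smul_tm]))

theorem zInvLin_tm {U : GrVec α} {f : G} {u : U} (hu : U.HasDeg f u) (x : Z.X) :
    Z.zInvLin U (tm x u) = tm u ((Z.actEquiv f).symm x) := by
  rw [zInvLin, uncurry_tm, LinearMap.mk₂_apply, Finset.sum_eq_single f, hu]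
  · intro b _ hb; rw [hu.proj_eq_zero hb, zero_tm]
  · simp

/-- The half-braiding as a linear equivalence. -/
def zEquiv (U : GrVec α) : tensor U Z.X ≃ₗ[k] tensor Z.X U :=
  LinearEquiv.ofLinearMap (Z.zLin U) (Z.zInvLin U)
    (by
      apply ext_hom₂
      intro g f x u _ hu
      rw [LinearMap.comp_apply, zInvLin_tm _ hu, zLin_tm _ hu, ← actEquiv_apply,
        LinearEquiv.apply_symm_apply]; rfl)
    (by
      apply ext_hom₂
      intro f g u x hu _
      rw [LinearMap.comp_apply, zLin_tm _ hu, zInvLin_tm _ hu, ← actEquiv_apply,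
        LinearEquiv.symm_apply_apply]; rfl)

theorem zEquiv_hasDeg (U : GrVec α) (a : G) (y : tensor U Z.X)
    (hy : (tensor U Z.X).HasDeg a y) : (tensor Z.X U).HasDeg a (Z.zEquiv U y) := by
  have := tensor_comm (X := tensor Z.X U) (Z.zLin U)
    (fun f g u x hu hx => by
      rw [zLin_tm _ hu]
      have := (Z.act_deg f g x hx).tm hu
      rwa [inv_mul_cancel_right] at this) a y
  rw [hy] at this
  exact this.symm

/-- The half-braiding `z_U : U ⊗ X ≅ X ⊗ U`, `u ⊗ x ↦ f.x ⊗ u` for `u ∈ U_f`. -/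
def z (U : GrVec α) : tensor U Z.X ≅ tensor Z.X U := mkIso (Z.zEquiv U) (Z.zEquiv_hasDeg U)

@[simp] theorem z_hom_lin (U : GrVec α) : Hom.lin (Z.z U).hom = Z.zLin U := rfl

theorem z_naturality {U U' : GrVec α} (f : U ⟶ U') :
    tensorMap f (𝟙 Z.X) ≫ (Z.z U').hom = (Z.z U).hom ≫ tensorMap (𝟙 Z.X) f := by
  ext1
  apply ext_hom₂
  intro a b u x hu hx
  simp only [comp_lin, z_hom_lin, LinearMap.comp_apply, tensorMap_tm, zLin_tm _ hu,
    zLin_tm _ (f.hasDeg hu), id_lin, LinearMap.id_apply]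

@[simp] theorem assocIso_inv_lin (U V W : GrVec α) :
    Hom.lin (assocIso U V W).inv = (assocEquiv U V W).symm.toLinearMap := rfl

theorem z_monoidal (U U' : GrVec α) :
    (Z.z (tensor U U')).hom = (assocIso U U' Z.X).hom ≫ tensorMap (𝟙 U) (Z.z U').hom ≫
      (assocIso U Z.X U').inv ≫ tensorMap (Z.z U).hom (𝟙 U') ≫ (assocIso Z.X U U').hom := by
  ext1
  apply ext_hom₃
  intro f g h u u' x hu hu' hx
  have hgx := Z.act_deg g h x hx
  have hfgx := Z.act_deg f _ _ hgx
  simp only [comp_lin, z_hom_lin, LinearMap.comp_apply, tensorMap_tm, assocIso_hom_lin,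
    assocIso_inv_lin, LinearEquiv.coe_coe, zLin_tm _ (hu.tm hu'), assocEquiv_tm hu hu' hx,
    map_smul, id_lin, LinearMap.id_apply, zLin_tm _ hu', assocEquiv_symm_tm hu hgx hu',
    zLin_tm _ hu, assocEquiv_tm hfgx hu hu', smul_smul, smul_tm, tm_smul, Z.act_mul f g h x hx]
  rw [← Units.val_mul, ← Units.val_mul, Cocycle₃.two]
  congr 2
  simp only [mul_assoc, mul_inv_rev]

/-- The object of the monoidal centre of `𝒱(G, α)` given by an object of `𝒵(G, α)`. -/
def toCenter : Center (GrVec α) :=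
  ⟨Z.X, CatAlg.halfBraidingOfInv (X := Z.X) Z.z (Z.z_monoidal) (fun f => Z.z_naturality f)⟩

end ProjGrVec

/-! ### Algebras in `𝒱(G, α)` and in its centre -/

namespace GrVec

open MonObj

variable {k G : Type u} [Field k] [Group G] [Fintype G] {α : Cocycle₃ k G}

/-- An `α`-associative unital graded multiplication, `a(bc) = α(f, g, h) (ab)c` for
`a ∈ A_f`, `b ∈ A_g`, `c ∈ A_h`, on a graded vector space `A`. -/
structure GradedMul (A : GrVec α) where
  mul : A →ₗ[k] A →ₗ[k] A
  one : A
  mul_deg : ∀ f g a b, A.HasDeg f a → A.HasDeg g b → A.HasDeg (f * g) (mul a b)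
  one_deg : A.HasDeg 1 one
  one_mul : ∀ a, mul one a = a
  mul_one : ∀ a, mul a one = a
  mul_assoc : ∀ f g h a b c, A.HasDeg f a → A.HasDeg g b → A.HasDeg h c →
    mul a (mul b c) = (α.toFun f g h).val • mul (mul a b) c

namespace GradedMul

variable {A : GrVec α} (m : GradedMul A)

/-- The multiplication morphism. -/
def mulHom : tensor A A ⟶ A where
  lin := uncurry m.mul
  comm := tensor_comm _ fun f g a b ha hb => by
    rw [uncurry_tm]; exact m.mul_deg f g a b ha hb

@[simp] theorem mulHom_tm (a b : A) : m.mulHom.lin (tm a b) = m.mul a b := uncurry_tm _ _ _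

/-- The unit morphism. -/
def oneHom : unit α ⟶ A where
  lin := (LinearMap.toSpanSingleton k A m.one : k →ₗ[k] A)
  comm := comm_of_hasDeg (V := unit α) _ fun g c hc => by
    by_cases hg : g = 1
    · subst hg; exact m.one_deg.smul _
    · rw [unitVal_eq_zero hg hc]
      have : (LinearMap.toSpanSingleton k A m.one : k →ₗ[k] A) 0 = 0 := map_zero _
      exact (congrArg (A.HasDeg g) this).mpr (map_zero _)

@[simp] theorem oneHom_apply (c : unit α) : m.oneHom.lin c = unitVal c • m.one := rfl

theorem oneHom_mulHom : tensorMap m.oneHom (𝟙 A) ≫ m.mulHom = (leftIso A).hom := by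
  ext1
  apply ext_tm
  intro c a
  simp only [comp_lin, LinearMap.comp_apply, tensorMap_tm, oneHom_apply, id_lin,
    LinearMap.id_apply, mulHom_tm, leftIso_hom_lin, LinearEquiv.coe_coe, lid_tm, map_smul,
    LinearMap.smul_apply, m.one_mul]

theorem mulHom_oneHom : tensorMap (𝟙 A) m.oneHom ≫ m.mulHom = (rightIso A).hom := by
  ext1
  apply ext_tm
  intro a c
  simp only [comp_lin, LinearMap.comp_apply, tensorMap_tm, oneHom_apply, id_lin,
    LinearMap.id_apply, mulHom_tm, rightIso_hom_lin, LinearEquiv.coe_coe, rid_tm, map_smul,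
    LinearMap.smul_apply, m.mul_one]

theorem mulHom_assoc : tensorMap m.mulHom (𝟙 A) ≫ m.mulHom =
    (assocIso A A A).hom ≫ tensorMap (𝟙 A) m.mulHom ≫ m.mulHom := by
  ext1
  apply ext_hom₃
  intro f g h a b c ha hb hc
  simp only [comp_lin, LinearMap.comp_apply, tensorMap_tm, id_lin, LinearMap.id_apply, mulHom_tm,
    assocIso_hom_lin, LinearEquiv.coe_coe, assocEquiv_tm ha hb hc, map_smul,
    m.mul_assoc f g h a b c ha hb hc, smul_smul]
  simp

/-- The algebra in `𝒱(G, α)` given by an `α`-associative multiplication. -/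
def toMon : Mon (GrVec α) :=
  letI : MonObj A :=
    { one := m.oneHom
      mul := m.mulHom
      one_mul := m.oneHom_mulHom
      mul_one := m.mulHom_oneHom
      mul_assoc := m.mulHom_assoc }
  ⟨A⟩

end GradedMul

end GrVec

namespace ProjGrVec

open GrVec

variable {k G : Type u} [Field k] [Group G] [Fintype G] {α : Cocycle₃ k G} (Z : ProjGrVec α)

/-- A multiplication on an object of `𝒵(G, α)` that is compatible with the action:
`f.(ab) = α(f | g, h) (f.a)(f.b)` for `a ∈ Z_g`, `b ∈ Z_h`. -/
structure EquivMul extends GradedMul Z.X where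
  act_one : ∀ f, Z.act f one = one
  act_mul : ∀ f g h a b, Z.X.HasDeg g a → Z.X.HasDeg h b →
    Z.act f (mul a b) = (α.one f g h).val • mul (Z.act f a) (Z.act f b)

namespace EquivMul

variable {Z} (m : Z.EquivMul)

theorem oneHom_comm (U : GrVec α) : tensorMap (𝟙 U) m.oneHom ≫ (Z.z U).hom =
    (rightIso U).hom ≫ (leftIso U).inv ≫ tensorMap m.oneHom (𝟙 U) := by
  have h1 : ∀ (u : U), (leftIso U).inv.lin u = tm unitOne u := fun u => rfl
  ext1
  apply ext_hom₂
  intro f g u c hu hc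
  simp only [comp_lin, LinearMap.comp_apply, tensorMap_tm, GradedMul.oneHom_apply, id_lin,
    LinearMap.id_apply, z_hom_lin, zLin_tm _ hu, map_smul, m.act_one, rightIso_hom_lin,
    LinearEquiv.coe_coe, rid_tm, h1, smul_tm, unitVal_unitOne, one_smul]

theorem mulHom_comm (U : GrVec α) : tensorMap (𝟙 U) m.mulHom ≫ (Z.z U).hom =
    ((assocIso U Z.X Z.X).inv ≫ tensorMap (Z.z U).hom (𝟙 Z.X) ≫ (assocIso Z.X U Z.X).hom ≫
      tensorMap (𝟙 Z.X) (Z.z U).hom ≫ (assocIso Z.X Z.X U).inv) ≫ tensorMap m.mulHom (𝟙 U) := by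
  ext1
  apply ext_hom₃'
  intro f g h u a b hu ha hb
  have hfa := Z.act_deg f g a ha
  have hfb := Z.act_deg f h b hb
  simp only [comp_lin, LinearMap.comp_apply, tensorMap_tm, id_lin, LinearMap.id_apply,
    GradedMul.mulHom_tm, z_hom_lin, zLin_tm _ hu, assocIso_hom_lin, assocIso_inv_lin,
    LinearEquiv.coe_coe, assocEquiv_symm_tm hu ha hb, map_smul, assocEquiv_tm hfa hu hb,
    assocEquiv_symm_tm hfa hfb hu, smul_smul, m.act_mul f g h a b ha hb, smul_tm]
  rw [← Units.val_mul, ← Units.val_mul, ← mul_assoc]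
  rfl

/-- The algebra in the centre of `𝒱(G, α)` given by a compatible multiplication. -/
def toMon : Mon (Center (GrVec α)) :=
  letI : MonObj Z.toCenter :=
    { one := ⟨m.oneHom, CatAlg.center_comm_of_inv (X := 𝟙_ (Center (GrVec α))) (Y := Z.toCenter)
        m.oneHom fun U => (m.oneHom_comm U).trans (Category.assoc _ _ _).symm⟩
      mul := ⟨m.mulHom, CatAlg.center_comm_of_inv (X := Z.toCenter ⊗ Z.toCenter) (Y := Z.toCenter)
        m.mulHom fun U => (m.mulHom_comm U).trans (by congr 1)⟩
      one_mul := Center.ext _ _ m.oneHom_mulHom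
      mul_one := Center.ext _ _ m.mulHom_oneHom
      mul_assoc := Center.ext _ _ m.mulHom_assoc }
  ⟨Z.toCenter⟩

end EquivMul

end ProjGrVec

/-! ### Twisted convolution -/

section Convolution

variable {k M : Type u} [Field k] [Group M] [Fintype M]

/-- The bilinear product on functions on `M` with `e_r e_s = w(r, s) e_{rs}`. -/
def conv (w : M → M → kˣ) : (M → k) →ₗ[k] (M → k) →ₗ[k] (M → k) :=
  LinearMap.mk₂ k (fun a b t => ∑ r, (w r (r⁻¹ * t)).val * (a r * b (r⁻¹ * t)))
    (fun a a' b => by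
      ext t; simp only [Pi.add_apply, ← Finset.sum_add_distrib]
      exact Finset.sum_congr rfl fun _ _ => by ring)
    (fun c a b => by
      ext t; simp only [Pi.smul_apply, smul_eq_mul, Finset.mul_sum]
      exact Finset.sum_congr rfl fun _ _ => by ring)
    (fun a b b' => by
      ext t; simp only [Pi.add_apply, ← Finset.sum_add_distrib]
      exact Finset.sum_congr rfl fun _ _ => by ring)
    (fun c a b => by
      ext t; simp only [Pi.smul_apply, smul_eq_mul, Finset.mul_sum]
      exact Finset.sum_congr rfl fun _ _ => by ring)

theorem conv_apply (w : M → M → kˣ) (a b : M → k) (t : M) :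
    conv w a b t = ∑ r, (w r (r⁻¹ * t)).val * (a r * b (r⁻¹ * t)) := rfl

theorem conv_assoc (w : M → M → kˣ) (A : kˣ) (a b c : M → k)
    (h : ∀ r s u, a r ≠ 0 → b s ≠ 0 → c u ≠ 0 →
      w s u * w r (s * u) = A * (w r s * w (r * s) u)) :
    conv w a (conv w b c) = A.val • conv w (conv w a b) c := by
  ext t
  simp only [conv_apply, Pi.smul_apply, smul_eq_mul, Finset.mul_sum, Finset.sum_mul]
  conv_rhs => rw [Finset.sum_comm]
  refine Finset.sum_congr rfl fun r _ => ?_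
  refine Fintype.sum_equiv (Equiv.mulLeft r) _ _ fun s => ?_
  simp only [Equiv.coe_mulLeft, mul_inv_rev, inv_mul_cancel_left, mul_assoc]
  by_cases ha : a r = 0
  · simp [ha]
  by_cases hb : b s = 0
  · simp [hb]
  by_cases hc : c (s⁻¹ * (r⁻¹ * t)) = 0
  · simp [hc]
  have := congrArg Units.val (h r s _ ha hb hc)
  simp only [Units.val_mul, mul_inv_cancel_left, mul_assoc] at this
  linear_combination (a r * b s * c (s⁻¹ * (r⁻¹ * t))) * this

theorem conv_one_left (w : M → M → kˣ) (c : kˣ) (hw : ∀ s, w 1 s = c) (a : M → k)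
    [DecidableEq M] : conv w (fun t => if t = 1 then (c⁻¹ : kˣ).val else 0) a = a := by
  ext t
  rw [conv_apply, Finset.sum_eq_single 1]
  · simp [hw]
  · intro b _ hb; simp [hb]
  · simp

theorem conv_one_right (w : M → M → kˣ) (c : kˣ) (hw : ∀ s, w s 1 = c) (a : M → k)
    [DecidableEq M] : conv w a (fun t => if t = 1 then (c⁻¹ : kˣ).val else 0) = a := by
  ext t
  rw [conv_apply, Finset.sum_eq_single t]
  · simp only [inv_mul_cancel, hw, if_true]
    rw [mul_comm, mul_assoc, Units.inv_mul, mul_one]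
  · intro b _ hb
    have : b⁻¹ * t ≠ 1 := fun h => hb (inv_mul_eq_one.mp h)
    simp [this]
  · simp

end Convolution

/-! ### The twisted group algebra `k[H, γ]` -/

/-- A 2-cochain `γ` of the subgroup `H` with `d(γ) = α|_H`, that is,
`γ(g, h) γ(f, gh) = α(f, g, h) γ(f, g) γ(fg, h)`. -/
structure Cobounding {k G : Type u} [Field k] [Group G] (α : Cocycle₃ k G) (H : Subgroup G) where
  toFun : H → H → kˣ
  d_eq : ∀ f g h : H, toFun g h * toFun f (g * h) =
    α.toFun f g h * (toFun f g * toFun (f * g) h)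

/-- Subgroups of a finite group are finite. -/
@[reducible] def subgroupFintype {G : Type u} [Group G] [Fintype G] (H : Subgroup G) : Fintype H :=
  Fintype.ofFinite H

attribute [local instance] subgroupFintype

set_option linter.unusedSectionVars false

namespace Cobounding

variable {k G : Type u} [Field k] [Group G] [Fintype G] {α : Cocycle₃ k G} {H : Subgroup G}
  (γ : Cobounding α H)

theorem one_left (h : H) : γ.toFun 1 h = γ.toFun 1 1 := by
  have := γ.d_eq 1 1 h
  simp only [one_mul, OneMemClass.coe_one, α.one_left] at this
  exact mul_right_cancel this

theorem one_right (h : H) : γ.toFun h 1 = γ.toFun 1 1 := by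
  have := γ.d_eq h 1 1
  simp only [mul_one, OneMemClass.coe_one, α.one_right, one_mul] at this
  exact (mul_right_cancel this).symm

/-- `ε_f(g) = γ(f, g) / γ(fgf⁻¹, f)`, so that `e_f e_g = ε_f(g) e_{fgf⁻¹} e_f`. -/
def eps (f g : H) : kˣ := γ.toFun f g * (γ.toFun (f * g * f⁻¹) f)⁻¹

@[simp] theorem eps_one (f : H) : γ.eps f 1 = 1 := by
  simp [eps, γ.one_left, γ.one_right]

theorem add_d_eq (f g h : H) :
    Additive.ofMul (γ.toFun g h) + Additive.ofMul (γ.toFun f (g * h)) =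
      Additive.ofMul (α.toFun f g h) +
        (Additive.ofMul (γ.toFun f g) + Additive.ofMul (γ.toFun (f * g) h)) :=
  congrArg Additive.ofMul (γ.d_eq f g h)

theorem eps_mul (h f g : H) : γ.toFun f g * γ.eps h (f * g) =
    α.one h f g * (γ.eps h f * γ.eps h g * γ.toFun (h * f * h⁻¹) (h * g * h⁻¹)) := by
  apply Additive.ofMul.injective
  have h1 := γ.add_d_eq h f g
  have h2 := γ.add_d_eq (h * f * h⁻¹) h g
  have h3 := γ.add_d_eq (h * f * h⁻¹) (h * g * h⁻¹) h
  simp only [eps, Cocycle₃.one, ofMul_mul, ofMul_inv]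
  simp only [Subgroup.coe_mul, InvMemClass.coe_inv, mul_assoc, mul_inv_rev, inv_mul_cancel_left,
    inv_mul_cancel, mul_one] at h1 h2 h3 ⊢
  linear_combination (norm := abel) h1 - h2 + h3

open scoped Classical in
/-- The graded vector space with basis `e_h`, `h ∈ H`, of degrees `|e_h| = h`; its elements are
written as functions `a : H → k`, representing `∑ a(h) e_h`. -/
def twistedX (_γ : Cobounding α H) : GrVec α where
  carrier := H → k
  proj g :=
    { toFun := fun a t => if (t : G) = g then a t else 0
      map_add' := fun a b => by ext t; simp only [Pi.add_apply]; split <;> simp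
      map_smul' := fun c a => by ext t; simp }
  proj_self g a := by ext t; by_cases h : (t : G) = g <;> simp [h]
  proj_ne g g' a hne := by
    ext t
    by_cases h : (t : G) = g
    · subst h; simp [hne]
    · simp [h]
  sum_proj a := by
    ext t
    rw [Finset.sum_apply, Finset.sum_eq_single (t : G)]
    · simp
    · intro b _ hb; simp [hb.symm]
    · simp

theorem twistedX_hasDeg {g : G} {a : H → k} :
    γ.twistedX.HasDeg g a ↔ ∀ t : H, a t ≠ 0 → (t : G) = g := by
  classical
  constructor
  · intro h t ht
    by_contra hne
    apply ht
    rw [← h]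
    exact if_neg hne
  · intro h
    funext t
    change (if (t : G) = g then a t else 0) = a t
    by_cases ht : a t = 0
    · simp [ht]
    · rw [if_pos (h t ht)]

theorem conv_deg_aux {w : H → H → kˣ} {a b : H → k} {t : H} (h : conv w a b t ≠ 0) :
    ∃ r s, a r ≠ 0 ∧ b s ≠ 0 ∧ r * s = t := by
  rw [conv_apply] at h
  obtain ⟨r, _, hr⟩ := Finset.exists_ne_zero_of_sum_ne_zero h
  refine ⟨r, r⁻¹ * t, fun h0 => hr (by simp [h0]), fun h0 => hr (by simp [h0]), by simp⟩

open scoped Classical in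
/-- The multiplication `e_f e_g = γ(f, g) e_{fg}`. -/
def twistedMul : GrVec.GradedMul γ.twistedX where
  mul := conv γ.toFun
  one := fun t : H => if t = 1 then ((γ.toFun 1 1)⁻¹ : kˣ).val else 0
  mul_deg f g a b ha hb := by
    replace ha := γ.twistedX_hasDeg.1 ha
    replace hb := γ.twistedX_hasDeg.1 hb
    refine γ.twistedX_hasDeg.2 fun t ht => ?_
    obtain ⟨r, s, hr, hs, rfl⟩ := conv_deg_aux ht
    rw [Subgroup.coe_mul, ha r hr, hb s hs]
  one_deg := by
    refine γ.twistedX_hasDeg.2 fun t ht => ?_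
    by_cases h : t = 1
    · simp [h]
    · simp [h] at ht
  one_mul a := conv_one_left _ _ γ.one_left a
  mul_one a := conv_one_right _ _ γ.one_right a
  mul_assoc f g h a b c ha hb hc := by
    replace ha := γ.twistedX_hasDeg.1 ha
    replace hb := γ.twistedX_hasDeg.1 hb
    replace hc := γ.twistedX_hasDeg.1 hc
    refine conv_assoc _ _ _ _ _ fun r s u hr hs hu => ?_
    rw [← ha r hr, ← hb s hs, ← hc u hu]
    exact γ.d_eq r s u

/-- The twisted group algebra `k[H, γ]` as an algebra in `𝒱(G, α)`. -/
def twistedGroupAlgebra : Mon (GrVec α) := γ.twistedMul.toMon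

/-! ### The algebra `L(H, γ)` -/

/-- The space `L(H, γ)` of maps `a : G → k[H, γ]` with
`a(xh) = α(h⁻¹, x⁻¹ | f) h⁻¹.a(x)` for homogeneous `a` of degree `f`, `x ∈ G`, `h ∈ H`, where
`|a| = f` means that `|a(x)| = x⁻¹fx` for all `x`, and where `H` acts on `k[H, γ]` by
`h.e_t = ε_h(t) e_{hth⁻¹}`. In terms of the coefficients `a(x)(t)` of `e_t` in `a(x)`, which belong
to the component of degree `xtx⁻¹` of `a`, this condition reads as follows. -/
def LSpace : Submodule k (G → H → k) where
  carrier := {a | ∀ (x : G) (h t : H), a (x * h) (h⁻¹ * t * h) =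
    (α.two (h : G)⁻¹ x⁻¹ (x * t * x⁻¹) * γ.eps h⁻¹ t).val * a x t}
  add_mem' {a b} ha hb x h t := by
    simp only [Pi.add_apply, ha x h t, hb x h t, mul_add]
  zero_mem' x h t := by simp
  smul_mem' c a ha x h t := by
    simp only [Pi.smul_apply, ha x h t, smul_eq_mul]
    ring

open scoped Classical in
/-- `L(H, γ)` as a graded vector space. -/
def LX : GrVec α where
  carrier := γ.LSpace
  proj f :=
    { toFun := fun a => ⟨fun x t => if x * t * x⁻¹ = f then a.1 x t else 0, fun x h t => by
        have : x * h * ((h⁻¹ * t * h : H) : G) * (x * h)⁻¹ = x * t * x⁻¹ := by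
          simp only [Subgroup.coe_mul, InvMemClass.coe_inv]; group
        simp only [this, a.2 x h t]
        split <;> simp⟩
      map_add' := fun a b => by
        ext x t
        simp only [Submodule.coe_add, Pi.add_apply]
        split <;> simp
      map_smul' := fun c a => by
        ext x t
        simp }
  proj_self f a := by
    ext x t
    by_cases h : x * t * x⁻¹ = f <;> simp [h]
  proj_ne f f' a hne := by
    ext x t
    by_cases h : x * t * x⁻¹ = f
    · simp [h, hne]
    · simp [h]
  sum_proj a := by
    ext x t
    rw [Submodule.coe_sum, Finset.sum_apply, Finset.sum_apply,
      Finset.sum_eq_single (x * t * x⁻¹)]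
    · simp
    · intro b _ hb; simp [hb.symm]
    · simp

theorem LX_hasDeg {f : G} {a : γ.LSpace} :
    γ.LX.HasDeg f a ↔ ∀ (x : G) (t : H), a.1 x t ≠ 0 → x * t * x⁻¹ = f := by
  classical
  constructor
  · intro h x t ht
    by_contra hne
    apply ht
    have := congrArg (fun b : γ.LSpace => b.1 x t) h
    rw [← this]
    exact if_neg hne
  · intro h
    apply Subtype.ext
    funext x t
    change (if x * t * x⁻¹ = f then a.1 x t else 0) = a.1 x t
    by_cases ht : a.1 x t = 0
    · simp [ht]
    · rw [if_pos (h x t ht)]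

/-- The action `(g.a)(x) = α(x⁻¹, g | f)⁻¹ a(g⁻¹x)` for `|a| = f`. -/
def LAct (g : G) : γ.LSpace →ₗ[k] γ.LSpace where
  toFun a := ⟨fun x t =>
      ((α.two x⁻¹ g (g⁻¹ * (x * t * x⁻¹) * g))⁻¹ : kˣ).val * a.1 (g⁻¹ * x) t,
    fun x h t => by
      have h0 := a.2 (g⁻¹ * x) h t
      have e1 : x * h * ((h⁻¹ * t * h : H) : G) * (x * h)⁻¹ = x * t * x⁻¹ := by
        simp only [Subgroup.coe_mul, InvMemClass.coe_inv]; group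
      have e2 : g⁻¹ * x * t * (g⁻¹ * x)⁻¹ = g⁻¹ * (x * t * x⁻¹) * g := by group
      have e3 : (g⁻¹ * x)⁻¹ = x⁻¹ * g := by group
      have e4 : g * (g⁻¹ * (x * t * x⁻¹) * g) * g⁻¹ = x * t * x⁻¹ := by group
      have e5 : (x * h)⁻¹ = (h : G)⁻¹ * x⁻¹ := by group
      have hc := congrArg Additive.ofMul
        (α.two_cocycle (h : G)⁻¹ x⁻¹ g (g⁻¹ * (x * t * x⁻¹) * g))
      rw [e4] at hc
      rw [e2, e3] at h0
      beta_reduce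
      have e6 : g⁻¹ * (x * (h : G)) = g⁻¹ * x * h := (mul_assoc _ _ _).symm
      have key : (α.two ((h : G)⁻¹ * x⁻¹) g (g⁻¹ * (x * t * x⁻¹) * g))⁻¹ *
          (α.two (h : G)⁻¹ (x⁻¹ * g) (g⁻¹ * (x * t * x⁻¹) * g) * γ.eps h⁻¹ t) =
          (α.two (h : G)⁻¹ x⁻¹ (x * t * x⁻¹) * γ.eps h⁻¹ t) *
            (α.two x⁻¹ g (g⁻¹ * (x * t * x⁻¹) * g))⁻¹ := by
        apply Additive.ofMul.injective
        simp only [ofMul_mul, ofMul_inv] at hc ⊢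
        linear_combination (norm := abel) hc
      rw [e1, e5, e6, h0]
      have key' := congrArg Units.val key
      simp only [Units.val_mul] at key' ⊢
      linear_combination (a.1 (g⁻¹ * x) t) * key'⟩
  map_add' a b := by ext x t; simp [mul_add]
  map_smul' c a := by ext x t; simp; ring

theorem LAct_apply (g : G) (a : γ.LSpace) (x : G) (t : H) : (γ.LAct g a).1 x t =
    ((α.two x⁻¹ g (g⁻¹ * (x * t * x⁻¹) * g))⁻¹ : kˣ).val * a.1 (g⁻¹ * x) t := rfl

theorem LAct_mul (f g h : G) (a : γ.LSpace)
    (ha : ∀ (x : G) (t : H), a.1 x t ≠ 0 → x * t * x⁻¹ = h) :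
    γ.LAct (f * g) a = (α.two f g h).val • γ.LAct f (γ.LAct g a) := by
  ext x t
  simp only [Submodule.coe_smul, Pi.smul_apply, smul_eq_mul, LAct_apply]
  have e0 : g⁻¹ * (f⁻¹ * x) = (f * g)⁻¹ * x := by group
  rw [e0]
  by_cases h0 : a.1 ((f * g)⁻¹ * x) t = 0
  · simp only [h0, mul_zero]
  have hh := ha _ _ h0
  have e1 : (f * g)⁻¹ * (x * t * x⁻¹) * (f * g) = h := by rw [← hh]; group
  have e2 : g⁻¹ * (f⁻¹ * x * t * (f⁻¹ * x)⁻¹) * g = h := by rw [← hh]; group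
  have e3 : f⁻¹ * (x * t * x⁻¹) * f = g * h * g⁻¹ := by rw [← hh]; group
  have e4 : (f⁻¹ * x)⁻¹ = x⁻¹ * f := by group
  rw [e1, e2, e3, e4, ← mul_assoc, ← mul_assoc, ← Units.val_mul, ← Units.val_mul]
  congr 2
  have hc := congrArg Additive.ofMul (α.two_cocycle x⁻¹ f g h)
  apply Additive.ofMul.injective
  simp only [ofMul_mul, ofMul_inv] at hc ⊢
  linear_combination (norm := abel) -hc

/-- `L(H, γ)` as an object of `𝒵(G, α)`. -/
def LRep : ProjGrVec α where
  X := γ.LX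
  act := γ.LAct
  act_deg f g a ha := γ.LX_hasDeg.2 fun x t ht => by
    have := γ.LX_hasDeg.1 ha (f⁻¹ * x) t (right_ne_zero_of_mul ht)
    rw [← this]; group
  act_one a := by
    apply Subtype.ext
    funext x t
    change ((α.two x⁻¹ 1 _)⁻¹ : kˣ).val * a.1 (1⁻¹ * x) t = a.1 x t
    simp
  act_mul f g h a ha := γ.LAct_mul f g h a (γ.LX_hasDeg.1 ha)

/-- The weights of the multiplication on `L(H, γ)`. -/
def LWeight (x : G) (r s : H) : kˣ :=
  α.one x⁻¹ (x * r * x⁻¹) (x * s * x⁻¹) * γ.toFun r s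

theorem LWeight_conj (x : G) (h r s : H) :
    γ.LWeight (x * h) (h⁻¹ * r * h) (h⁻¹ * s * h) *
      ((α.two (h : G)⁻¹ x⁻¹ (x * r * x⁻¹) * γ.eps h⁻¹ r) *
        (α.two (h : G)⁻¹ x⁻¹ (x * s * x⁻¹) * γ.eps h⁻¹ s)) =
      (α.two (h : G)⁻¹ x⁻¹ (x * (r * s : H) * x⁻¹) * γ.eps h⁻¹ (r * s)) * γ.LWeight x r s := by
  have e1 : ∀ t : H, x * h * ((h⁻¹ * t * h : H) : G) * (x * h)⁻¹ = x * t * x⁻¹ := fun t => by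
    simp only [Subgroup.coe_mul, InvMemClass.coe_inv]; group
  have e2 : (x * h)⁻¹ = (h : G)⁻¹ * x⁻¹ := by group
  have e3 : ∀ t : H, x⁻¹ * (x * t * x⁻¹) * x⁻¹⁻¹ = t := fun t => by group
  have e4 : x * r * x⁻¹ * (x * s * x⁻¹) = x * (r * s : H) * x⁻¹ := by
    rw [Subgroup.coe_mul]; group
  have h1 := congrArg Additive.ofMul (γ.eps_mul h⁻¹ r s)
  have h2 := congrArg Additive.ofMul (α.two_one (h : G)⁻¹ x⁻¹ (x * r * x⁻¹) (x * s * x⁻¹))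
  rw [e3, e3, e4] at h2
  unfold LWeight
  rw [e1, e1, e2]
  apply Additive.ofMul.injective
  simp only [ofMul_mul, inv_inv, InvMemClass.coe_inv] at h1 h2 ⊢
  linear_combination (norm := abel) h2 - h1

/-- The multiplication `(ab)(x) = α(x⁻¹ | f, g) a(x) b(x)` for `|a| = f`, `|b| = g`, where the
product on the right is that of `k[H, γ]`. -/
def LMulFun (a b : γ.LSpace) : γ.LSpace :=
  ⟨fun x => conv (γ.LWeight x) (a.1 x) (b.1 x), fun x h t => by
    beta_reduce
    rw [conv_apply, conv_apply, Finset.mul_sum]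
    symm
    refine Fintype.sum_equiv (MulAut.conj h⁻¹).toEquiv _ _ fun r => ?_
    have e1 : (MulAut.conj h⁻¹).toEquiv r = h⁻¹ * r * h := by simp
    have e2 : (h⁻¹ * r * h)⁻¹ * (h⁻¹ * t * h) = h⁻¹ * (r⁻¹ * t) * h := by group
    rw [e1, e2, a.2 x h r, b.2 x h (r⁻¹ * t)]
    have := congrArg Units.val (γ.LWeight_conj x h r (r⁻¹ * t))
    rw [mul_inv_cancel_left] at this
    simp only [Units.val_mul] at this ⊢
    linear_combination (-(a.1 x r * b.1 x (r⁻¹ * t))) * this⟩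

/-- The multiplication as a bilinear map. -/
def LMulLin : γ.LSpace →ₗ[k] γ.LSpace →ₗ[k] γ.LSpace :=
  LinearMap.mk₂ k γ.LMulFun
    (fun a a' b => by apply Subtype.ext; funext x; simp [LMulFun])
    (fun c a b => by apply Subtype.ext; funext x; simp [LMulFun])
    (fun a b b' => by apply Subtype.ext; funext x; simp [LMulFun])
    (fun c a b => by apply Subtype.ext; funext x; simp [LMulFun])

theorem LMulLin_apply (a b : γ.LSpace) (x : G) :
    (γ.LMulLin a b).1 x = conv (γ.LWeight x) (a.1 x) (b.1 x) := rfl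

open scoped Classical in
/-- The unit of `L(H, γ)`: the constant map with value the unit of `k[H, γ]`. -/
def LOne : γ.LSpace :=
  ⟨fun _ t => if t = 1 then ((γ.toFun 1 1)⁻¹ : kˣ).val else 0, fun x h t => by
    beta_reduce
    by_cases ht : t = 1
    · subst ht; simp
    · have : h⁻¹ * t * h ≠ 1 := fun h' => ht (by
        have := congrArg (fun y => h * y * h⁻¹) h'
        simpa [mul_assoc] using this)
      rw [if_neg ht, if_neg this, mul_zero]⟩

open scoped Classical in
theorem LOne_apply (x : G) (t : H) :
    γ.LOne.1 x t = if t = 1 then ((γ.toFun 1 1)⁻¹ : kˣ).val else 0 := rfl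

theorem LMulLin_assoc (f g h : G) (a b c : γ.LSpace)
    (ha : ∀ (x : G) (t : H), a.1 x t ≠ 0 → x * t * x⁻¹ = f)
    (hb : ∀ (x : G) (t : H), b.1 x t ≠ 0 → x * t * x⁻¹ = g)
    (hc : ∀ (x : G) (t : H), c.1 x t ≠ 0 → x * t * x⁻¹ = h) :
    γ.LMulLin a (γ.LMulLin b c) = (α.toFun f g h).val • γ.LMulLin (γ.LMulLin a b) c := by
  apply Subtype.ext; funext x
  refine conv_assoc _ _ _ _ _ fun r s u hr hs hu => ?_
  have h1 := congrArg Additive.ofMul (γ.d_eq r s u)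
  have h2 := congrArg Additive.ofMul
    (α.one_assoc x⁻¹ (x * r * x⁻¹) (x * s * x⁻¹) (x * u * x⁻¹))
  have e3 : ∀ t : H, x⁻¹ * (x * t * x⁻¹) * x⁻¹⁻¹ = t := fun t => by group
  have e4 : ∀ r s : H, x * r * x⁻¹ * (x * s * x⁻¹) = x * (r * s : H) * x⁻¹ := fun r s => by
    rw [Subgroup.coe_mul]; group
  rw [e3, e3, e3, e4, e4] at h2
  rw [← ha x r hr, ← hb x s hs, ← hc x u hu]
  unfold LWeight
  apply Additive.ofMul.injective
  simp only [ofMul_mul] at h1 h2 ⊢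
  linear_combination (norm := abel) h1 - h2

theorem LAct_one (f : G) : γ.LAct f γ.LOne = γ.LOne := by
  ext x t
  rw [LAct_apply, LOne_apply, LOne_apply]
  by_cases h : t = 1
  · subst h; simp
  · simp [h]

theorem LAct_LMulLin (f g h : G) (a b : γ.LSpace)
    (ha : ∀ (x : G) (t : H), a.1 x t ≠ 0 → x * t * x⁻¹ = g)
    (hb : ∀ (x : G) (t : H), b.1 x t ≠ 0 → x * t * x⁻¹ = h) :
    γ.LAct f (γ.LMulLin a b) =
      (α.one f g h).val • γ.LMulLin (γ.LAct f a) (γ.LAct f b) := by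
  ext x t
  simp only [Submodule.coe_smul, Pi.smul_apply, smul_eq_mul, LAct_apply, LMulLin_apply,
    conv_apply, Finset.mul_sum]
  refine Finset.sum_congr rfl fun r _ => ?_
  obtain ⟨s, hs⟩ : ∃ s, r⁻¹ * t = s := ⟨_, rfl⟩
  have ht : t = r * s := by rw [← hs]; group
  rw [hs]
  by_cases ha0 : a.1 (f⁻¹ * x) r = 0
  · simp [ha0]
  by_cases hb0 : b.1 (f⁻¹ * x) s = 0
  · simp [hb0]
  have hg := ha _ _ ha0
  have hh := hb _ _ hb0
  have e1 : f⁻¹ * (x * r * x⁻¹) * f = g := by rw [← hg]; group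
  have e2 : f⁻¹ * (x * s * x⁻¹) * f = h := by rw [← hh]; group
  have e3 : f⁻¹ * (x * t * x⁻¹) * f = g * h := by
    rw [← hg, ← hh, ht, Subgroup.coe_mul]; group
  have e4 : x * r * x⁻¹ = f * g * f⁻¹ := by rw [← hg]; group
  have e5 : x * s * x⁻¹ = f * h * f⁻¹ := by rw [← hh]; group
  have e6 : (f⁻¹ * x)⁻¹ = x⁻¹ * f := by group
  have hc := congrArg Additive.ofMul (α.two_one x⁻¹ f g h)
  have key : (α.two x⁻¹ f (g * h))⁻¹ * γ.LWeight (f⁻¹ * x) r s =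
      α.one f g h * γ.LWeight x r s * (α.two x⁻¹ f g)⁻¹ * (α.two x⁻¹ f h)⁻¹ := by
    unfold LWeight
    rw [hg, hh, e4, e5, e6]
    apply Additive.ofMul.injective
    simp only [ofMul_mul, ofMul_inv] at hc ⊢
    linear_combination (norm := abel) hc
  rw [e1, e2, e3]
  have key' := congrArg Units.val key
  simp only [Units.val_mul] at key'
  linear_combination (a.1 (f⁻¹ * x) r * b.1 (f⁻¹ * x) s) * key'

/-- `L(H, γ)` with its multiplication. -/
def LMul : γ.LRep.EquivMul where
  mul := γ.LMulLin
  one := γ.LOne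
  mul_deg f g a b ha hb := γ.LX_hasDeg.2 fun x t ht => by
    obtain ⟨r, s, hr, hs, rfl⟩ := conv_deg_aux ht
    rw [← γ.LX_hasDeg.1 ha x r hr, ← γ.LX_hasDeg.1 hb x s hs, Subgroup.coe_mul]; group
  one_deg := γ.LX_hasDeg.2 fun x t ht => by
    classical
    rw [LOne_apply] at ht
    by_cases h : t = 1
    · simp [h]
    · simp [h] at ht
  one_mul a := by
    classical
    apply Subtype.ext; funext x
    refine (congrArg (fun b => conv (γ.LWeight x) b (Subtype.val a x)) ?_).trans
      (conv_one_left _ (γ.toFun 1 1) (fun s => by simp [LWeight, γ.one_left]) _)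
    funext t; rw [LOne_apply]
  mul_one a := by
    classical
    apply Subtype.ext; funext x
    refine (congrArg (fun b => conv (γ.LWeight x) (Subtype.val a x) b) ?_).trans
      (conv_one_right _ (γ.toFun 1 1) (fun s => by simp [LWeight, γ.one_right]) _)
    funext t; rw [LOne_apply]
  mul_assoc f g h a b c ha hb hc :=
    γ.LMulLin_assoc f g h a b c (γ.LX_hasDeg.1 ha) (γ.LX_hasDeg.1 hb) (γ.LX_hasDeg.1 hc)
  act_one := γ.LAct_one
  act_mul f g h a b ha hb :=
    γ.LAct_LMulLin f g h a b (γ.LX_hasDeg.1 ha) (γ.LX_hasDeg.1 hb)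

/-- The algebra `L(H, γ)` in the centre of `𝒱(G, α)`. -/
def lagrangian : Mon (Center (GrVec α)) := γ.LMul.toMon

/-- The evaluation `ζ(a) = a(1)`, as a morphism `L(H, γ) ⟶ k[H, γ]` in `𝒱(G, α)`. -/
def evalHom : γ.LX ⟶ γ.twistedX where
  lin := ((LinearMap.proj (1 : G) : (G → H → k) →ₗ[k] (H → k)) ∘ₗ γ.LSpace.subtype :
    γ.LSpace →ₗ[k] (H → k))
  comm := GrVec.comm_of_hasDeg (V := γ.LX) (W := γ.twistedX) _ fun g a ha =>
    γ.twistedX_hasDeg.2 fun t ht => by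
      have := γ.LX_hasDeg.1 ha 1 t ht
      simpa using this

theorem evalHom_one : γ.LMul.oneHom ≫ γ.evalHom = γ.twistedMul.oneHom := by
  ext1
  apply LinearMap.ext
  intro c
  rfl

theorem evalHom_mul : γ.LMul.mulHom ≫ γ.evalHom =
    GrVec.tensorMap γ.evalHom γ.evalHom ≫ γ.twistedMul.mulHom := by
  ext1
  apply GrVec.ext_tm
  intro a b
  simp only [GrVec.comp_lin, LinearMap.comp_apply, GrVec.tensorMap_tm, GrVec.GradedMul.mulHom_tm]
  have h : γ.LWeight 1 = γ.toFun := by funext r s; simp [LWeight]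
  change conv (γ.LWeight 1) _ _ = conv γ.toFun _ _
  rw [h]
  rfl

/-- The evaluation `ζ(a) = a(1)` as a homomorphism of algebras. -/
def zeta : (Center.forget (GrVec α)).mapMon.obj γ.lagrangian ⟶ γ.twistedGroupAlgebra :=
  Mon.Hom.mk' (M := (Center.forget (GrVec α)).mapMon.obj γ.lagrangian)
    (N := γ.twistedGroupAlgebra) γ.evalHom
    ((Category.assoc _ _ _).trans ((Category.id_comp _).trans γ.evalHom_one))
    ((Category.assoc _ _ _).trans ((Category.id_comp _).trans γ.evalHom_mul))

end Cobounding

/-! ### Separable algebras and Lagrangian algebras -/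

section Lagrangian

open MonObj

variable {k G : Type u} [Field k] [Group G] [Fintype G] {α : Cocycle₃ k G}

/-- The multiplication of an algebra in `𝒱(G, α)` as a bilinear map. -/
def algMul (A : Mon (GrVec α)) : A.X →ₗ[k] A.X →ₗ[k] A.X :=
  GrVec.curry (V := A.X) (W := A.X) (GrVec.Hom.lin μ[A.X])

/-- The canonical trace form `(a, b) ↦ τ(ab)` of an algebra in `𝒱(G, α)`, where `τ(a)` is the
trace of the multiplication by `a` from the left. -/
def traceForm (A : Mon (GrVec α)) : LinearMap.BilinForm k A.X :=
  (algMul A).compr₂ (LinearMap.trace k A.X ∘ₗ algMul A)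

/-- An algebra in `𝒱(G, α)` is separable if its canonical trace form is non-degenerate. -/
def IsSeparableAlgebra (A : Mon (GrVec α)) : Prop := (traceForm A).Nondegenerate

/-- A Lagrangian algebra: an étale (that is, commutative and separable), indecomposable algebra
all of whose local modules are direct sums of copies of the regular module. -/
def IsLagrangian (L : Mon (Center (GrVec α))) : Prop :=
  (β_ L.X L.X).hom ≫ μ[L.X] = μ[L.X] ∧
    IsSeparableAlgebra ((Center.forget (GrVec α)).mapMon.obj L) ∧
    CatAlg.IsIndecomposable L ∧ CatAlg.LocalModulesFree L

end Lagrangian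

end

set_option linter.unusedSectionVars false

/-! The full centre of an algebra `A` depends only on its module category. A central morphism from
`Y` to `A` amounts to a linear natural transformation from `Y ⊗ -` to the identity of the category
of `A`-modules (`CentralFamily`): by linearity and naturality along the actions `M ⊗ A → M`, such a
transformation is determined by its component at the regular module. Linear equivalences carry these
families over, together with their products, units and pull-backs, and hence carry over the
universal central morphism (`IsFullCentre.transport`).

Every separable indecomposable algebra is Morita equivalent to some `k[H, γ]`. Its part of degree 1
is semisimple, so it contains a primitive idempotent `q`. The degree 1 part of `qAq` is `kq`, and
non-degeneracy of the trace form makes every non-zero homogeneous element of `qAq` invertible; so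
`qAq` is a twisted group algebra on the subgroup of degrees that occur. The ideal `AqA` is generated
by a central idempotent, which must be 1, and then `M ↦ Mq` is an equivalence
(`exists_moduleCategoriesEquivalent`).

The full centre of `k[H, γ]` is `L(H, γ)` by Frobenius reciprocity: a central `ξ` corresponds to `y
↦ (x ↦ ξ(x⁻¹.y))` (`isFullCentre_zeta`). The algebra `L(H, γ)` consists of sections over `G/H`, and
its idempotents cut a module into pieces over the cosets. Locality forces the piece over `H` to have
degrees in `H`, and forces `H` to fix its elements of degree 1. Averaging over `G` then shows that a
local module is free on its invariants of degree 1 (`LocalAction.exists_basis`).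

Conversely, in a Lagrangian algebra `L` a primitive idempotent of degree 1 is central, by
commutativity. Multiplication by it is a central homomorphism onto some `k[H, γ]`, which lifts to a
homomorphism from `L` to `L(H, γ)`. Along it `L(H, γ)` becomes a local `L`-module, so it is a sum of
copies of `L`. Since the unit object has only scalar morphisms to `L(H, γ)`, all module maps from
`L` to it are multiples of the homomorphism, which is therefore invertible
(`nonempty_iso_lagrangian`).

Finally, an isomorphism from `L(H, γ)` to `L(H', γ')` yields a second homomorphism out of `L(H, γ)`,
to `k[H', γ']`. Its kernel is `{a | a(x) = 0}` for some `x`, and `x⁻¹` moves this kernel to that of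
`ζ`. So the half-braiding with the line of degree `x⁻¹` descends to an isomorphism which intertwines
`k[H, γ]` and `k[H', γ']`, and tensoring with this invertible line is an equivalence of module
categories. -/

noncomputable section

/-! ### Linear functors between module categories -/

namespace CatAlg

section LinearFunctor

open MonoidalLeftAction Functor LaxLeftLinear OplaxLeftLinear LeftLinear

universe w₁ w₂ w₃ w₄ w₅ w₆

variable {C : Type u} [Category.{v} C] [MonoidalCategory C]
  {D : Type w₁} [Category.{w₂} D] [MonoidalLeftAction C D]
  {D' : Type w₃} [Category.{w₄} D'] [MonoidalLeftAction C D']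
  {D₂ : Type w₅} [Category.{w₆} D₂] [MonoidalLeftAction C D₂]

/-- A linear structure from invertible lineators. -/
@[reducible] def leftLinearOfIso (F : D ⥤ D') (m : ∀ (c : C) (d : D), c ⊙ₗ F.obj d ≅ F.obj (c ⊙ₗ d))
    (natl : ∀ {c c' : C} (f : c ⟶ c') (d : D),
      f ⊵ₗ F.obj d ≫ (m c' d).hom = (m c d).hom ≫ F.map (f ⊵ₗ d))
    (natr : ∀ (c : C) {d d' : D} (f : d ⟶ d'),
      c ⊴ₗ F.map f ≫ (m c d').hom = (m c d).hom ≫ F.map (c ⊴ₗ f))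
    (assoc : ∀ (c c' : C) (d : D), (m (c ⊗ c') d).hom ≫ F.map (αₗ c c' d).hom =
      (αₗ c c' (F.obj d)).hom ≫ c ⊴ₗ (m c' d).hom ≫ (m c (c' ⊙ₗ d)).hom)
    (unit : ∀ d : D, (λₗ[C] (F.obj d)).hom = (m (𝟙_ C) d).hom ≫ F.map (λₗ[C] d).hom) :
    F.LeftLinear C where
  μₗ c d := (m c d).hom
  μₗ_naturality_left := natl
  μₗ_naturality_right := natr
  μₗ_associativity := assoc
  μₗ_unitality := unit
  δₗ c d := (m c d).inv
  δₗ_naturality_left f d := by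
    rw [Iso.eq_inv_comp, ← Category.assoc, Iso.comp_inv_eq, natl]
  δₗ_naturality_right c _ _ f := by
    rw [Iso.eq_inv_comp, ← Category.assoc, Iso.comp_inv_eq, natr]
  δₗ_associativity c c' d := by
    have h := assoc c c' d
    rw [Iso.inv_comp_eq, ← Category.assoc, h]
    simp only [Category.assoc, Iso.hom_inv_id_assoc, actionHomRight_hom_inv, Category.comp_id]
  δₗ_unitality_inv d := by
    rw [← cancel_epi (λₗ[C] (F.obj d)).hom, Iso.hom_inv_id, unit d, Category.assoc,
      ← F.map_comp_assoc, Iso.hom_inv_id, F.map_id, Category.id_comp, Iso.hom_inv_id]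
  μₗ_comp_δₗ c d := (m c d).hom_inv_id
  δₗ_comp_μₗ c d := (m c d).inv_hom_id

/-- The composition of linear functors is linear. -/
@[reducible] def leftLinearComp (F : D ⥤ D') (F' : D' ⥤ D₂) [F.LeftLinear C] [F'.LeftLinear C] :
    (F ⋙ F').LeftLinear C :=
  leftLinearOfIso (F ⋙ F') (fun c d => μₗIso F' c (F.obj d) ≪≫ F'.mapIso (μₗIso F c d))
    (fun f d => by
      dsimp
      rw [μₗ_naturality_left_assoc, Category.assoc, ← F'.map_comp, ← F'.map_comp,
        μₗ_naturality_left])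
    (fun c _ _ f => by
      dsimp
      rw [μₗ_naturality_right_assoc, Category.assoc, ← F'.map_comp, ← F'.map_comp,
        μₗ_naturality_right])
    (fun c c' d => by
      dsimp
      simp only [Category.assoc, actionHomRight_comp]
      rw [← F'.map_comp, μₗ_associativity, F'.map_comp, F'.map_comp, μₗ_associativity_assoc,
        μₗ_naturality_right_assoc])
    (fun d => by
      dsimp
      rw [Category.assoc, ← F'.map_comp, ← μₗ_unitality, ← μₗ_unitality])

/-- A right quasi-inverse of a fully faithful linear functor is linear. -/
@[reducible] def leftLinearInv (F : D ⥤ D') [F.Full] [F.Faithful] [F.LeftLinear C] (F' : D' ⥤ D)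
    (e : ∀ x, F.obj (F'.obj x) ≅ x)
    (he : ∀ {x y : D'} (f : x ⟶ y), F.map (F'.map f) ≫ (e y).hom = (e x).hom ≫ f) :
    F'.LeftLinear C := by
  have he' : ∀ {x y : D'} (f : x ⟶ y), (e x).inv ≫ F.map (F'.map f) = f ≫ (e y).inv :=
    fun f => by rw [Iso.inv_comp_eq, ← Category.assoc, ← he, Category.assoc, Iso.hom_inv_id,
      Category.comp_id]
  let a : ∀ (c : C) (d : D'), c ⊙ₗ F.obj (F'.obj d) ≅ c ⊙ₗ d := fun c d =>
    ⟨c ⊴ₗ (e d).hom, c ⊴ₗ (e d).inv, actionHomRight_hom_inv _ _, actionHomRight_inv_hom _ _⟩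
  -- The lineator is determined by its image under `F`, so each axiom below is checked after
  -- applying the faithful functor `F`.
  let m : ∀ (c : C) (d : D'), c ⊙ₗ F'.obj d ≅ F'.obj (c ⊙ₗ d) := fun c d =>
    F.preimageIso ((μₗIso F c (F'.obj d)).symm ≪≫ a c d ≪≫ (e (c ⊙ₗ d)).symm)
  have hm : ∀ c d, F.map (m c d).hom = δₗ F c (F'.obj d) ≫ c ⊴ₗ (e d).hom ≫ (e (c ⊙ₗ d)).inv :=
    fun c d => by simp [m, a]
  refine leftLinearOfIso F' m ?_ ?_ ?_ ?_
  · intro c c' f d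
    apply F.map_injective
    rw [F.map_comp, F.map_comp, hm, hm, δₗ_naturality_left_assoc, Category.assoc, Category.assoc,
      he', action_exchange_assoc]
  · intro c d d' f
    apply F.map_injective
    rw [F.map_comp, F.map_comp, hm, hm, δₗ_naturality_right_assoc, Category.assoc, Category.assoc,
      he', ← actionHomRight_comp_assoc, he, actionHomRight_comp_assoc]
  · intro c c' d
    apply F.map_injective
    simp only [F.map_comp, hm, Category.assoc]
    rw [he', δₗ_naturality_right_assoc, ← actionHomRight_comp_assoc, hm]
    simp only [Category.assoc, Iso.inv_hom_id, Category.comp_id, actionHomRight_comp]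
    have h2 := δₗ_associativity F c c' (F'.obj d)
    rw [← reassoc_of% h2, tensor_actionHomRight]
    simp only [Category.assoc, Iso.inv_hom_id_assoc]
  · intro d
    apply F.map_injective
    rw [F.map_comp, hm, Category.assoc, Category.assoc, he',
      ← actionUnitIso_hom_naturality_assoc, Iso.hom_inv_id, Category.comp_id, δₗ_unitality_hom]

end LinearFunctor

variable {C : Type u} [Category.{v} C] [MonoidalCategory C]

theorem ModuleCategoriesEquivalent.symm {A B : Mon C} (h : ModuleCategoriesEquivalent A B) :
    ModuleCategoriesEquivalent B A := by
  obtain ⟨F, hF, ⟨hl⟩⟩ := h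
  exact ⟨F.inv, inferInstance, ⟨leftLinearInv F F.inv (fun x => F.asEquivalence.counitIso.app x)
    fun f => F.asEquivalence.counitIso.hom.naturality f⟩⟩

theorem ModuleCategoriesEquivalent.trans {A B D : Mon C} (h : ModuleCategoriesEquivalent A B)
    (h' : ModuleCategoriesEquivalent B D) : ModuleCategoriesEquivalent A D := by
  obtain ⟨F, hF, ⟨hl⟩⟩ := h
  obtain ⟨F', hF', ⟨hl'⟩⟩ := h'
  exact ⟨F ⋙ F', inferInstance, ⟨leftLinearComp F F'⟩⟩

end CatAlg

/-! ### Central families on module categories and the transport of full centres -/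

namespace CatAlg

open MonObj MonoidalLeftAction Functor LaxLeftLinear OplaxLeftLinear LeftLinear

universe w₁ w₂ w₃ w₄

variable {C : Type u} [Category.{v} C] [MonoidalCategory C]

/-- A linear natural transformation from the functor `Y ⊗ -` to the identity of a module category,
where the half-braiding of `Y` makes `Y ⊗ -` a linear functor. -/
structure CentralFamily {Y : C} (b : HalfBraiding Y) (D : Type w₁) [Category.{w₂} D]
    [MonoidalLeftAction C D] where
  app : ∀ d : D, Y ⊙ₗ d ⟶ d
  naturality : ∀ {d d' : D} (f : d ⟶ d'), Y ⊴ₗ f ≫ app d' = app d ≫ f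
  linear : ∀ (c : C) (d : D), app (c ⊙ₗ d) = (αₗ Y c d).inv ≫ (b.β c).hom ⊵ₗ d ≫
    (αₗ c Y d).hom ≫ c ⊴ₗ app d

namespace CentralFamily

variable {D : Type w₁} [Category.{w₂} D] [MonoidalLeftAction C D]
  {D' : Type w₃} [Category.{w₄} D'] [MonoidalLeftAction C D'] {Y : C} {b : HalfBraiding Y}

@[ext]
theorem ext {θ θ' : CentralFamily b D} (h : ∀ d, θ.app d = θ'.app d) : θ = θ' := by
  obtain ⟨a, _, _⟩ := θ
  obtain ⟨b, _, _⟩ := θ'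
  obtain rfl : a = b := funext h
  rfl

/-- Two central families correspond to each other under a linear functor. -/
def Match (F : D ⥤ D') [F.LeftLinear C] (θ : CentralFamily b D) (θ' : CentralFamily b D') : Prop :=
  ∀ d, θ'.app (F.obj d) = μₗ F Y d ≫ F.map (θ.app d)

variable (F : D ⥤ D') [F.LeftLinear C]

theorem Match.left_unique [F.Faithful] {θ₁ θ₂ : CentralFamily b D} {θ' : CentralFamily b D'}
    (h₁ : Match F θ₁ θ') (h₂ : Match F θ₂ θ') : θ₁ = θ₂ := by
  ext d
  apply F.map_injective
  rw [← cancel_epi (μₗ F Y d), ← h₁, ← h₂]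

/-- By naturality a family is determined by its components at objects of the form `F.obj d`, and
every object is isomorphic to one of these. -/
theorem Match.right_unique [F.EssSurj] {θ : CentralFamily b D} {θ₁ θ₂ : CentralFamily b D'}
    (h₁ : Match F θ θ₁) (h₂ : Match F θ θ₂) : θ₁ = θ₂ := by
  ext d
  have e := F.objObjPreimageIso d
  rw [← cancel_epi (Y ⊴ₗ e.hom), θ₁.naturality, θ₂.naturality, h₁, h₂]

theorem exists_match_left [F.Full] [F.Faithful] (θ' : CentralFamily b D') :
    ∃ θ : CentralFamily b D, Match F θ θ' := by
  let a : ∀ d : D, Y ⊙ₗ d ⟶ d := fun d => F.preimage (δₗ F Y d ≫ θ'.app (F.obj d))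
  have ha : ∀ d, F.map (a d) = δₗ F Y d ≫ θ'.app (F.obj d) := fun d => F.map_preimage _
  refine ⟨⟨a, fun {d d'} f => ?_, fun c d => ?_⟩, fun d => ?_⟩
  · apply F.map_injective
    rw [F.map_comp, F.map_comp, ha, ha, δₗ_naturality_right_assoc, θ'.naturality, Category.assoc]
  · apply F.map_injective
    -- Precomposing with the invertible lineators replaces `F.obj (Y ⊙ₗ c ⊙ₗ d)` by `Y ⊙ₗ c ⊙ₗ F.obj
    -- d`, where linearity of `θ'` applies.
    rw [← cancel_epi (μₗ F Y (c ⊙ₗ d)), ← cancel_epi (Y ⊴ₗ μₗ F c d)]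
    simp only [F.map_comp, ha, μₗ_comp_δₗ_assoc]
    rw [θ'.naturality, θ'.linear, μₗ_associativity_inv_assoc, ← μₗ_naturality_left_assoc,
      μₗ_associativity_assoc, ← μₗ_naturality_right, ha]
    simp only [Category.assoc, actionHomRight_comp]
    rw [← actionHomRight_comp_assoc c (μₗ F Y d), μₗ_comp_δₗ, actionHomRight_id,
      Category.id_comp]
  · exact (by rw [ha, μₗ_comp_δₗ_assoc] : θ'.app (F.obj d) = μₗ F Y d ≫ F.map (a d))

theorem exists_match_right [F.Full] [F.Faithful] [F.EssSurj] (θ : CentralFamily b D) :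
    ∃ θ' : CentralFamily b D', Match F θ θ' := by
  let p : D' → D := F.objPreimage
  let e : ∀ x, F.obj (p x) ≅ x := F.objObjPreimageIso
  let a : ∀ d : D', Y ⊙ₗ d ⟶ d := fun d =>
    Y ⊴ₗ (e d).inv ≫ μₗ F Y (p d) ≫ F.map (θ.app (p d)) ≫ (e d).hom
  have ha : ∀ d, a d = Y ⊴ₗ (e d).inv ≫ μₗ F Y (p d) ≫ F.map (θ.app (p d)) ≫ (e d).hom :=
    fun _ => rfl
  have hnat : ∀ {d d' : D'} (f : d ⟶ d'), Y ⊴ₗ f ≫ a d' = a d ≫ f := fun {d d'} f => by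
    obtain ⟨g, hg⟩ := F.map_surjective ((e d).hom ≫ f ≫ (e d').inv)
    have h1 : (e d).hom ≫ f = F.map g ≫ (e d').hom := by rw [hg]; simp
    have h2 : f ≫ (e d').inv = (e d).inv ≫ F.map g := by rw [hg]; simp
    rw [ha, ha]
    simp only [Category.assoc]
    rw [h1, ← actionHomRight_comp_assoc, h2, actionHomRight_comp_assoc, μₗ_naturality_right_assoc,
      ← F.map_comp_assoc, θ.naturality, F.map_comp_assoc]
  have hmap : ∀ d : D, a (F.obj d) = μₗ F Y d ≫ F.map (θ.app d) := fun d => by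
    obtain ⟨g, hg⟩ := F.map_surjective (e (F.obj d)).hom
    rw [← cancel_epi (Y ⊴ₗ (e (F.obj d)).hom), ha, actionHomRight_hom_inv_assoc, ← hg,
      ← F.map_comp, ← θ.naturality, F.map_comp, μₗ_naturality_right_assoc]
  refine ⟨⟨a, hnat, fun c d' => ?_⟩, hmap⟩
  -- Linearity is proved first at the objects `F.obj d`, where `a` is the image of `θ` up to a
  -- lineator. Naturality along `e d'` then gives it at every object.
  have key : ∀ d : D, a (c ⊙ₗ F.obj d) = (αₗ Y c (F.obj d)).inv ≫
      (b.β c).hom ⊵ₗ F.obj d ≫ (αₗ c Y (F.obj d)).hom ≫ c ⊴ₗ a (F.obj d) := fun d => by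
    rw [← cancel_mono (μₗ F c d), ← hnat, hmap, hmap, θ.linear]
    simp only [F.map_comp, Category.assoc, actionHomRight_comp]
    rw [μₗ_associativity_inv_assoc, ← μₗ_naturality_left_assoc, μₗ_associativity_assoc,
      ← μₗ_naturality_right]
  have h3 := key (p d')
  rw [← cancel_epi (Y ⊴ₗ c ⊴ₗ (e d').hom), hnat, h3]
  simp only [Category.assoc]
  rw [← actionHomRight_comp, ← hnat, actionHomRight_comp]
  have h4 : Y ⊴ₗ c ⊴ₗ (e d').hom ≫ (αₗ Y c d').inv =
      (αₗ Y c (F.obj (p d'))).inv ≫ (Y ⊗ c) ⊴ₗ (e d').hom := by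
    rw [tensor_actionHomRight]; simp
  have h5 : c ⊴ₗ Y ⊴ₗ (e d').hom =
      (αₗ c Y (F.obj (p d'))).inv ≫ (c ⊗ Y) ⊴ₗ (e d').hom ≫ (αₗ c Y d').hom := by
    rw [tensor_actionHomRight]; simp
  rw [reassoc_of% h4, h5, Category.assoc, Category.assoc, Iso.hom_inv_id_assoc,
    ← action_exchange_assoc]

end CentralFamily

variable {A : Mon C}

theorem isCentral_iff {Y : C} {b : HalfBraiding Y} {ξ : Y ⟶ A.X} : IsCentral A ⟨Y, b⟩ ξ ↔
    (b.β A.X).hom ≫ A.X ◁ ξ ≫ μ[A.X] = ξ ▷ A.X ≫ μ[A.X] :=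
  (Iso.eq_inv_comp (b.β A.X))

/-- The central family given by a central morphism. -/
def familyOfCentral {Y : C} {b : HalfBraiding Y} (ξ : Y ⟶ A.X)
    (h : (b.β A.X).hom ≫ A.X ◁ ξ ≫ μ[A.X] = ξ ▷ A.X ≫ μ[A.X]) :
    CentralFamily b (RMod A) where
  app M := ⟨(b.β M.X).hom ≫ M.X ◁ ξ ≫ M.act, by
    -- The hexagon splits the half-braiding with `M ⊗ A`, and centrality of `ξ` absorbs the factor
    -- that belongs to `A`.
    have key : ((α_ Y M.X A.X).hom ≫ Y ◁ M.act) ≫ (b.β M.X).hom ≫ M.X ◁ ξ ≫ M.act =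
        ((b.β M.X).hom ≫ M.X ◁ ξ ≫ M.act) ▷ A.X ≫ M.act := by
      rw [Category.assoc, HalfBraiding.naturality_assoc, ← whisker_exchange_assoc, M.act_assoc,
        associator_naturality_right_assoc, HalfBraiding.monoidal]
      simp only [Category.assoc, Iso.inv_hom_id_assoc, Iso.hom_inv_id_assoc, comp_whiskerRight]
      rw [← MonoidalCategory.whiskerLeft_comp_assoc, ← MonoidalCategory.whiskerLeft_comp_assoc,
        Category.assoc, h, M.act_assoc]
      simp
    exact key⟩
  naturality {M N} f := by
    ext
    have key : Y ◁ f.hom ≫ (b.β N.X).hom ≫ N.X ◁ ξ ≫ N.act =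
        ((b.β M.X).hom ≫ M.X ◁ ξ ≫ M.act) ≫ f.hom := by
      simp only [Category.assoc, f.comm]
      rw [HalfBraiding.naturality_assoc, whisker_exchange_assoc]
    exact key
  linear c M := by
    ext
    have key : (b.β (c ⊗ M.X)).hom ≫ (c ⊗ M.X) ◁ ξ ≫ (α_ c M.X A.X).hom ≫ c ◁ M.act =
        (α_ Y c M.X).inv ≫ (b.β c).hom ▷ M.X ≫ (α_ c Y M.X).hom ≫
          c ◁ ((b.β M.X).hom ≫ M.X ◁ ξ ≫ M.act) := by
      rw [HalfBraiding.monoidal]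
      simp
    exact key

/-- The action of a module, as a morphism from a free module. -/
def RMod.actHom (M : RMod A) : M.X ⊙ₗ RMod.regular A ⟶ M := ⟨M.act, by
  have key : ((α_ M.X A.X A.X).hom ≫ M.X ◁ μ[A.X]) ≫ M.act = M.act ▷ A.X ≫ M.act := by
    rw [M.act_assoc, Category.assoc]
  exact key⟩

/-- The half-braiding with the unit object is the canonical isomorphism. -/
theorem halfBraiding_unit {Y : C} (b : HalfBraiding Y) :
    (b.β (𝟙_ C)).hom = (ρ_ Y).hom ≫ (λ_ Y).inv := by
  have h1 := b.monoidal (𝟙_ C) (𝟙_ C)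
  have h2 := b.naturality (λ_ (𝟙_ C)).hom
  rw [h1] at h2
  have h3 : (b.β (𝟙_ C)).hom = ((b.β (𝟙_ C)).hom ≫ (λ_ Y).hom ≫ (ρ_ Y).inv) ≫
      (b.β (𝟙_ C)).hom := by
    have h4 := congrArg (fun t => Y ◁ (λ_ (𝟙_ C)).inv ≫ t) h2
    simp only [← MonoidalCategory.whiskerLeft_comp_assoc, Iso.inv_hom_id,
      MonoidalCategory.whiskerLeft_id, Category.id_comp] at h4
    refine h4.trans ?_
    simp only [Category.assoc]
    have e1 : (α_ (𝟙_ C) (𝟙_ C) Y).inv ≫ (λ_ (𝟙_ C)).hom ▷ Y = (λ_ (𝟙_ C ⊗ Y)).hom := by monoidal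
    have e2 : Y ◁ (λ_ (𝟙_ C)).inv ≫ (α_ Y (𝟙_ C) (𝟙_ C)).inv = (ρ_ (Y ⊗ 𝟙_ C)).inv := by monoidal
    have e3 : (α_ (𝟙_ C) Y (𝟙_ C)).hom = (ρ_ (𝟙_ C ⊗ Y)).hom ≫ 𝟙_ C ◁ (ρ_ Y).inv := by monoidal
    rw [e1, reassoc_of% e2, e3]
    simp only [Category.assoc]
    rw [rightUnitor_naturality_assoc, Iso.inv_hom_id_assoc, leftUnitor_naturality,
      leftUnitor_naturality_assoc]
  have h5 : (b.β (𝟙_ C)).hom ≫ (λ_ Y).hom ≫ (ρ_ Y).inv = 𝟙 _ := by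
    rw [← cancel_mono (b.β (𝟙_ C)).hom, ← h3, Category.id_comp]
  rw [← cancel_mono ((λ_ Y).hom ≫ (ρ_ Y).inv), h5]
  simp

namespace CentralFamily

variable {Y : C} {b : HalfBraiding Y} (θ : CentralFamily b (RMod A))

/-- The component of a central family at a module, as a morphism in `C`. -/
def hom (M : RMod A) : Y ⊗ M.X ⟶ M.X := RMod.Hom.hom (θ.app M)

/-- The component of a central family at the regular module, as a morphism in `C`. -/
def regHom : Y ⊗ A.X ⟶ A.X := RMod.Hom.hom (θ.app (RMod.regular A))

/-- The morphism determining a central family. -/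
def toHom : Y ⟶ A.X := (ρ_ Y).inv ≫ Y ◁ η[A.X] ≫ θ.regHom

/-- The action is a morphism from the free module `M.X ⊗ A` to `M`. Naturality along it and
linearity for `M.X` express the component at `M` by the one at the regular module. -/
theorem act_hom (M : RMod A) : Y ◁ M.act ≫ θ.hom M = ((α_ Y M.X A.X).inv ≫
    (b.β M.X).hom ▷ A.X ≫ (α_ M.X Y A.X).hom ≫ M.X ◁ θ.regHom) ≫ M.act := by
  have h1 := congrArg RMod.Hom.hom (θ.naturality M.actHom)
  rw [θ.linear M.X (RMod.regular A)] at h1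
  exact h1

/-- Inserting the unit of `A` splits the action `M ⊗ A → M`, so `act_hom` recovers the component at
`M` from `toHom`. This is why a central family carries no more information than a central morphism.
-/
theorem hom_eq (M : RMod A) : θ.hom M = (b.β M.X).hom ≫ M.X ◁ θ.toHom ≫ M.act := by
  have h3 : Y ◁ ((ρ_ M.X).inv ≫ M.X ◁ η[A.X] ≫ M.act) = 𝟙 (Y ⊗ M.X) := by
    rw [M.act_one]; simp
  rw [← Category.id_comp (θ.hom M), ← h3]
  simp only [MonoidalCategory.whiskerLeft_comp, Category.assoc, act_hom, toHom]
  rw [associator_inv_naturality_right_assoc, whisker_exchange_assoc,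
    associator_naturality_right_assoc]
  have e1 : Y ◁ (ρ_ M.X).inv ≫ (α_ Y M.X (𝟙_ C)).inv = (ρ_ (Y ⊗ M.X)).inv := by monoidal
  have e2 : M.X ◁ (ρ_ Y).inv = (ρ_ (M.X ⊗ Y)).inv ≫ (α_ M.X Y (𝟙_ C)).hom := by monoidal
  rw [reassoc_of% e1, e2, Category.assoc, ← rightUnitor_inv_naturality_assoc]

theorem regHom_eq : θ.regHom = (b.β A.X).hom ≫ A.X ◁ θ.toHom ≫ μ[A.X] :=
  θ.hom_eq (RMod.regular A)

/-- The component at the regular module is known in two ways: `regHom_eq` gives one side, and its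
right linearity, evaluated at the unit, makes it left multiplication by `toHom`. -/
theorem toHom_central : (b.β A.X).hom ≫ A.X ◁ θ.toHom ≫ μ[A.X] = θ.toHom ▷ A.X ≫ μ[A.X] := by
  have h2 : ((α_ Y A.X A.X).hom ≫ Y ◁ μ[A.X]) ≫ θ.regHom = θ.regHom ▷ A.X ≫ μ[A.X] :=
    RMod.Hom.comm (θ.app (RMod.regular A))
  rw [← regHom_eq, toHom, comp_whiskerRight, comp_whiskerRight, Category.assoc, Category.assoc,
    ← h2, Category.assoc, associator_naturality_middle_assoc,
    ← MonoidalCategory.whiskerLeft_comp_assoc, MonObj.one_mul]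
  simp

theorem family_toHom : familyOfCentral θ.toHom θ.toHom_central = θ := by
  ext M
  exact (θ.hom_eq M).symm

end CentralFamily

theorem familyOfCentral_toHom {Y : C} {b : HalfBraiding Y} (ξ : Y ⟶ A.X) (h) :
    (familyOfCentral (b := b) ξ h).toHom = ξ := by
  change (ρ_ Y).inv ≫ Y ◁ η[A.X] ≫ (b.β A.X).hom ≫ A.X ◁ ξ ≫ μ[A.X] = ξ
  rw [h, whisker_exchange_assoc, MonObj.mul_one]
  simp

end CatAlg

/-! ### Products and pull-backs of central families; Morita invariance and uniqueness of full
centres. -/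

namespace CatAlg

open MonObj MonoidalLeftAction Functor LaxLeftLinear OplaxLeftLinear LeftLinear

universe w₁ w₂ w₃ w₄

variable {C : Type u} [Category.{v} C] [MonoidalCategory C]

/-- The half-braiding of a tensor product. -/
def tensorHalfBraiding {Y Y' : C} (b : HalfBraiding Y) (b' : HalfBraiding Y') :
    HalfBraiding (Y ⊗ Y') := (Center.tensorObj ⟨Y, b⟩ ⟨Y', b'⟩).2

theorem tensorHalfBraiding_hom {Y Y' : C} (b : HalfBraiding Y) (b' : HalfBraiding Y') (U : C) :
    ((tensorHalfBraiding b b').β U).hom = (α_ Y Y' U).hom ≫ Y ◁ (b'.β U).hom ≫ (α_ Y U Y').inv ≫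
      (b.β U).hom ▷ Y' ≫ (α_ U Y Y').hom := rfl

/-- The half-braiding of the unit object. -/
def unitHalfBraiding (C : Type u) [Category.{v} C] [MonoidalCategory C] : HalfBraiding (𝟙_ C) :=
  (Center.tensorUnit (C := C)).2

theorem unitHalfBraiding_hom (U : C) :
    ((unitHalfBraiding C).β U).hom = (λ_ U).hom ≫ (ρ_ U).inv := rfl

namespace CentralFamily

section

variable {D : Type w₁} [Category.{w₂} D] [MonoidalLeftAction C D]
  {D' : Type w₃} [Category.{w₄} D'] [MonoidalLeftAction C D']
  {Y Y' : C} {b' : HalfBraiding Y'} {b : HalfBraiding Y}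

/-- The pull-back of a central family along a morphism of the monoidal centre. -/
def comap (f : Y ⟶ Y') (hf : ∀ U, f ▷ U ≫ (b'.β U).hom = (b.β U).hom ≫ U ◁ f)
    (θ : CentralFamily b' D) : CentralFamily b D where
  app d := f ⊵ₗ d ≫ θ.app d
  naturality g := by rw [action_exchange_assoc, θ.naturality, Category.assoc]
  linear c d := by
    rw [θ.linear, actionHomRight_comp]
    have h1 := congrArg (fun t => t ⊵ₗ d) (hf c)
    simp only [comp_actionHomLeft, whiskerRight_actionHomLeft, whiskerLeft_actionHomLeft] at h1
    rw [← cancel_epi (αₗ Y c d).hom]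
    simp only [Category.assoc] at h1
    simp only [Iso.hom_inv_id_assoc]
    rw [reassoc_of% h1, Iso.inv_hom_id_assoc]

theorem Match.comap {F : D ⥤ D'} [F.LeftLinear C] {θ : CentralFamily b' D}
    {θ' : CentralFamily b' D'} (h : Match F θ θ') (f : Y ⟶ Y')
    (hf : ∀ U, f ▷ U ≫ (b'.β U).hom = (b.β U).hom ≫ U ◁ f) :
    Match F (θ.comap f hf) (θ'.comap f hf) := fun d => by
  simp only [CentralFamily.comap]
  rw [h, F.map_comp, μₗ_naturality_left_assoc]

/-- The product of central families. -/
def mul (θ : CentralFamily b D) (θ' : CentralFamily b' D) :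
    CentralFamily (tensorHalfBraiding b b') D where
  app d := (αₗ Y Y' d).hom ≫ Y ⊴ₗ θ'.app d ≫ θ.app d
  naturality g := by
    rw [tensor_actionHomRight]
    simp only [Category.assoc, Iso.inv_hom_id_assoc]
    rw [← actionHomRight_comp_assoc, θ'.naturality, actionHomRight_comp_assoc, θ.naturality]
  linear c d := by
    rw [tensorHalfBraiding_hom, θ'.linear, θ.linear]
    simp only [comp_actionHomLeft, actionHomRight_comp, whiskerRight_actionHomLeft,
      whiskerLeft_actionHomLeft, Category.assoc]
    have h1 := associator_actionHom Y Y' c d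
    have h2 := associator_actionHom Y c Y' d
    have h3 := associator_actionHom c Y Y' d
    have p1 : (αₗ (Y ⊗ Y') c d).inv ≫ (α_ Y Y' c).hom ⊵ₗ d ≫ (αₗ Y (Y' ⊗ c) d).hom =
        (αₗ Y Y' (c ⊙ₗ d)).hom ≫ Y ⊴ₗ (αₗ Y' c d).inv := by
      rw [Iso.inv_comp_eq, ← reassoc_of% h1, actionHomRight_hom_inv, Category.comp_id]
    have p2 : (αₗ Y (c ⊗ Y') d).inv ≫ (α_ Y c Y').inv ⊵ₗ d ≫ (αₗ (Y ⊗ c) Y' d).hom =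
        Y ⊴ₗ (αₗ c Y' d).hom ≫ (αₗ Y c (Y' ⊙ₗ d)).inv := by
      rw [Iso.inv_comp_eq, ← Category.assoc, Iso.eq_comp_inv, Category.assoc, ← h2,
        inv_hom_actionHomLeft_assoc]
    have p4 : Y ⊴ₗ c ⊴ₗ θ'.app d ≫ (αₗ Y c d).inv =
        (αₗ Y c (Y' ⊙ₗ d)).inv ≫ (Y ⊗ c) ⊴ₗ θ'.app d := by
      rw [tensor_actionHomRight]; simp only [Category.assoc, Iso.inv_hom_id_assoc, Iso.hom_inv_id,
        Category.comp_id]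
    have p5 : (c ⊗ Y) ⊴ₗ θ'.app d ≫ (αₗ c Y d).hom =
        (αₗ c Y (Y' ⊙ₗ d)).hom ≫ c ⊴ₗ Y ⊴ₗ θ'.app d := by
      rw [tensor_actionHomRight]; simp only [Category.assoc, Iso.inv_hom_id, Category.comp_id]
    rw [reassoc_of% p1, reassoc_of% p2, reassoc_of% h3, Iso.inv_hom_id_assoc, reassoc_of% p4,
      action_exchange_assoc, reassoc_of% p5]

theorem Match.mul {F : D ⥤ D'} [F.LeftLinear C] {θ₁ : CentralFamily b D}
    {θ₁' : CentralFamily b D'} {θ₂ : CentralFamily b' D} {θ₂' : CentralFamily b' D'}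
    (h₁ : Match F θ₁ θ₁') (h₂ : Match F θ₂ θ₂') : Match F (θ₁.mul θ₂) (θ₁'.mul θ₂') := fun d => by
  simp only [CentralFamily.mul]
  rw [h₁, h₂]
  simp only [F.map_comp, actionHomRight_comp, Category.assoc]
  rw [μₗ_associativity_assoc, μₗ_naturality_right_assoc]

/-- The trivial central family. -/
def one (C : Type u) [Category.{v} C] [MonoidalCategory C]
    (D : Type w₁) [Category.{w₂} D] [MonoidalLeftAction C D] :
    CentralFamily (unitHalfBraiding C) D where
  app d := (λₗ[C] d).hom
  naturality f := (actionUnitIso_hom_naturality f).symm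
  linear c d := by
    rw [unitHalfBraiding_hom, comp_actionHomLeft, leftUnitor_actionHom]
    have h : (ρ_ c).inv ⊵ₗ d ≫ (αₗ c (𝟙_ C) d).hom ≫ c ⊴ₗ (λₗ[C] d).hom = 𝟙 _ := by
      rw [← rightUnitor_actionHom, inv_hom_actionHomLeft]
    simp only [Category.assoc, h, Category.comp_id, Iso.inv_hom_id_assoc]

theorem Match.one {F : D ⥤ D'} [F.LeftLinear C] :
    Match F (CentralFamily.one C D) (CentralFamily.one C D') := fun d => μₗ_unitality F d

end

variable {A : Mon C} {Y Y' : C} {b : HalfBraiding Y} {b' : HalfBraiding Y'}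

theorem toHom_comap (f : Y ⟶ Y') (hf) (θ : CentralFamily b' (RMod A)) :
    (θ.comap (b := b) f hf).toHom = f ≫ θ.toHom := by
  change (ρ_ Y).inv ≫ Y ◁ η[A.X] ≫ f ▷ A.X ≫ θ.regHom = f ≫ (ρ_ Y').inv ≫ Y' ◁ η[A.X] ≫ θ.regHom
  rw [whisker_exchange_assoc, rightUnitor_inv_naturality_assoc]

/-- The composite applies `θ'` to the unit first, and by centrality `θ` acts as left multiplication
by `θ.toHom`, so the product appears in this order. Being a homomorphism of algebras can thus be
stated in terms of families alone. -/
theorem toHom_mul (θ : CentralFamily b (RMod A)) (θ' : CentralFamily b' (RMod A)) :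
    (θ.mul θ').toHom = (θ.toHom ⊗ₘ θ'.toHom) ≫ μ[A.X] := by
  change (ρ_ (Y ⊗ Y')).inv ≫ (Y ⊗ Y') ◁ η[A.X] ≫ (α_ Y Y' A.X).hom ≫ Y ◁ θ'.regHom ≫ θ.regHom = _
  rw [θ.regHom_eq, θ.toHom_central, associator_naturality_right_assoc]
  have e : (ρ_ (Y ⊗ Y')).inv ≫ (α_ Y Y' (𝟙_ C)).hom = Y ◁ (ρ_ Y').inv := by monoidal
  rw [reassoc_of% e, ← MonoidalCategory.whiskerLeft_comp_assoc,
    ← MonoidalCategory.whiskerLeft_comp_assoc, Category.assoc, ← toHom, tensorHom_def',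
    Category.assoc]

theorem toHom_one : (CentralFamily.one C (RMod A)).toHom = η[A.X] := by
  change (ρ_ (𝟙_ C)).inv ≫ 𝟙_ C ◁ η[A.X] ≫ (λ_ A.X).hom = _
  rw [leftUnitor_naturality, unitors_equal, Iso.inv_hom_id_assoc]

theorem toHom_injective {θ θ' : CentralFamily b (RMod A)} (h : θ.toHom = θ'.toHom) : θ = θ' := by
  rw [← θ.family_toHom, ← θ'.family_toHom]
  congr 1

end CentralFamily

/-- The object underlying an object of the monoidal centre. -/
def fobj (Y : Center C) : C := Y.1

/-- The half-braiding of an object of the monoidal centre. -/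
def fbraid (Y : Center C) : HalfBraiding (fobj Y) := Y.2

/-- The morphism underlying a morphism of the monoidal centre. -/
def fmap {Y Z : Center C} (f : Y ⟶ Z) : fobj Y ⟶ fobj Z := f.f

theorem fmap_comp {X Y Z : Center C} (f : X ⟶ Y) (g : Y ⟶ Z) : fmap (f ≫ g) = fmap f ≫ fmap g := rfl

theorem fmap_comm {Y Z : Center C} (f : Y ⟶ Z) (U : C) :
    fmap f ▷ U ≫ ((fbraid Z).β U).hom = ((fbraid Y).β U).hom ≫ U ◁ fmap f := f.comm U

theorem fmap_injective {Y Z : Center C} {f g : Y ⟶ Z} (h : fmap f = fmap g) : f = g :=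
  Center.ext _ _ h

/-- The unit of the algebra underlying an algebra in the monoidal centre. -/
def fone (L : Mon (Center C)) : 𝟙_ C ⟶ fobj L.X := Center.Hom.f η[L.X]

/-- The multiplication of the algebra underlying an algebra in the monoidal centre. -/
def fmul (L : Mon (Center C)) : fobj L.X ⊗ fobj L.X ⟶ fobj L.X := Center.Hom.f μ[L.X]

theorem fone_comm (L : Mon (Center C)) (U : C) : fone L ▷ U ≫ ((fbraid L.X).β U).hom =
    ((unitHalfBraiding C).β U).hom ≫ U ◁ fone L := Center.Hom.comm η[L.X] U

theorem fmul_comm (L : Mon (Center C)) (U : C) : fmul L ▷ U ≫ ((fbraid L.X).β U).hom =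
    ((tensorHalfBraiding (fbraid L.X) (fbraid L.X)).β U).hom ≫ U ◁ fmul L :=
  Center.Hom.comm μ[L.X] U

theorem fmul_fmap {L L' : Mon (Center C)} (f : L ⟶ L') :
    fmul L ≫ fmap f.hom = (fmap f.hom ⊗ₘ fmap f.hom) ≫ fmul L' :=
  congrArg Center.Hom.f f.isMonHom_hom.mul_hom

/-- The morphism underlying a homomorphism from the underlying algebra of an algebra in the
monoidal centre. -/
def fhom {L : Mon (Center C)} {A : Mon C} (ζ : (Center.forget C).mapMon.obj L ⟶ A) :
    fobj L.X ⟶ A.X := ζ.hom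

theorem fone_fhom {L : Mon (Center C)} {A : Mon C} (ζ : (Center.forget C).mapMon.obj L ⟶ A) :
    fone L ≫ fhom ζ = η[A.X] :=
  ((Category.assoc _ _ _).trans (Category.id_comp _)).symm.trans ζ.isMonHom_hom.one_hom

theorem fmul_fhom {L : Mon (Center C)} {A : Mon C} (ζ : (Center.forget C).mapMon.obj L ⟶ A) :
    fmul L ≫ fhom ζ = (fhom ζ ⊗ₘ fhom ζ) ≫ μ[A.X] :=
  ((Category.assoc _ _ _).trans (Category.id_comp _)).symm.trans ζ.isMonHom_hom.mul_hom

/-- A homomorphism to an algebra from the underlying algebra of an algebra in the centre. -/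
def homOfForget {L : Mon (Center C)} {A : Mon C} (ζ : fobj L.X ⟶ A.X)
    (h1 : fone L ≫ ζ = η[A.X]) (h2 : fmul L ≫ ζ = (ζ ⊗ₘ ζ) ≫ μ[A.X]) :
    (Center.forget C).mapMon.obj L ⟶ A :=
  Mon.Hom.mk' (M := (Center.forget C).mapMon.obj L) (N := A) ζ
    ((Category.assoc _ _ _).trans ((Category.id_comp _).trans h1))
    ((Category.assoc _ _ _).trans ((Category.id_comp _).trans h2))

theorem isCentral_iff_fobj {A : Mon C} {Y : Center C} {ξ : fobj Y ⟶ A.X} : IsCentral A Y ξ ↔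
    ((fbraid Y).β A.X).hom ≫ A.X ◁ ξ ≫ μ[A.X] = ξ ▷ A.X ≫ μ[A.X] :=
  isCentral_iff (b := fbraid Y)

theorem IsCentral.comp {A : Mon C} {Y Z : Center C} {ζ : fobj Z ⟶ A.X} (h : IsCentral A Z ζ)
    (φ : Y ⟶ Z) {ξ : fobj Y ⟶ A.X} (hξ : fmap φ ≫ ζ = ξ) : IsCentral A Y ξ := by
  refine isCentral_iff_fobj.2 ?_
  rw [← hξ, MonoidalCategory.whiskerLeft_comp, Category.assoc, ← reassoc_of% (fmap_comm φ A.X),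
    isCentral_iff_fobj.1 h,    comp_whiskerRight, Category.assoc]

theorem IsFullCentre.isCentral {A : Mon C} {Z : Mon (Center C)}
    {ζ : (Center.forget C).mapMon.obj Z ⟶ A} (h : IsFullCentre A Z ζ) :
    IsCentral A Z.X (fhom ζ) := h.1

theorem IsFullCentre.hom_ext {A : Mon C} {Z : Mon (Center C)}
    {ζ : (Center.forget C).mapMon.obj Z ⟶ A} (h : IsFullCentre A Z ζ) {Y : Center C}
    {f g : Y ⟶ Z.X} (hfg : fmap f ≫ fhom ζ = fmap g ≫ fhom ζ) : f = g := by
  obtain ⟨_, _, hu⟩ := h.2 Y (fmap f ≫ fhom ζ) (h.isCentral.comp f rfl)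
  exact (hu f rfl).trans (hu g hfg.symm).symm

theorem IsFullCentre.exists_lift {A : Mon C} {Z : Mon (Center C)}
    {ζ : (Center.forget C).mapMon.obj Z ⟶ A} (h : IsFullCentre A Z ζ) {Y : Center C}
    {ξ : fobj Y ⟶ A.X} (hξ : IsCentral A Y ξ) : ∃ φ : Y ⟶ Z.X, fmap φ ≫ fhom ζ = ξ :=
  (h.2 Y ξ hξ).exists

theorem IsFullCentre.mk' {A : Mon C} {Z : Mon (Center C)}
    {ζ : (Center.forget C).mapMon.obj Z ⟶ A} (h : IsCentral A Z.X (fhom ζ))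
    (h1 : ∀ (Y : Center C) (ξ : fobj Y ⟶ A.X), IsCentral A Y ξ →
      ∃ φ : Y ⟶ Z.X, fmap φ ≫ fhom ζ = ξ)
    (h2 : ∀ (Y : Center C) (f g : Y ⟶ Z.X), fmap f ≫ fhom ζ = fmap g ≫ fhom ζ → f = g) :
    IsFullCentre A Z ζ :=
  ⟨h, fun Y ξ hξ => (h1 Y ξ hξ).imp fun φ hφ => ⟨hφ, fun ψ hψ => h2 Y ψ φ (hψ.trans hφ.symm)⟩⟩

/-- The full centre of an algebra depends only on its module category. -/
theorem IsFullCentre.transport {A B : Mon C} (hAB : ModuleCategoriesEquivalent A B)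
    {L : Mon (Center C)} {ζ : (Center.forget C).mapMon.obj L ⟶ A} (h : IsFullCentre A L ζ) :
    ∃ ζ' : (Center.forget C).mapMon.obj L ⟶ B, IsFullCentre B L ζ' := by
  obtain ⟨F, hF, ⟨hl⟩⟩ := hAB
  -- The family of `ζ` is carried over to modules over `B`; the morphism of the resulting family is
  -- the new universal central morphism.
  let θ := familyOfCentral (fhom ζ) (isCentral_iff_fobj.1 h.isCentral)
  have hθ : θ.toHom = fhom ζ := familyOfCentral_toHom _ _
  obtain ⟨θ', hm⟩ := CentralFamily.exists_match_right F θ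
  -- That `ζ` is a homomorphism says that the pull-backs of `θ` along the unit and the
  -- multiplication of `L` are the trivial family and `θ.mul θ`. Matching respects both identities.
  have h1 : fone L ≫ θ'.toHom = η[B.X] := by
    rw [← CentralFamily.toHom_one (A := B), ← CentralFamily.toHom_comap _ (fone_comm L)]
    congr 1
    refine (hm.comap _ (fone_comm L)).right_unique F ?_
    have : θ.comap _ (fone_comm L) = CentralFamily.one C (RMod A) := by
      apply CentralFamily.toHom_injective
      rw [CentralFamily.toHom_comap, CentralFamily.toHom_one, hθ, fone_fhom ζ]
    rw [this]
    exact CentralFamily.Match.one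
  have h2 : fmul L ≫ θ'.toHom = (θ'.toHom ⊗ₘ θ'.toHom) ≫ μ[B.X] := by
    rw [← CentralFamily.toHom_mul, ← CentralFamily.toHom_comap _ (fmul_comm L)]
    congr 1
    refine (hm.comap _ (fmul_comm L)).right_unique F ?_
    have : θ.comap _ (fmul_comm L) = θ.mul θ := by
      apply CentralFamily.toHom_injective
      rw [CentralFamily.toHom_comap, CentralFamily.toHom_mul, hθ, fmul_fhom ζ]
    rw [this]
    exact hm.mul hm
  have hζ' : fhom (homOfForget θ'.toHom h1 h2) = θ'.toHom := rfl
  refine ⟨homOfForget θ'.toHom h1 h2, .mk' (isCentral_iff_fobj.2 θ'.toHom_central) ?_ ?_⟩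
  · intro Y ξ hξ
    -- A central morphism to `B` is carried back to `A` and lifted there. Uniqueness of matching
    -- families shows that the same lift works for `B`.
    let ψ' := familyOfCentral ξ (isCentral_iff_fobj.1 hξ)
    obtain ⟨ψ, hψ⟩ := CentralFamily.exists_match_left F ψ'
    obtain ⟨φ, hφ⟩ := h.exists_lift (isCentral_iff_fobj.2 ψ.toHom_central)
    refine ⟨φ, ?_⟩
    have e1 : ψ'.toHom = ξ := familyOfCentral_toHom _ _
    rw [hζ', ← e1, ← CentralFamily.toHom_comap _ (fmap_comm φ)]
    congr 1
    refine (hm.comap _ (fmap_comm φ)).right_unique F ?_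
    have : θ.comap _ (fmap_comm φ) = ψ := by
      apply CentralFamily.toHom_injective
      rw [CentralFamily.toHom_comap, hθ, hφ]
    rw [this]
    exact hψ
  · intro Y f g hfg
    rw [hζ', ← CentralFamily.toHom_comap _ (fmap_comm f),
      ← CentralFamily.toHom_comap _ (fmap_comm g)] at hfg
    apply h.hom_ext
    rw [← hθ, ← CentralFamily.toHom_comap _ (fmap_comm f),
      ← CentralFamily.toHom_comap _ (fmap_comm g)]
    congr 1
    refine (hm.comap _ (fmap_comm f)).left_unique F ?_
    rw [CentralFamily.toHom_injective hfg]
    exact hm.comap _ (fmap_comm g)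

/-- Central homomorphisms of algebras factor through the full centre. -/
theorem IsFullCentre.exists_hom {A : Mon C} {Z W : Mon (Center C)}
    {ζ : (Center.forget C).mapMon.obj Z ⟶ A} (h : IsFullCentre A Z ζ)
    (π : (Center.forget C).mapMon.obj W ⟶ A) (hπ : IsCentral A W.X (fhom π)) :
    ∃ φ : W ⟶ Z, fmap φ.hom ≫ fhom ζ = fhom π := by
  obtain ⟨φ, hφ⟩ := h.exists_lift hπ
  -- Compatibility with units and products may be tested after composition with `ζ`, where it is
  -- that of `π`.
  refine ⟨Mon.Hom.mk' φ (h.hom_ext ?_) (h.hom_ext ?_), hφ⟩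
  · change (fone W ≫ fmap φ) ≫ fhom ζ = fone Z ≫ fhom ζ
    rw [fone_fhom, Category.assoc, hφ, fone_fhom]
  · change (fmul W ≫ fmap φ) ≫ fhom ζ = ((fmap φ ⊗ₘ fmap φ) ≫ fmul Z) ≫ fhom ζ
    rw [Category.assoc, Category.assoc, fmul_fhom, hφ, fmul_fhom, tensorHom_comp_tensorHom_assoc,
      hφ]

/-- Full centres are unique. -/
theorem IsFullCentre.unique {A : Mon C} {Z W : Mon (Center C)}
    {ζ : (Center.forget C).mapMon.obj Z ⟶ A} {π : (Center.forget C).mapMon.obj W ⟶ A}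
    (h : IsFullCentre A Z ζ) (h' : IsFullCentre A W π) : Nonempty (Z ≅ W) := by
  obtain ⟨φ, hφ⟩ := h.exists_hom π h'.isCentral
  obtain ⟨ψ, hψ⟩ := h'.exists_hom ζ h.isCentral
  refine ⟨⟨ψ, φ, Mon.Hom.ext' (h.hom_ext ?_), Mon.Hom.ext' (h'.hom_ext ?_)⟩⟩
  · change (fmap ψ.hom ≫ fmap φ.hom) ≫ fhom ζ = 𝟙 (fobj Z.X) ≫ fhom ζ
    rw [Category.assoc, hφ, hψ, Category.id_comp]
  · change (fmap φ.hom ≫ fmap ψ.hom) ≫ fhom π = 𝟙 (fobj W.X) ≫ fhom π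
    rw [Category.assoc, hψ, hφ, Category.id_comp]

/-- A full centre may be replaced by an isomorphic algebra. -/
theorem IsFullCentre.of_iso {A : Mon C} {Z W : Mon (Center C)}
    {ζ : (Center.forget C).mapMon.obj Z ⟶ A} (h : IsFullCentre A Z ζ) (e : W ≅ Z) :
    ∃ π : (Center.forget C).mapMon.obj W ⟶ A, IsFullCentre A W π := by
  have e1 : e.inv.hom ≫ e.hom.hom = 𝟙 Z.X := congrArg Mon.Hom.hom e.inv_hom_id
  have e2 : e.hom.hom ≫ e.inv.hom = 𝟙 W.X := congrArg Mon.Hom.hom e.hom_inv_id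
  have hπ : fhom ((Center.forget C).mapMon.map e.hom ≫ ζ) = fmap e.hom.hom ≫ fhom ζ := rfl
  refine ⟨(Center.forget C).mapMon.map e.hom ≫ ζ, .mk' (h.isCentral.comp e.hom.hom rfl) ?_ ?_⟩
  · intro Y ξ hξ
    obtain ⟨φ, hφ⟩ := h.exists_lift hξ
    refine ⟨φ ≫ e.inv.hom, ?_⟩
    rw [hπ, ← Category.assoc, ← fmap_comp, Category.assoc, e1, Category.comp_id, hφ]
  · intro Y f g hfg
    rw [hπ, ← Category.assoc, ← Category.assoc, ← fmap_comp, ← fmap_comp] at hfg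
    have := h.hom_ext hfg
    rw [← Category.comp_id f, ← e2, ← Category.assoc, this, Category.assoc, e2, Category.comp_id]

end CatAlg

/-! ### Corners of algebras and Morita equivalence -/

namespace CatAlg

open MonObj MonoidalLeftAction

variable {C : Type u} [Category.{v} C] [MonoidalCategory C]

/-- The algebra `B` is the corner `qAq` of the algebra `A`, where `q : 𝟙 ⟶ A` is the unit of `B`. -/
structure Corner (A B : Mon C) where
  inc : B.X ⟶ A.X
  ret : A.X ⟶ B.X
  inc_ret : inc ≫ ret = 𝟙 B.X
  mul_inc : μ[B.X] ≫ inc = (inc ⊗ₘ inc) ≫ μ[A.X]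
  ret_inc : ret ≫ inc = ((λ_ A.X).inv ≫ (η[B.X] ≫ inc) ▷ A.X ≫ μ[A.X]) ≫
    (ρ_ A.X).inv ≫ A.X ◁ (η[B.X] ≫ inc) ≫ μ[A.X]

namespace Corner

variable {A B : Mon C} (c : Corner A B)

/-- The idempotent defining the corner. -/
def q : 𝟙_ C ⟶ A.X := η[B.X] ≫ c.inc
/-- Multiplication by `q` from the left. -/
def lq : A.X ⟶ A.X := (λ_ A.X).inv ≫ c.q ▷ A.X ≫ μ[A.X]
/-- Multiplication by `q` from the right. -/
def rq : A.X ⟶ A.X := (ρ_ A.X).inv ≫ A.X ◁ c.q ≫ μ[A.X]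
/-- Multiplication by `q` on a module. -/
def e (M : RMod A) : M.X ⟶ M.X := (ρ_ M.X).inv ≫ M.X ◁ c.q ≫ M.act

theorem ret_inc_eq : c.ret ≫ c.inc = c.lq ≫ c.rq := c.ret_inc

/-- In elements, `lq a = qa`, `rq a = aq` and `e m = mq`. This and the following identities are
associativity together with `qb = b = bq` for `b` in the corner. -/
theorem inc_lq : c.inc ≫ c.lq = c.inc := by
  rw [lq, leftUnitor_inv_naturality_assoc, whisker_exchange_assoc, q, comp_whiskerRight,
    Category.assoc, ← tensorHom_def_assoc, ← c.mul_inc, MonObj.one_mul_assoc, Iso.inv_hom_id_assoc]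

theorem inc_rq : c.inc ≫ c.rq = c.inc := by
  rw [rq, rightUnitor_inv_naturality_assoc, ← whisker_exchange_assoc, q,
    MonoidalCategory.whiskerLeft_comp, Category.assoc, ← tensorHom_def'_assoc, ← c.mul_inc,
    MonObj.mul_one_assoc, Iso.inv_hom_id_assoc]

theorem act_e (M : RMod A) : M.act ≫ c.e M = M.X ◁ c.rq ≫ M.act := by
  rw [e, rightUnitor_inv_naturality_assoc, ← whisker_exchange_assoc, M.act_assoc,
    associator_naturality_right_assoc, rq]
  simp

theorem e_act (M : RMod A) : c.e M ▷ A.X ≫ M.act = M.X ◁ c.lq ≫ M.act := by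
  rw [e, comp_whiskerRight, comp_whiskerRight, Category.assoc, Category.assoc, M.act_assoc,
    associator_naturality_middle_assoc, lq]
  simp

theorem q_rq : c.q ≫ c.rq = c.q := by
  rw [q, Category.assoc, inc_rq]

theorem e_e (M : RMod A) : c.e M ≫ c.e M = c.e M := by
  conv_lhs => lhs; rw [e]
  rw [Category.assoc, Category.assoc, act_e, ← MonoidalCategory.whiskerLeft_comp_assoc, q_rq]
  rfl

theorem e_hom {M N : RMod A} (f : M ⟶ N) : c.e M ≫ f.hom = f.hom ≫ c.e N := by
  rw [e, e, Category.assoc, Category.assoc, f.comm, whisker_exchange_assoc,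
    rightUnitor_inv_naturality_assoc]

theorem mul_rq : μ[A.X] ≫ c.rq = A.X ◁ c.rq ≫ μ[A.X] := c.act_e (RMod.regular A)

theorem rq_mul : c.rq ▷ A.X ≫ μ[A.X] = A.X ◁ c.lq ≫ μ[A.X] := c.e_act (RMod.regular A)

theorem mul_lq : μ[A.X] ≫ c.lq = c.lq ▷ A.X ≫ μ[A.X] := by
  rw [lq, leftUnitor_inv_naturality_assoc, whisker_exchange_assoc, MonObj.mul_assoc_flip]
  simp

theorem rq_lq : c.rq ≫ c.lq = c.lq ≫ c.rq := by
  conv_lhs => rw [rq]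
  rw [Category.assoc, Category.assoc, mul_lq, whisker_exchange_assoc,
    ← rightUnitor_inv_naturality_assoc]
  rfl

theorem lq_lq : c.lq ≫ c.lq = c.lq := by
  have h : c.q ≫ c.lq = c.q := by rw [q, Category.assoc, inc_lq]
  conv_lhs => lhs; rw [lq]
  rw [Category.assoc, Category.assoc, mul_lq, ← comp_whiskerRight_assoc, h]
  rfl

theorem lq_ret : c.lq ≫ c.ret = c.ret := by
  have h : c.ret = c.lq ≫ c.rq ≫ c.ret := by
    rw [← Category.assoc, ← ret_inc_eq, Category.assoc, inc_ret, Category.comp_id]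
  rw [h, reassoc_of% c.lq_lq]

/-! #### The functor `M ↦ Mq` -/

variable [IsIdempotentComplete C]

theorem exists_splitting (M : RMod A) : ∃ (X : C) (i : X ⟶ M.X) (r : M.X ⟶ X),
    i ≫ r = 𝟙 X ∧ r ≫ i = c.e M := IsIdempotentComplete.idempotents_split _ _ (c.e_e M)

/-- The object `Mq`. -/
def X (M : RMod A) : C := (c.exists_splitting M).choose
/-- The inclusion of `Mq` into `M`. -/
def i (M : RMod A) : c.X M ⟶ M.X := (c.exists_splitting M).choose_spec.choose
/-- The projection from `M` to `Mq`. -/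
def r (M : RMod A) : M.X ⟶ c.X M := (c.exists_splitting M).choose_spec.choose_spec.choose

theorem i_r (M : RMod A) : c.i M ≫ c.r M = 𝟙 (c.X M) :=
  (c.exists_splitting M).choose_spec.choose_spec.choose_spec.1
theorem r_i (M : RMod A) : c.r M ≫ c.i M = c.e M :=
  (c.exists_splitting M).choose_spec.choose_spec.choose_spec.2
theorem i_e (M : RMod A) : c.i M ≫ c.e M = c.i M := by
  rw [← r_i, reassoc_of% c.i_r]
theorem e_r (M : RMod A) : c.e M ≫ c.r M = c.r M := by
  rw [← r_i, Category.assoc, i_r, Category.comp_id]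

/-- The action of the corner on `Mq`. -/
def cact (M : RMod A) : c.X M ⊗ B.X ⟶ c.X M := c.i M ▷ B.X ≫ M.X ◁ c.inc ≫ M.act ≫ c.r M

theorem cact_i (M : RMod A) : c.cact M ≫ c.i M = c.i M ▷ B.X ≫ M.X ◁ c.inc ≫ M.act := by
  rw [cact, Category.assoc, Category.assoc, Category.assoc, r_i, act_e,
    ← MonoidalCategory.whiskerLeft_comp_assoc, inc_rq]

theorem i_cancel {M : RMod A} {Y : C} {f g : Y ⟶ c.X M} (h : f ≫ c.i M = g ≫ c.i M) : f = g := by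
  rw [← Category.comp_id f, ← i_r, ← Category.assoc, h, Category.assoc, i_r, Category.comp_id]

/-- The module `Mq` over the corner. -/
def obj (M : RMod A) : RMod B where
  X := c.X M
  act := c.cact M
  act_assoc := by
    apply c.i_cancel
    simp only [Category.assoc]
    rw [cact_i, ← comp_whiskerRight_assoc, cact_i, comp_whiskerRight_assoc,
      comp_whiskerRight_assoc, ← whisker_exchange_assoc, M.act_assoc, whisker_exchange_assoc,
      ← MonoidalCategory.whiskerLeft_comp_assoc, c.mul_inc]
    simp only [MonoidalCategory.tensorHom_def, MonoidalCategory.whiskerLeft_comp, Category.assoc]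
    simp
  act_one := by
    apply c.i_cancel
    rw [Category.assoc, cact_i, whisker_exchange_assoc, ← MonoidalCategory.whiskerLeft_comp_assoc]
    have h := c.i_e M
    rw [e, rightUnitor_inv_naturality_assoc, Iso.inv_comp_eq] at h
    exact h

/-- The functor `M ↦ Mq`. -/
def functor : RMod A ⥤ RMod B where
  obj := c.obj
  map {M N} f := ⟨c.i M ≫ f.hom ≫ c.r N, by
    have key : c.cact M ≫ c.i M ≫ f.hom ≫ c.r N = (c.i M ≫ f.hom ≫ c.r N) ▷ B.X ≫ c.cact N := by
      apply c.i_cancel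
      simp only [Category.assoc]
      rw [reassoc_of% c.cact_i, cact_i, r_i, ← comp_whiskerRight_assoc]
      simp only [Category.assoc]
      rw [r_i, ← e_hom, reassoc_of% c.i_e, reassoc_of% c.act_e,
        ← MonoidalCategory.whiskerLeft_comp_assoc, inc_rq, f.comm, comp_whiskerRight_assoc,
        whisker_exchange_assoc]
    exact key⟩
  map_id M := by
    ext
    change c.i M ≫ 𝟙 M.X ≫ c.r M = 𝟙 (c.X M)
    rw [Category.id_comp, i_r]
  map_comp {M N P} f g := by
    ext
    change c.i M ≫ (f.hom ≫ g.hom) ≫ c.r P = (c.i M ≫ f.hom ≫ c.r N) ≫ c.i N ≫ g.hom ≫ c.r P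
    simp only [Category.assoc]
    rw [reassoc_of% c.r_i, ← reassoc_of% c.e_hom, reassoc_of% c.i_e]

/-- A reducible form of the module `d ⊗ M`. -/
abbrev whisk (d : C) (M : RMod A) : RMod A where
  X := d ⊗ M.X
  act := (α_ d M.X A.X).hom ≫ d ◁ M.act
  act_assoc := (RMod.tensorLeft d M).act_assoc
  act_one := (RMod.tensorLeft d M).act_one

theorem e_tensorLeft (d : C) (M : RMod A) : c.e (whisk d M) = d ◁ c.e M := by
  change (ρ_ (d ⊗ M.X)).inv ≫ (d ⊗ M.X) ◁ c.q ≫ (α_ d M.X A.X).hom ≫ d ◁ M.act = _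
  rw [e]
  simp

/-- The lineator of the functor `M ↦ Mq`. -/
def lineator (d : C) (M : RMod A) : d ⊗ c.X M ≅ c.X (whisk d M) where
  hom := d ◁ c.i M ≫ c.r (whisk d M)
  inv := c.i (whisk d M) ≫ d ◁ c.r M
  hom_inv_id := by
    rw [Category.assoc, reassoc_of% c.r_i, e_tensorLeft, ← MonoidalCategory.whiskerLeft_comp,
      ← MonoidalCategory.whiskerLeft_comp, e_r, i_r, MonoidalCategory.whiskerLeft_id]
  inv_hom_id := by
    rw [Category.assoc, ← MonoidalCategory.whiskerLeft_comp_assoc, r_i, ← e_tensorLeft, e_r]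
    exact c.i_r _

theorem lineator_i (d : C) (M : RMod A) : (c.lineator d M).hom ≫ c.i (whisk d M) =
    d ◁ c.i M := by
  rw [lineator, Category.assoc, r_i, e_tensorLeft, ← MonoidalCategory.whiskerLeft_comp, i_e]

theorem lineator_act (d : C) (M : RMod A) : ((α_ d (c.X M) B.X).hom ≫ d ◁ c.cact M) ≫
    (c.lineator d M).hom = (c.lineator d M).hom ▷ B.X ≫ c.cact (whisk d M) := by
  apply c.i_cancel
  rw [Category.assoc, Category.assoc, Category.assoc, lineator_i, cact_i,
    ← comp_whiskerRight_assoc, lineator_i, ← MonoidalCategory.whiskerLeft_comp, cact_i]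
  simp

/-- The functor `M ↦ Mq` is linear. -/
@[reducible] def functorLinear : c.functor.LeftLinear C :=
  leftLinearOfIso c.functor (fun d M => RMod.isoMk (c.lineator d M) (c.lineator_act d M))
    (fun {d d'} f M => by
      ext
      have key : f ▷ c.X M ≫ (c.lineator d' M).hom = (c.lineator d M).hom ≫
          c.i (whisk d M) ≫ f ▷ M.X ≫ c.r (whisk d' M) := by
        apply c.i_cancel
        simp only [Category.assoc]
        rw [lineator_i, r_i, reassoc_of% c.lineator_i, e_tensorLeft, ← whisker_exchange f (c.e M),
          ← MonoidalCategory.whiskerLeft_comp_assoc, i_e, whisker_exchange]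
      exact key)
    (fun d {M N} f => by
      ext
      have key : d ◁ (c.i M ≫ f.hom ≫ c.r N) ≫ (c.lineator d N).hom = (c.lineator d M).hom ≫
          c.i (whisk d M) ≫ d ◁ f.hom ≫ c.r (whisk d N) := by
        apply c.i_cancel
        simp only [Category.assoc]
        rw [lineator_i, r_i, reassoc_of% c.lineator_i, e_tensorLeft]
        simp only [← MonoidalCategory.whiskerLeft_comp, Category.assoc, r_i]
      exact key)
    (fun d d' M => by
      ext
      have key : (c.lineator (d ⊗ d') M).hom ≫ c.i (whisk (d ⊗ d') M) ≫
          (α_ d d' M.X).hom ≫ c.r (whisk d (whisk d' M)) =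
          (α_ d d' (c.X M)).hom ≫ d ◁ (c.lineator d' M).hom ≫
            (c.lineator d (whisk d' M)).hom := by
        apply c.i_cancel
        simp only [Category.assoc]
        rw [lineator_i, r_i, reassoc_of% c.lineator_i, e_tensorLeft, e_tensorLeft,
          ← MonoidalCategory.whiskerLeft_comp, lineator_i]
        simp only [tensor_whiskerLeft, Category.assoc, Iso.inv_hom_id_assoc]
        rw [← MonoidalCategory.whiskerLeft_comp, ← MonoidalCategory.whiskerLeft_comp, i_e]
      exact key)
    (fun M => by
      ext
      have key : (λ_ (c.X M)).hom = (c.lineator (𝟙_ C) M).hom ≫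
          c.i (whisk (𝟙_ C) M) ≫ (λ_ M.X).hom ≫ c.r M := by
        rw [reassoc_of% c.lineator_i, leftUnitor_naturality_assoc, i_r, Category.comp_id]
      exact key)

/-! #### The inverse construction -/

variable (S : 𝟙_ C ⟶ A.X ⊗ A.X)

/-- The action `Mq ⊗ A ⟶ M`. -/
def t (M : RMod A) : c.X M ⊗ A.X ⟶ M.X := c.i M ▷ A.X ≫ M.act

/-- The map `m ↦ ∑ (m aᵢ q) ⊗ bᵢ` for `S = ∑ aᵢ ⊗ bᵢ`. -/
def s (M : RMod A) : M.X ⟶ c.X M ⊗ A.X :=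
  (ρ_ M.X).inv ≫ M.X ◁ S ≫ (α_ M.X A.X A.X).inv ≫ (M.act ≫ c.r M) ▷ A.X

/-- The map `a ↦ ∑ (q a aᵢ q) ⊗ bᵢ`. -/
def sig : A.X ⟶ B.X ⊗ A.X :=
  (ρ_ A.X).inv ≫ A.X ◁ S ≫ (α_ A.X A.X A.X).inv ≫ (μ[A.X] ≫ c.ret) ▷ A.X

theorem ret_cact (M : RMod A) : c.X M ◁ c.ret ≫ c.cact M = c.i M ▷ A.X ≫ M.act ≫ c.r M := by
  rw [cact, whisker_exchange_assoc, ← MonoidalCategory.whiskerLeft_comp_assoc, ret_inc_eq,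
    MonoidalCategory.whiskerLeft_comp_assoc, ← reassoc_of% c.act_e, e_r, ← reassoc_of% c.e_act,
    ← comp_whiskerRight_assoc, i_e]

/-- For `n = nq` one has `(na)aᵢq = n(qaaᵢq)`. Hence `t ≫ s` involves only the action of the corner
on `Mq`, and so commutes with every map that is linear over the corner, even one not known to come
from `A`-modules. -/
theorem t_s_eq (M : RMod A) : c.t M ≫ c.s S M =
    c.X M ◁ c.sig S ≫ (α_ (c.X M) B.X A.X).inv ≫ c.cact M ▷ A.X := by
  have h := congrArg (fun f => f ▷ A.X) (c.ret_cact M)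
  simp only [comp_whiskerRight] at h
  have h' := congrArg (fun f => f ▷ A.X) M.act_assoc
  simp only [comp_whiskerRight, Category.assoc] at h'
  rw [t, s, sig]
  simp only [Category.assoc, comp_whiskerRight, MonoidalCategory.whiskerLeft_comp]
  rw [associator_inv_naturality_middle_assoc, associator_inv_naturality_middle_assoc, h]
  rw [rightUnitor_inv_naturality_assoc, ← whisker_exchange_assoc,
    associator_inv_naturality_left_assoc, reassoc_of% h',
    ← comp_whiskerRight_assoc (c.X M ◁ μ), whisker_exchange, comp_whiskerRight_assoc]
  simp only [tensor_whiskerLeft, whisker_assoc, Category.assoc, Iso.inv_hom_id_assoc,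
    whiskerLeft_rightUnitor_inv]
  rw [← associator_inv_naturality_left_assoc, whisker_exchange_assoc,
    whisker_exchange_assoc, ← associator_naturality_left_assoc, ← rightUnitor_inv_naturality_assoc]
  simp

theorem sig_naturality {Y Z : C} (f : Y ⟶ Z) :
    f ▷ A.X ≫ Z ◁ c.sig S = Y ◁ c.sig S ≫ f ▷ (B.X ⊗ A.X) := (whisker_exchange _ _).symm

theorem t_act (M : RMod A) : c.t M ▷ A.X ≫ M.act =
    (α_ (c.X M) A.X A.X).hom ≫ c.X M ◁ μ[A.X] ≫ c.t M := by
  rw [t, comp_whiskerRight_assoc, M.act_assoc, whisker_exchange_assoc, associator_naturality_left_assoc]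

theorem q_t (M : RMod A) : (ρ_ (c.X M)).inv ≫ c.X M ◁ c.q ≫ c.t M = c.i M := by
  rw [t, whisker_exchange_assoc, ← rightUnitor_inv_naturality_assoc]
  exact c.i_e M

theorem inc_mul_ret : c.inc ▷ A.X ≫ μ[A.X] ≫ c.ret = B.X ◁ c.ret ≫ μ[B.X] := by
  have : Mono c.inc := mono_of_mono_fac c.inc_ret
  rw [← cancel_mono c.inc]
  simp only [Category.assoc]
  rw [c.ret_inc_eq, c.mul_inc, MonoidalCategory.tensorHom_def, Category.assoc,
    whisker_exchange_assoc, ← MonoidalCategory.whiskerLeft_comp_assoc, c.ret_inc_eq,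
    MonoidalCategory.whiskerLeft_comp_assoc, reassoc_of% c.mul_lq, ← mul_rq, ← reassoc_of% c.rq_mul,
    ← comp_whiskerRight_assoc, ← comp_whiskerRight_assoc, inc_lq, inc_rq]

theorem mul_inc_ret : A.X ◁ c.inc ≫ μ[A.X] ≫ c.ret = c.ret ▷ B.X ≫ μ[B.X] := by
  have : Mono c.inc := mono_of_mono_fac c.inc_ret
  rw [← cancel_mono c.inc]
  simp only [Category.assoc]
  rw [c.ret_inc_eq, c.mul_inc, MonoidalCategory.tensorHom_def', Category.assoc,
    ← whisker_exchange_assoc, ← comp_whiskerRight_assoc, c.ret_inc_eq,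
    ← rq_lq, reassoc_of% c.mul_rq, mul_lq, ← MonoidalCategory.whiskerLeft_comp_assoc, inc_rq, rq_lq,
    comp_whiskerRight_assoc, rq_mul, ← whisker_exchange_assoc,
    ← MonoidalCategory.whiskerLeft_comp_assoc, inc_lq]

theorem lq_sig : c.lq ≫ c.sig S = c.sig S := by
  rw [sig, rightUnitor_inv_naturality_assoc, ← whisker_exchange_assoc,
    associator_inv_naturality_left_assoc, ← comp_whiskerRight, ← reassoc_of% c.mul_lq, lq_ret]

theorem inc_mul_sig : c.inc ▷ A.X ≫ μ[A.X] ≫ c.sig S =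
    B.X ◁ c.sig S ≫ (α_ B.X B.X A.X).inv ≫ μ[B.X] ▷ A.X := by
  have h := congrArg (fun f => f ▷ A.X) c.inc_mul_ret
  simp only [comp_whiskerRight] at h
  have h' := congrArg (fun f => f ▷ A.X) (MonObj.mul_assoc A.X)
  simp only [comp_whiskerRight, Category.assoc] at h'
  rw [sig]
  simp only [Category.assoc, comp_whiskerRight, MonoidalCategory.whiskerLeft_comp]
  rw [associator_inv_naturality_middle_assoc, associator_inv_naturality_middle_assoc, ← h]
  rw [rightUnitor_inv_naturality_assoc, ← whisker_exchange_assoc,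
    associator_inv_naturality_left_assoc, reassoc_of% h',
    ← comp_whiskerRight_assoc (B.X ◁ μ), whisker_exchange, comp_whiskerRight_assoc]
  simp only [tensor_whiskerLeft, whisker_assoc, Category.assoc, Iso.inv_hom_id_assoc,
    whiskerLeft_rightUnitor_inv]
  rw [← associator_inv_naturality_left_assoc, whisker_exchange_assoc,
    whisker_exchange_assoc, ← associator_naturality_left_assoc, ← rightUnitor_inv_naturality_assoc]
  simp

section

variable {S}

/-- The hypothesis `hS` reads `∑ aᵢ(qbᵢ) = 1` and expresses that `q` is a full idempotent. Acting on
a module it gives `∑ (maᵢ)(qbᵢ) = m`. -/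
theorem whisker_S (hS : S ≫ A.X ◁ c.lq ≫ μ[A.X] = η[A.X]) (M : RMod A) : M.X ◁ S ≫
    (α_ M.X A.X A.X).inv ≫ M.act ▷ A.X ≫
    M.X ◁ c.lq ≫ M.act = (ρ_ M.X).hom := by
  rw [← whisker_exchange_assoc, M.act_assoc, ← M.act_one, ← hS]
  simp

theorem s_t (hS : S ≫ A.X ◁ c.lq ≫ μ[A.X] = η[A.X]) (M : RMod A) : c.s S M ≫ c.t M = 𝟙 M.X := by
  rw [s, t]
  simp only [Category.assoc, comp_whiskerRight]
  rw [← comp_whiskerRight_assoc (c.r M), r_i, e_act, c.whisker_S hS, Iso.inv_hom_id]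

theorem sig_mul (hS : S ≫ A.X ◁ c.lq ≫ μ[A.X] = η[A.X]) :
    c.sig S ≫ c.inc ▷ A.X ≫ μ[A.X] = c.lq := by
  have h : A.X ◁ S ≫ (α_ A.X A.X A.X).inv ≫ μ[A.X] ▷ A.X ≫ A.X ◁ c.lq ≫ μ[A.X] = (ρ_ A.X).hom :=
    c.whisker_S hS (RMod.regular A)
  rw [sig]
  simp only [Category.assoc]
  rw [← comp_whiskerRight_assoc, Category.assoc, c.ret_inc_eq, reassoc_of% c.mul_lq,
    comp_whiskerRight, comp_whiskerRight, Category.assoc, Category.assoc, rq_mul,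
    ← associator_inv_naturality_left_assoc, whisker_exchange_assoc,
    ← rightUnitor_inv_naturality_assoc, h, Iso.inv_hom_id, Category.comp_id]

/-- The extension of a morphism of modules over the corner is characterised on `Mq`. -/
theorem t_s_hom (hS : S ≫ A.X ◁ c.lq ≫ μ[A.X] = η[A.X]) {M N : RMod A} (f : c.X M ⟶ c.X N)
    (hf : c.cact M ≫ f = f ▷ B.X ≫ c.cact N) :
    c.t M ≫ c.s S M ≫ f ▷ A.X ≫ c.t N = f ▷ A.X ≫ c.t N := by
  have h : c.t M ≫ c.s S M ≫ f ▷ A.X = f ▷ A.X ≫ c.t N ≫ c.s S N := by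
    rw [t_s_eq, ← Category.assoc, t_s_eq, reassoc_of% c.sig_naturality,
      associator_inv_naturality_left_assoc, ← comp_whiskerRight, ← hf, comp_whiskerRight]
    simp only [Category.assoc]
  rw [← Category.assoc (c.s S M), ← Category.assoc, h]
  simp only [Category.assoc]
  rw [c.s_t hS, Category.comp_id]

/-- The map `t` is a split epimorphism by `s_t`, so `Mq` generates `M` and a morphism of modules is
determined on it. -/
theorem functor_faithful (hS : S ≫ A.X ◁ c.lq ≫ μ[A.X] = η[A.X]) : c.functor.Faithful where
  map_injective {M N f g} h := by
    ext
    have h1 : c.i M ≫ f.hom ≫ c.r N = c.i M ≫ g.hom ≫ c.r N := congrArg RMod.Hom.hom h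
    have h2 := congrArg (fun y => y ≫ c.i N) h1
    simp only [Category.assoc, r_i, ← e_hom, reassoc_of% c.i_e] at h2
    have h3 : c.t M ≫ f.hom = c.t M ≫ g.hom := by
      rw [t, Category.assoc, Category.assoc, f.comm, g.comm, ← comp_whiskerRight_assoc, h2,
        comp_whiskerRight_assoc]
    rw [← Category.id_comp f.hom, ← c.s_t hS, Category.assoc, h3, reassoc_of% (c.s_t hS)]

/-- The extension of `f` is forced: `m = ∑ (maᵢq)bᵢ` has to go to `∑ f(maᵢq)bᵢ`. By `t_s_hom` this
sends `na` to `f(n)a` for `n` in `Mq`, from which its linearity follows. -/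
theorem functor_full (hS : S ≫ A.X ◁ c.lq ≫ μ[A.X] = η[A.X]) : c.functor.Full where
  map_surjective {M N} φ := by
    obtain ⟨f, hf⟩ : ∃ f : c.X M ⟶ c.X N, f = φ.hom := ⟨_, rfl⟩
    have hfc : c.cact M ≫ f = f ▷ B.X ≫ c.cact N := by subst hf; exact φ.comm
    have ht := c.t_s_hom hS f hfc
    have : Epi (c.t M ▷ A.X) := epi_of_epi_fac
      (h := 𝟙 _) (f := c.s S M ▷ A.X) (by rw [← comp_whiskerRight, c.s_t hS, id_whiskerRight])
    refine ⟨⟨c.s S M ≫ f ▷ A.X ≫ c.t N, ?_⟩, ?_⟩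
    · rw [← cancel_epi (c.t M ▷ A.X), reassoc_of% c.t_act, ht, ← comp_whiskerRight_assoc, ht,
        comp_whiskerRight_assoc, t_act, associator_naturality_left_assoc, whisker_exchange_assoc]
    · ext
      have key : c.i M ≫ (c.s S M ≫ f ▷ A.X ≫ c.t N) ≫ c.r N = f := by
        rw [← c.q_t M]
        simp only [Category.assoc]
        rw [← Category.assoc (c.s S M)]
        rw [← Category.assoc _ _ (c.r N), ← Category.assoc _ _ (c.r N), Category.assoc _ _ (c.t N), ht]
        simp only [Category.assoc]
        rw [whisker_exchange_assoc, ← rightUnitor_inv_naturality_assoc]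
        have := c.q_t N
        rw [← Category.assoc (c.X N ◁ c.q), ← Category.assoc (ρ_ (c.X N)).inv, this, i_r,
          Category.comp_id]
      exact key.trans hf

/-- The idempotent of `N ⊗ A` with image the induced module. -/
def E (S : 𝟙_ C ⟶ A.X ⊗ A.X) (N : RMod B) : N.X ⊗ A.X ⟶ N.X ⊗ A.X :=
  N.X ◁ c.sig S ≫ (α_ N.X B.X A.X).inv ≫ N.act ▷ A.X

/-- Here `(nb) ⊗ a` is identified with `n ⊗ ba`, and in `lq_E` the tensor `n ⊗ a` with `n ⊗ qa`. So
the image of `E` plays the part of the tensor product of `N` with `qA` over the corner, without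
using coequalisers. -/
theorem act_E (N : RMod B) : N.act ▷ A.X ≫ c.E S N =
    (α_ N.X B.X A.X).hom ≫ N.X ◁ (c.inc ▷ A.X ≫ μ[A.X]) ≫ c.E S N := by
  rw [E, reassoc_of% c.sig_naturality, associator_inv_naturality_left_assoc, ← comp_whiskerRight,
    N.act_assoc, ← MonoidalCategory.whiskerLeft_comp_assoc, Category.assoc, inc_mul_sig]
  simp

theorem lq_E (N : RMod B) : N.X ◁ c.lq ≫ c.E S N = c.E S N := by
  rw [E, ← MonoidalCategory.whiskerLeft_comp_assoc, lq_sig]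

/-- Since `∑ (qaaᵢq)bᵢ = qa` by `sig_mul`, the right multiplication of `A` descends to the image of
`E`. Putting 1 in the right factor yields idempotence of `E`. -/
theorem E_mul (hS : S ≫ A.X ◁ c.lq ≫ μ[A.X] = η[A.X]) (N : RMod B) : c.E S N ▷ A.X ≫
    (α_ N.X A.X A.X).hom ≫ N.X ◁ μ[A.X] ≫ c.E S N =
    (α_ N.X A.X A.X).hom ≫ N.X ◁ μ[A.X] ≫ c.E S N := by
  have h : c.sig S ▷ A.X ≫ (α_ B.X A.X A.X).hom ≫ B.X ◁ μ[A.X] ≫ c.inc ▷ A.X ≫ μ[A.X] =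
      μ[A.X] ≫ c.lq := by
    rw [whisker_exchange_assoc, ← associator_naturality_left_assoc, ← MonObj.mul_assoc,
      ← comp_whiskerRight_assoc, ← comp_whiskerRight_assoc, Category.assoc, c.sig_mul hS, mul_lq]
  conv_lhs => lhs; rw [E]
  simp only [comp_whiskerRight, Category.assoc]
  rw [associator_naturality_left_assoc, ← whisker_exchange_assoc, act_E]
  have h' := congrArg (fun f => N.X ◁ f) h
  simp only [MonoidalCategory.whiskerLeft_comp] at h' ⊢
  conv_rhs => rw [← lq_E, ← reassoc_of% h']
  simp

theorem E_E (hS : S ≫ A.X ◁ c.lq ≫ μ[A.X] = η[A.X]) (N : RMod B) : c.E S N ≫ c.E S N = c.E S N := by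
  have h := congrArg (fun f => (ρ_ _).inv ≫ (N.X ⊗ A.X) ◁ η[A.X] ≫ f) (c.E_mul hS N)
  have h' : (ρ_ (N.X ⊗ A.X)).inv ≫ (N.X ⊗ A.X) ◁ η[A.X] ≫ (α_ N.X A.X A.X).hom ≫ N.X ◁ μ[A.X] =
      𝟙 _ := by
    rw [associator_naturality_right_assoc, ← MonoidalCategory.whiskerLeft_comp, MonObj.mul_one]
    simp
  rw [whisker_exchange_assoc, ← rightUnitor_inv_naturality_assoc, reassoc_of% h'] at h
  exact h

theorem functor_essSurj (hS : S ≫ A.X ◁ c.lq ≫ μ[A.X] = η[A.X]) : c.functor.EssSurj where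
  mem_essImage N := by
    -- The induced module is the image of `E`, with `A` acting on the second tensor factor.
    obtain ⟨X₀, iE, rE, hir, hri⟩ :=
      IsIdempotentComplete.idempotents_split _ _ (c.E_E hS N)
    have : Mono iE := mono_of_mono_fac hir
    have : Epi rE := epi_of_epi_fac hir
    have epiA : ∀ Z : C, Epi (rE ▷ Z) := fun Z => epi_of_epi_fac (f := iE ▷ Z) (h := 𝟙 _)
      (by rw [← comp_whiskerRight, hir, id_whiskerRight])
    obtain ⟨a₀, ha₀⟩ : ∃ a₀, a₀ = iE ▷ A.X ≫ (α_ N.X A.X A.X).hom ≫ N.X ◁ μ[A.X] ≫ rE := ⟨_, rfl⟩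
    have hra : rE ▷ A.X ≫ a₀ = (α_ N.X A.X A.X).hom ≫ N.X ◁ μ[A.X] ≫ rE := by
      rw [← cancel_mono iE, ha₀]
      simp only [Category.assoc]
      rw [hri, ← comp_whiskerRight_assoc, hri, c.E_mul hS]
    have lq_r : N.X ◁ c.lq ≫ rE = rE := by
      rw [← cancel_mono iE, Category.assoc, hri, lq_E]
    have act_r : N.act ▷ A.X ≫ rE =
        (α_ N.X B.X A.X).hom ≫ N.X ◁ (c.inc ▷ A.X ≫ μ[A.X]) ≫ rE := by
      rw [← cancel_mono iE]; simp only [Category.assoc]; rw [hri, act_E]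
    let M₀ : RMod A :=
      { X := X₀
        act := a₀
        act_assoc := by
          have := epiA A.X
          have : Epi (rE ▷ A.X ▷ A.X) := epi_of_epi_fac (f := iE ▷ A.X ▷ A.X) (h := 𝟙 _)
            (by rw [← comp_whiskerRight, ← comp_whiskerRight, hir, id_whiskerRight, id_whiskerRight])
          rw [← cancel_epi (rE ▷ A.X ▷ A.X), ← comp_whiskerRight_assoc, hra,
            comp_whiskerRight_assoc, comp_whiskerRight_assoc, hra,
            associator_naturality_left_assoc, ← whisker_exchange_assoc, hra]
          simp only [whisker_assoc, tensor_whiskerLeft, Category.assoc, Iso.inv_hom_id_assoc]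
          rw [← MonoidalCategory.whiskerLeft_comp_assoc N.X (μ[A.X] ▷ A.X), MonObj.mul_assoc]
          simp
        act_one := by
          have := epiA (𝟙_ C)
          rw [← cancel_epi (rE ▷ 𝟙_ C), ← whisker_exchange_assoc, hra,
            associator_naturality_right_assoc, ← MonoidalCategory.whiskerLeft_comp_assoc,
            MonObj.mul_one, rightUnitor_naturality]
          simp }
    -- The map `w` is `n ⊗ a ↦ n(qaq)` and `j` is `n ↦ n ⊗ q`. Restricted to the image of `E`, one
    -- composite is the identity of `N` and the other is multiplication by `q`, so they identify `N`
    -- with the part of `M₀` cut out by `q`.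
    obtain ⟨w, hw⟩ : ∃ w, w = N.X ◁ c.ret ≫ N.act := ⟨_, rfl⟩
    obtain ⟨j, hj⟩ : ∃ j, j = (ρ_ N.X).inv ≫ N.X ◁ c.q := ⟨_, rfl⟩
    have jw : j ≫ w = 𝟙 N.X := by
      rw [hj, hw, Category.assoc, ← MonoidalCategory.whiskerLeft_comp_assoc, q, Category.assoc,
        c.inc_ret, Category.comp_id, N.act_one, Iso.inv_hom_id]
    have Ew : c.E S N ≫ w = w := by
      rw [E, hw]
      simp only [Category.assoc]
      rw [← whisker_exchange_assoc, N.act_assoc, ← associator_inv_naturality_right_assoc,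
        Iso.inv_hom_id_assoc, ← MonoidalCategory.whiskerLeft_comp_assoc,
        ← MonoidalCategory.whiskerLeft_comp_assoc, Category.assoc, ← inc_mul_ret,
        reassoc_of% (c.sig_mul hS), lq_ret]
    have re : rE ≫ c.e M₀ = N.X ◁ c.rq ≫ rE := by
      change rE ≫ (ρ_ X₀).inv ≫ X₀ ◁ c.q ≫ a₀ = _
      rw [rightUnitor_inv_naturality_assoc, ← whisker_exchange_assoc, hra, rq]
      simp
    have wj : w ≫ j ≫ rE = rE ≫ c.e M₀ := by
      rw [re, hw, hj]
      simp only [Category.assoc]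
      rw [rightUnitor_inv_naturality_assoc, ← whisker_exchange_assoc, act_r]
      have : (ρ_ (N.X ⊗ B.X)).inv ≫ (N.X ⊗ B.X) ◁ c.q ≫ (α_ N.X B.X A.X).hom ≫
          N.X ◁ (c.inc ▷ A.X ≫ μ[A.X]) = N.X ◁ c.inc := by
        conv_rhs => rw [← c.inc_rq, rq, rightUnitor_inv_naturality_assoc,
          ← whisker_exchange_assoc]
        simp
      rw [reassoc_of% this, ← MonoidalCategory.whiskerLeft_comp_assoc, c.ret_inc_eq, ← rq_lq,
        MonoidalCategory.whiskerLeft_comp_assoc, lq_r]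
    have uv : (j ≫ rE) ≫ iE ≫ w = 𝟙 _ := by
      rw [Category.assoc, reassoc_of% hri, Ew, jw]
    have vu : (iE ≫ w) ≫ j ≫ rE = c.e M₀ := by
      rw [Category.assoc, wj, reassoc_of% hir]
    have iso_hom_inv : (c.i M₀ ≫ iE ≫ w) ≫ (j ≫ rE) ≫ c.r M₀ = 𝟙 _ := by
      have : (c.i M₀ ≫ iE ≫ w) ≫ (j ≫ rE) ≫ c.r M₀ = c.i M₀ ≫ ((iE ≫ w) ≫ j ≫ rE) ≫ c.r M₀ := by
        simp only [Category.assoc]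
      rw [this, vu, e_r, i_r]
    have iso_inv_hom : ((j ≫ rE) ≫ c.r M₀) ≫ c.i M₀ ≫ iE ≫ w = 𝟙 _ := by
      have : ((j ≫ rE) ≫ c.r M₀) ≫ c.i M₀ ≫ iE ≫ w = (j ≫ rE) ≫ (c.r M₀ ≫ c.i M₀) ≫ iE ≫ w := by
        simp only [Category.assoc]
      have h2 : (j ≫ rE) ≫ ((iE ≫ w) ≫ j ≫ rE) ≫ iE ≫ w =
          ((j ≫ rE) ≫ iE ≫ w) ≫ (j ≫ rE) ≫ iE ≫ w := by simp only [Category.assoc]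
      rw [this, r_i, ← vu, h2, uv, Category.id_comp]
    have lin : X₀ ◁ c.inc ≫ a₀ ≫ iE ≫ w = (iE ≫ w) ▷ B.X ≫ N.act := by
      have := epiA B.X
      rw [← cancel_epi (rE ▷ B.X), ← whisker_exchange_assoc, reassoc_of% hra, reassoc_of% hri, Ew,
        ← comp_whiskerRight_assoc, reassoc_of% hri, Ew, hw, comp_whiskerRight_assoc, N.act_assoc,
        associator_naturality_middle_assoc, ← MonoidalCategory.whiskerLeft_comp_assoc (f := c.ret ▷ B.X),
        ← mul_inc_ret]
      simp
    refine ⟨M₀, ⟨RMod.isoMk (M := c.obj M₀) (N := N)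
      ⟨c.i M₀ ≫ iE ≫ w, (j ≫ rE) ≫ c.r M₀, iso_hom_inv, iso_inv_hom⟩ ?_⟩⟩
    have key : c.cact M₀ ≫ c.i M₀ ≫ iE ≫ w = (c.i M₀ ≫ iE ≫ w) ▷ B.X ≫ N.act := by
      rw [reassoc_of% c.cact_i, comp_whiskerRight_assoc, ← lin]
    exact key

/-- Morita equivalence of an algebra with a full corner. -/
theorem moduleCategoriesEquivalent (hS : S ≫ A.X ◁ c.lq ≫ μ[A.X] = η[A.X]) :
    ModuleCategoriesEquivalent A B :=
  have := c.functor_faithful hS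
  have := c.functor_full hS
  have := c.functor_essSurj hS
  ⟨c.functor, {}, ⟨c.functorLinear⟩⟩

end

end Corner

end CatAlg

/-! ### Twisting module categories by an invertible object -/

namespace CatAlg

open MonObj MonoidalLeftAction

variable {C : Type u} [Category.{v} C] [MonoidalCategory C]

/-- An isomorphism `B ⊗ x ≅ x ⊗ B'` that intertwines two algebra structures. -/
structure Intertwiner (B B' : Mon C) (x : C) where
  iso : B.X ⊗ x ≅ x ⊗ B'.X
  one : η[B.X] ▷ x ≫ iso.hom = (λ_ x).hom ≫ (ρ_ x).inv ≫ x ◁ η[B'.X]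
  mul : μ[B.X] ▷ x ≫ iso.hom = (α_ B.X B.X x).hom ≫ B.X ◁ iso.hom ≫ (α_ B.X x B'.X).inv ≫
    iso.hom ▷ B'.X ≫ (α_ x B'.X B'.X).hom ≫ x ◁ μ[B'.X]

namespace Intertwiner

variable {B B' : Mon C} {x : C} (τ : Intertwiner B B' x)

theorem one_inv : x ◁ η[B'.X] ≫ τ.iso.inv = (ρ_ x).hom ≫ (λ_ x).inv ≫ η[B.X] ▷ x := by
  rw [Iso.comp_inv_eq, Category.assoc, Category.assoc, τ.one]
  simp

theorem mul_inv : x ◁ μ[B'.X] ≫ τ.iso.inv = (α_ x B'.X B'.X).inv ≫ τ.iso.inv ▷ B'.X ≫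
    (α_ B.X x B'.X).hom ≫ B.X ◁ τ.iso.inv ≫ (α_ B.X B.X x).inv ≫ μ[B.X] ▷ x := by
  rw [Iso.comp_inv_eq]
  simp only [Category.assoc]
  rw [τ.mul]
  simp

/-- The action of `B'` on `N ⊗ x`. -/
def tact (N : RMod B) : (N.X ⊗ x) ⊗ B'.X ⟶ N.X ⊗ x :=
  (α_ N.X x B'.X).hom ≫ N.X ◁ τ.iso.inv ≫ (α_ N.X B.X x).inv ≫ N.act ▷ x

/-- The module `N ⊗ x`. -/
abbrev obj (N : RMod B) : RMod B' where
  X := N.X ⊗ x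
  act := τ.tact N
  act_assoc := by
    simp only [tact, comp_whiskerRight, Category.assoc]
    rw [associator_naturality_left_assoc, ← whisker_exchange_assoc,
      associator_inv_naturality_left_assoc, ← comp_whiskerRight, N.act_assoc]
    rw [tensor_whiskerLeft N.X x μ[B'.X]]
    simp only [Category.assoc, Iso.inv_hom_id_assoc]
    rw [← MonoidalCategory.whiskerLeft_comp_assoc N.X (x ◁ μ[B'.X]), mul_inv]
    simp
  act_one := by
    simp only [tact]
    rw [associator_naturality_right_assoc, ← MonoidalCategory.whiskerLeft_comp_assoc N.X (x ◁ η[B'.X]), one_inv]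
    simp only [MonoidalCategory.whiskerLeft_comp, Category.assoc]
    rw [associator_inv_naturality_middle_assoc, ← comp_whiskerRight, N.act_one]
    simp

theorem tact_hom {N N' : RMod B} (f : N.X ⟶ N'.X) (hf : N.act ≫ f = f ▷ B.X ≫ N'.act) :
    τ.tact N ≫ f ▷ x = (f ▷ x) ▷ B'.X ≫ τ.tact N' := by
  simp only [tact, Category.assoc]
  rw [← comp_whiskerRight, hf, comp_whiskerRight, associator_naturality_left_assoc,
    ← whisker_exchange_assoc, associator_inv_naturality_left_assoc]

/-- The functor `N ↦ N ⊗ x`. -/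
def functor : RMod B ⥤ RMod B' where
  obj := τ.obj
  map {M N} f := ⟨f.hom ▷ x, τ.tact_hom f.hom f.comm⟩
  map_id M := by
    ext
    exact id_whiskerRight _ _
  map_comp f g := by
    ext
    exact comp_whiskerRight _ _ _

theorem assoc_act (d : C) (N : RMod B) : ((α_ d (N.X ⊗ x) B'.X).hom ≫ d ◁ τ.tact N) ≫
    (α_ d N.X x).inv = (α_ d N.X x).inv ▷ B'.X ≫ τ.tact (Corner.whisk d N) := by
  simp [tact]

/-- The functor `N ↦ N ⊗ x` is linear. -/
@[reducible] def functorLinear : τ.functor.LeftLinear C :=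
  leftLinearOfIso τ.functor
    (fun d N => RMod.isoMk (M := RMod.tensorLeft d (τ.obj N)) (α_ d N.X x).symm (τ.assoc_act d N))
    (fun {d d'} f N => by
      ext
      have key : f ▷ (N.X ⊗ x) ≫ (α_ d' N.X x).inv = (α_ d N.X x).inv ≫ f ▷ N.X ▷ x := by simp
      exact key)
    (fun d {N N'} f => by
      ext
      have key : d ◁ (f.hom ▷ x) ≫ (α_ d N'.X x).inv = (α_ d N.X x).inv ≫ (d ◁ f.hom) ▷ x := by simp
      exact key)
    (fun d d' N => by
      ext
      have key : (α_ (d ⊗ d') N.X x).inv ≫ (α_ d d' N.X).hom ▷ x = (α_ d d' (N.X ⊗ x)).hom ≫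
          d ◁ (α_ d' N.X x).inv ≫ (α_ d (d' ⊗ N.X) x).inv := by simp
      exact key)
    (fun N => by
      ext
      have key : (λ_ (N.X ⊗ x)).hom = (α_ (𝟙_ C) N.X x).inv ≫ (λ_ N.X).hom ▷ x := by simp
      exact key)

section

theorem whisker_injective (hx : (tensorRight x).IsEquivalence) {Y Z : C} {f g : Y ⟶ Z}
    (h : f ▷ x = g ▷ x) : f = g :=
  (tensorRight x).map_injective h

theorem functor_faithful (hx : (tensorRight x).IsEquivalence) : τ.functor.Faithful where
  map_injective h := by
    ext
    exact whisker_injective hx (congrArg RMod.Hom.hom h)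

/-- A morphism between modules of the form `N ⊗ x` comes from some `f` because `- ⊗ x` is full. As
`- ⊗ x` is faithful too, linearity of `f` may be tested after tensoring with `x`, where `τ`
translates one action into the other. -/
theorem functor_full (hx : (tensorRight x).IsEquivalence) : τ.functor.Full where
  map_surjective {N N'} φ := by
    obtain ⟨f, hf⟩ : ∃ f : N.X ⟶ N'.X, f ▷ x = φ.hom := (tensorRight x).map_surjective φ.hom
    have hc : τ.tact N ≫ f ▷ x = (f ▷ x) ▷ B'.X ≫ τ.tact N' := by rw [hf]; exact φ.comm
    refine ⟨⟨f, ?_⟩, by ext; exact hf⟩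
    apply whisker_injective hx
    rw [← cancel_epi (α_ N.X B.X x).inv, ← cancel_epi (N.X ◁ τ.iso.inv),
      ← cancel_epi (α_ N.X x B'.X).hom]
    simp only [tact, Category.assoc] at hc
    rw [comp_whiskerRight, comp_whiskerRight, hc, associator_naturality_left_assoc,
      ← whisker_exchange_assoc, associator_inv_naturality_left_assoc]

theorem functor_essSurj (hx : (tensorRight x).IsEquivalence) : τ.functor.EssSurj where
  mem_essImage N' := by
    obtain ⟨N₀, e, -⟩ : ∃ (N₀ : C) (_ : N₀ ⊗ x ≅ N'.X), True :=
      ⟨_, (tensorRight x).objObjPreimageIso N'.X, trivial⟩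
    -- The action of `B` is prescribed after tensoring with `x`: there it is the action of `B'` on
    -- `N'`, transported along `τ` and `e`.
    obtain ⟨a, ha⟩ : ∃ a : N₀ ⊗ B.X ⟶ N₀, a ▷ x = (α_ N₀ B.X x).hom ≫ N₀ ◁ τ.iso.hom ≫
        (α_ N₀ x B'.X).inv ≫ e.hom ▷ B'.X ≫ N'.act ≫ e.inv := (tensorRight x).map_surjective _
    let N : RMod B :=
      { X := N₀
        act := a
        act_assoc := by
          apply whisker_injective hx
          rw [comp_whiskerRight, comp_whiskerRight, comp_whiskerRight, ha]
          rw [associator_naturality_left_assoc, ← whisker_exchange_assoc,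
            associator_inv_naturality_left_assoc, ← comp_whiskerRight_assoc, ha]
          simp only [comp_whiskerRight, Category.assoc, inv_hom_whiskerRight_assoc]
          rw [reassoc_of% N'.act_assoc, whisker_assoc N₀ μ[B.X] x]
          simp only [Category.assoc, Iso.inv_hom_id_assoc]
          rw [← MonoidalCategory.whiskerLeft_comp_assoc N₀ (μ[B.X] ▷ x), τ.mul]
          have : e.hom ▷ B'.X ▷ B'.X ≫ (α_ N'.X B'.X B'.X).hom ≫ N'.X ◁ μ[B'.X] =
            (α_ (N₀ ⊗ x) B'.X B'.X).hom ≫ (N₀ ⊗ x) ◁ μ[B'.X] ≫ e.hom ▷ B'.X := by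
            rw [associator_naturality_left_assoc, whisker_exchange]
          rw [reassoc_of% this]
          simp
        act_one := by
          apply whisker_injective hx
          rw [comp_whiskerRight, ha, whisker_assoc]
          simp only [Category.assoc, Iso.inv_hom_id_assoc]
          rw [← MonoidalCategory.whiskerLeft_comp_assoc, τ.one]
          simp only [MonoidalCategory.whiskerLeft_comp, Category.assoc]
          rw [associator_inv_naturality_right_assoc, whisker_exchange_assoc,
            reassoc_of% N'.act_one]
          simp }
    refine ⟨N, ⟨RMod.isoMk (M := τ.obj N) (N := N') e ?_⟩⟩
    change ((α_ N₀ x B'.X).hom ≫ N₀ ◁ τ.iso.inv ≫ (α_ N₀ B.X x).inv ≫ a ▷ x) ≫ e.hom = _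
    simp only [Category.assoc]
    rw [ha]
    simp

/-- Intertwined algebras have equivalent module categories. -/
theorem moduleCategoriesEquivalent (τ : Intertwiner B B' x) (hx : (tensorRight x).IsEquivalence) :
    ModuleCategoriesEquivalent B B' :=
  have := τ.functor_faithful hx
  have := τ.functor_full hx
  have := τ.functor_essSurj hx
  ⟨τ.functor, {}, ⟨τ.functorLinear⟩⟩

end

end Intertwiner

/-- If the half-braiding of an algebra in the centre with an invertible object `x` identifies the
kernels of two split epimorphisms of algebras, then the two quotients have equivalent module
categories. -/
theorem moduleCategoriesEquivalent_of_halfBraiding {L : Mon (Center C)} {B B' : Mon C}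
    (ζ : (Center.forget C).mapMon.obj L ⟶ B) (ζ' : (Center.forget C).mapMon.obj L ⟶ B')
    (s : B.X ⟶ fobj L.X) (hs : s ≫ fhom ζ = 𝟙 B.X)
    (s' : B'.X ⟶ fobj L.X) (hs' : s' ≫ fhom ζ' = 𝟙 B'.X)
    (x : C) (hx : (tensorRight x).IsEquivalence)
    (h : (fhom ζ ≫ s) ▷ x ≫ ((fbraid L.X).β x).hom ≫ x ◁ fhom ζ' =
      ((fbraid L.X).β x).hom ≫ x ◁ fhom ζ')
    (h' : x ◁ (fhom ζ' ≫ s') ≫ ((fbraid L.X).β x).inv ≫ fhom ζ ▷ x =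
      ((fbraid L.X).β x).inv ≫ fhom ζ ▷ x) : ModuleCategoriesEquivalent B B' := by
  obtain ⟨p, hp⟩ : ∃ p, p = fhom ζ := ⟨_, rfl⟩
  obtain ⟨p', hp'⟩ : ∃ p', p' = fhom ζ' := ⟨_, rfl⟩
  obtain ⟨b, hb⟩ : ∃ b, b = (fbraid L.X).β x := ⟨_, rfl⟩
  have p1 := fone_fhom ζ
  have p1' := fone_fhom ζ'
  have p2 := fmul_fhom ζ
  have p2' := fmul_fhom ζ'
  have b1 := fone_comm L x
  have b2 := fmul_comm L x
  rw [unitHalfBraiding_hom] at b1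
  rw [tensorHalfBraiding_hom] at b2
  rw [← hb] at b1 b2 h h'
  rw [← hp] at hs p1 p2 h h'
  rw [← hp'] at hs' p1' p2' h h'
  clear hb hp hp'
  -- By hypothesis the half-braiding and its inverse respect the kernels of the two quotient maps,
  -- so they descend to mutually inverse morphisms between `B ⊗ x` and `x ⊗ B'`.
  have e1 : p ▷ x ≫ s ▷ x ≫ b.hom ≫ x ◁ p' = b.hom ≫ x ◁ p' := by
    rw [← comp_whiskerRight_assoc, h]
  have e2 : x ◁ p' ≫ x ◁ s' ≫ b.inv ≫ p ▷ x = b.inv ≫ p ▷ x := by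
    rw [← MonoidalCategory.whiskerLeft_comp_assoc, h']
  have ep : Epi p := epi_of_epi_fac hs
  have i1 : (s ▷ x ≫ b.hom ≫ x ◁ p') ≫ x ◁ s' ≫ b.inv ≫ p ▷ x = 𝟙 _ := by
    simp only [Category.assoc]
    rw [e2, Iso.hom_inv_id_assoc, ← comp_whiskerRight, hs, id_whiskerRight]
  have i2 : (x ◁ s' ≫ b.inv ≫ p ▷ x) ≫ s ▷ x ≫ b.hom ≫ x ◁ p' = 𝟙 _ := by
    simp only [Category.assoc]
    rw [e1, Iso.inv_hom_id_assoc, ← MonoidalCategory.whiskerLeft_comp, hs',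
      MonoidalCategory.whiskerLeft_id]
  obtain ⟨t, ht⟩ : ∃ t : B.X ⊗ x ≅ x ⊗ B'.X, p ▷ x ≫ t.hom = b.hom ≫ x ◁ p' :=
    ⟨⟨_, _, i1, i2⟩, e1⟩
  refine Intertwiner.moduleCategoriesEquivalent ⟨t, ?_, ?_⟩ hx
  · rw [← p1, comp_whiskerRight_assoc, ht, reassoc_of% b1, ← p1',
      MonoidalCategory.whiskerLeft_comp]
  -- Multiplicativity may be tested before passing to the quotients, where it says that the
  -- multiplication of `L` is compatible with the half-braidings.
  · have : Epi ((p ⊗ₘ p) ▷ x) := epi_of_epi_fac (f := (s ⊗ₘ s) ▷ x) (h := 𝟙 _)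
      (by rw [← comp_whiskerRight, tensorHom_comp_tensorHom, hs, id_tensorHom_id, id_whiskerRight])
    rw [← cancel_epi ((p ⊗ₘ p) ▷ x), ← comp_whiskerRight_assoc, ← p2, comp_whiskerRight_assoc, ht,
      reassoc_of% b2, ← MonoidalCategory.whiskerLeft_comp, p2']
    have : (p ⊗ₘ p) ▷ x ≫ (α_ B.X B.X x).hom ≫ B.X ◁ t.hom = (α_ _ _ x).hom ≫ fobj L.X ◁ (b.hom ≫ x ◁ p') ≫
        p ▷ (x ⊗ B'.X) := by
      rw [← ht, MonoidalCategory.whiskerLeft_comp, Category.assoc, whisker_exchange]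
      simp [MonoidalCategory.tensorHom_def']
    rw [reassoc_of% this, associator_inv_naturality_left_assoc, ← comp_whiskerRight_assoc, ht]
    have h3 : b.hom ▷ fobj L.X ≫ (α_ x (fobj L.X) (fobj L.X)).hom ≫ x ◁ fobj L.X ◁ p' =
        (α_ _ _ _).hom ≫ fobj L.X ◁ x ◁ p' ≫ (α_ _ _ _).inv ≫ b.hom ▷ B'.X ≫ (α_ _ _ _).hom := by
      have := whisker_exchange b.hom p'
      simp only [tensor_whiskerLeft, Category.assoc] at this
      rw [reassoc_of% this]
      simp
    simp [MonoidalCategory.tensorHom_def', reassoc_of% h3]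

end CatAlg

/-! ### Elements of algebras in `𝒱(G, α)` and of objects of its centre -/

namespace GrVec

open MonObj

variable {k G : Type u} [Field k] [Group G] [Fintype G] {α : Cocycle₃ k G}

theorem HasDeg.add {V : GrVec α} {g : G} {v w : V} (hv : V.HasDeg g v) (hw : V.HasDeg g w) :
    V.HasDeg g (v + w) := by
  unfold HasDeg; rw [map_add, hv, hw]

theorem HasDeg.zero (V : GrVec α) (g : G) : V.HasDeg g 0 := map_zero _

theorem HasDeg.sum {V : GrVec α} {g : G} {ι' : Type*} {s : Finset ι'} {f : ι' → V}
    (h : ∀ i ∈ s, V.HasDeg g (f i)) : V.HasDeg g (∑ i ∈ s, f i) := by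
  unfold HasDeg; rw [map_sum]; exact Finset.sum_congr rfl h

theorem HasDeg.eq_zero {V : GrVec α} {g h : G} {v : V} (hv : V.HasDeg g v) (hw : V.HasDeg h v)
    (hne : g ≠ h) : v = 0 := by
  rw [← hv, hw.proj_eq_zero hne]

theorem eq_zero_of_proj {V : GrVec α} {v : V} (h : ∀ g, V.proj g v = 0) : v = 0 := by
  rw [← V.sum_proj v]; exact Finset.sum_eq_zero fun g _ => h g

/-- An `α`-associative multiplication from structure morphisms. -/
def GradedMul.ofHoms {V : GrVec α} (o : unit α ⟶ V) (m : tensor V V ⟶ V)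
    (h1 : tensorMap o (𝟙 V) ≫ m = (leftIso V).hom)
    (h2 : tensorMap (𝟙 V) o ≫ m = (rightIso V).hom)
    (h3 : tensorMap m (𝟙 V) ≫ m = (assocIso V V V).hom ≫ tensorMap (𝟙 V) m ≫ m) :
    GradedMul V where
  mul := curry m.lin
  one := o.lin unitOne
  mul_deg f g a b ha hb := m.hasDeg (ha.tm hb)
  one_deg := o.hasDeg (unit_hasDeg _)
  one_mul a := by
    have h := LinearMap.congr_fun (congrArg Hom.lin h1) (tm unitOne a)
    exact h.trans ((lid_tm V _ a).trans (one_smul k a))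
  mul_one a := by
    have h := LinearMap.congr_fun (congrArg Hom.lin h2) (tm a unitOne)
    exact h.trans ((rid_tm V _ a).trans (one_smul k a))
  mul_assoc f g h a b c ha hb hc := by
    have h := LinearMap.congr_fun (congrArg Hom.lin h3) (tm (tm a b) c)
    simp only [comp_lin, LinearMap.comp_apply, tensorMap_tm, id_lin, LinearMap.id_apply,
      assocIso_hom_lin, LinearEquiv.coe_coe, assocEquiv_tm ha hb hc, map_smul] at h
    simp only [curry_apply]
    rw [h, smul_smul]
    simp

/-- The multiplication of an algebra in `𝒱(G, α)`, on elements. -/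
def gradedMul (A : Mon (GrVec α)) : GradedMul A.X :=
  GradedMul.ofHoms η[A.X] μ[A.X] (MonObj.one_mul A.X) (MonObj.mul_one A.X) (MonObj.mul_assoc A.X)

theorem eta_unitOne (A : Mon (GrVec α)) :
    GrVec.Hom.lin η[A.X] (unitOne : unit α) = (gradedMul A).one := rfl

theorem unit_eq_smul (c : unit α) : c = unitVal c • (unitOne : unit α) :=
  (_root_.mul_one (unitVal c)).symm

theorem unit_hom_apply {V : GrVec α} (f : unit α ⟶ V) (c : unit α) :
    f.lin c = unitVal c • f.lin unitOne := by
  conv_lhs => rw [unit_eq_smul c]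
  rw [map_smul]

theorem unit_hom_ext {V : GrVec α} {f g : unit α ⟶ V} (h : f.lin unitOne = g.lin unitOne) :
    f = g := by
  ext1; apply LinearMap.ext; intro c; rw [unit_hom_apply, unit_hom_apply g, h]

open scoped Classical in
/-- The morphism from the unit object given by an element of degree one. -/
def ofUnit {V : GrVec α} (v : V) (hv : V.HasDeg 1 v) : unit α ⟶ V where
  lin := (LinearMap.toSpanSingleton k V v : k →ₗ[k] V)
  comm := comm_of_hasDeg (V := unit α) _ fun g c hc => by
    by_cases hg : g = 1
    · subst hg; exact hv.smul _
    · rw [unitVal_eq_zero hg hc]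
      have : (LinearMap.toSpanSingleton k V v : k →ₗ[k] V) 0 = 0 := map_zero _
      exact (congrArg (V.HasDeg g) this).mpr (map_zero _)

@[simp] theorem ofUnit_one {V : GrVec α} (v : V) (hv : V.HasDeg 1 v) :
    (ofUnit v hv).lin unitOne = v := one_smul k v

/-- Homomorphisms of algebras in `𝒱(G, α)`. -/
def monHom {A B : Mon (GrVec α)} (φ : A.X ⟶ B.X)
    (h1 : φ.lin (gradedMul A).one = (gradedMul B).one)
    (h2 : ∀ a b, φ.lin ((gradedMul A).mul a b) = (gradedMul B).mul (φ.lin a) (φ.lin b)) : A ⟶ B :=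
  Mon.Hom.mk' φ (unit_hom_ext h1) (by ext1; exact ext_tm h2)

/-- The image of an idempotent endomorphism. -/
def image {V : GrVec α} (e : V ⟶ V) : GrVec α where
  carrier := LinearMap.range e.lin
  proj g := (V.proj g).restrict (by
    rintro _ ⟨v, rfl⟩
    exact ⟨V.proj g v, e.comm g v⟩)
  proj_self g v := Subtype.ext (V.proj_self g v)
  proj_ne g h v hne := Subtype.ext (V.proj_ne g h v hne)
  sum_proj v := by
    apply Subtype.ext
    rw [← Submodule.subtype_apply, map_sum]
    exact V.sum_proj v

instance : IsIdempotentComplete (GrVec α) where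
  idempotents_split V e he := by
    refine ⟨image e, ⟨(LinearMap.range e.lin).subtype, fun _ _ => rfl⟩,
      ⟨e.lin.rangeRestrict, fun g v => Subtype.ext (e.comm g v)⟩, ?_, ?_⟩
    · ext1
      apply LinearMap.ext
      rintro ⟨_, v, rfl⟩
      exact Subtype.ext (LinearMap.congr_fun (congrArg Hom.lin he) v)
    · rfl

open scoped Classical in
/-- The one-dimensional space of degree `x`. -/
def line (α : Cocycle₃ k G) (x : G) : GrVec α where
  carrier := k
  proj g := if g = x then LinearMap.id else 0
  proj_self g v := by split <;> simp
  proj_ne g h v hne := by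
    by_cases hg : g = x
    · subst hg; simp [hne.symm]
    · simp [hg]
  sum_proj v := by
    rw [Finset.sum_eq_single x] <;> simp +contextual

/-- The basis vector of the one-dimensional space of degree `x`. -/
def lineOne (x : G) : line α x := (1 : k)

theorem line_hasDeg {x : G} (c : line α x) : (line α x).HasDeg x c := by
  have : (line α x).proj x = LinearMap.id := if_pos rfl
  simp [HasDeg, this]

theorem line_eq_zero {x f : G} (hf : f ≠ x) {c : line α x} (hc : (line α x).HasDeg f c) :
    c = 0 := by
  rw [← hc, (line_hasDeg c).proj_eq_zero hf]

/-- The morphism from the one-dimensional space of degree `x` given by an element of degree `x`. -/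
def ofLine {V : GrVec α} {x : G} (v : V) (hv : V.HasDeg x v) : line α x ⟶ V where
  lin := (LinearMap.toSpanSingleton k V v : k →ₗ[k] V)
  comm := comm_of_hasDeg (V := line α x) _ fun g c hc => by
    by_cases hg : g = x
    · subst hg; exact hv.smul _
    · rw [line_eq_zero hg hc]
      have : (LinearMap.toSpanSingleton k V v : k →ₗ[k] V) 0 = 0 := map_zero _
      exact (congrArg (V.HasDeg g) this).mpr (map_zero _)

@[simp] theorem ofLine_one {V : GrVec α} {x : G} (v : V) (hv : V.HasDeg x v) :
    (ofLine v hv).lin (lineOne x) = v := one_smul k v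

/-- Forgetting the one-dimensional factor. -/
def ridLine (V : GrVec α) (x : G) : tensor V (line α x) →ₗ[k] V :=
    (TensorProduct.rid k V).toLinearMap

theorem ridLine_tm {V : GrVec α} {x : G} (v : V) : ridLine V x (tm v (lineOne x)) = v :=
  one_smul k v

theorem ridLine_tm' {V : GrVec α} {x : G} (t : tensor V (line α x)) :
    t = tm (ridLine V x t) (lineOne x) :=
  ((TensorProduct.rid k V).symm_apply_apply t).symm

theorem ridLine_hasDeg {V : GrVec α} {x g : G} {t : tensor V (line α x)}
    (ht : (tensor V (line α x)).HasDeg (g * x) t) : V.HasDeg g (ridLine V x t) := by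
  have h1 : ∀ f, (tensor V (line α x)).proj (f * x) t = tm (V.proj f (ridLine V x t)) (lineOne x) := by
    intro f
    conv_lhs => rw [ridLine_tm' t, ← V.sum_proj (ridLine V x t)]
    have : tm (∑ g, V.proj g (ridLine V x t)) (lineOne x) =
        ∑ g, tm (V.proj g (ridLine V x t)) (lineOne x) := TensorProduct.sum_tmul _ _ _
    rw [this, map_sum, Finset.sum_eq_single f]
    · exact (V.hasDeg_proj f _).tm (line_hasDeg _)
    · intro b _ hb
      exact ((V.hasDeg_proj b _).tm (line_hasDeg _)).proj_eq_zero (by simpa using hb.symm)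
    · simp
  have h2 := h1 g
  rw [ht] at h2
  have h3 := congrArg (ridLine V x) h2
  rw [ridLine_tm] at h3
  exact h3.symm

end GrVec

/-! ### Objects of the centre as graded spaces with a projective action. -/

namespace CatAlg

open GrVec MonObj

variable {k G : Type u} [Field k] [Group G] [Fintype G] {α : Cocycle₃ k G}

/-- The graded vector space underlying an object of the centre. -/
abbrev gobj (Y : Center (GrVec α)) : GrVec α := fobj Y

/-- The half-braiding `U ⊗ Y ⟶ Y ⊗ U` of an object of the centre. -/
def zmap (Y : Center (GrVec α)) (U : GrVec α) : tensor U (gobj Y) ⟶ tensor (gobj Y) U :=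
  ((fbraid Y).β U).inv

theorem zmap_naturality (Y : Center (GrVec α)) {U U' : GrVec α} (f : U ⟶ U') :
    tensorMap f (𝟙 (gobj Y)) ≫ zmap Y U' = zmap Y U ≫ tensorMap (𝟙 (gobj Y)) f := by
  have h := (fbraid Y).naturality f
  change f ▷ gobj Y ≫ ((fbraid Y).β U').inv = ((fbraid Y).β U).inv ≫ gobj Y ◁ f
  rw [Iso.comp_inv_eq, Category.assoc, h, Iso.inv_hom_id_assoc]

theorem zmap_unit (Y : Center (GrVec α)) :
    zmap Y (unit α) = (leftIso (gobj Y)).hom ≫ (rightIso (gobj Y)).inv := by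
  have h := halfBraiding_unit (fbraid Y)
  change ((fbraid Y).β (𝟙_ (GrVec α))).inv = (λ_ (gobj Y)).hom ≫ (ρ_ (gobj Y)).inv
  rw [← cancel_epi ((fbraid Y).β (𝟙_ (GrVec α))).hom, Iso.hom_inv_id, h]
  simp

theorem zmap_tensor (Y : Center (GrVec α)) (U U' : GrVec α) :
    zmap Y (tensor U U') = (assocIso U U' (gobj Y)).hom ≫ tensorMap (𝟙 U) (zmap Y U') ≫
      (assocIso U (gobj Y) U').inv ≫ tensorMap (zmap Y U) (𝟙 U') ≫
        (assocIso (gobj Y) U U').hom := by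
  have h := (fbraid Y).monoidal U U'
  change ((fbraid Y).β (U ⊗ U')).inv = (α_ U U' (gobj Y)).hom ≫ U ◁ ((fbraid Y).β U').inv ≫
    (α_ U (gobj Y) U').inv ≫ ((fbraid Y).β U).inv ▷ U' ≫ (α_ (gobj Y) U U').hom
  rw [← cancel_epi ((fbraid Y).β (U ⊗ U')).hom, Iso.hom_inv_id, h]
  simp

/-- The action of `g` on an object of the centre. -/
def gact (Y : Center (GrVec α)) (g : G) : gobj Y →ₗ[k] gobj Y :=
  ridLine (gobj Y) g ∘ₗ (zmap Y (line α g)).lin ∘ₗ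
    (TensorProduct.mk k (line α g) (gobj Y) (lineOne g) : gobj Y →ₗ[k] tensor (line α g) (gobj Y))

theorem zmap_line (Y : Center (GrVec α)) (g : G) (y : gobj Y) :
    (zmap Y (line α g)).lin (tm (lineOne g) y) = tm (gact Y g y) (lineOne g) :=
  ridLine_tm' _

/-- A homogeneous element of degree `g` is the image of the basis vector of the line of degree `g`.
Naturality along this morphism shows that the half-braiding is governed by one map for each `g`. -/
theorem zmap_tm (Y : Center (GrVec α)) {U : GrVec α} {g : G} {u : U} (hu : U.HasDeg g u)
    (y : gobj Y) : (zmap Y U).lin (tm u y) = tm (gact Y g y) u := by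
  have h := LinearMap.congr_fun (congrArg Hom.lin (zmap_naturality Y (ofLine u hu)))
    (tm (lineOne g) y)
  simp only [comp_lin, LinearMap.comp_apply, tensorMap_tm, id_lin, LinearMap.id_apply,
    zmap_line, ofLine_one] at h
  exact h

theorem tm_lineOne_injective {V : GrVec α} {x : G} {v w : V}
    (h : tm v (lineOne x) = tm w (lineOne x)) : v = w := by
  rw [← ridLine_tm (x := x) v, h, ridLine_tm]

/-- An object of the centre as a graded space with a projective action. -/
def toProj (Y : Center (GrVec α)) : ProjGrVec α where
  X := gobj Y
  act := gact Y
  act_deg f g y hy := by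
    apply ridLine_hasDeg (x := f)
    have := (zmap Y (line α f)).hasDeg ((line_hasDeg (α := α) (lineOne f)).tm hy)
    rwa [inv_mul_cancel_right]
  act_one y := by
    have h := zmap_tm Y (unit_hasDeg (unitOne : unit α)) y
    rw [zmap_unit] at h
    have h2 := congrArg (rid (gobj Y)) h
    rw [rid_tm, unitVal_unitOne, one_smul] at h2
    rw [← h2]
    change rid (gobj Y) ((rid (gobj Y)).symm (lid (gobj Y) (tm unitOne y))) = y
    rw [LinearEquiv.apply_symm_apply, lid_tm, unitVal_unitOne, one_smul]
  act_mul f g h y hy := by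
    have hu := line_hasDeg (α := α) (lineOne f)
    have hu' := line_hasDeg (α := α) (lineOne g)
    -- The half-braiding with the tensor product of the lines of degrees `f` and `g` is computed
    -- once as the action of `fg` and once by the hexagon. The three associators of the hexagon
    -- contribute `α(f, g | h)`.
    have key := zmap_tm Y (hu.tm hu') y
    have hgy : (gobj Y).HasDeg (g * h * g⁻¹) (gact Y g y) := by
      apply ridLine_hasDeg (x := g)
      have := (zmap Y (line α g)).hasDeg ((line_hasDeg (lineOne g)).tm hy)
      rwa [inv_mul_cancel_right]
    have hfgy : (gobj Y).HasDeg (f * (g * h * g⁻¹) * f⁻¹) (gact Y f (gact Y g y)) := by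
      apply ridLine_hasDeg (x := f)
      have := (zmap Y (line α f)).hasDeg ((line_hasDeg (lineOne f)).tm hgy)
      rwa [inv_mul_cancel_right]
    rw [zmap_tensor] at key
    simp only [comp_lin, LinearMap.comp_apply, tensorMap_tm, assocIso_hom_lin,
      ProjGrVec.assocIso_inv_lin, LinearEquiv.coe_coe, assocEquiv_tm hu hu' hy,
      map_smul, id_lin, LinearMap.id_apply, zmap_tm Y hu', assocEquiv_symm_tm hu hgy hu',
      zmap_tm Y hu, assocEquiv_tm hfgy hu hu', smul_smul, smul_tm, tm_smul] at key
    have key3 := congrArg (assoc₀ (gobj Y) (line α f) (line α g)).symm key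
    simp only [map_smul] at key3
    have e : ∀ v : gobj Y, (assoc₀ (gobj Y) (line α f) (line α g)).symm
        (tm v (tm (lineOne f) (lineOne g))) = tm (tm v (lineOne f)) (lineOne g) := fun _ => rfl
    rw [e, e, ← smul_tm, ← smul_tm] at key3
    have := tm_lineOne_injective (tm_lineOne_injective key3)
    rw [← this, ← Units.val_mul, ← Units.val_mul, Cocycle₃.two]
    congr 2
    simp only [_root_.mul_assoc, mul_inv_rev]

theorem gact_deg (Y : Center (GrVec α)) {f g : G} {y : gobj Y} (hy : (gobj Y).HasDeg g y) :
    (gobj Y).HasDeg (f * g * f⁻¹) (gact Y f y) := (toProj Y).act_deg f g y hy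

@[simp] theorem gact_one (Y : Center (GrVec α)) (y : gobj Y) : gact Y 1 y = y :=
    (toProj Y).act_one y

theorem gact_mul (Y : Center (GrVec α)) {f g h : G} {y : gobj Y} (hy : (gobj Y).HasDeg h y) :
    gact Y (f * g) y = (α.two f g h).val • gact Y f (gact Y g y) := (toProj Y).act_mul f g h y hy

theorem gact_surjective (Y : Center (GrVec α)) (g : G) : Function.Surjective (gact Y g) :=
  ((toProj Y).actEquiv g).surjective

theorem gact_toCenter (Z : ProjGrVec α) (g : G) (x : Z.X) :
    gact Z.toCenter g x = Z.act g x := by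
  have h := zmap_tm Z.toCenter (line_hasDeg (α := α) (lineOne g)) x
  have h2 := Z.zLin_tm (line_hasDeg (α := α) (lineOne g)) x
  exact tm_lineOne_injective (h.symm.trans h2)

theorem braid_tm (Y : Center (GrVec α)) {U : GrVec α} {g : G} {u : U} (hu : U.HasDeg g u)
    (y : gobj Y) : GrVec.Hom.lin ((fbraid Y).β U).hom (tm (gact Y g y) u) = tm u y := by
  rw [← zmap_tm Y hu y]
  exact LinearMap.congr_fun (congrArg GrVec.Hom.lin ((fbraid Y).β U).inv_hom_id) (tm u y)

theorem fmap_gact {Y Z : Center (GrVec α)} (f : Y ⟶ Z) (g : G) (y : gobj Y) :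
    (fmap f).lin (gact Y g y) = gact Z g ((fmap f).lin y) := by
  have h := fmap_comm f (line α g)
  rw [← Iso.inv_comp_eq, ← Category.assoc, ← Iso.eq_comp_inv] at h
  have h' : zmap Y (line α g) ≫ tensorMap (fmap f) (𝟙 _) =
      tensorMap (𝟙 _) (fmap f) ≫ zmap Z (line α g) := h
  have h2 := LinearMap.congr_fun (congrArg GrVec.Hom.lin h') (tm (lineOne g) y)
  simp only [comp_lin, LinearMap.comp_apply, tensorMap_tm, id_lin, LinearMap.id_apply,
    zmap_line] at h2
  exact tm_lineOne_injective h2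

theorem gact_unit (g : G) (c : unit α) : gact (𝟙_ (Center (GrVec α))) g c = c := by
  have h := zmap_line (𝟙_ (Center (GrVec α))) g c
  have h' : (zmap (𝟙_ (Center (GrVec α))) (line α g)).lin (tm (V := line α g) (W := unit α) (lineOne g) c) =
      tm (V := unit α) (W := line α g) unitOne (unitVal c • lineOne g) := rfl
  rw [tm_smul, ← smul_tm] at h'
  rw [← unit_eq_smul c] at h'
  exact (tm_lineOne_injective (h'.symm.trans h)).symm

/-- The half-braiding of a tensor product passes through three associators, whose values at these
degrees multiply to `α(f | g, h)`. -/
theorem gact_tensor (X Y : Center (GrVec α)) (f : G) {g h : G} {x : gobj X} {y : gobj Y}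
    (hx : (gobj X).HasDeg g x) (hy : (gobj Y).HasDeg h y) :
    gact (X ⊗ Y) f (tm x y) = (α.one f g h).val • tm (gact X f x) (gact Y f y) := by
  have hu := line_hasDeg (α := α) (lineOne f)
  have hfx := gact_deg X (f := f) hx
  have hfy := gact_deg Y (f := f) hy
  obtain ⟨w, hw⟩ : ∃ w : tensor (gobj X) (gobj Y), gact (X ⊗ Y) f (tm x y) = w := ⟨_, rfl⟩
  have key : ((assocIso (line α f) (gobj X) (gobj Y)).inv ≫
      tensorMap (zmap X (line α f)) (𝟙 (gobj Y)) ≫ (assocIso (gobj X) (line α f) (gobj Y)).hom ≫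
        tensorMap (𝟙 (gobj X)) (zmap Y (line α f)) ≫
          (assocIso (gobj X) (gobj Y) (line α f)).inv).lin (tm (lineOne f) (tm x y)) =
      tm w (lineOne f) := by rw [← hw]; exact zmap_line (X ⊗ Y) f (tm x y)
  simp only [comp_lin, LinearMap.comp_apply, tensorMap_tm, id_lin, LinearMap.id_apply,
    zmap_tm _ hu, assocIso_hom_lin, ProjGrVec.assocIso_inv_lin,
    LinearEquiv.coe_coe, assocEquiv_symm_tm hu hx hy, map_smul, assocEquiv_tm hfx hu hy,
    assocEquiv_symm_tm hfx hfy hu, smul_smul] at key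
  rw [← smul_tm, ← Units.val_mul, ← Units.val_mul, ← _root_.mul_assoc] at key
  exact hw.trans (tm_lineOne_injective key).symm

/-- Morphisms of the centre are the equivariant morphisms. -/
def centerHom {Y Z : Center (GrVec α)} (φ : gobj Y ⟶ gobj Z)
    (h : ∀ g y, φ.lin (gact Y g y) = gact Z g (φ.lin y)) : Y ⟶ Z where
  f := φ
  comm U := center_comm_of_inv φ (fun U => by
    have key : tensorMap (𝟙 U) φ ≫ zmap Z U = zmap Y U ≫ tensorMap φ (𝟙 U) := by
      ext1
      apply ext_hom₂
      intro f g u y hu hy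
      simp only [comp_lin, LinearMap.comp_apply, tensorMap_tm, id_lin, LinearMap.id_apply,
        zmap_tm Y hu, zmap_tm Z hu, h]
    exact key) U

theorem isCentral_iff_elements {A : Mon (GrVec α)} {Y : Center (GrVec α)} {ξ : gobj Y ⟶ A.X} :
    IsCentral A Y ξ ↔ ∀ g a y, A.X.HasDeg g a →
      (gradedMul A).mul a (ξ.lin y) = (gradedMul A).mul (ξ.lin (gact Y g y)) a := by
  have key : IsCentral A Y ξ ↔ tensorMap (𝟙 A.X) ξ ≫ μ[A.X] =
      zmap Y A.X ≫ tensorMap ξ (𝟙 A.X) ≫ μ[A.X] := Iff.rfl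
  rw [key]
  constructor
  · intro h g a y ha
    have h' := LinearMap.congr_fun (congrArg GrVec.Hom.lin h) (tm a y)
    simp only [comp_lin, LinearMap.comp_apply, tensorMap_tm, id_lin, LinearMap.id_apply,
      zmap_tm Y ha] at h'
    exact h'
  · intro h
    ext1
    apply ext_hom₂
    intro f g a y ha hy
    simp only [comp_lin, LinearMap.comp_apply, tensorMap_tm, id_lin, LinearMap.id_apply,
      zmap_tm Y ha]
    exact h f a y ha

/-- The multiplication of an algebra in the centre, on elements. -/
def equivMul (L : Mon (Center (GrVec α))) : (toProj L.X).EquivMul :=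
  { GradedMul.ofHoms (V := gobj L.X) (fone L) (fmul L)
      (congrArg Center.Hom.f (MonObj.one_mul L.X)) (congrArg Center.Hom.f (MonObj.mul_one L.X))
      (congrArg Center.Hom.f (MonObj.mul_assoc L.X)) with
    act_one := fun f => by
      have h := fmap_gact η[L.X] f (unitOne : unit α)
      have h2 := gact_unit (α := α) f unitOne
      exact h.symm.trans (congrArg (fone L).lin h2)
    act_mul := fun f g h a b ha hb => by
      have h1 := fmap_gact μ[L.X] f (tm (V := gobj L.X) (W := gobj L.X) a b)
      have h2 := gact_tensor L.X L.X f ha hb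
      exact h1.symm.trans ((congrArg (fmul L).lin h2).trans (map_smul _ _ _)) }

theorem gradedMul_toMon_mul {V : GrVec α} (m : GradedMul V) (a b : V) :
    (gradedMul m.toMon).mul a b = m.mul a b := m.mulHom_tm a b

theorem gradedMul_toMon_one {V : GrVec α} (m : GradedMul V) :
    (gradedMul m.toMon).one = m.one := one_smul k m.one

theorem equivMul_toMon_mul {Z : ProjGrVec α} (m : Z.EquivMul) (a b : Z.X) :
    (equivMul m.toMon).mul a b = m.mul a b := m.mulHom_tm a b

theorem equivMul_toMon_one {Z : ProjGrVec α} (m : Z.EquivMul) :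
    (equivMul m.toMon).one = m.one := one_smul k m.one

end CatAlg

/-! ### Separable algebras and their corners -/

namespace GrVec

variable {k G : Type u} [Field k] [Group G] [Fintype G] {α : Cocycle₃ k G}

/-- A linear map that shifts the degrees by `g ≠ 1` has trace zero. -/
theorem trace_eq_zero_of_shift {V : GrVec α} {g : G} (hg : g ≠ 1) (φ : V →ₗ[k] V)
    (h : ∀ l v, V.HasDeg l v → V.HasDeg (g * l) (φ v)) : LinearMap.trace k V φ = 0 := by
  have h1 : φ = ∑ l, V.proj l ∘ₗ φ := by
    ext v; rw [LinearMap.sum_apply]; exact (V.sum_proj _).symm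
  rw [h1, map_sum]
  refine Finset.sum_eq_zero fun l _ => ?_
  have h2 : V.proj l ∘ₗ φ = V.proj l ∘ₗ (V.proj l ∘ₗ φ) := by
    ext v; exact (V.proj_self l _).symm
  rw [h2, LinearMap.trace_comp_comm']
  have h3 : (V.proj l ∘ₗ φ) ∘ₗ V.proj l = 0 := by
    ext v
    exact (h l _ (V.hasDeg_proj l v)).proj_eq_zero (by simpa using hg)
  rw [h3, map_zero]

namespace GradedMul

variable {V : GrVec α} (m : GradedMul V)

/-- The trace `τ(a)` of the multiplication by `a` from the left. -/
def tr : V →ₗ[k] k := LinearMap.trace k V ∘ₗ m.mul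

/-- The trace form is non-degenerate. -/
def IsSeparable : Prop := LinearMap.BilinForm.Nondegenerate (m.mul.compr₂ m.tr)

theorem tr_apply (a : V) : m.tr a = LinearMap.trace k V (m.mul a) := rfl

theorem tr_eq_zero {g : G} (hg : g ≠ 1) {a : V} (ha : V.HasDeg g a) : m.tr a = 0 :=
  trace_eq_zero_of_shift hg _ fun l v hv => m.mul_deg g l a v ha hv

/-- The cocycle is normalised, so a factor of degree 1, in any of the three positions, associates
strictly, and the other factors need not be homogeneous. -/
theorem mul_assoc_left {a : V} (ha : V.HasDeg 1 a) (b c : V) :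
    m.mul a (m.mul b c) = m.mul (m.mul a b) c := by
  suffices h : m.mul a ∘ₗ (m.mul b) = m.mul (m.mul a b) from LinearMap.congr_fun h c
  suffices h : (LinearMap.llcomp k V V V (m.mul a)) ∘ₗ m.mul = m.mul ∘ₗ m.mul a from
    LinearMap.congr_fun h b
  refine ext_hom fun g b hb => ext_hom fun h c hc => ?_
  have := m.mul_assoc 1 g h a b c ha hb hc
  rw [α.one_left, Units.val_one, one_smul] at this
  exact this

theorem mul_assoc_mid {b : V} (hb : V.HasDeg 1 b) (a c : V) :
    m.mul a (m.mul b c) = m.mul (m.mul a b) c := by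
  suffices h : m.mul a ∘ₗ (m.mul b) = m.mul (m.mul a b) from LinearMap.congr_fun h c
  refine ext_hom fun h c hc => ?_
  suffices h : m.mul.flip (m.mul b c) = m.mul.flip c ∘ₗ m.mul.flip b from LinearMap.congr_fun h a
  refine ext_hom fun g a ha => ?_
  have := m.mul_assoc g 1 h a b c ha hb hc
  rw [α.one_mid, Units.val_one, one_smul] at this
  exact this

theorem mul_assoc_right {c : V} (hc : V.HasDeg 1 c) (a b : V) :
    m.mul a (m.mul b c) = m.mul (m.mul a b) c := by
  suffices h : m.mul a ∘ₗ m.mul.flip c = m.mul.flip c ∘ₗ m.mul a from LinearMap.congr_fun h b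
  refine ext_hom fun h b hb => ?_
  suffices h : m.mul.flip (m.mul b c) = m.mul.flip c ∘ₗ m.mul.flip b from LinearMap.congr_fun h a
  refine ext_hom fun g a ha => ?_
  have := m.mul_assoc g h 1 a b c ha hb hc
  rw [α.one_right, Units.val_one, one_smul] at this
  exact this

/-- As `a` has degree 1, the left multiplications by `ab` and `ba` are the two composites of those
by `a` and `b`, and these have the same trace. -/
theorem tr_mul_comm {a : V} (ha : V.HasDeg 1 a) (b : V) : m.tr (m.mul a b) = m.tr (m.mul b a) := by
  rw [tr_apply, tr_apply]
  have h1 : m.mul (m.mul a b) = m.mul a ∘ₗ m.mul b := by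
    ext c; exact (m.mul_assoc_left ha b c).symm
  have h2 : m.mul (m.mul b a) = m.mul b ∘ₗ m.mul a := by
    ext c; exact (m.mul_assoc_mid ha b c).symm
  rw [h1, h2, LinearMap.trace_comp_comm']

/-- Left multiplication by a component of degree different from 1 shifts degrees and has trace zero.
-/
theorem tr_mul_proj {g : G} {a : V} (ha : V.HasDeg g a) (b : V) :
    m.tr (m.mul a (V.proj g⁻¹ b)) = m.tr (m.mul a b) := by
  conv_rhs => rw [← V.sum_proj b, map_sum, map_sum]
  rw [Finset.sum_eq_single g⁻¹]
  · intro h _ hne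
    refine m.tr_eq_zero (g := g * h) (fun he => hne ?_) (m.mul_deg _ _ _ _ ha (V.hasDeg_proj _ _))
    exact (inv_eq_of_mul_eq_one_right he).symm
  · simp

theorem isSeparable_of_homogeneous
    (h : ∀ g a, V.HasDeg g a → a ≠ 0 → ∃ b, m.tr (m.mul a b) ≠ 0) : m.IsSeparable := by
  refine LinearMap.BilinForm.Nondegenerate.ofSeparatingLeft fun x hx => ?_
  refine eq_zero_of_proj fun g => ?_
  by_contra hne
  obtain ⟨b, hb⟩ := h g _ (V.hasDeg_proj g x) hne
  apply hb
  rw [← m.tr_mul_proj (V.hasDeg_proj g x)]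
  have h1 := hx (V.proj g⁻¹ b)
  change m.tr (m.mul x _) = 0 at h1
  rw [← V.sum_proj x, map_sum, LinearMap.sum_apply, map_sum, Finset.sum_eq_single g] at h1
  · exact h1
  · intro l _ hl
    refine m.tr_eq_zero (g := l * g⁻¹) (fun he => hl ?_)
      (m.mul_deg _ _ _ _ (V.hasDeg_proj _ _) (V.hasDeg_proj _ _))
    exact mul_inv_eq_one.1 he
  · simp

theorem IsSeparable.exists_tr_ne_zero {m : GradedMul V} (h : m.IsSeparable) {g : G} {a : V}
    (ha : V.HasDeg g a) (hne : a ≠ 0) : ∃ b, V.HasDeg g⁻¹ b ∧ m.tr (m.mul a b) ≠ 0 := by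
  by_contra! hc
  refine hne (h.1 a fun b => ?_)
  exact (m.tr_mul_proj ha b).symm.trans (hc _ (V.hasDeg_proj _ b))

/-! #### The algebra of elements of degree one -/

/-- The subspace of elements of degree one. -/
def degOne (V : GrVec α) : Submodule k V where
  carrier := {v | V.HasDeg 1 v}
  add_mem' := HasDeg.add
  zero_mem' := HasDeg.zero V 1
  smul_mem' c _ h := h.smul c

/-- The algebra of elements of degree one. -/
def DegOne (_m : GradedMul V) : Type u := degOne V

instance : AddCommGroup m.DegOne := inferInstanceAs (AddCommGroup (degOne V))
instance : Module k m.DegOne := inferInstanceAs (Module k (degOne V))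
instance : FiniteDimensional k m.DegOne := inferInstanceAs (FiniteDimensional k (degOne V))

/-- An element of degree one as an element of the graded algebra. -/
def DegOne.val {m : GradedMul V} (a : m.DegOne) : V := Subtype.val a

theorem DegOne.hasDeg {m : GradedMul V} (a : m.DegOne) : V.HasDeg 1 a.val := a.2

theorem DegOne.ext {m : GradedMul V} {a b : m.DegOne} (h : a.val = b.val) : a = b := Subtype.ext h

/-- An element of degree one. -/
def DegOne.mk {m : GradedMul V} (a : V) (ha : V.HasDeg 1 a) : m.DegOne := ⟨a, ha⟩

@[simp] theorem DegOne.val_mk {m : GradedMul V} (a : V) (ha : V.HasDeg 1 a) :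
    (DegOne.mk a ha : m.DegOne).val = a := rfl
@[simp] theorem DegOne.val_add {m : GradedMul V} (a b : m.DegOne) :
    (a + b).val = a.val + b.val := rfl
@[simp] theorem DegOne.val_zero {m : GradedMul V} : (0 : m.DegOne).val = 0 := rfl
@[simp] theorem DegOne.val_smul {m : GradedMul V} (c : k) (a : m.DegOne) :
    (c • a).val = c • a.val := rfl

theorem hasDeg_one_mul {a b : V} (ha : V.HasDeg 1 a) (hb : V.HasDeg 1 b) : V.HasDeg 1
    (m.mul a b) := by
  have := m.mul_deg 1 1 a b ha hb; rwa [_root_.mul_one] at this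

instance : Mul m.DegOne := ⟨fun a b => .mk (m.mul a.val b.val) (m.hasDeg_one_mul a.hasDeg b.hasDeg)⟩
instance : One m.DegOne := ⟨.mk m.one m.one_deg⟩

@[simp] theorem DegOne.val_mul {m : GradedMul V} (a b : m.DegOne) :
    (a * b).val = m.mul a.val b.val := rfl
@[simp] theorem DegOne.val_one {m : GradedMul V} : (1 : m.DegOne).val = m.one := rfl

instance : Ring m.DegOne :=
  { (inferInstance : AddCommGroup m.DegOne) with
    left_distrib := fun a b c => DegOne.ext (by simp)
    right_distrib := fun a b c => DegOne.ext (by simp)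
    zero_mul := fun a => DegOne.ext (by simp)
    mul_zero := fun a => DegOne.ext (by simp)
    mul_assoc := fun a b c => DegOne.ext (by simp [m.mul_assoc_left a.hasDeg])
    one_mul := fun a => DegOne.ext (by simp [m.one_mul])
    mul_one := fun a => DegOne.ext (by simp [m.mul_one]) }

instance : Algebra k m.DegOne := Algebra.ofModule
  (fun c a b => DegOne.ext (by simp)) (fun c a b => DegOne.ext (by simp))

theorem mul_pow_eq (a : m.DegOne) (n : ℕ) : m.mul (a ^ n).val = (m.mul a.val) ^ n := by
  induction n with
  | zero => ext b; simp [m.one_mul]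
  | succ n ih =>
    ext b
    rw [pow_succ, pow_succ, DegOne.val_mul, ← m.mul_assoc_left (a ^ n).hasDeg, ih]; rfl

theorem tr_eq_zero_of_isNilpotent {a : m.DegOne} (ha : IsNilpotent a) : m.tr a.val = 0 := by
  obtain ⟨n, hn⟩ := ha
  have : IsNilpotent (m.mul a.val) := ⟨n, by rw [← m.mul_pow_eq, hn]; simp⟩
  exact (LinearMap.isNilpotent_trace_of_isNilpotent this).eq_zero

/-- If `x` lies in the Jacobson radical, which is nilpotent, then `bx` is nilpotent for every `b` of
degree 1, so `τ(xb) = τ(bx) = 0`. Other degrees do not contribute to the trace, and non-degeneracy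
gives `x = 0`. -/
theorem IsSeparable.isSemisimpleRing {m : GradedMul V} (h : m.IsSeparable) :
    IsSemisimpleRing m.DegOne := by
  have : IsArtinianRing m.DegOne := IsArtinianRing.of_finite k m.DegOne
  rw [IsArtinianRing.isSemisimpleRing_iff_jacobson, eq_bot_iff]
  intro x hx
  obtain ⟨n, hn⟩ := IsArtinianRing.isNilpotent_jacobson_bot (R := m.DegOne)
  rw [Ideal.jacobson_bot] at hn
  refine DegOne.ext (by_contra fun hne => ?_)
  obtain ⟨b, hb, hb'⟩ := h.exists_tr_ne_zero x.hasDeg hne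
  rw [inv_one] at hb
  apply hb'
  rw [m.tr_mul_comm x.hasDeg]
  have : IsNilpotent ((DegOne.mk b hb : m.DegOne) * x) := by
    refine ⟨n, ?_⟩
    have h1 : (DegOne.mk b hb : m.DegOne) * x ∈ Ring.jacobson m.DegOne := Ideal.mul_mem_left _ _ hx
    have h2 := Ideal.pow_mem_pow h1 n
    rw [hn] at h2
    exact h2
  exact m.tr_eq_zero_of_isNilpotent this

/-- Over an algebraically closed field the degree 1 part is a product of matrix algebras. The
diagonal matrix unit `E` of one factor satisfies `EaE = a₀₀E`. -/
theorem IsSeparable.exists_primitive [IsAlgClosed k] {m : GradedMul V} (h : m.IsSeparable)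
    (h1 : m.one ≠ 0) : ∃ q : V, V.HasDeg 1 q ∧ q ≠ 0 ∧ m.mul q q = q ∧
      ∀ a, V.HasDeg 1 a → ∃ c : k, m.mul (m.mul q a) q = c • q := by
  have := h.isSemisimpleRing
  obtain ⟨n, d, hd, ⟨e⟩⟩ := IsSemisimpleRing.exists_algEquiv_pi_matrix_of_isAlgClosed k m.DegOne
  have hn : 0 < n := by
    rcases Nat.eq_zero_or_pos n with rfl | hn
    · exfalso
      apply h1
      have : (1 : m.DegOne) = 0 := e.injective (Subsingleton.elim _ _)
      exact congrArg DegOne.val this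
    · exact hn
  let i : Fin n := ⟨0, hn⟩
  have := hd i
  let E : Π i, Matrix (Fin (d i)) (Fin (d i)) k := Pi.single i (Matrix.single 0 0 1)
  have hEE : E * E = E := by
    change Pi.single i _ * Pi.single i _ = Pi.single i _
    rw [← Pi.single_mul]
    simp
  have hE0 : E ≠ 0 := by
    intro h0
    have := congrFun (congrFun (congrFun h0 i) 0) 0
    simp [E] at this
  have hEa : ∀ a, E * a * E = (a i 0 0) • E := by
    intro a
    funext j
    by_cases hj : j = i
    · subst hj
      simp only [E, Pi.mul_apply, Pi.single_eq_same, Pi.smul_apply]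
      ext r s
      simp [Matrix.single_mul_mul_single, Matrix.single_apply]
    · simp [E, Pi.single_eq_of_ne hj]
  refine ⟨(e.symm E).val, (e.symm E).hasDeg, fun h0 => hE0 ?_, ?_, fun a ha => ⟨e (.mk a ha) i 0 0, ?_⟩⟩
  · have : e.symm E = 0 := DegOne.ext h0
    simpa using this
  · rw [← DegOne.val_mul, ← map_mul, hEE]
  · have : e.symm E * .mk a ha * e.symm E = (e (.mk a ha) i 0 0) • e.symm E := by
      apply e.injective
      simp only [map_mul, map_smul, AlgEquiv.apply_symm_apply, hEa]
    exact congrArg DegOne.val this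

end GradedMul

end GrVec

/-! ### The corner of a separable algebra defined by a primitive idempotent -/

attribute [local instance] subgroupFintype

theorem conv_single {k M : Type u} [Field k] [Group M] [Fintype M] [DecidableEq M]
    (w : M → M → kˣ) (r s : M) (a b : k) :
    conv w (Pi.single r a) (Pi.single s b) = Pi.single (r * s) ((w r s).val * (a * b)) := by
  funext t
  rw [conv_apply, Finset.sum_eq_single r]
  · by_cases h : t = r * s
    · subst h; simp
    · have : r⁻¹ * t ≠ s := fun h' => h (by rw [← h']; simp)
      simp [h, this]
  · intro b _ hb; simp [hb]
  · simp

namespace GrVec.GradedMul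

variable {k G : Type u} [Field k] [Group G] [Fintype G] {α : Cocycle₃ k G} {V : GrVec α}
  (m : GradedMul V)

/-- Homogeneous elements of the corner `qVq`. -/
structure InCorner (q : V) (h : G) (b : V) : Prop where
  deg : V.HasDeg h b
  left : m.mul q b = b
  right : m.mul b q = b

/-- A primitive idempotent. -/
structure IsPrimitive (q : V) : Prop where
  deg : V.HasDeg 1 q
  ne_zero : q ≠ 0
  idem : m.mul q q = q
  prim : ∀ a, V.HasDeg 1 a → ∃ c : k, m.mul (m.mul q a) q = c • q

variable {m} {q : V}

theorem IsPrimitive.inCorner (hq : m.IsPrimitive q) {h : G} {v : V} (hv : V.HasDeg h v) :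
    m.InCorner q h (m.mul (m.mul q v) q) where
  deg := by
    have := m.mul_deg _ _ _ _ (m.mul_deg _ _ _ _ hq.deg hv) hq.deg
    rwa [_root_.mul_one, _root_.one_mul] at this
  left := by rw [m.mul_assoc_left hq.deg, m.mul_assoc_left hq.deg, hq.idem]
  right := by rw [← m.mul_assoc_right hq.deg, hq.idem]

theorem IsPrimitive.inCorner_self (hq : m.IsPrimitive q) : m.InCorner q 1 q :=
  ⟨hq.deg, hq.idem, hq.idem⟩

theorem InCorner.mul (hq : m.IsPrimitive q) {g h : G} {b b' : V} (hb : m.InCorner q g b)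
    (hb' : m.InCorner q h b') : m.InCorner q (g * h) (m.mul b b') where
  deg := m.mul_deg _ _ _ _ hb.deg hb'.deg
  left := by rw [m.mul_assoc_left hq.deg, hb.left]
  right := by rw [← m.mul_assoc_right hq.deg, hb'.right]

theorem InCorner.eq_smul (hq : m.IsPrimitive q) {b : V} (hb : m.InCorner q 1 b) :
    ∃ c : k, b = c • q := by
  obtain ⟨c, hc⟩ := hq.prim b hb.deg
  exact ⟨c, by rw [← hc, hb.left, hb.right]⟩

/-- Non-degeneracy supplies `c` of degree `h⁻¹` with `τ(bc) ≠ 0`, and replacing `c` by `d = qcq`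
does not change this trace. Then `bd` has degree 1, so it is a multiple `rq`, with `r ≠ 0` as its
trace is non-zero. If `db` vanished, so would `b(db)`, which is a non-zero multiple of `(bd)b = rb`.
-/
theorem InCorner.exists_inverse (hs : m.IsSeparable) (hq : m.IsPrimitive q) {h : G} {b : V}
    (hb : m.InCorner q h b) (hne : b ≠ 0) : ∃ c, m.InCorner q h⁻¹ c ∧
      (∃ r : k, r ≠ 0 ∧ m.mul b c = r • q) ∧ ∃ r : k, r ≠ 0 ∧ m.mul c b = r • q := by
  obtain ⟨c, hc, hc'⟩ := hs.exists_tr_ne_zero hb.deg hne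
  have h1 := hq.inCorner hc
  have h2 : m.tr (m.mul b (m.mul (m.mul q c) q)) = m.tr (m.mul b c) := by
    rw [m.mul_assoc_right hq.deg, ← m.tr_mul_comm hq.deg, m.mul_assoc_left hq.deg, hb.left,
      m.mul_assoc_mid hq.deg, hb.right]
  obtain ⟨d, hd⟩ : ∃ d, d = m.mul (m.mul q c) q := ⟨_, rfl⟩
  rw [← hd] at h1 h2
  have hbd := InCorner.mul hq hb h1
  rw [mul_inv_cancel] at hbd
  have hdb := InCorner.mul hq h1 hb
  rw [inv_mul_cancel] at hdb
  obtain ⟨r, hr⟩ := hbd.eq_smul hq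
  obtain ⟨r', hr'⟩ := hdb.eq_smul hq
  have hr0 : r ≠ 0 := by
    rintro rfl
    rw [zero_smul] at hr
    exact hc' (by rw [← h2, hr, map_zero])
  refine ⟨d, h1, ⟨r, hr0, hr⟩, r', ?_, hr'⟩
  rintro rfl
  have h3 := m.mul_assoc _ _ _ _ _ _ hb.deg h1.deg hb.deg
  rw [hr, hr', zero_smul, map_zero, map_smul, LinearMap.smul_apply, hb.left] at h3
  have := smul_eq_zero.1 (h3.symm)
  rcases this with h4 | h4
  · exact (Units.ne_zero _) h4
  · rcases smul_eq_zero.1 h4 with h5 | h5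
    · exact hr0 h5
    · exact hne h5

theorem InCorner.mul_ne_zero (hs : m.IsSeparable) (hq : m.IsPrimitive q) {g h : G} {b b' : V}
    (hb : m.InCorner q g b) (hne : b ≠ 0) (hb' : m.InCorner q h b') (hne' : b' ≠ 0) :
    m.mul b b' ≠ 0 := by
  intro h0
  obtain ⟨c, hc, -, r, hr, hr'⟩ := hb.exists_inverse hs hq hne
  have h3 := m.mul_assoc _ _ _ _ _ _ hc.deg hb.deg hb'.deg
  rw [h0, map_zero, hr', map_smul, LinearMap.smul_apply, hb'.left] at h3
  rcases smul_eq_zero.1 h3.symm with h4 | h4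
  · exact (Units.ne_zero _) h4
  · rcases smul_eq_zero.1 h4 with h5 | h5
    · exact hr h5
    · exact hne' h5

/-- For an inverse `c` of `b` up to a scalar, `cb'` has degree 1 and is a multiple of `q`;
multiplying by `b` makes `b'` a multiple of `b`. So the homogeneous components of the corner are at
most one-dimensional. -/
theorem InCorner.eq_smul_of_ne_zero (hs : m.IsSeparable) (hq : m.IsPrimitive q) {h : G} {b b' : V}
    (hb : m.InCorner q h b) (hne : b ≠ 0) (hb' : m.InCorner q h b') : ∃ c : k, b' = c • b := by
  obtain ⟨c, hc, ⟨r, hr, hr'⟩, -⟩ := hb.exists_inverse hs hq hne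
  have h3 := m.mul_assoc _ _ _ _ _ _ hb.deg hc.deg hb'.deg
  have hcb := InCorner.mul hq hc hb'
  rw [inv_mul_cancel] at hcb
  obtain ⟨s, hs'⟩ := hcb.eq_smul hq
  rw [hs', map_smul, hb.right, hr', map_smul, LinearMap.smul_apply, hb'.left, smul_smul] at h3
  have hu : (α.toFun h h⁻¹ h).val * r ≠ 0 := _root_.mul_ne_zero (Units.ne_zero _) hr
  refine ⟨((α.toFun h h⁻¹ h).val * r)⁻¹ * s, ?_⟩
  rw [mul_smul, h3, smul_smul, inv_mul_cancel₀ hu, one_smul]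

/-- The corner of a separable algebra at a primitive idempotent is a twisted group algebra. -/
theorem IsPrimitive.exists_twistedGroupAlgebra (hq : m.IsPrimitive q) (hs : m.IsSeparable) :
    ∃ (H : Subgroup G) (γ : Cobounding α H) (inc : γ.twistedX ⟶ V) (ret : V ⟶ γ.twistedX),
      (∀ b, ret.lin (inc.lin b) = b) ∧
      (∀ a b, inc.lin (γ.twistedMul.mul a b) = m.mul (inc.lin a) (inc.lin b)) ∧
      (inc.lin γ.twistedMul.one = q) ∧ ∀ v, inc.lin (ret.lin v) = m.mul (m.mul q v) q := by
  classical
  -- `H` is the set of degrees that occur in `qVq`. It is a subgroup because non-zero homogeneous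
  -- elements of the corner have non-zero products and inverses up to scalars.
  let H : Subgroup G :=
    { carrier := {h | ∃ b, b ≠ 0 ∧ m.InCorner q h b}
      mul_mem' := by
        rintro g h ⟨b, hb0, hb⟩ ⟨c, hc0, hc⟩
        exact ⟨m.mul b c, hb.mul_ne_zero hs hq hb0 hc hc0, InCorner.mul hq hb hc⟩
      one_mem' := ⟨q, hq.ne_zero, hq.inCorner_self⟩
      inv_mem' := by
        rintro h ⟨b, hb0, hb⟩
        obtain ⟨c, hc, ⟨r, hr, hr'⟩, -⟩ := hb.exists_inverse hs hq hb0
        refine ⟨c, ?_, hc⟩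
        rintro rfl
        rw [map_zero] at hr'
        rcases smul_eq_zero.1 hr'.symm with h1 | h1
        · exact hr h1
        · exact hq.ne_zero h1 }
  have hH : ∀ h : H, ∃ b, b ≠ 0 ∧ m.InCorner q (h : G) b := fun h => h.2
  choose e he0 he using hH
  have hg : ∀ g h : H, ∃ c : k, m.mul (e g) (e h) = c • e (g * h) := fun g h =>
    (he (g * h)).eq_smul_of_ne_zero hs hq (he0 _) (InCorner.mul hq (he g) (he h))
  choose w hw using hg
  have hw0 : ∀ g h, w g h ≠ 0 := fun g h h0 => by
    have := (he g).mul_ne_zero hs hq (he0 g) (he h) (he0 h)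
    rw [hw, h0, zero_smul] at this
    exact this rfl
  -- The cochain consists of the structure constants for a choice of one non-zero element in each
  -- degree; its coboundary condition is the associativity of `V` up to `α`.
  let γ : Cobounding α H :=
    { toFun := fun g h => Units.mk0 (w g h) (hw0 g h)
      d_eq := fun f g h => by
        apply Units.ext
        have h1 := m.mul_assoc _ _ _ _ _ _ (he f).deg (he g).deg (he h).deg
        rw [hw g h, map_smul, hw, hw f g, map_smul, LinearMap.smul_apply, hw, smul_smul, smul_smul,
          smul_smul, ← _root_.mul_assoc f g h] at h1
        simpa [_root_.mul_assoc] using smul_left_injective k (he0 _) h1 }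
  have hγ : ∀ g h, (γ.toFun g h).val = w g h := fun _ _ => rfl
  -- Any such functional will do, since it is only applied to the component of degree `h` of the
  -- corner, which is the line spanned by `e h`.
  have hf : ∀ h : H, ∃ f : V →ₗ[k] k, f (e h) = 1 := fun h => by
    obtain ⟨f, hf⟩ := LinearMap.exists_leftInverse_of_injective
      (LinearMap.toSpanSingleton k V (e h)) (LinearMap.ker_toSpanSingleton k (he0 h))
    exact ⟨f, by simpa using LinearMap.congr_fun hf 1⟩
  choose f hf using hf
  have hfe : ∀ (h : H) b, m.InCorner q (h : G) b → f h b • e h = b := fun h b hb => by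
    obtain ⟨c, rfl⟩ := (he h).eq_smul_of_ne_zero hs hq (he0 h) hb
    rw [map_smul, hf, smul_eq_mul, _root_.mul_one]
  have hnot : ∀ (g : G) b, m.InCorner q g b → g ∉ H → b = 0 := fun g b hb hg =>
    by_contra fun hne => hg ⟨b, hne, hb⟩
  let incL : (H → k) →ₗ[k] V :=
    ∑ h : H, LinearMap.toSpanSingleton k V (e h) ∘ₗ LinearMap.proj h
  have incL_apply : ∀ a, incL a = ∑ h : H, a h • e h := fun a => by
    simp [incL, LinearMap.sum_apply]
  let P : V →ₗ[k] V := m.mul.flip q ∘ₗ m.mul q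
  let retL : V →ₗ[k] (H → k) := LinearMap.pi fun h => f h ∘ₗ P ∘ₗ V.proj h
  have retL_apply : ∀ v h, retL v h = f h (m.mul (m.mul q (V.proj h v)) q) := fun _ _ => rfl
  have inc_deg : ∀ g (a : H → k), γ.twistedX.HasDeg g a → V.HasDeg g (incL a) := fun g a ha => by
    replace ha := γ.twistedX_hasDeg.1 ha
    rw [incL_apply]
    refine HasDeg.sum fun h _ => ?_
    by_cases h0 : a h = 0
    · rw [h0, zero_smul]; exact HasDeg.zero V g
    · rw [← ha h h0]; exact (he h).deg.smul _
  have ret_deg : ∀ g v, V.HasDeg g v → γ.twistedX.HasDeg g (retL v) := fun g v hv => by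
    refine γ.twistedX_hasDeg.2 fun h hh => ?_
    by_contra hne
    apply hh
    rw [retL_apply, hv.proj_eq_zero hne]; simp
  have inc_single : ∀ h c, incL (Pi.single h c) = c • e h := fun h c => by
    rw [incL_apply, Finset.sum_eq_single h]
    · simp
    · intro b _ hb; simp [hb]
    · simp
  have inc_mul : ∀ a b, incL (conv γ.toFun a b) = m.mul (incL a) (incL b) := by
    intro a b
    suffices h : (conv γ.toFun).compr₂ incL = m.mul.compl₁₂ incL incL from
      LinearMap.congr_fun (LinearMap.congr_fun h a) b
    refine LinearMap.pi_ext' fun r => LinearMap.ext_ring (LinearMap.pi_ext' fun s =>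
      LinearMap.ext_ring ?_)
    change incL (conv γ.toFun (Pi.single r 1) (Pi.single s 1)) =
      m.mul (incL (Pi.single r 1)) (incL (Pi.single s 1))
    rw [conv_single, inc_single, inc_single, inc_single, one_smul, one_smul, hw, hγ,
      _root_.mul_one, _root_.mul_one]
  have inc_ret : ∀ v, incL (retL v) = m.mul (m.mul q v) q := by
    intro v
    suffices h : incL ∘ₗ retL = P from LinearMap.congr_fun h v
    refine ext_hom fun g v hv => ?_
    change incL (retL v) = m.mul (m.mul q v) q
    have hc := hq.inCorner hv
    rw [incL_apply]
    by_cases hg : g ∈ H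
    · rw [Finset.sum_eq_single ⟨g, hg⟩]
      · rw [retL_apply, hv]; exact hfe ⟨g, hg⟩ _ hc
      · intro b _ hb
        rw [retL_apply, hv.proj_eq_zero (fun h' => hb (Subtype.ext h'))]; simp
      · simp
    · rw [hnot g _ hc hg]
      refine Finset.sum_eq_zero fun b _ => ?_
      rw [retL_apply, hv.proj_eq_zero (fun h' => hg (h' ▸ b.2))]; simp
  have ret_inc : ∀ b, retL (incL b) = b := by
    intro b
    suffices h : retL ∘ₗ incL = LinearMap.id from LinearMap.congr_fun h b
    refine LinearMap.pi_ext' fun r => LinearMap.ext_ring ?_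
    change retL (incL (Pi.single r 1)) = Pi.single r 1
    rw [inc_single, one_smul]
    funext h
    rw [retL_apply]
    by_cases hr : h = r
    · subst hr
      rw [(he h).deg, (he h).left, (he h).right, hf, Pi.single_eq_same]
    · rw [(he r).deg.proj_eq_zero (fun h' => hr (Subtype.ext h')), Pi.single_eq_of_ne hr]; simp
  have inc_q : ∀ a, m.mul (incL a) q = incL a := fun a => by
    rw [incL_apply, map_sum, LinearMap.sum_apply]
    refine Finset.sum_congr rfl fun h _ => ?_
    rw [map_smul, LinearMap.smul_apply, (he h).right]
  -- Preservation of the unit follows from multiplicativity: `q = inc(1 · ret q) = inc(1) q =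
  -- inc(1)`.
  have hone : incL γ.twistedMul.one = q := by
    have h1 : incL (retL q) = q := by rw [inc_ret, hq.idem, hq.idem]
    have h2 := inc_mul γ.twistedMul.one (retL q)
    have h3 : conv γ.toFun γ.twistedMul.one (retL q) = retL q := γ.twistedMul.one_mul (retL q)
    rw [h3, h1] at h2
    exact (inc_q γ.twistedMul.one).symm.trans h2.symm
  exact ⟨H, γ, ⟨incL, comm_of_hasDeg (V := γ.twistedX) (W := V) incL inc_deg⟩,
    ⟨retL, comm_of_hasDeg (V := V) (W := γ.twistedX) retL ret_deg⟩, ret_inc, inc_mul, hone, inc_ret⟩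

end GrVec.GradedMul

/-! ### Indecomposable separable algebras are Morita equivalent to twisted group algebras -/

namespace GrVec

open Limits

variable {k G : Type u} [Field k] [Group G] [Fintype G] {α : Cocycle₃ k G}

instance (V W : GrVec α) : Zero (V ⟶ W) := ⟨⟨0, fun _ _ => (map_zero _).symm⟩⟩

@[simp] theorem zero_lin (V W : GrVec α) : Hom.lin (0 : V ⟶ W) = 0 := rfl

instance : HasZeroMorphisms (GrVec α) where
  comp_zero _ _ := hom_ext (LinearMap.zero_comp _)
  zero_comp _ _ _ _ := hom_ext (LinearMap.comp_zero _)

theorem isZero_iff {V : GrVec α} : IsZero V ↔ ∀ v : V, v = 0 := by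
  rw [IsZero.iff_id_eq_zero]
  constructor
  · intro h v
    exact LinearMap.congr_fun (congrArg Hom.lin h) v
  · intro h
    ext1; apply LinearMap.ext; intro v; exact h v

namespace GradedMul

variable {V : GrVec α} (m : GradedMul V)

/-- Multiplication by an element of degree one from the left. -/
def lmul (e : V) (he : V.HasDeg 1 e) : V ⟶ V where
  lin := m.mul e
  comm := comm_of_hasDeg _ fun g v hv => by
    have := m.mul_deg 1 g e v he hv
    rwa [_root_.one_mul] at this

/-- A central idempotent of degree one. -/
structure IsCentralIdem (e : V) : Prop where
  deg : V.HasDeg 1 e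
  idem : m.mul e e = e
  comm : ∀ a, m.mul e a = m.mul a e

variable {m}

theorem IsCentralIdem.mul_mul {e : V} (h : m.IsCentralIdem e) (a b : V) :
    m.mul (m.mul e a) (m.mul e b) = m.mul e (m.mul a b) := by
  rw [m.mul_assoc_mid h.deg, ← h.comm, m.mul_assoc_left h.deg, h.idem, m.mul_assoc_left h.deg]

theorem IsCentralIdem.compl {e : V} (h : m.IsCentralIdem e) : m.IsCentralIdem (m.one - e) where
  deg := by
    have := m.one_deg.add (h.deg.smul (-1))
    rwa [neg_one_smul, ← sub_eq_add_neg] at this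
  idem := by simp [m.one_mul, m.mul_one, h.idem]
  comm a := by simp [m.one_mul, m.mul_one, h.comm a]

theorem IsCentralIdem.one_mem {e : V} (h : m.IsCentralIdem e) (x : LinearMap.range (m.mul e)) :
    m.mul e x.1 = x.1 := by
  obtain ⟨_, v, rfl⟩ := x
  exact (m.mul_assoc_left h.deg _ _).trans (by rw [h.idem])

/-- The algebra `eV` for a central idempotent `e`. -/
def IsCentralIdem.summand {e : V} (h : m.IsCentralIdem e) : GradedMul (image (m.lmul e h.deg)) where
  mul := LinearMap.mk₂ k (fun a b : LinearMap.range (m.mul e) =>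
      (⟨m.mul a.1 b.1, m.mul a.1 b.1, by
        rw [m.mul_assoc_left h.deg, h.one_mem]⟩ : LinearMap.range (m.mul e)))
    (fun a b c => Subtype.ext (LinearMap.congr_fun (map_add m.mul a.1 b.1) c.1))
    (fun r a b => Subtype.ext (LinearMap.congr_fun (map_smul m.mul r a.1) b.1))
    (fun a b c => Subtype.ext (map_add (m.mul a.1) b.1 c.1))
    (fun r a b => Subtype.ext (map_smul (m.mul a.1) r b.1))
  one := (⟨e, e, h.idem⟩ : LinearMap.range (m.mul e))
  mul_deg f g a b ha hb := Subtype.ext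
    (m.mul_deg f g _ _ (congrArg Subtype.val ha) (congrArg Subtype.val hb))
  one_deg := Subtype.ext h.deg
  one_mul a := Subtype.ext (h.one_mem a)
  mul_one a := Subtype.ext ((h.comm _).symm.trans (h.one_mem a))
  mul_assoc f g l a b c ha hb hc := Subtype.ext
    (m.mul_assoc f g l _ _ _ (congrArg Subtype.val ha) (congrArg Subtype.val hb)
      (congrArg Subtype.val hc))

end GradedMul

/-- The projection to the summand defined by a central idempotent. -/
def toSummand (A : Mon (GrVec α)) {e : A.X} (h : (gradedMul A).IsCentralIdem e) :
    A ⟶ h.summand.toMon :=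
  monHom (B := h.summand.toMon)
    (⟨((gradedMul A).mul e).rangeRestrict, fun g v => Subtype.ext
      (((gradedMul A).lmul e h.deg).comm g v)⟩ : A.X ⟶ image ((gradedMul A).lmul e h.deg))
    ((Subtype.ext ((gradedMul A).mul_one e)).trans (CatAlg.gradedMul_toMon_one h.summand).symm)
    (fun a b => Eq.trans (b := h.summand.mul
        ⟨(gradedMul A).mul e a, a, rfl⟩ ⟨(gradedMul A).mul e b, b, rfl⟩)
      (Subtype.ext (h.mul_mul a b).symm) (CatAlg.gradedMul_toMon_mul h.summand _ _).symm)

/-- A central idempotent of degree 1 exhibits `A` as the product of the algebras `eA` and `(1 -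
e)A`. The first is non-zero if `e` is, so the second must vanish. -/
theorem eq_one_of_isIndecomposable {A : Mon (GrVec α)} (hA : CatAlg.IsIndecomposable A) {e : A.X}
    (h : (gradedMul A).IsCentralIdem e) (h0 : e ≠ 0) : e = (gradedMul A).one := by
  have hc := h.compl
  have e0 : ∀ x y : A.X, (gradedMul A).mul e x = x →
      (gradedMul A).mul ((gradedMul A).one - e) y = y →
      (gradedMul A).mul e (x + y) = x ∧ (gradedMul A).mul ((gradedMul A).one - e) (x + y) = y := by
    intro x y hx hy
    have h1 : (gradedMul A).mul e y = 0 := by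
      rw [← hy, (gradedMul A).mul_assoc_left h.deg]
      simp [h.idem, (gradedMul A).mul_one]
    have h2 : (gradedMul A).mul e (x + y) = x := by rw [map_add, hx, h1, add_zero]
    refine ⟨h2, ?_⟩
    rw [map_sub, LinearMap.sub_apply, h2, (gradedMul A).one_mul, add_sub_cancel_left]
  have e1 : ∀ w : A.X, (gradedMul A).mul e w + (gradedMul A).mul ((gradedMul A).one - e) w = w := by
    intro w
    rw [map_sub, LinearMap.sub_apply, (gradedMul A).one_mul, add_sub_cancel]
  let i₁ : h.summand.toMon.X ⟶ A.X :=
    ⟨(LinearMap.range ((gradedMul A).mul e)).subtype, fun _ _ => rfl⟩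
  let i₂ : hc.summand.toMon.X ⟶ A.X :=
    ⟨(LinearMap.range ((gradedMul A).mul ((gradedMul A).one - e))).subtype, fun _ _ => rfl⟩
  let l {W : GrVec α} (f : W ⟶ h.summand.toMon.X) (g : W ⟶ hc.summand.toMon.X) : W ⟶ A.X :=
    ⟨(f ≫ i₁).lin + (g ≫ i₂).lin, fun l w => by
      rw [LinearMap.add_apply, (f ≫ i₁).comm, (g ≫ i₂).comm, ← map_add]; rfl⟩
  have l₁ : ∀ {W : GrVec α} (f : W ⟶ h.summand.toMon.X) (g : W ⟶ hc.summand.toMon.X),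
      l f g ≫ (toSummand A h).hom = f := fun f g => by
    ext1
    refine LinearMap.ext fun w => Subtype.ext ?_
    exact (e0 (i₁.lin (f.lin w)) (i₂.lin (g.lin w)) (h.one_mem _) (hc.one_mem _)).1
  have l₂ : ∀ {W : GrVec α} (f : W ⟶ h.summand.toMon.X) (g : W ⟶ hc.summand.toMon.X),
      l f g ≫ (toSummand A hc).hom = g := fun f g => by
    ext1
    refine LinearMap.ext fun w => Subtype.ext ?_
    exact (e0 (i₁.lin (f.lin w)) (i₂.lin (g.lin w)) (h.one_mem _) (hc.one_mem _)).2
  have l₃ : ∀ {W : GrVec α} (m : W ⟶ A.X),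
      m = l (m ≫ (toSummand A h).hom) (m ≫ (toSummand A hc).hom) := fun m => by
    ext1
    exact LinearMap.ext fun w => (e1 (m.lin w)).symm
  rcases hA.2 _ _ (toSummand A h) (toSummand A hc) ⟨BinaryFan.IsLimit.mk _ l l₁ l₂
    fun f g m' hf hg => by subst hf hg; exact l₃ m'⟩ with hz | hz
  · exact absurd (congrArg Subtype.val (isZero_iff.1 hz h.summand.one)) h0
  · have := congrArg Subtype.val (isZero_iff.1 hz hc.summand.one)
    exact (sub_eq_zero.1 this).symm

namespace GradedMul

variable {V : GrVec α} (m : GradedMul V)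

/-- The map `a ⊗ b ↦ a(qb)`. -/
def idealMap {q : V} (hq : V.HasDeg 1 q) : tensor V V ⟶ V :=
  tensorMap (𝟙 V) (m.lmul q hq) ≫ m.mulHom

theorem idealMap_tm {q : V} (hq : V.HasDeg 1 q) (a b : V) :
    (m.idealMap hq).lin (tm a b) = m.mul a (m.mul q b) := m.mulHom_tm _ _

/-- The range is the ideal `AqA`. As associativity holds only up to a scalar that depends on the
degrees, stability is checked on homogeneous tensors, by showing that a linear map to the quotient
by the range is zero. -/
theorem mul_mem_range_idealMap {q : V} (hq : V.HasDeg 1 q) (c : V) {y : V}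
    (hy : y ∈ LinearMap.range (m.idealMap hq).lin) :
    m.mul c y ∈ LinearMap.range (m.idealMap hq).lin := by
  rw [← V.sum_proj c, map_sum, LinearMap.sum_apply]
  refine Submodule.sum_mem _ fun g _ => ?_
  have hc := V.hasDeg_proj g c
  obtain ⟨t, rfl⟩ := hy
  rw [← Submodule.Quotient.mk_eq_zero]
  suffices h : (LinearMap.range (m.idealMap hq).lin).mkQ ∘ₗ m.mul (V.proj g c) ∘ₗ
      (m.idealMap hq).lin = 0 from LinearMap.congr_fun h t
  refine ext_hom₂ fun f l a b ha hb => ?_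
  simp only [LinearMap.comp_apply, idealMap_tm, Submodule.mkQ_apply, LinearMap.zero_apply]
  rw [Submodule.Quotient.mk_eq_zero, m.mul_assoc _ _ _ _ _ _ hc ha (m.mul_deg _ _ _ _ hq hb),
    ← m.idealMap_tm hq]
  exact Submodule.smul_mem _ _ ⟨_, rfl⟩

theorem mem_range_idealMap_mul {q : V} (hq : V.HasDeg 1 q) (c : V) {y : V}
    (hy : y ∈ LinearMap.range (m.idealMap hq).lin) :
    m.mul y c ∈ LinearMap.range (m.idealMap hq).lin := by
  rw [← V.sum_proj c, map_sum]
  refine Submodule.sum_mem _ fun g _ => ?_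
  have hc := V.hasDeg_proj g c
  obtain ⟨t, rfl⟩ := hy
  rw [← Submodule.Quotient.mk_eq_zero]
  suffices h : (LinearMap.range (m.idealMap hq).lin).mkQ ∘ₗ m.mul.flip (V.proj g c) ∘ₗ
      (m.idealMap hq).lin = 0 from LinearMap.congr_fun h t
  refine ext_hom₂ fun f l a b ha hb => ?_
  simp only [LinearMap.comp_apply, idealMap_tm, Submodule.mkQ_apply, LinearMap.zero_apply,
    LinearMap.flip_apply]
  rw [Submodule.Quotient.mk_eq_zero]
  have h1 := m.mul_assoc _ _ _ _ _ _ ha (m.mul_deg _ _ _ _ hq hb) hc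
  rw [← m.mul_assoc_left hq] at h1
  have h2 : m.mul (m.mul a (m.mul q b)) (V.proj g c) =
      ((α.toFun f (1 * l) g)⁻¹ : kˣ).val • m.mul a (m.mul q (m.mul b (V.proj g c))) := by
    rw [h1, smul_smul]; simp
  rw [h2, ← m.idealMap_tm hq]
  exact Submodule.smul_mem _ _ ⟨_, rfl⟩

theorem proj_mem_range_idealMap {q : V} (hq : V.HasDeg 1 q) (g : G) {y : V}
    (hy : y ∈ LinearMap.range (m.idealMap hq).lin) :
    V.proj g y ∈ LinearMap.range (m.idealMap hq).lin := by
  obtain ⟨t, rfl⟩ := hy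
  exact ⟨_, (m.idealMap hq).comm g t⟩

variable {m}

/-- The degree 1 part of `AqA` is a left ideal of a semisimple ring, hence is generated by an
idempotent `e`, and `ye = y` for `y` in it. So `z(1 - e)` has no component of degree 1 for any `z`
in `AqA`, and its trace vanishes. Since `AqA` is an ideal, non-degeneracy on both sides yields `ey =
y = ye` for all `y` in `AqA`, and then `ea = (ea)e = e(ae) = ae`. -/
theorem IsSeparable.exists_isCentralIdem (hs : m.IsSeparable) {q : V} (hq : V.HasDeg 1 q) :
    ∃ e, m.IsCentralIdem e ∧ e ∈ LinearMap.range (m.idealMap hq).lin ∧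
      ∀ y ∈ LinearMap.range (m.idealMap hq).lin, m.mul e y = y := by
  have := hs.isSemisimpleRing
  let I : Ideal m.DegOne :=
    { carrier := {a | a.val ∈ LinearMap.range (m.idealMap hq).lin}
      add_mem' := fun ha hb => Submodule.add_mem (LinearMap.range (m.idealMap hq).lin) ha hb
      zero_mem' := Submodule.zero_mem (LinearMap.range (m.idealMap hq).lin)
      smul_mem' := fun c a ha => m.mul_mem_range_idealMap hq c.val ha }
  obtain ⟨e, he, hI⟩ := IsSemisimpleRing.ideal_eq_span_idempotent I
  have heI : e ∈ I := by rw [hI]; exact Ideal.mem_span_singleton_self e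
  have h1 : ∀ y, V.HasDeg 1 y → y ∈ LinearMap.range (m.idealMap hq).lin → m.mul y e.val = y := by
    intro y hy hy'
    have hyI : (DegOne.mk y hy : m.DegOne) ∈ I := hy'
    rw [hI, Ideal.mem_span_singleton'] at hyI
    obtain ⟨a, ha⟩ := hyI
    have : (DegOne.mk y hy : m.DegOne) * e = DegOne.mk y hy := by
      rw [← ha, _root_.mul_assoc, he]
    exact congrArg DegOne.val this
  have hf : V.HasDeg 1 (m.one - e.val) := by
    have := m.one_deg.add (e.hasDeg.smul (-1))
    rwa [neg_one_smul, ← sub_eq_add_neg] at this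
  have h2 : ∀ z ∈ LinearMap.range (m.idealMap hq).lin, m.tr (m.mul z (m.one - e.val)) = 0 := by
    intro z hz
    rw [← V.sum_proj z, map_sum, LinearMap.sum_apply, map_sum]
    refine Finset.sum_eq_zero fun g _ => ?_
    have hz' := m.proj_mem_range_idealMap hq g hz
    have hzg := V.hasDeg_proj g z
    by_cases hg : g = 1
    · subst hg
      rw [map_sub, m.mul_one, h1 _ hzg hz', sub_self, map_zero]
    · exact m.tr_eq_zero (g := g * 1) (by simpa using hg) (m.mul_deg _ _ _ _ hzg hf)
  have h3 : ∀ y ∈ LinearMap.range (m.idealMap hq).lin, m.mul e.val y = y := by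
    intro y hy
    have : m.mul (m.one - e.val) y = 0 := hs.1 _ fun b => by
      change m.tr (m.mul (m.mul _ y) b) = 0
      rw [← m.mul_assoc_left hf, m.tr_mul_comm hf]
      exact h2 _ (m.mem_range_idealMap_mul hq b hy)
    rw [map_sub, LinearMap.sub_apply, m.one_mul, sub_eq_zero] at this
    exact this.symm
  have h4 : ∀ y ∈ LinearMap.range (m.idealMap hq).lin, m.mul y e.val = y := by
    intro y hy
    have : m.mul y (m.one - e.val) = 0 := hs.2 _ fun b => by
      change m.tr (m.mul b (m.mul y _)) = 0
      rw [m.mul_assoc_right hf]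
      exact h2 _ (m.mul_mem_range_idealMap hq b hy)
    rw [map_sub, m.mul_one, sub_eq_zero] at this
    exact this.symm
  refine ⟨e.val, ⟨e.hasDeg, congrArg DegOne.val he, fun a => ?_⟩, heI, h3⟩
  rw [← h4 _ (m.mem_range_idealMap_mul hq a heI), ← m.mul_assoc_left e.hasDeg,
    h3 _ (m.mul_mem_range_idealMap hq a heI)]

end GradedMul

end GrVec

namespace CatAlg

open GrVec

variable {k G : Type u} [Field k] [Group G] [Fintype G] {α : Cocycle₃ k G}

theorem one_ne_zero_of_not_isZero {A : Mon (GrVec α)} (h : ¬ Limits.IsZero A.X) :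
    (gradedMul A).one ≠ 0 := by
  intro h0
  refine h (isZero_iff.2 fun v => ?_)
  rw [← (gradedMul A).one_mul v, h0, map_zero, LinearMap.zero_apply]

theorem exists_isPrimitive [IsAlgClosed k] {A : Mon (GrVec α)} (hs : IsSeparableAlgebra A)
    (h0 : ¬ Limits.IsZero A.X) : ∃ q, (gradedMul A).IsPrimitive q := by
  have hs' : (gradedMul A).IsSeparable := hs
  obtain ⟨q, h1, h2, h3, h4⟩ := hs'.exists_primitive (one_ne_zero_of_not_isZero h0)
  exact ⟨q, h1, h2, h3, h4⟩

theorem exists_moduleCategoriesEquivalent [IsAlgClosed k] {A : Mon (GrVec α)}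
    (hs : IsSeparableAlgebra A) (hA : IsIndecomposable A) :
    ∃ (H : Subgroup G) (γ : Cobounding α H), ModuleCategoriesEquivalent A γ.twistedGroupAlgebra := by
  obtain ⟨q, hq⟩ := exists_isPrimitive hs hA.1
  have hs' : (gradedMul A).IsSeparable := hs
  obtain ⟨H, γ, inc, ret, h1, h2, h3, h4⟩ := hq.exists_twistedGroupAlgebra hs'
  let i : γ.twistedGroupAlgebra.X ⟶ A.X := inc
  have hi : (MonObj.one (X := γ.twistedGroupAlgebra.X) ≫ i).lin unitOne = q :=
    (congrArg inc.lin (gradedMul_toMon_one γ.twistedMul)).trans h3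
  let c : Corner A γ.twistedGroupAlgebra :=
    { inc := i
      ret := ret
      inc_ret := by ext1; exact LinearMap.ext h1
      mul_inc := by
        ext1
        refine ext_tm fun a b => ?_
        exact (congrArg inc.lin (gradedMul_toMon_mul γ.twistedMul a b)).trans (h2 a b)
      ret_inc := by
        ext1
        refine LinearMap.ext fun v => ?_
        refine (h4 v).trans ?_
        have : (gradedMul A).mul ((gradedMul A).mul
          ((MonObj.one (X := γ.twistedGroupAlgebra.X) ≫ i).lin unitOne) v)
          ((MonObj.one (X := γ.twistedGroupAlgebra.X) ≫ i).lin unitOne) =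
            (gradedMul A).mul ((gradedMul A).mul q v) q := by rw [hi]
        exact this.symm }
  -- The ideal `AqA` has a central idempotent `e` as its unit. It is non-zero because `q = eq`, so
  -- indecomposability gives `e = 1` and thus `1 ∈ AqA`.
  obtain ⟨e, he, heI, hy⟩ := hs'.exists_isCentralIdem hq.deg
  have hqI : q ∈ LinearMap.range ((gradedMul A).idealMap hq.deg).lin :=
    ⟨tm (gradedMul A).one (gradedMul A).one, by
      rw [GradedMul.idealMap_tm, (gradedMul A).one_mul, (gradedMul A).mul_one]⟩
  have he0 : e ≠ 0 := fun h0 => hq.ne_zero (by rw [← hy q hqI, h0, map_zero, LinearMap.zero_apply])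
  rw [eq_one_of_isIndecomposable hA he he0] at heI
  obtain ⟨t, ht⟩ := heI
  -- The morphism `S` must start at the unit object, so a preimage `t` of 1 is replaced by its
  -- component of degree 1. This still maps to 1, since 1 has degree 1.
  refine ⟨H, γ, c.moduleCategoriesEquivalent (S := ofUnit _ ((tensor A.X A.X).hasDeg_proj 1 t)) ?_⟩
  refine unit_hom_ext ?_
  have e1 : ∀ w : tensor A.X A.X, (A.X ◁ c.lq ≫ MonObj.mul (X := A.X)).lin w =
      ((gradedMul A).idealMap hq.deg).lin w := by
    intro w
    suffices h : (A.X ◁ c.lq ≫ MonObj.mul (X := A.X)).lin = ((gradedMul A).idealMap hq.deg).lin from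
      LinearMap.congr_fun h w
    refine ext_tm fun a b => ?_
    rw [GradedMul.idealMap_tm, ← hi]
    rfl
  refine (congrArg (A.X ◁ c.lq ≫ MonObj.mul (X := A.X)).lin (ofUnit_one _ _)).trans ((e1 _).trans ?_)
  rw [((gradedMul A).idealMap hq.deg).comm, ht]
  exact (gradedMul A).one_deg

end CatAlg

/-! ### Commutativity, indecomposability and invariance under isomorphisms -/

namespace CatAlg

open MonObj Limits

section

variable {C : Type u} [Category.{v} C] [MonoidalCategory C]

/-- Morphisms to `Z` may be compared after `ζ`. Naturality of the half-braiding moves one `ζ`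
through it, and centrality of the other `ζ` undoes the crossing. -/
theorem IsFullCentre.commutative {A : Mon C} {Z : Mon (Center C)}
    {ζ : (Center.forget C).mapMon.obj Z ⟶ A} (h : IsFullCentre A Z ζ) :
    (β_ Z.X Z.X).hom ≫ μ[Z.X] = μ[Z.X] := by
  apply h.hom_ext
  have key : ((fbraid Z.X).β (fobj Z.X)).hom ≫ fmul Z ≫ fhom ζ = fmul Z ≫ fhom ζ := by
    rw [fmul_fhom]
    conv_lhs => rw [MonoidalCategory.tensorHom_def, Category.assoc,
      ← reassoc_of% ((fbraid Z.X).naturality (fhom ζ)), isCentral_iff_fobj.1 h.isCentral]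
    rw [tensorHom_def', Category.assoc]
  exact (Category.assoc _ _ _).trans key

/-- An algebra is indecomposable if all elements of its unit component are multiples
of its unit. -/
theorem isIndecomposable_of_unit [HasZeroMorphisms C] (A : Mon C) (h0 : ¬ IsZero A.X)
    (hz : ∀ B : Mon C, η[B.X] = 0 → IsZero B.X)
    (h : ∀ u : 𝟙_ C ⟶ A.X, u = 0 ∨ ∃ v : 𝟙_ C ⟶ 𝟙_ C, IsIso v ∧ u = v ≫ η[A.X]) :
    IsIndecomposable A := by
  refine ⟨h0, ?_⟩
  rintro B₁ B₂ p₁ p₂ ⟨hl⟩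
  obtain ⟨u, hu₁, hu₂⟩ := BinaryFan.IsLimit.lift' hl η[B₁.X] (0 : 𝟙_ C ⟶ B₂.X)
  have hu₁' : u ≫ p₁.hom = η[B₁.X] := hu₁
  have hu₂' : u ≫ p₂.hom = 0 := hu₂
  rcases h u with rfl | ⟨v, hv, rfl⟩
  · left
    apply hz
    rw [← hu₁', zero_comp]
  · right
    apply hz
    rw [Category.assoc, p₂.isMonHom_hom.one_hom] at hu₂'
    rw [← cancel_epi v, hu₂', comp_zero]

theorem IsIndecomposable.of_iso {A A' : Mon C} (h : IsIndecomposable A) (e : A ≅ A') :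
    IsIndecomposable A' := by
  have e1 : e.inv.hom ≫ e.hom.hom = 𝟙 A'.X := congrArg Mon.Hom.hom e.inv_hom_id
  have e2 : e.hom.hom ≫ e.inv.hom = 𝟙 A.X := congrArg Mon.Hom.hom e.hom_inv_id
  let e' : A.X ≅ A'.X := ⟨e.hom.hom, e.inv.hom, e2, e1⟩
  refine ⟨fun hz => h.1 (hz.of_iso e'), ?_⟩
  rintro B₁ B₂ p₁ p₂ ⟨hl⟩
  refine h.2 B₁ B₂ (e.hom ≫ p₁) (e.hom ≫ p₂) ⟨IsLimit.ofIsoLimit hl (BinaryFan.ext e'.symm ?_ ?_)⟩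
  · change p₁.hom = e.inv.hom ≫ e.hom.hom ≫ p₁.hom
    rw [reassoc_of% e1]
  · change p₂.hom = e.inv.hom ≫ e.hom.hom ≫ p₂.hom
    rw [reassoc_of% e1]

/-- The restriction of a module along a homomorphism of algebras. -/
def RMod.restrict {A B : Mon C} (f : A ⟶ B) (M : RMod B) : RMod A where
  X := M.X
  act := M.X ◁ f.hom ≫ M.act
  act_assoc := by
    have h := f.isMonHom_hom.mul_hom
    rw [comp_whiskerRight, Category.assoc, ← whisker_exchange_assoc, M.act_assoc,
      ← MonoidalCategory.whiskerLeft_comp_assoc, h, MonoidalCategory.tensorHom_def]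
    simp
  act_one := by
    rw [← MonoidalCategory.whiskerLeft_comp_assoc, f.isMonHom_hom.one_hom, M.act_one]

theorem RMod.IsLocal.restrict [BraidedCategory C] {A B : Mon C} (f : A ⟶ B) {M : RMod B}
    (h : M.IsLocal) :
    (RMod.restrict f M).IsLocal := by
  have key : (β_ M.X A.X).hom ≫ (β_ A.X M.X).hom ≫ M.X ◁ f.hom ≫ M.act = M.X ◁ f.hom ≫ M.act := by
    rw [← BraidedCategory.braiding_naturality_left_assoc,
      ← BraidedCategory.braiding_naturality_right_assoc]
    exact congrArg (M.X ◁ f.hom ≫ ·) h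
  exact key

/-- A morphism of modules on the restrictions along an isomorphism is a morphism of modules. -/
def RMod.ofRestrict {A B : Mon C} (e : A ≅ B) {M N : RMod B} (f : M.X ⟶ N.X)
    (hf : (M.X ◁ e.hom.hom ≫ M.act) ≫ f = f ▷ A.X ≫ N.X ◁ e.hom.hom ≫ N.act) : M ⟶ N :=
  ⟨f, by
    have e1 : e.inv.hom ≫ e.hom.hom = 𝟙 B.X := congrArg Mon.Hom.hom e.inv_hom_id
    have h := congrArg (M.X ◁ e.inv.hom ≫ ·) hf
    simp only [Category.assoc] at h
    rw [← MonoidalCategory.whiskerLeft_comp_assoc, e1, MonoidalCategory.whiskerLeft_id,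
      Category.id_comp, whisker_exchange_assoc, ← MonoidalCategory.whiskerLeft_comp_assoc, e1,
      MonoidalCategory.whiskerLeft_id, Category.id_comp] at h
    exact h⟩

/-- The map between the regular modules of isomorphic algebras. -/
def RMod.regularRestrict {A B : Mon C} (f : A ⟶ B) :
    RMod.regular A ⟶ RMod.restrict f (RMod.regular B) :=
  ⟨f.hom, by
    have h : μ[A.X] ≫ f.hom = f.hom ▷ A.X ≫ B.X ◁ f.hom ≫ μ[B.X] := by
      rw [f.isMonHom_hom.mul_hom, MonoidalCategory.tensorHom_def, Category.assoc]
    exact h⟩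

/-- The restriction of a morphism of modules. -/
def RMod.restrictMap {A B : Mon C} (f : A ⟶ B) {M N : RMod B} (g : M ⟶ N) :
    RMod.restrict f M ⟶ RMod.restrict f N :=
  ⟨g.hom, by
    have h : (M.X ◁ f.hom ≫ M.act) ≫ g.hom = g.hom ▷ A.X ≫ N.X ◁ f.hom ≫ N.act := by
      rw [Category.assoc, g.comm, whisker_exchange_assoc]
    exact h⟩

/-- A morphism from the regular module of `A` to a restricted module, as a morphism from the
regular module of `B`. -/
def RMod.ofRegularRestrict {A B : Mon C} (e : A ≅ B) {M : RMod B} (f : A.X ⟶ M.X)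
    (hf : μ[A.X] ≫ f = f ▷ A.X ≫ M.X ◁ e.hom.hom ≫ M.act) : RMod.regular B ⟶ M :=
  ⟨e.inv.hom ≫ f, by
    have e1 : e.inv.hom ≫ e.hom.hom = 𝟙 B.X := congrArg Mon.Hom.hom e.inv_hom_id
    have hinv := e.inv.isMonHom_hom.mul_hom
    have key : μ[B.X] ≫ e.inv.hom ≫ f = (e.inv.hom ≫ f) ▷ B.X ≫ M.act := by
      rw [reassoc_of% hinv, hf, MonoidalCategory.tensorHom_def', Category.assoc,
        ← comp_whiskerRight_assoc, whisker_exchange_assoc, ← MonoidalCategory.whiskerLeft_comp_assoc,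
        e1, MonoidalCategory.whiskerLeft_id, Category.id_comp]
    exact key⟩

/-- Restriction along the isomorphism preserves locality, and the regular modules correspond to each
other; so the direct sum decomposition of the restricted module is also one over `B`. -/
theorem LocalModulesFree.of_iso [BraidedCategory C] {A B : Mon C} (h : LocalModulesFree A)
    (e : A ≅ B) : LocalModulesFree B := by
  intro M hM
  have e1 : e.inv.hom ≫ e.hom.hom = 𝟙 B.X := congrArg Mon.Hom.hom e.inv_hom_id
  have e2 : e.hom.hom ≫ e.inv.hom = 𝟙 A.X := congrArg Mon.Hom.hom e.hom_inv_id
  obtain ⟨n, i, ⟨hi⟩⟩ := h (RMod.restrict e.hom M) (hM.restrict e.hom)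
  have hreg : ∀ j, RMod.regularRestrict e.hom ≫ RMod.restrictMap e.hom
      (RMod.ofRegularRestrict e (M := M) (i j).hom (i j).comm) = i j := fun j => by
    apply RMod.hom_ext
    have key : ∀ f : A.X ⟶ M.X, e.hom.hom ≫ e.inv.hom ≫ f = f := fun f => by rw [reassoc_of% e2]
    exact key _
  refine ⟨n, fun j => RMod.ofRegularRestrict e (M := M) (i j).hom (i j).comm,
    ⟨Cofan.IsColimit.mk _ (fun s => RMod.ofRestrict e (Cofan.IsColimit.desc hi
      fun j => RMod.regularRestrict e.hom ≫ RMod.restrictMap e.hom (s.inj j)).hom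
      (Cofan.IsColimit.desc hi
      fun j => RMod.regularRestrict e.hom ≫ RMod.restrictMap e.hom (s.inj j)).comm) ?_ ?_⟩⟩
  · intro s j
    have h1 := congrArg RMod.Hom.hom (Cofan.IsColimit.fac hi
      (fun j => RMod.regularRestrict e.hom ≫ RMod.restrictMap e.hom (s.inj j)) j)
    apply RMod.hom_ext
    have key : ∀ (X : C) (f : A.X ⟶ M.X) (g : M.X ⟶ X) (l : B.X ⟶ X), f ≫ g = e.hom.hom ≫ l →
        (e.inv.hom ≫ f) ≫ g = l := fun X f g l hfg => by
      rw [Category.assoc, hfg, reassoc_of% e1]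
    exact key _ _ _ _ h1
  · intro s m hm
    have h1 : RMod.restrictMap e.hom m = Cofan.IsColimit.desc hi
        (fun j => RMod.regularRestrict e.hom ≫ RMod.restrictMap e.hom (s.inj j)) := by
      refine Cofan.IsColimit.hom_ext hi _ _ fun j => ?_
      rw [Cofan.IsColimit.fac]
      rw [← hm j]
      apply RMod.hom_ext
      have h2 := congrArg RMod.Hom.hom (hreg j)
      exact (congrArg (· ≫ m.hom) h2.symm).trans (Category.assoc _ _ _)
    have h3 := congrArg RMod.Hom.hom h1
    exact RMod.hom_ext h3

end

/-! ### Commutativity on elements; invariance of the Lagrangian property under isomorphisms. -/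

section Graded

open GrVec

variable {k G : Type u} [Field k] [Group G] [Fintype G] {α : Cocycle₃ k G}

theorem commutative_iff {L : Mon (Center (GrVec α))} :
    (β_ L.X L.X).hom ≫ μ[L.X] = μ[L.X] ↔ ∀ g (a b : gobj L.X), (gobj L.X).HasDeg g a →
      (equivMul L).mul a b = (equivMul L).mul (gact L.X g b) a := by
  have key : (β_ L.X L.X).hom ≫ μ[L.X] = μ[L.X] ↔
      ((fbraid L.X).β (gobj L.X)).hom ≫ fmul L = fmul L :=
    ⟨fun h => congrArg fmap h, fun h => fmap_injective h⟩
  rw [key]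
  constructor
  · intro h g a b ha
    have h1 := LinearMap.congr_fun (congrArg GrVec.Hom.lin h) (tm (gact L.X g b) a)
    have h2 := congrArg (fmul L).lin (braid_tm L.X ha b)
    exact h2.symm.trans h1
  · intro h
    rw [← Iso.eq_inv_comp]
    ext1
    refine ext_hom₂ fun f g a b ha hb => ?_
    refine (h f a b ha).trans ?_
    exact (congrArg (fmul L).lin (zmap_tm L.X ha b)).symm

theorem commutative_of_iso {L L' : Mon (Center (GrVec α))} (e : L ≅ L')
    (h : (β_ L.X L.X).hom ≫ μ[L.X] = μ[L.X]) : (β_ L'.X L'.X).hom ≫ μ[L'.X] = μ[L'.X] := by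
  have e1 : e.inv.hom ≫ e.hom.hom = 𝟙 L'.X := congrArg Mon.Hom.hom e.inv_hom_id
  have hm := e.hom.isMonHom_hom.mul_hom
  have h1 : (e.hom.hom ⊗ₘ e.hom.hom) ≫ (β_ L'.X L'.X).hom ≫ μ[L'.X] =
      (e.hom.hom ⊗ₘ e.hom.hom) ≫ μ[L'.X] := by
    rw [BraidedCategory.braiding_naturality_assoc, ← hm, reassoc_of% h]
  have h2 := congrArg ((e.inv.hom ⊗ₘ e.inv.hom) ≫ ·) h1
  simpa [e1] using h2

theorem isSeparable_of_equiv {V W : GrVec α} {m : GradedMul V} {m' : GradedMul W} (e : V ≃ₗ[k] W)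
    (he : ∀ a b, e (m.mul a b) = m'.mul (e a) (e b)) (h : m.IsSeparable) : m'.IsSeparable := by
  have h1 : ∀ a, m'.mul (e a) = e.conj (m.mul a) := fun a => by
    ext b
    rw [LinearEquiv.conj_apply_apply, he, LinearEquiv.apply_symm_apply]
  have h2 : ∀ a, m'.tr (e a) = m.tr a := fun a => by
    rw [GradedMul.tr_apply, h1, LinearMap.trace_conj', GradedMul.tr_apply]
  refine LinearMap.BilinForm.Nondegenerate.ofSeparatingLeft fun x hx => ?_
  obtain ⟨a, rfl⟩ := e.surjective x
  have : a = 0 := h.1 a fun b => by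
    have h3 := hx (e b)
    change m'.tr (m'.mul (e a) (e b)) = 0 at h3
    rw [← he, h2] at h3
    exact h3
  rw [this, map_zero]

/-- Isomorphisms of the centre are bijective. -/
def fmapEquiv {Y Z : Center (GrVec α)} (e : Y ≅ Z) : gobj Y ≃ₗ[k] gobj Z :=
  LinearEquiv.ofLinearMap (fmap e.hom).lin (fmap e.inv).lin
    (congrArg GrVec.Hom.lin (congrArg fmap e.inv_hom_id))
    (congrArg GrVec.Hom.lin (congrArg fmap e.hom_inv_id))

theorem fmap_mul {L L' : Mon (Center (GrVec α))} (φ : L ⟶ L') (a b : gobj L.X) :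
    (fmap φ.hom).lin ((equivMul L).mul a b) =
      (equivMul L').mul ((fmap φ.hom).lin a) ((fmap φ.hom).lin b) :=
  LinearMap.congr_fun (congrArg GrVec.Hom.lin (fmul_fmap φ)) (tm a b)

theorem isLagrangian_of_iso {L L' : Mon (Center (GrVec α))} (h : IsLagrangian L) (e : L ≅ L') :
    IsLagrangian L' := by
  refine ⟨commutative_of_iso e h.1, ?_, h.2.2.1.of_iso e, h.2.2.2.of_iso e⟩
  have hs : (equivMul L).toGradedMul.IsSeparable := h.2.1
  have e1 : e.inv.hom ≫ e.hom.hom = 𝟙 L'.X := congrArg Mon.Hom.hom e.inv_hom_id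
  have e2 : e.hom.hom ≫ e.inv.hom = 𝟙 L.X := congrArg Mon.Hom.hom e.hom_inv_id
  have : (equivMul L').toGradedMul.IsSeparable :=
    isSeparable_of_equiv (m := (equivMul L).toGradedMul) (m' := (equivMul L').toGradedMul)
      (fmapEquiv ⟨e.hom.hom, e.inv.hom, e2, e1⟩) (fun a b => fmap_mul e.hom a b) hs
  exact this

instance (Y Z : Center (GrVec α)) : Zero (Y ⟶ Z) :=
  ⟨centerHom 0 fun g _ => (map_zero (gact Z g)).symm⟩

instance : HasZeroMorphisms (Center (GrVec α)) where
  comp_zero f _ := fmap_injective (comp_zero (f := fmap f))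
  zero_comp _ _ _ f := fmap_injective (zero_comp (f := fmap f))

theorem isZero_center_iff {Y : Center (GrVec α)} : IsZero Y ↔ ∀ y : gobj Y, y = 0 := by
  rw [IsZero.iff_id_eq_zero]
  constructor
  · intro h y
    exact LinearMap.congr_fun (congrArg GrVec.Hom.lin (congrArg fmap h)) y
  · intro h
    refine fmap_injective ?_
    ext1; apply LinearMap.ext; intro y; exact h y

theorem isZero_of_one_eq_zero {B : Mon (GrVec α)} (h : η[B.X] = 0) : IsZero B.X := by
  refine isZero_iff.2 fun v => ?_
  rw [← (gradedMul B).one_mul v, ← eta_unitOne, h, zero_lin, LinearMap.zero_apply, map_zero,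
    LinearMap.zero_apply]

theorem isZero_center_of_one_eq_zero {B : Mon (Center (GrVec α))} (h : η[B.X] = 0) :
    IsZero B.X := by
  refine isZero_center_iff.2 fun v => ?_
  have h1 : fone B = 0 := congrArg fmap h
  have h2 : (equivMul B).one = 0 := LinearMap.congr_fun (congrArg GrVec.Hom.lin h1) unitOne
  exact ((equivMul B).one_mul v).symm.trans
    ((congrArg (fun t => (equivMul B).mul t v) h2).trans
      (LinearMap.congr_fun (map_zero (equivMul B).mul) v))

end Graded

end CatAlg

/-! ### The twisted group algebra and its full centre -/

section

variable {k M : Type u} [Field k] [Group M] [Fintype M] [DecidableEq M]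

theorem conv_single_left (w : M → M → kˣ) (r : M) (c : k) (a : M → k) (t : M) :
    conv w (Pi.single r c) a t = (w r (r⁻¹ * t)).val * (c * a (r⁻¹ * t)) := by
  rw [conv_apply, Finset.sum_eq_single r]
  · rw [Pi.single_eq_same]
  · intro b _ hb; simp [hb]
  · simp

theorem conv_single_right (w : M → M → kˣ) (r : M) (c : k) (a : M → k) (t : M) :
    conv w a (Pi.single r c) t = (w (t * r⁻¹) r).val * (a (t * r⁻¹) * c) := by
  rw [conv_apply, Finset.sum_eq_single (t * r⁻¹)]
  · have : (t * r⁻¹)⁻¹ * t = r := by group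
    rw [this, Pi.single_eq_same]
  · intro b _ hb
    have : b⁻¹ * t ≠ r := fun h => hb (by rw [← h]; group)
    simp [this]
  · simp

end

namespace Cobounding

open GrVec CatAlg

variable {k G : Type u} [Field k] [Group G] [Fintype G] {α : Cocycle₃ k G} {H : Subgroup G}
  (γ : Cobounding α H)

open scoped Classical in
theorem eq_single_of_hasDeg {h : H} {a : H → k} (ha : γ.twistedX.HasDeg (h : G) a) :
    a = Pi.single h (a h) := by
  funext t
  by_cases ht : t = h
  · subst ht; simp
  · rw [Pi.single_eq_of_ne ht]
    by_contra hne
    exact ht (Subtype.ext (γ.twistedX_hasDeg.1 ha t hne))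

theorem eq_zero_of_hasDeg {g : G} (hg : g ∉ H) {a : H → k} (ha : γ.twistedX.HasDeg g a) :
    a = 0 := by
  funext t
  by_contra hne
  exact hg ((γ.twistedX_hasDeg.1 ha t hne) ▸ t.2)

open scoped Classical in
theorem single_hasDeg (h : H) (c : k) : γ.twistedX.HasDeg (h : G) (Pi.single h c : H → k) :=
  γ.twistedX_hasDeg.2 fun t ht => by
    by_contra hne
    have hth : t ≠ h := fun h' => hne (congrArg Subtype.val h')
    simp [hth] at ht

open scoped Classical in
theorem single_one_eq (c : k) : (Pi.single 1 c : H → k) =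
    (c * (γ.toFun 1 1).val) • (γ.twistedMul.one : H → k) := by
  funext t
  change _ = (c * (γ.toFun 1 1).val) * (if t = 1 then ((γ.toFun 1 1)⁻¹ : kˣ).val else 0)
  by_cases ht : t = 1
  · subst ht; simp [mul_assoc]
  · simp [ht]

theorem twisted_hasDeg_one {a : H → k} (ha : γ.twistedX.HasDeg 1 a) :
    ∃ c : k, a = c • (γ.twistedMul.one : H → k) := by
  classical
  exact ⟨_, (γ.eq_single_of_hasDeg (h := 1) ha).trans (γ.single_one_eq _)⟩

theorem twistedMul_one_ne_zero : (γ.twistedMul.one : H → k) ≠ 0 := by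
  classical
  intro h
  have : (if (1 : H) = 1 then ((γ.toFun 1 1)⁻¹ : kˣ).val else 0) = 0 := congrFun h 1
  simp at this

/-- The product of `e_g` and `e_{g⁻¹}` is a non-zero multiple of the unit, whose trace `|H|` does
not vanish in characteristic 0. -/
theorem twistedMul_isSeparable [CharZero k] : γ.twistedMul.IsSeparable := by
  classical
  refine GradedMul.isSeparable_of_homogeneous _ fun g a ha hne => ?_
  by_cases hg : g ∈ H
  · lift g to H using hg
    have h1 := γ.eq_single_of_hasDeg ha
    -- The expression denotes the coefficient of `e_g` in `a`.
    have hc : Subtype.val (p := fun _ : H → k => True) ⟨a, trivial⟩ g ≠ 0 := fun h0 => hne (by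
      rw [h1]; exact (congrArg (Pi.single g) h0).trans (Pi.single_zero g))
    obtain ⟨c, hc'⟩ : ∃ c : k, c = Subtype.val (p := fun _ : H → k => True) ⟨a, trivial⟩ g := ⟨_, rfl⟩
    refine ⟨(Pi.single g⁻¹ 1 : H → k), ?_⟩
    have h2 : γ.twistedMul.mul a (Pi.single g⁻¹ 1 : H → k) =
        ((γ.toFun g g⁻¹).val * (c * 1) * (γ.toFun 1 1).val) • γ.twistedMul.one := by
      refine (congrArg (fun b => conv γ.toFun b (Pi.single g⁻¹ 1)) h1).trans ?_
      refine (conv_single γ.toFun g g⁻¹ _ 1).trans ?_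
      rw [mul_inv_cancel, hc']
      exact γ.single_one_eq _
    have h3 : γ.twistedMul.mul γ.twistedMul.one = LinearMap.id := LinearMap.ext γ.twistedMul.one_mul
    have h4 : γ.twistedMul.tr γ.twistedMul.one = (Module.finrank k γ.twistedX : k) := by
      rw [GradedMul.tr_apply, h3]; exact LinearMap.trace_id k γ.twistedX
    have h5 : Module.finrank k γ.twistedX ≠ 0 := by
      have : Module.finrank k (H → k) = Fintype.card H := Module.finrank_fintype_fun_eq_card k
      exact this ▸ Fintype.card_ne_zero
    rw [h2, map_smul, h4, smul_eq_mul]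
    rw [← hc'] at hc
    simp [hc, h5]
  · exact absurd (γ.eq_zero_of_hasDeg hg ha) hne

theorem gradedMul_twisted_mul (a b : H → k) :
    (gradedMul γ.twistedGroupAlgebra).mul a b = conv γ.toFun a b :=
  gradedMul_toMon_mul γ.twistedMul a b

theorem isSeparableAlgebra_twisted [CharZero k] : IsSeparableAlgebra γ.twistedGroupAlgebra :=
  isSeparable_of_equiv (m := γ.twistedMul) (m' := gradedMul γ.twistedGroupAlgebra)
    (LinearEquiv.refl k (H → k) : γ.twistedX ≃ₗ[k] γ.twistedX)
    (fun a b => (gradedMul_toMon_mul γ.twistedMul a b).symm) γ.twistedMul_isSeparable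

theorem unit_hom_twisted (u : 𝟙_ (GrVec α) ⟶ γ.twistedGroupAlgebra.X) :
    ∃ c : k, u.lin (unitOne : unit α) = c • (gradedMul γ.twistedGroupAlgebra).one := by
  obtain ⟨c, hc⟩ := γ.twisted_hasDeg_one (u.hasDeg (unit_hasDeg unitOne))
  exact ⟨c, hc.trans (congrArg (c • ·) (gradedMul_toMon_one γ.twistedMul).symm)⟩

/-- Scalar endomorphisms of the unit object are invertible. -/
theorem unit_scalar (c : k) (hc : c ≠ 0) :
    IsIso (ofUnit (c • unitOne : unit α) (unit_hasDeg _)) := by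
  refine ⟨ofUnit (c⁻¹ • unitOne : unit α) (unit_hasDeg _), ?_, ?_⟩
  · refine unit_hom_ext ?_
    rw [comp_lin, LinearMap.comp_apply, ofUnit_one, map_smul, ofUnit_one, smul_smul,
      mul_inv_cancel₀ hc, one_smul]; rfl
  · refine unit_hom_ext ?_
    rw [comp_lin, LinearMap.comp_apply, ofUnit_one, map_smul, ofUnit_one, smul_smul,
      inv_mul_cancel₀ hc, one_smul]; rfl

/-- The component of degree 1 of `k[H, γ]` is spanned by its unit. -/
theorem isIndecomposable_twisted : IsIndecomposable γ.twistedGroupAlgebra := by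
  refine isIndecomposable_of_unit _ (fun h => γ.twistedMul_one_ne_zero ?_)
    (fun B => isZero_of_one_eq_zero) fun u => ?_
  · exact isZero_iff.1 h γ.twistedMul.one
  · obtain ⟨c, hc⟩ := γ.unit_hom_twisted u
    by_cases h0 : c = 0
    · left
      refine unit_hom_ext (hc.trans ?_)
      rw [h0, zero_smul]; rfl
    · right
      refine ⟨_, unit_scalar c h0, unit_hom_ext (hc.trans ?_)⟩
      refine Eq.trans ?_ (congrArg (Hom.lin (MonObj.one (X := γ.twistedGroupAlgebra.X)))
        (ofUnit_one (c • unitOne : unit α) (unit_hasDeg _))).symm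
      exact (map_smul _ c (unitOne : unit α)).symm

/-- The coefficient of `e_t` in an element of `k[H, γ]`. -/
def coeff (a : γ.twistedX) (t : H) : k := Subtype.val (p := fun _ : H → k => True) ⟨a, trivial⟩ t

theorem coeff_ext {a b : γ.twistedX} (h : ∀ t, γ.coeff a t = γ.coeff b t) : a = b := funext h

theorem coeff_smul (c : k) (a : γ.twistedX) (t : H) : γ.coeff (c • a) t = c * γ.coeff a t := rfl

theorem coeff_eq_zero {g : G} {a : γ.twistedX} (ha : γ.twistedX.HasDeg g a) {t : H}
    (ht : (t : G) ≠ g) :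
    γ.coeff a t = 0 := by
  by_contra hne
  exact ht (γ.twistedX_hasDeg.1 ha t hne)

/-- Comparing the coefficients of `e_{ht}` in `e_h ξ(y) = ξ(h.y) e_h`, the quotient of the two
values of `γ` is `ε_h(t)`. Degrees outside `H` impose no condition. -/
theorem isCentral_iff_coeff {Y : Center (GrVec α)} {ξ : gobj Y ⟶ γ.twistedX} :
    IsCentral γ.twistedGroupAlgebra Y ξ ↔ ∀ (h t : H) (y : gobj Y),
      γ.coeff (ξ.lin (gact Y h y)) (h * t * h⁻¹) = (γ.eps h t).val * γ.coeff (ξ.lin y) t := by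
  classical
  have key : ∀ (h : H) (c : k) (a b : H → k),
      (gradedMul γ.twistedGroupAlgebra).mul (Pi.single h c : H → k) a =
        (gradedMul γ.twistedGroupAlgebra).mul b (Pi.single h c : H → k) ↔
      ∀ t : H, (γ.toFun h t).val * (c * a t) =
        (γ.toFun (h * t * h⁻¹) h).val * (b (h * t * h⁻¹) * c) := by
    intro h c a b
    have e1 : (gradedMul γ.twistedGroupAlgebra).mul (Pi.single h c : H → k) a =
      conv γ.toFun (Pi.single h c) a := γ.gradedMul_twisted_mul _ _
    have e2 : (gradedMul γ.twistedGroupAlgebra).mul b (Pi.single h c : H → k) =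
      conv γ.toFun b (Pi.single h c) := γ.gradedMul_twisted_mul _ _
    constructor
    · intro he t
      have := congrFun (e1.symm.trans (he.trans e2)) (h * t)
      rw [conv_single_left, conv_single_right, inv_mul_cancel_left] at this
      exact this
    · intro he
      refine e1.trans (Eq.trans (funext fun t => ?_) e2.symm)
      rw [conv_single_left, conv_single_right]
      have := he (h⁻¹ * t)
      rw [mul_inv_cancel_left] at this
      exact this
  refine isCentral_iff_elements.trans ⟨fun hξ h t y => ?_, fun hξ g a y ha => ?_⟩
  · have h1 := hξ h (Pi.single h 1 : H → k) y (γ.single_hasDeg h 1)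
    have h2 := (key _ _ _ _).1 h1 t
    have h3 : (γ.eps h t).val = (γ.toFun h t).val * ((γ.toFun (h * t * h⁻¹) h).val)⁻¹ := by
      rw [eps, Units.val_mul, Units.val_inv_eq_inv_val]
    have h4 : (γ.toFun (h * t * h⁻¹) h).val ≠ 0 := Units.ne_zero _
    rw [h3]
    field_simp
    have h5 : (γ.toFun h t).val * (1 * γ.coeff (ξ.lin y) t) = (γ.toFun (h * t * h⁻¹) h).val *
      (γ.coeff (ξ.lin (gact Y h y)) (h * t * h⁻¹) * 1) := h2
    linear_combination -h5
  · by_cases hg : g ∈ H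
    · lift g to H using hg
      obtain ⟨c, hc⟩ : ∃ c : k, a = (Pi.single g c : H → k) := ⟨_, γ.eq_single_of_hasDeg ha⟩
      rw [hc]
      refine (key _ _ _ _).2 fun t => ?_
      have h1 := hξ g t y
      rw [eps, Units.val_mul, Units.val_inv_eq_inv_val] at h1
      have h4 : (γ.toFun (g * t * g⁻¹) g).val ≠ 0 := Units.ne_zero _
      have h5 : (γ.toFun g t).val * (c * γ.coeff (ξ.lin y) t) = (γ.toFun (g * t * g⁻¹) g).val *
          (γ.coeff (ξ.lin (gact Y g y)) (g * t * g⁻¹) * c) := by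
        rw [h1]; field_simp
      exact h5
    · have h0 : a = 0 := γ.eq_zero_of_hasDeg hg ha
      rw [h0, map_zero, map_zero, LinearMap.zero_apply]

theorem gact_lagrangian (g : G) (a : γ.LSpace) : gact γ.lagrangian.X g a = γ.LAct g a :=
  gact_toCenter γ.LRep g a

theorem mul_lagrangian (a b : γ.LSpace) : (equivMul γ.lagrangian).mul a b = γ.LMulLin a b :=
  equivMul_toMon_mul γ.LMul a b

theorem one_lagrangian : (equivMul γ.lagrangian).one = γ.LOne :=
  equivMul_toMon_one γ.LMul

/-- The equivariance of `a` at `x = 1` with respect to `h⁻¹` is exactly the condition for evaluation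
at 1 to be central. -/
theorem LAct_apply_one (h t : H) (a : γ.LSpace) :
    (γ.LAct h a).1 1 (h * t * h⁻¹) = (γ.eps h t).val * a.1 1 t := by
  have h2 := a.2 1 h⁻¹ t
  simp only [InvMemClass.coe_inv, one_mul, inv_inv, inv_one, Cocycle₃.two_one_mid] at h2
  rw [LAct_apply]
  simp only [inv_one, Cocycle₃.two_one_left, Units.val_one, one_mul, mul_one]
  exact h2

/-- Translation by `x⁻¹` moves the value at `x` to the value at 1. This makes an equivariant map to
`L(H, γ)` determined by its evaluation at 1, and reduces questions about any coset to the trivial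
one. -/
theorem LAct_inv_apply_one (x : G) (t : H) (a : γ.LSpace) : (γ.LAct x⁻¹ a).1 1 t = a.1 x t := by
  simp only [LAct_apply, inv_one, Cocycle₃.two_one_left, Units.val_one, one_mul, inv_inv, mul_one]

theorem isCentral_zeta : IsCentral γ.twistedGroupAlgebra γ.lagrangian.X γ.evalHom := by
  refine γ.isCentral_iff_coeff.2 fun h t a => ?_
  have h1 : γ.coeff (γ.evalHom.lin (gact γ.lagrangian.X h a)) (h * t * h⁻¹) =
      (γ.LAct h a).1 1 (h * t * h⁻¹) :=
    congrArg (fun b : γ.LSpace => b.1 1 (h * t * h⁻¹)) (γ.gact_lagrangian h a)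
  refine h1.trans (γ.LAct_apply_one h t a)

/-- The map `y ↦ (x ↦ ξ(x⁻¹.y))` defined by a central morphism `ξ`. -/
def liftLin {Y : Center (GrVec α)} (ξ : gobj Y ⟶ γ.twistedX) : gobj Y →ₗ[k] (G → H → k) where
  toFun y x t := γ.coeff (ξ.lin (gact Y x⁻¹ y)) t
  map_add' y y' := by funext x t; rw [map_add, map_add]; rfl
  map_smul' c y := by funext x t; rw [map_smul, map_smul]; rfl

theorem liftLin_apply {Y : Center (GrVec α)} (ξ : gobj Y ⟶ γ.twistedX) (y : gobj Y) (x : G)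
    (t : H) :
    γ.liftLin ξ y x t = γ.coeff (ξ.lin (gact Y x⁻¹ y)) t := rfl

theorem liftLin_eq_zero {Y : Center (GrVec α)} (ξ : gobj Y ⟶ γ.twistedX) {f : G} {y : gobj Y}
    (hy : (gobj Y).HasDeg f y) {x : G} {t : H} (ht : x * t * x⁻¹ ≠ f) : γ.liftLin ξ y x t = 0 := by
  refine γ.coeff_eq_zero (ξ.hasDeg (gact_deg Y (f := x⁻¹) hy)) fun h => ht ?_
  rw [h]; group

/-- Projectivity of the action for `(xh)⁻¹ = h⁻¹x⁻¹` provides the factor `α(h⁻¹, x⁻¹ | f)`, and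
centrality of `ξ` for `h⁻¹` provides `ε_{h⁻¹}(t)`. -/
theorem liftLin_mem {Y : Center (GrVec α)} {ξ : gobj Y ⟶ γ.twistedX}
    (hξ : IsCentral γ.twistedGroupAlgebra Y ξ) (y : gobj Y) : γ.liftLin ξ y ∈ γ.LSpace := by
  rw [← (gobj Y).sum_proj y, map_sum]
  refine Submodule.sum_mem _ fun f _ => ?_
  have hy := (gobj Y).hasDeg_proj f y
  intro x h t
  have e1 : x * h * ((h⁻¹ * t * h : H) : G) * (x * h)⁻¹ = x * t * x⁻¹ := by
    simp only [Subgroup.coe_mul, InvMemClass.coe_inv]; group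
  by_cases ht : x * t * x⁻¹ = f
  · rw [liftLin_apply, liftLin_apply, mul_inv_rev x (h : G), gact_mul Y hy, ht, map_smul]
    have h1 := γ.isCentral_iff_coeff.1 hξ h⁻¹ t (gact Y x⁻¹ ((gobj Y).proj f y))
    rw [InvMemClass.coe_inv, inv_inv] at h1
    rw [Units.val_mul, coeff_smul, h1, mul_assoc]
  · rw [γ.liftLin_eq_zero ξ hy ht, γ.liftLin_eq_zero ξ hy (e1 ▸ ht), mul_zero]

/-- The lift of a central morphism to `L(H, γ)`. -/
def liftHom {Y : Center (GrVec α)} {ξ : gobj Y ⟶ γ.twistedX}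
    (hξ : IsCentral γ.twistedGroupAlgebra Y ξ) : gobj Y ⟶ γ.LX where
  lin := ((γ.liftLin ξ).codRestrict γ.LSpace (γ.liftLin_mem hξ) : gobj Y →ₗ[k] γ.LSpace)
  comm := comm_of_hasDeg (W := γ.LX) _ fun f y hy => γ.LX_hasDeg.2 fun x t ht => by
    by_contra hne
    exact ht (γ.liftLin_eq_zero ξ hy hne)

theorem liftHom_gact {Y : Center (GrVec α)} {ξ : gobj Y ⟶ γ.twistedX}
    (hξ : IsCentral γ.twistedGroupAlgebra Y ξ) (g : G) (y : gobj Y) :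
    (γ.liftHom hξ).lin (gact Y g y) = γ.LAct g ((γ.liftHom hξ).lin y) := by
  suffices h : (γ.liftHom hξ).lin ∘ₗ gact Y g =
      (γ.LAct g : γ.LX →ₗ[k] γ.LX) ∘ₗ (γ.liftHom hξ).lin from LinearMap.congr_fun h y
  refine ext_hom fun f y hy => ?_
  apply Subtype.ext
  funext x t
  have key : γ.liftLin ξ (gact Y g y) x t =
      ((α.two x⁻¹ g (g⁻¹ * (x * t * x⁻¹) * g))⁻¹ : kˣ).val * γ.liftLin ξ y (g⁻¹ * x) t := by
    by_cases ht : g⁻¹ * x * t * (g⁻¹ * x)⁻¹ = f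
    · have e1 : g⁻¹ * (x * t * x⁻¹) * g = f := by rw [← ht]; group
      have e2 : (g⁻¹ * x)⁻¹ = x⁻¹ * g := by group
      rw [liftLin_apply, liftLin_apply, e1, e2, gact_mul Y hy, map_smul]
      rw [coeff_smul, ← mul_assoc, Units.inv_mul, one_mul]
    · rw [γ.liftLin_eq_zero ξ hy ht, mul_zero]
      refine γ.liftLin_eq_zero ξ (gact_deg Y hy) fun h => ht ?_
      have : g⁻¹ * x * t * (g⁻¹ * x)⁻¹ = g⁻¹ * (x * t * x⁻¹) * g := by group
      rw [this, h]; group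
  exact key

/-- This is Frobenius reciprocity. Centrality says that `ξ` is equivariant under `H`, and `L(H, γ)`
is induced from `H`, so `ξ` extends uniquely to an equivariant map over `G`. -/
theorem isFullCentre_zeta : IsFullCentre γ.twistedGroupAlgebra γ.lagrangian γ.zeta := by
  refine IsFullCentre.mk' γ.isCentral_zeta (fun Y ξ hξ => ?_) (fun Y f g hfg => ?_)
  · refine ⟨centerHom (Z := γ.lagrangian.X) (γ.liftHom hξ) fun g y =>
      (γ.liftHom_gact hξ g y).trans (γ.gact_lagrangian g _).symm, ?_⟩
    ext1
    refine LinearMap.ext fun y => γ.coeff_ext fun t => ?_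
    have key : ∀ (ξ : gobj Y ⟶ γ.twistedX) (y : gobj Y),
        γ.liftLin ξ y 1 t = γ.coeff (ξ.lin y) t := fun ξ y => by
      rw [liftLin_apply, inv_one, gact_one]
    exact key ξ y
  · refine fmap_injective ?_
    ext1
    refine LinearMap.ext fun y => Subtype.ext (funext fun x => funext fun t => ?_)
    have h1 : ∀ (φ : Y ⟶ γ.lagrangian.X), γ.coeff ((fmap φ ≫ fhom γ.zeta).lin (gact Y x⁻¹ y)) t =
        Subtype.val (p := fun a => a ∈ γ.LSpace) ((fmap φ).lin y) x t := by
      intro φ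
      have h2 := (fmap_gact φ x⁻¹ y).trans (γ.gact_lagrangian x⁻¹ _)
      have h3 := congrArg (fun a : γ.LSpace => a.1 1 t) h2
      exact h3.trans (γ.LAct_inv_apply_one x t _)
    rw [← h1 f, ← h1 g, hfg]

end Cobounding

/-! ### Elements of `L(H, γ)` -/

namespace Cobounding

open GrVec CatAlg

variable {k G : Type u} [Field k] [Group G] [Fintype G] {α : Cocycle₃ k G} {H : Subgroup G}
  (γ : Cobounding α H)

/-- Three instances of `dγ = α`. The identity says that `H` acts projectively on `k[H, γ]` by `h.e_t
= ε_h(t) e_{hth⁻¹}`, and it is what allows a value at 1 to be extended over the coset `H` in `elem`.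
-/
theorem eps_cocycle (h h' t : H) : γ.eps (h * h') t =
    α.two h h' t * (γ.eps h (h' * t * h'⁻¹) * γ.eps h' t) := by
  apply Additive.ofMul.injective
  have h1 := γ.add_d_eq h h' t
  have h2 := γ.add_d_eq (h * h' * t * (h * h')⁻¹) h h'
  have h3 := γ.add_d_eq h (h' * t * h'⁻¹) h'
  simp only [eps, Cocycle₃.two, ofMul_mul, ofMul_inv]
  simp only [Subgroup.coe_mul, InvMemClass.coe_inv, mul_assoc, mul_inv_rev, inv_mul_cancel_left,
    inv_mul_cancel, mul_one] at h1 h2 h3 ⊢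
  linear_combination (norm := abel) -h1 - h2 + h3

@[simp] theorem eps_one_left (t : H) : γ.eps 1 t = 1 := by
  simp [eps, γ.one_left, γ.one_right]

open scoped Classical in
/-- The coefficients of the element of `L(H, γ)` with support `H` and with value `e_t` at `1`. -/
def elemFun (t : H) (y : G) (s : H) : k :=
  if hy : y ∈ H then
    if s = (⟨y, hy⟩ : H)⁻¹ * t * ⟨y, hy⟩ then (γ.eps (⟨y, hy⟩ : H)⁻¹ t).val else 0
  else 0

open scoped Classical in
theorem elemFun_coe (t y s : H) : γ.elemFun t y s = if s = y⁻¹ * t * y then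
    (γ.eps y⁻¹ t).val else 0 :=
  dif_pos y.2

theorem elemFun_of_notMem (t : H) {y : G} (hy : y ∉ H) (s : H) : γ.elemFun t y s = 0 := dif_neg hy

/-- The element of `L(H, γ)` with support `H` and with value `e_t` at `1`. -/
def elem (t : H) : γ.LSpace := ⟨γ.elemFun t, fun x h s => by
  classical
  by_cases hx : x ∈ H
  · lift x to H using hx
    rw [← Subgroup.coe_mul, elemFun_coe, elemFun_coe]
    by_cases hs : s = x⁻¹ * t * x
    · have h1 : h⁻¹ * s * h = (x * h)⁻¹ * t * (x * h) := by rw [hs]; group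
      rw [if_pos h1, if_pos hs, mul_inv_rev, eps_cocycle, ← Units.val_mul, inv_inv, ← hs]
      have h2 : (x : G) * s * (x : G)⁻¹ = t := by
        rw [hs]; simp only [Subgroup.coe_mul, InvMemClass.coe_inv]; group
      rw [h2, mul_assoc, InvMemClass.coe_inv, InvMemClass.coe_inv]
    · have h1 : h⁻¹ * s * h ≠ (x * h)⁻¹ * t * (x * h) := fun h' => hs (by
        have := congrArg (fun z => h * z * h⁻¹) h'
        simp only [mul_inv_rev, mul_assoc, mul_inv_cancel_left, mul_inv_cancel, mul_one] at this
        rw [this, mul_assoc])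
      rw [if_neg h1, if_neg hs, mul_zero]
  · rw [γ.elemFun_of_notMem t hx, γ.elemFun_of_notMem t (fun h' => hx (by
      have := H.mul_mem h' (h⁻¹).2; simpa using this)), mul_zero]⟩

theorem elem_deg (t : H) : γ.LX.HasDeg (t : G) (γ.elem t) := γ.LX_hasDeg.2 fun x s hs => by
  classical
  have hs' : γ.elemFun t x s ≠ 0 := hs
  by_cases hx : x ∈ H
  · lift x to H using hx
    rw [elemFun_coe] at hs'
    by_cases h : s = x⁻¹ * t * x
    · rw [h]; simp only [Subgroup.coe_mul, InvMemClass.coe_inv]; group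
    · exact absurd (if_neg h) hs'
  · exact absurd (γ.elemFun_of_notMem t hx s) hs'

open scoped Classical in
theorem elem_apply_one (t : H) : (γ.elem t).1 1 = Pi.single t 1 := by
  funext s
  have := γ.elemFun_coe t 1 s
  simp only [inv_one, one_mul, mul_one, eps_one_left, Units.val_one] at this
  rw [Pi.single_apply]
  exact this

theorem elem_apply_of_notMem (t : H) {y : G} (hy : y ∉ H) : (γ.elem t).1 y = 0 :=
  funext fun s => γ.elemFun_of_notMem t hy s

open scoped Classical in
/-- The idempotent of `L(H, γ)` with support `xH`. -/
def idem (x : G) : γ.LSpace := ⟨fun y s => if x⁻¹ * y ∈ H then γ.LOne.1 y s else 0, fun y h s => by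
  have h1 : x⁻¹ * (y * h) ∈ H ↔ x⁻¹ * y ∈ H := by
    rw [← mul_assoc]; exact H.mul_mem_cancel_right h.2
  beta_reduce
  by_cases hy : x⁻¹ * y ∈ H
  · rw [if_pos (h1.2 hy), if_pos hy, γ.LOne.2 y h s]
  · rw [if_neg (fun h' => hy (h1.1 h')), if_neg hy, mul_zero]⟩

open scoped Classical in
theorem idem_apply (x y : G) : (γ.idem x).1 y = if x⁻¹ * y ∈ H then γ.LOne.1 y else 0 := by
  funext s
  change (if x⁻¹ * y ∈ H then γ.LOne.1 y s else 0) = _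
  split <;> rfl

theorem idem_deg (x : G) : γ.LX.HasDeg 1 (γ.idem x) := γ.LX_hasDeg.2 fun y s hs => by
  classical
  rw [idem_apply] at hs
  refine γ.LX_hasDeg.1 γ.LMul.one_deg y s fun h0 => hs ?_
  have h0' : γ.LOne.1 y s = 0 := h0
  split
  · exact h0'
  · rfl

open scoped Classical in
theorem mul_idem_apply (a : γ.LSpace) (x y : G) :
    (γ.LMulLin a (γ.idem x)).1 y = if x⁻¹ * y ∈ H then a.1 y else 0 := by
  rw [LMulLin_apply, idem_apply]
  split
  · rw [← LMulLin_apply]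
    exact congrArg (fun b : γ.LSpace => b.1 y) (γ.LMul.mul_one a)
  · rw [map_zero]

theorem LAct_idem (g x : G) : γ.LAct g (γ.idem x) = γ.idem (g * x) := by
  classical
  apply Subtype.ext
  funext y s
  have h1 : x⁻¹ * (g⁻¹ * y) = (g * x)⁻¹ * y := by group
  have h2 := congrArg (fun b : γ.LSpace => b.1 y s) (γ.LAct_one g)
  simp only [LAct_apply] at h2 ⊢
  rw [idem_apply, idem_apply, h1]
  split
  · exact h2
  · simp

/-- Each `y` lies in the coset `xH` for exactly `|H|` elements `x`. -/
theorem sum_idem : ∑ x : G, γ.idem x = (Fintype.card H : k) • γ.LOne := by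
  classical
  apply Subtype.ext
  funext y s
  rw [Submodule.coe_sum, Finset.sum_apply, Finset.sum_apply]
  have h1 : ∀ x, (γ.idem x).1 y s = if x⁻¹ * y ∈ H then γ.LOne.1 y s else 0 := fun x => rfl
  simp only [h1]
  rw [Finset.sum_ite, Finset.sum_const_zero, add_zero, Finset.sum_const, nsmul_eq_mul]
  have h2 : (Finset.univ.filter fun x => x⁻¹ * y ∈ H).card = Fintype.card H := by
    rw [← Finset.card_univ]
    refine Finset.card_bij' (fun x hx => ⟨x⁻¹ * y, (Finset.mem_filter.1 hx).2⟩)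
      (fun h _ => y * (h : G)⁻¹) ?_ ?_ ?_ ?_
    · intros; simp
    · intro h _; simp
    · intro x _; simp
    · intro h _; apply Subtype.ext; simp
  rw [h2]
  rfl

theorem LSpace_ext {a b : γ.LSpace} (h1 : a.1 1 = b.1 1) (h2 : ∀ x, x ∉ H → a.1 x = b.1 x) :
    a = b := by
  apply Subtype.ext
  funext x t
  by_cases hx : x ∈ H
  · lift x to H using hx
    have ha := a.2 1 x (x * t * x⁻¹)
    have hb := b.2 1 x (x * t * x⁻¹)
    have e : x⁻¹ * (x * t * x⁻¹) * x = t := by group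
    rw [one_mul, e] at ha hb
    rw [ha, hb, h1]
  · rw [h2 x hx]

/-- Both sides vanish outside `H`, and on `H` equivariance reduces the comparison to the value at 1,
where `a` is a multiple of `e_t`. This is the tool that turns a non-zero coefficient of `a` into a
non-zero multiple of an idempotent. -/
theorem mul_elem_inv {t : H} {a : γ.LSpace} (ha : γ.LX.HasDeg (t : G) a) :
    γ.LMulLin a (γ.elem t⁻¹) =
      ((γ.toFun t t⁻¹).val * (γ.toFun 1 1).val * a.1 1 t) • γ.idem 1 := by
  classical
  refine γ.LSpace_ext ?_ fun x hx => ?_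
  · have h1 : γ.LWeight 1 = γ.toFun := by funext r s; simp [LWeight]
    have h2 : a.1 1 = Pi.single t (a.1 1 t) := γ.eq_single_of_hasDeg (γ.evalHom.hasDeg ha)
    rw [LMulLin_apply, elem_apply_one, h1, h2, conv_single, mul_inv_cancel, Pi.single_eq_same]
    funext s
    change _ = _ * (γ.idem 1).1 1 s
    rw [idem_apply, if_pos (by simp), LOne_apply]
    by_cases hs : s = 1
    · subst hs
      have : (γ.toFun 1 1).val ≠ 0 := Units.ne_zero _
      simp only [Pi.single_eq_same, if_true, Units.val_inv_eq_inv_val]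
      field_simp
    · simp [hs]
  · rw [LMulLin_apply, γ.elem_apply_of_notMem _ hx, map_zero]
    have h1 : (γ.idem 1).1 x = 0 := by rw [idem_apply, if_neg (by simpa using hx)]
    rw [Submodule.coe_smul, Pi.smul_apply, h1, smul_zero]

theorem elem_mul_idem (t : H) : γ.LMulLin (γ.elem t) (γ.idem 1) = γ.elem t := by
  classical
  apply Subtype.ext
  funext y
  rw [mul_idem_apply]
  by_cases hy : y ∈ H
  · rw [if_pos (by simpa using hy)]
  · rw [if_neg (by simpa using hy), γ.elem_apply_of_notMem t hy]

theorem idem_mul_idem_self (x : G) : γ.LMulLin (γ.idem x) (γ.idem x) = γ.idem x := by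
  classical
  apply Subtype.ext
  funext y
  rw [mul_idem_apply, idem_apply]
  split <;> rfl

theorem idem_mul_idem {x y : G} (h : x⁻¹ * y ∉ H) : γ.LMulLin (γ.idem x) (γ.idem y) = 0 := by
  classical
  apply Subtype.ext
  funext z
  rw [mul_idem_apply, idem_apply]
  by_cases h1 : x⁻¹ * z ∈ H
  · rw [if_neg, Submodule.coe_zero, Pi.zero_apply]
    intro h2
    apply h
    have := H.mul_mem h1 (H.inv_mem h2)
    have e : x⁻¹ * z * (y⁻¹ * z)⁻¹ = x⁻¹ * y := by group
    rwa [e] at this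
  · rw [if_neg h1]; split <;> rfl

theorem idem_eq {x y : G} (h : x⁻¹ * y ∈ H) : γ.idem x = γ.idem y := by
  classical
  apply Subtype.ext
  funext z
  rw [idem_apply, idem_apply]
  have : x⁻¹ * z ∈ H ↔ y⁻¹ * z ∈ H := by
    have e : x⁻¹ * z = x⁻¹ * y * (y⁻¹ * z) := by group
    rw [e]; exact H.mul_mem_cancel_left h
  simp only [this]

theorem idem_one_ne_zero : γ.idem 1 ≠ 0 := by
  classical
  intro h
  have := congrFun (congrFun (congrArg Subtype.val h) 1) 1
  rw [idem_apply, if_pos (by simp), LOne_apply, if_pos rfl] at this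
  exact Units.ne_zero _ this

/-- Left multiplication by an idempotent of degree 1 is a projection, so its trace is the dimension
of a non-zero space. -/
theorem tr_idem_one_ne_zero [CharZero k] : γ.LMul.tr (γ.idem 1) ≠ 0 := by
  have h0 : γ.LMul.mul (γ.idem 1) (γ.idem 1) = γ.idem 1 := γ.idem_mul_idem_self 1
  have h1 : IsIdempotentElem (γ.LMul.mul (γ.idem 1)) := by
    ext1 a
    have := γ.LMul.mul_assoc_left (γ.idem_deg 1) (γ.idem 1) a
    rw [h0] at this
    exact this
  intro h2
  have h2 := (((LinearMap.isProj_range_iff_isIdempotentElem _).2 h1).trace).symm.trans h2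
  rw [Nat.cast_eq_zero] at h2
  rw [Submodule.finrank_eq_zero] at h2
  have h3 : γ.idem 1 ∈ LinearMap.range (γ.LMul.mul (γ.idem 1)) := ⟨_, h0⟩
  rw [h2] at h3
  exact γ.idem_one_ne_zero h3

theorem tr_LAct (g : G) {a : γ.LSpace} (ha : γ.LX.HasDeg 1 a) :
    γ.LMul.tr (γ.LAct g a) = γ.LMul.tr a := by
  have h1 : γ.LMul.mul (γ.LAct g a) = (γ.LRep.actEquiv g).conj (γ.LMul.mul a) := by
    refine LinearMap.ext fun b => ?_
    rw [LinearEquiv.conj_apply_apply]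
    obtain ⟨b, rfl⟩ := (γ.LRep.actEquiv g).surjective b
    rw [LinearEquiv.symm_apply_apply]
    suffices h : γ.LMul.mul (γ.LAct g a) ∘ₗ γ.LRep.act g = γ.LRep.act g ∘ₗ γ.LMul.mul a from
      LinearMap.congr_fun h b
    refine ext_hom fun f b hb => ?_
    have := γ.LMul.act_mul g 1 f a b ha hb
    rw [Cocycle₃.one_one_mid, Units.val_one, one_smul] at this
    exact this.symm
  exact (congrArg (LinearMap.trace k γ.LX) h1).trans (LinearMap.trace_conj' _ _)

theorem LAct_hasDeg (g : G) {f : G} {a : γ.LSpace} (ha : γ.LX.HasDeg f a) :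
    γ.LX.HasDeg (g * f * g⁻¹) (γ.LAct g a) := γ.LRep.act_deg g f a ha

/-- Given `a(x)(t) ≠ 0`, translate by `x⁻¹` and multiply by `elem t⁻¹`: the product is a non-zero
multiple of `idem 1`, which has non-zero trace. The trace of elements of degree 1 is invariant under
translation, so `x.(elem t⁻¹)` pairs non-trivially with `a`. -/
theorem LMul_isSeparable [CharZero k] : γ.LMul.toGradedMul.IsSeparable := by
  refine GradedMul.isSeparable_of_homogeneous _ fun f a ha hne => ?_
  have key : ∀ a : γ.LSpace, γ.LX.HasDeg f a → a ≠ 0 → ∃ b : γ.LSpace,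
      γ.LMul.tr (γ.LMulLin a b) ≠ 0 := by
    intro a ha hne
    obtain ⟨x, t, hxt⟩ : ∃ x t, a.1 x t ≠ 0 := by
      by_contra! h
      exact hne (Subtype.ext (funext fun x => funext fun t => h x t))
    have hf := γ.LX_hasDeg.1 ha x t hxt
    have h1 : γ.LX.HasDeg (t : G) (γ.LAct x⁻¹ a) := by
      have := γ.LAct_hasDeg x⁻¹ ha
      have e : x⁻¹ * f * x⁻¹⁻¹ = t := by rw [← hf]; group
      rwa [e] at this
    have h2 := γ.LAct_hasDeg x (γ.elem_deg t⁻¹)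
    have h3 := γ.LAct_mul x⁻¹ x _ _ (γ.LX_hasDeg.1 (γ.elem_deg t⁻¹))
    rw [inv_mul_cancel] at h3
    have h4 : γ.LAct 1 (γ.elem t⁻¹) = γ.elem t⁻¹ := γ.LRep.act_one (γ.elem t⁻¹)
    have h5 := γ.mul_elem_inv h1
    rw [← h4, h3, map_smul, LAct_inv_apply_one] at h5
    have h6 := γ.LAct_LMulLin x⁻¹ _ _ _ _ (γ.LX_hasDeg.1 ha) (γ.LX_hasDeg.1 h2)
    have h7 : γ.LX.HasDeg 1 (γ.LMulLin a (γ.LAct x (γ.elem t⁻¹))) := by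
      have := γ.LMul.mul_deg _ _ _ _ ha h2
      have e : f * (x * ((t⁻¹ : H) : G) * x⁻¹) = 1 := by
        rw [← hf, InvMemClass.coe_inv]; group
      rwa [e] at this
    refine ⟨γ.LAct x (γ.elem t⁻¹), fun h0 => ?_⟩
    have h8 : γ.LMul.tr ((α.two x⁻¹ x ((t⁻¹ : H) : G)).val •
        γ.LAct x⁻¹ (γ.LMulLin a (γ.LAct x (γ.elem t⁻¹)))) = 0 :=
      (map_smul γ.LMul.tr _ _).trans (by rw [γ.tr_LAct _ h7, h0, smul_zero])
    rw [h6, smul_comm, h5, smul_smul] at h8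
    have h9 := (map_smul γ.LMul.tr _ _).symm.trans h8
    rcases smul_eq_zero.1 h9 with h10 | h10
    · simp [hxt] at h10
    · exact γ.tr_idem_one_ne_zero h10
  exact key a ha hne

theorem isSeparableAlgebra_lagrangian [CharZero k] :
    IsSeparableAlgebra ((Center.forget (GrVec α)).mapMon.obj γ.lagrangian) :=
  isSeparable_of_equiv (m := γ.LMul.toGradedMul) (m' := (equivMul γ.lagrangian).toGradedMul)
    (LinearEquiv.refl k γ.LSpace : γ.LX ≃ₗ[k] γ.LX)
    (fun a b => (γ.mul_lagrangian a b).symm) γ.LMul_isSeparable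

theorem LOne_ne_zero : γ.LOne ≠ 0 := by
  classical
  intro h
  have := congrFun (congrFun (congrArg Subtype.val h) 1) 1
  rw [LOne_apply, if_pos rfl] at this
  exact Units.ne_zero _ this

/-- Scalar endomorphisms of the unit object of the centre. -/
def centerScalar (α : Cocycle₃ k G) (c : k) : 𝟙_ (Center (GrVec α)) ⟶ 𝟙_ (Center (GrVec α)) :=
  centerHom (ofUnit (c • unitOne : unit α) (unit_hasDeg _) : unit α ⟶ unit α)
    fun g y => by
      have h1 := gact_unit (α := α) g y
      have h2 := gact_unit (α := α) g
        ((ofUnit (c • unitOne : unit α) (unit_hasDeg _) : unit α ⟶ unit α).lin y)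
      exact (congrArg _ h1).trans h2.symm

theorem isIso_centerScalar {c : k} (hc : c ≠ 0) : IsIso (centerScalar α c) := by
  refine ⟨centerScalar α c⁻¹, fmap_injective ?_, fmap_injective ?_⟩
  · refine unit_hom_ext ?_
    change (ofUnit (c⁻¹ • unitOne : unit α) (unit_hasDeg _)).lin
      ((ofUnit (c • unitOne : unit α) (unit_hasDeg _)).lin unitOne) = unitOne
    rw [ofUnit_one, map_smul, ofUnit_one, smul_smul, mul_inv_cancel₀ hc, one_smul]
  · refine unit_hom_ext ?_
    change (ofUnit (c • unitOne : unit α) (unit_hasDeg _)).lin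
      ((ofUnit (c⁻¹ • unitOne : unit α) (unit_hasDeg _)).lin unitOne) = unitOne
    rw [ofUnit_one, map_smul, ofUnit_one, smul_smul, inv_mul_cancel₀ hc, one_smul]

/-- By the universal property a morphism from the unit object is determined by its composite with
`ζ`, which picks an element of degree 1 of `k[H, γ]`, a multiple of the unit. -/
theorem exists_eq_centerScalar (u : 𝟙_ (Center (GrVec α)) ⟶ γ.lagrangian.X) :
    ∃ c : k, u = centerScalar α c ≫ MonObj.one (X := γ.lagrangian.X) := by
  obtain ⟨c, hc⟩ := γ.unit_hom_twisted (fmap u ≫ fhom γ.zeta)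
  refine ⟨c, γ.isFullCentre_zeta.hom_ext (unit_hom_ext (hc.trans ?_))⟩
  have h1 : fone γ.lagrangian ≫ fhom γ.zeta = MonObj.one (X := γ.twistedGroupAlgebra.X) :=
    fone_fhom γ.zeta
  have h2 := LinearMap.congr_fun (congrArg Hom.lin h1) (c • unitOne : unit α)
  have h3 : (ofUnit (c • unitOne : unit α) (unit_hasDeg _)).lin unitOne = (c • unitOne : unit α) :=
    ofUnit_one _ _
  have h4 := congrArg (fone γ.lagrangian ≫ fhom γ.zeta).lin h3
  refine Eq.trans ?_ (h4.trans h2).symm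
  exact (map_smul _ c (unitOne : unit α)).symm

theorem isIndecomposable_lagrangian : IsIndecomposable γ.lagrangian := by
  refine isIndecomposable_of_unit _ (fun h => γ.LOne_ne_zero (isZero_center_iff.1 h γ.LOne))
    (fun B => isZero_center_of_one_eq_zero) fun u => ?_
  obtain ⟨c, rfl⟩ := γ.exists_eq_centerScalar u
  by_cases h0 : c = 0
  · left
    have h1 : centerScalar α c = 0 := fmap_injective (unit_hom_ext (by
      refine (ofUnit_one (c • unitOne : unit α) (unit_hasDeg _)).trans ?_
      rw [h0, zero_smul]; rfl))
    rw [h1, Limits.zero_comp]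
  · right
    exact ⟨_, isIso_centerScalar h0, rfl⟩

end Cobounding

/-! ### Local modules over `L(H, γ)` -/

namespace Cobounding

open GrVec CatAlg

variable {k G : Type u} [Field k] [Group G] [Fintype G] {α : Cocycle₃ k G} {H : Subgroup G}
  (γ : Cobounding α H)

/-- A local action of `L(H, γ)` on an object of `𝒵(G, α)`, on elements. -/
structure LocalAction (Z : ProjGrVec α) (r : Z.X →ₗ[k] γ.LSpace →ₗ[k] Z.X) : Prop where
  deg : ∀ f g m a, Z.X.HasDeg f m → γ.LX.HasDeg g a → Z.X.HasDeg (f * g) (r m a)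
  one : ∀ m, r m γ.LOne = m
  mul : ∀ f g h m a b, Z.X.HasDeg f m → γ.LX.HasDeg g a → γ.LX.HasDeg h b →
    r m (γ.LMulLin a b) = (α.toFun f g h).val • r (r m a) b
  act : ∀ g f h m a, Z.X.HasDeg f m → γ.LX.HasDeg h a →
    Z.act g (r m a) = (α.one g f h).val • r (Z.act g m) (γ.LAct g a)
  monodromy : ∀ f h m a, Z.X.HasDeg f m → γ.LX.HasDeg h a →
    r m a = r (Z.act (f * h * f⁻¹) m) (γ.LAct f a)

theorem LX_induction {p : γ.LSpace → Prop} (h0 : ∀ f a, γ.LX.HasDeg f a → p a)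
    (h1 : ∀ (s : Finset G) (F : G → γ.LSpace), (∀ g ∈ s, p (F g)) → p (∑ g ∈ s, F g)) (a : γ.LSpace) :
    p a := by
  have h2 : ∑ g, (γ.LX.proj g a : γ.LSpace) = a := γ.LX.sum_proj a
  rw [← h2]
  exact h1 _ _ fun g _ => h0 g _ (γ.LX.hasDeg_proj g a)

namespace LocalAction

variable {γ} {Z : ProjGrVec α} {r : Z.X →ₗ[k] γ.LSpace →ₗ[k] Z.X}

theorem mul_one_right (hr : γ.LocalAction Z r) {g : G} {a b : γ.LSpace} (ha : γ.LX.HasDeg g a)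
    (hb : γ.LX.HasDeg 1 b)
    {f : G} {m : Z.X} (hm : Z.X.HasDeg f m) : r m (γ.LMulLin a b) = r (r m a) b := by
  rw [hr.mul f g 1 m a b hm ha hb, α.one_right, Units.val_one, one_smul]

theorem mul_one_left (hr : γ.LocalAction Z r) {m : Z.X} (hm : Z.X.HasDeg 1 m) {g h : G}
    {a b : γ.LSpace}
    (ha : γ.LX.HasDeg g a) (hb : γ.LX.HasDeg h b) : r m (γ.LMulLin a b) = r (r m a) b := by
  rw [hr.mul 1 g h m a b hm ha hb, α.one_left, Units.val_one, one_smul]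

theorem act_idem (hr : γ.LocalAction Z r) {f : G} {m : Z.X} (hm : Z.X.HasDeg f m) (g x : G) :
    Z.act g (r m (γ.idem x)) = r (Z.act g m) (γ.idem (g * x)) := by
  rw [hr.act g f 1 m _ hm (γ.idem_deg x), α.one_one_right, Units.val_one, one_smul, LAct_idem]

/-- The element `idem x` has degree 1, so in the double braiding it leaves `m` alone and is itself
translated by the degree `f` of `m`. -/
theorem idem_monodromy (hr : γ.LocalAction Z r) {f : G} {m : Z.X} (hm : Z.X.HasDeg f m) (x : G) :
    r m (γ.idem x) = r m (γ.idem (f * x)) := by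
  rw [hr.monodromy f 1 m _ hm (γ.idem_deg x), mul_one, mul_inv_cancel, Z.act_one, LAct_idem]

/-- By `idem_monodromy` an element over the trivial coset also lies over the coset `fH`. The
idempotents of different cosets are orthogonal. -/
theorem deg_mem (hr : γ.LocalAction Z r) {f : G} {m : Z.X} (hm : Z.X.HasDeg f m)
    (h1 : r m (γ.idem 1) = m) (h0 : m ≠ 0) :
    f ∈ H := by
  by_contra hf
  apply h0
  have h2 := hr.idem_monodromy hm 1
  rw [mul_one, h1] at h2
  have h3 : γ.LMulLin (γ.idem f) (γ.idem 1) = 0 :=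
    γ.idem_mul_idem (by rw [mul_one]; exact fun h => hf (by simpa using H.inv_mem h))
  have h4 := hr.mul_one_right (γ.idem_deg f) (γ.idem_deg 1) hm
  rw [h3, map_zero, ← h2, h1] at h4
  exact h4.symm

theorem deg_idem (hr : γ.LocalAction Z r) {f : G} {m : Z.X} (hm : Z.X.HasDeg f m) (x : G) :
    Z.X.HasDeg f (r m (γ.idem x)) := by
  have := hr.deg f 1 _ _ hm (γ.idem_deg x)
  rwa [mul_one] at this

/-- So `elem t` acts invertibly, up to scalars, on the part over the trivial coset, and this part
can be shifted to degree 1. -/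
theorem mul_elem_elem (hr : γ.LocalAction Z r) {f : G} {m : Z.X} (hm : Z.X.HasDeg f m)
    (h1 : r m (γ.idem 1) = m) (t : H) :
    ∃ c : k, c ≠ 0 ∧ r (r m (γ.elem t)) (γ.elem t⁻¹) = c • m := by
  classical
  refine ⟨((α.toFun f t ((t⁻¹ : H) : G))⁻¹ : kˣ).val * ((γ.toFun t t⁻¹).val * (γ.toFun 1 1).val), by simp, ?_⟩
  have h2 := hr.mul f _ _ m _ _ hm (γ.elem_deg t) (γ.elem_deg t⁻¹)
  rw [γ.mul_elem_inv (γ.elem_deg t), elem_apply_one, Pi.single_eq_same, mul_one, map_smul, h1] at h2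
  rw [mul_smul, h2, smul_smul, Units.inv_mul, one_smul]

/-- For `n` of degree 1, locality with respect to `elem t` gives `n · elem t = (t.n) · elem t`. Both
`n` and `t.n` lie over the trivial coset, where `elem t` can be cancelled by means of `elem t⁻¹`. -/
theorem act_eq (hr : γ.LocalAction Z r) {n : Z.X} (hn : Z.X.HasDeg 1 n) (h1 : r n (γ.idem 1) = n)
    (t : H) :
    Z.act t n = n := by
  classical
  have hn' : Z.X.HasDeg 1 (Z.act t n) := by
    have := Z.act_deg t 1 n hn
    rwa [mul_one, mul_inv_cancel] at this
  have h2 : r n (γ.elem t) = r (Z.act t n) (γ.elem t) := by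
    have := hr.monodromy 1 t n _ hn (γ.elem_deg t)
    have h3 : γ.LAct 1 (γ.elem t) = γ.elem t := γ.LRep.act_one (γ.elem t)
    rwa [one_mul, inv_one, mul_one, h3] at this
  have h3 : r (Z.act t n) (γ.idem 1) = Z.act t n := by
    rw [γ.idem_eq (x := 1) (y := t * 1) (by simp), ← hr.act_idem hn, h1]
  have h4 := hr.mul_one_left hn (γ.elem_deg t) (γ.elem_deg t⁻¹)
  have h5 := hr.mul_one_left hn' (γ.elem_deg t) (γ.elem_deg t⁻¹)
  rw [← h2, ← h4, γ.mul_elem_inv (γ.elem_deg t), elem_apply_one, Pi.single_eq_same, mul_one,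
    map_smul, map_smul, h1, h3] at h5
  exact smul_right_injective Z.X (r := (γ.toFun t t⁻¹).val * (γ.toFun 1 1).val) (by simp) h5

/-- The space of invariant elements of degree one. -/
def invariants (Z : ProjGrVec α) : Submodule k Z.X where
  carrier := {m | Z.X.HasDeg 1 m ∧ ∀ g, Z.act g m = m}
  add_mem' ha hb := ⟨ha.1.add hb.1, fun g => by rw [map_add, ha.2, hb.2]⟩
  zero_mem' := ⟨map_zero _, fun g => map_zero _⟩
  smul_mem' c _ ha := ⟨ha.1.smul c, fun g => by rw [map_smul, ha.2]⟩

theorem sum_act_mem {n : Z.X} (hn : Z.X.HasDeg 1 n) : ∑ x, Z.act x n ∈ invariants Z := by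
  refine ⟨HasDeg.sum fun x _ => ?_, fun g => ?_⟩
  · have := Z.act_deg x 1 n hn
    rwa [mul_one, mul_inv_cancel] at this
  · rw [map_sum]
    refine Fintype.sum_equiv (Equiv.mulLeft g) _ _ fun x => ?_
    rw [Equiv.coe_mulLeft, Z.act_mul g x 1 n hn, α.two_one_right, Units.val_one, one_smul]

/-- The translates of `n` by elements of `H` equal `n`, and the other translates lie over other
cosets and are killed by `idem 1`. So `n` is recovered from an invariant. -/
theorem sum_act_idem (hr : γ.LocalAction Z r) {n : Z.X} (hn : Z.X.HasDeg 1 n)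
    (h1 : r n (γ.idem 1) = n) :
    r (∑ x, Z.act x n) (γ.idem 1) = (Fintype.card H : k) • n := by
  classical
  rw [map_sum, LinearMap.sum_apply]
  have h2 : ∀ x, r (Z.act x n) (γ.idem 1) = if x ∈ H then n else 0 := by
    intro x
    by_cases hx : x ∈ H
    · rw [if_pos hx, hr.act_eq hn h1 ⟨x, hx⟩, h1]
    · rw [if_neg hx]
      have h3 := hr.act_idem hn x 1
      rw [h1, mul_one] at h3
      have hn' := Z.act_deg x 1 n hn
      rw [h3, ← hr.mul_one_right (γ.idem_deg x) (γ.idem_deg 1) hn', γ.idem_mul_idem, map_zero]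
      rw [mul_one]; exact fun h => hx (by simpa using H.inv_mem h)
  simp only [h2]
  rw [Finset.sum_ite, Finset.sum_const_zero, add_zero, Finset.sum_const,
    ← Nat.cast_smul_eq_nsmul k]
  congr 2
  rw [Fintype.card_subtype]

theorem act_invariant (hr : γ.LocalAction Z r) {m : Z.X} (hm : m ∈ invariants Z) (g : G)
    (a : γ.LSpace) :
    Z.act g (r m a) = r m (γ.LAct g a) := by
  refine γ.LX_induction (p := fun a => Z.act g (r m a) = r m (γ.LAct g a)) ?_ ?_ a
  · intro f a ha
    rw [hr.act g 1 f m a hm.1 ha, α.one_one_mid, Units.val_one, one_smul, hm.2]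
  · intro s F hF
    simp only [map_sum]
    exact Finset.sum_congr rfl hF

theorem mul_invariant (hr : γ.LocalAction Z r) {m : Z.X} (hm : m ∈ invariants Z) (a b : γ.LSpace) :
    r (r m a) b = r m (γ.LMulLin a b) := by
  refine γ.LX_induction (p := fun b => r (r m a) b = r m (γ.LMulLin a b)) ?_ ?_ b
  · intro g b hb
    obtain ⟨b', hb'⟩ : ∃ b' : γ.LSpace, b' = b := ⟨b, rfl⟩
    rw [← hb'] at hb ⊢
    refine γ.LX_induction (p := fun a => r (r m a) b' = r m (γ.LMulLin a b')) ?_ ?_ a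
    · intro f a ha
      exact (hr.mul_one_left hm.1 ha hb).symm
    · intro s F hF
      have h1 : r (r m (∑ g ∈ s, F g)) b' = ∑ g ∈ s, r (r m (F g)) b' := by
        rw [map_sum, map_sum, LinearMap.sum_apply]
      have h2 : γ.LMulLin (∑ g ∈ s, F g) b' = ∑ g ∈ s, γ.LMulLin (F g) b' := by
        rw [map_sum, LinearMap.sum_apply]
      rw [h1, h2, map_sum]
      exact Finset.sum_congr rfl hF
  · intro s F hF
    simp only [map_sum]
    exact Finset.sum_congr rfl hF

/-- The span is stable under `G` and under the algebra. It contains the elements of degree 1 over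
the trivial coset by averaging, then all elements over this coset by applying `elem t`, and then
everything by translation between cosets. -/
theorem span_eq_top (hr : γ.LocalAction Z r) [CharZero k] :
    Submodule.span k {z | ∃ m ∈ invariants Z, ∃ a, r m a = z} = ⊤ := by
  obtain ⟨R, hR⟩ : ∃ R, R = Submodule.span k {z | ∃ m ∈ invariants Z, ∃ a, r m a = z} := ⟨_, rfl⟩
  rw [← hR]
  have hcard : (Fintype.card H : k) ≠ 0 := Nat.cast_ne_zero.2 Fintype.card_ne_zero
  have hmem : ∀ m ∈ invariants Z, ∀ a, r m a ∈ R := fun m hm a => by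
    rw [hR]; exact Submodule.subset_span ⟨m, hm, a, rfl⟩
  have hact : ∀ g, ∀ z ∈ R, Z.act g z ∈ R := by
    intro g z hz
    rw [hR] at hz
    induction hz using Submodule.span_induction with
    | mem z hz =>
      obtain ⟨m, hm, a, rfl⟩ := hz
      rw [hr.act_invariant hm]; exact hmem _ hm _
    | zero => rw [map_zero]; exact R.zero_mem
    | add _ _ _ _ ha hb => rw [map_add]; exact R.add_mem ha hb
    | smul c _ _ ha => rw [map_smul]; exact R.smul_mem c ha
  have hmul : ∀ b, ∀ z ∈ R, r z b ∈ R := by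
    intro b z hz
    rw [hR] at hz
    induction hz using Submodule.span_induction with
    | mem z hz =>
      obtain ⟨m, hm, a, rfl⟩ := hz
      rw [hr.mul_invariant hm]; exact hmem _ hm _
    | zero => rw [map_zero, LinearMap.zero_apply]; exact R.zero_mem
    | add _ _ _ _ ha hb => rw [map_add, LinearMap.add_apply]; exact R.add_mem ha hb
    | smul c _ _ ha => rw [map_smul, LinearMap.smul_apply]; exact R.smul_mem c ha
  -- elements supported on the trivial coset
  have h1 : ∀ f n, Z.X.HasDeg f n → r n (γ.idem 1) = n → n ∈ R := by
    intro f n hn hn1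
    by_cases h0 : n = 0
    · rw [h0]; exact R.zero_mem
    obtain ⟨t, rfl⟩ : ∃ t : H, f = t := ⟨⟨f, hr.deg_mem hn hn1 h0⟩, rfl⟩
    have hd : Z.X.HasDeg 1 (r n (γ.elem t⁻¹)) := by
      have := hr.deg _ _ _ _ hn (γ.elem_deg t⁻¹)
      rwa [InvMemClass.coe_inv, mul_inv_cancel] at this
    have hd1 : r (r n (γ.elem t⁻¹)) (γ.idem 1) = r n (γ.elem t⁻¹) := by
      rw [← hr.mul_one_right (γ.elem_deg t⁻¹) (γ.idem_deg 1) hn, γ.elem_mul_idem]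
    have h2 : r n (γ.elem t⁻¹) ∈ R := by
      have h3 := hmem _ (sum_act_mem hd) (γ.idem 1)
      rw [hr.sum_act_idem hd hd1] at h3
      exact (R.smul_mem_iff hcard).1 h3
    obtain ⟨c, hc, hc'⟩ := hr.mul_elem_elem hn hn1 t⁻¹
    rw [inv_inv] at hc'
    have h3 := hmul (γ.elem t) _ h2
    rw [hc'] at h3
    exact (R.smul_mem_iff hc).1 h3
  rw [eq_top_iff]
  rintro z -
  rw [← Z.X.sum_proj z]
  refine R.sum_mem fun f _ => ?_
  have hz := Z.X.hasDeg_proj f z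
  obtain ⟨z, hz'⟩ : ∃ y, y = Z.X.proj f z := ⟨_, rfl⟩
  rw [← hz'] at hz ⊢
  rw [← R.smul_mem_iff hcard]
  -- Up to the factor `|H|`, the element `z` is the sum of its parts over the cosets `xH`. Each part
  -- is moved to the trivial coset by `x⁻¹` and back by `x`, which multiplies it by a scalar only.
  have h2 : (Fintype.card H : k) • z = ∑ x, r z (γ.idem x) := by
    rw [← map_sum, sum_idem, map_smul, hr.one]
  rw [h2]
  refine R.sum_mem fun x _ => ?_
  have h3 := hr.act_idem hz x⁻¹ x
  rw [inv_mul_cancel] at h3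
  have hzx := Z.act_deg x⁻¹ f z hz
  have h4 : Z.act x⁻¹ (r z (γ.idem x)) ∈ R := by
    rw [h3]
    refine h1 _ _ (hr.deg_idem hzx 1) ?_
    rw [← hr.mul_one_right (γ.idem_deg 1) (γ.idem_deg 1) hzx, γ.idem_mul_idem_self]
  have h5 := hact x _ h4
  have h6 := Z.act_mul x x⁻¹ f _ (hr.deg_idem hz x)
  rw [mul_inv_cancel, Z.act_one] at h6
  rw [h6]
  exact R.smul_mem _ h5

/-- The parts of an invariant element over the various cosets are translates of its part over the
trivial coset. -/
theorem eq_zero_of_idem (hr : γ.LocalAction Z r) [CharZero k] {m : Z.X} (hm : m ∈ invariants Z)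
    (h : r m (γ.idem 1) = 0) :
    m = 0 := by
  have hcard : (Fintype.card H : k) ≠ 0 := Nat.cast_ne_zero.2 Fintype.card_ne_zero
  have h2 : (Fintype.card H : k) • m = ∑ x, r m (γ.idem x) := by
    rw [← map_sum, sum_idem, map_smul, hr.one]
  have h3 : ∀ x, r m (γ.idem x) = 0 := fun x => by
    have := hr.act_invariant hm x (γ.idem 1)
    rw [h, map_zero, LAct_idem, mul_one] at this
    exact this.symm
  simp only [h3, Finset.sum_const_zero] at h2
  exact (smul_eq_zero.1 h2).resolve_left hcard

/-- The coefficients at `x` and `t` are isolated by projecting to degree `xtx⁻¹`, translating by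
`x⁻¹` and multiplying by `elem t⁻¹`. This leaves a linear combination of the `m j` that `idem 1`
kills, hence one that is zero. -/
theorem eq_zero_of_sum (hr : γ.LocalAction Z r) [CharZero k] {J : Type*} [Fintype J] {m : J → Z.X}
    (hm : ∀ j, m j ∈ invariants Z)
    (hi : LinearIndependent k m) (l : J → γ.LSpace) (hl : ∑ j, r (m j) (l j) = 0) (j : J) : l j = 0 := by
  -- reduction to homogeneous elements
  have h1 : ∀ f, ∑ j, r (m j) (γ.LX.proj f (l j) : γ.LSpace) = 0 := by
    intro f
    have h2 : ∀ (j : J) (a : γ.LSpace), r (m j) (γ.LX.proj f a : γ.LSpace) = Z.X.proj f (r (m j) a) := by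
      intro j a
      refine comm_of_hasDeg (V := γ.LX) (W := Z.X) (r (m j)) (fun g a ha => ?_) f a
      have := hr.deg 1 g _ _ (hm j).1 ha
      rwa [one_mul] at this
    simp only [h2, ← map_sum, hl, map_zero]
  apply Subtype.ext
  funext x t
  obtain ⟨f, hf⟩ : ∃ f, f = x * t * x⁻¹ := ⟨_, rfl⟩
  obtain ⟨l', hl'⟩ : ∃ l' : J → γ.LSpace, ∀ j, l' j = γ.LX.proj f (l j) := ⟨_, fun _ => rfl⟩
  have h3 : ∀ j, (l' j).1 x t = (l j).1 x t := fun j => by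
    rw [hl', hf]; exact if_pos rfl
  have h4 : ∀ j, γ.LX.HasDeg f (l' j) := fun j => by
    rw [hl']; exact γ.LX.hasDeg_proj f (l j)
  have h5 := h1 f
  simp only [← hl'] at h5
  have h6 : ∀ j, γ.LX.HasDeg (t : G) (γ.LAct x⁻¹ (l' j)) := fun j => by
    have := γ.LAct_hasDeg x⁻¹ (h4 j)
    have e : x⁻¹ * f * x⁻¹⁻¹ = t := by rw [hf]; group
    rwa [e] at this
  have h7 : ∑ j, ((γ.toFun t t⁻¹).val * (γ.toFun 1 1).val * (l j).1 x t) • r (m j) (γ.idem 1) = 0 := by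
    have := congrArg (fun z => r (Z.act x⁻¹ z) (γ.elem t⁻¹)) h5
    simp only [map_sum, map_zero, LinearMap.zero_apply, LinearMap.sum_apply] at this
    rw [← this]
    refine Finset.sum_congr rfl fun j _ => ?_
    rw [hr.act_invariant (hm j), hr.mul_invariant (hm j), γ.mul_elem_inv (h6 j),
      LAct_inv_apply_one, h3, map_smul]
  have h8 : r (∑ j, ((γ.toFun t t⁻¹).val * (γ.toFun 1 1).val * (l j).1 x t) • m j) (γ.idem 1) = 0 := by
    rw [← h7, map_sum, LinearMap.sum_apply]
    exact Finset.sum_congr rfl fun j _ => by rw [map_smul, LinearMap.smul_apply]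
  have h9 := hr.eq_zero_of_idem (Submodule.sum_mem _ fun j _ => Submodule.smul_mem _ _ (hm j)) h8
  have h10 := Fintype.linearIndependent_iff.1 hi _ h9 j
  simpa using h10

/-- A vector space basis of the invariants of degree 1, that is, of the morphisms from the unit
object, is a basis of the module over `L(H, γ)`. -/
theorem exists_basis (hr : γ.LocalAction Z r) [CharZero k] : ∃ (n : ℕ) (m : Fin n → Z.X),
    (∀ j, m j ∈ invariants Z) ∧
    (∀ l : Fin n → γ.LSpace, ∑ j, r (m j) (l j) = 0 → l = 0) ∧
    ∀ z, ∃ l : Fin n → γ.LSpace, ∑ j, r (m j) (l j) = z := by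
  let b := Module.finBasis k (invariants Z)
  have hb : LinearIndependent k fun j => (b j : Z.X) :=
    b.linearIndependent.map' (invariants Z).subtype (Submodule.ker_subtype _)
  refine ⟨_, fun j => b j, fun j => (b j).2, fun l hl => funext fun j =>
    hr.eq_zero_of_sum (fun j => (b j).2) hb l hl j, fun z => ?_⟩
  have hz : z ∈ Submodule.span k {z | ∃ m ∈ invariants Z, ∃ a, r m a = z} := by
    rw [hr.span_eq_top]; trivial
  induction hz using Submodule.span_induction with
  | mem z hz =>
    obtain ⟨m, hm, a, rfl⟩ := hz
    refine ⟨fun j => b.repr ⟨m, hm⟩ j • a, ?_⟩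
    have h1 := congrArg Subtype.val (b.sum_repr ⟨m, hm⟩)
    rw [Submodule.coe_sum] at h1
    simp only [Submodule.coe_smul] at h1
    conv_rhs => rw [← h1, map_sum, LinearMap.sum_apply]
    refine Finset.sum_congr rfl fun j _ => ?_
    rw [map_smul, map_smul, LinearMap.smul_apply]
  | zero => exact ⟨0, by simp⟩
  | add _ _ _ _ ha hb =>
    obtain ⟨l, hl⟩ := ha
    obtain ⟨l', hl'⟩ := hb
    exact ⟨l + l', by simp only [Pi.add_apply, map_add, Finset.sum_add_distrib, hl, hl']⟩
  | smul c _ _ ha =>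
    obtain ⟨l, hl⟩ := ha
    exact ⟨c • l, by simp only [Pi.smul_apply, map_smul, ← Finset.smul_sum, hl]⟩

end LocalAction

end Cobounding

/-! ### `L(H, γ)` is Lagrangian -/

namespace CatAlg

open GrVec Limits

variable {k G : Type u} [Field k] [Group G] [Fintype G] {α : Cocycle₃ k G}

section

variable {L : Mon (Center (GrVec α))} (M : RMod L)

/-- The action morphism of a module over an algebra in the centre. -/
def fact : tensor (gobj M.X) (gobj L.X) ⟶ gobj M.X := fmap M.act

/-- The action of an algebra in the centre on a module, on elements. -/
def ract : gobj M.X →ₗ[k] gobj L.X →ₗ[k] gobj M.X := curry (fact M).lin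

theorem ract_deg {f g : G} {m : gobj M.X} {a : gobj L.X} (hm : (gobj M.X).HasDeg f m)
    (ha : (gobj L.X).HasDeg g a) : (gobj M.X).HasDeg (f * g) (ract M m a) :=
  (fact M).hasDeg (hm.tm ha)

theorem ract_one (m : gobj M.X) : ract M m (equivMul L).one = m := by
  have h : tensorMap (𝟙 (gobj M.X)) (fone L) ≫ fact M = (rightIso (gobj M.X)).hom :=
    congrArg fmap M.act_one
  have h2 := LinearMap.congr_fun (congrArg Hom.lin h) (tm m unitOne)
  exact h2.trans ((rid_tm (gobj M.X) _ m).trans (one_smul k m))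

theorem ract_mul {f g h : G} {m : gobj M.X} {a b : gobj L.X} (hm : (gobj M.X).HasDeg f m)
    (ha : (gobj L.X).HasDeg g a) (hb : (gobj L.X).HasDeg h b) :
    ract M m ((equivMul L).mul a b) = (α.toFun f g h).val • ract M (ract M m a) b := by
  have h1 : tensorMap (fact M) (𝟙 (gobj L.X)) ≫ fact M =
      (assocIso (gobj M.X) (gobj L.X) (gobj L.X)).hom ≫ tensorMap (𝟙 (gobj M.X)) (fmul L) ≫ fact M :=
    congrArg fmap M.act_assoc
  have h2 := LinearMap.congr_fun (congrArg Hom.lin h1) (tm (tm m a) b)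
  simp only [comp_lin, LinearMap.comp_apply, tensorMap_tm, id_lin, LinearMap.id_apply,
    assocIso_hom_lin, LinearEquiv.coe_coe, assocEquiv_tm hm ha hb, map_smul] at h2
  have h3 : ract M (ract M m a) b =
      ((α.toFun f g h)⁻¹ : kˣ).val • ract M m ((equivMul L).mul a b) := h2
  rw [h3, smul_smul, Units.mul_inv, one_smul]

theorem ract_gact (g : G) {f h : G} {m : gobj M.X} {a : gobj L.X} (hm : (gobj M.X).HasDeg f m)
    (ha : (gobj L.X).HasDeg h a) : gact M.X g (ract M m a) =
      (α.one g f h).val • ract M (gact M.X g m) (gact L.X g a) := by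
  have h1 := fmap_gact M.act g (tm m a : tensor (gobj M.X) (gobj L.X))
  have h2 := congrArg (fact M).lin (gact_tensor M.X L.X g hm ha)
  exact h1.symm.trans (h2.trans (map_smul _ _ _))

variable {M}

/-- By two applications of `braid_tm`, the double braiding sends `(fhf⁻¹).m ⊗ f.a` to `m ⊗ a`. -/
theorem ract_monodromy (hM : M.IsLocal) {f h : G} {m : gobj M.X} {a : gobj L.X}
    (hm : (gobj M.X).HasDeg f m) (ha : (gobj L.X).HasDeg h a) :
    ract M m a = ract M (gact M.X (f * h * f⁻¹) m) (gact L.X f a) := by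
  have h1 : ((fbraid M.X).β (gobj L.X)).hom ≫ ((fbraid L.X).β (gobj M.X)).hom ≫ fact M = fact M :=
    congrArg fmap hM
  have h2 := LinearMap.congr_fun (congrArg Hom.lin h1)
    (tm (gact M.X (f * h * f⁻¹) m) (gact L.X f a))
  have h3 := braid_tm M.X (gact_deg L.X (f := f) ha) m
  have h4 := braid_tm L.X hm a
  have h5 := (congrArg (Hom.lin ((fbraid L.X).β (gobj M.X)).hom) h3).trans h4
  exact (congrArg (fact M).lin h5).symm.trans h2

/-- The map underlying a morphism from the regular module. -/
def regMap (f : RMod.regular L ⟶ M) : gobj L.X ⟶ gobj M.X := fmap f.hom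

theorem regMap_gact (f : RMod.regular L ⟶ M) (g : G) (a : gobj L.X) :
    (regMap f).lin (gact L.X g a) = gact M.X g ((regMap f).lin a) := fmap_gact f.hom g a

theorem regMap_mul (f : RMod.regular L ⟶ M) (a b : gobj L.X) :
    (regMap f).lin ((equivMul L).mul a b) = ract M ((regMap f).lin a) b :=
  LinearMap.congr_fun (congrArg Hom.lin (congrArg fmap f.comm)) (tm a b)

/-- The morphism of modules given by an equivariant linear map. -/
def rmodHom {M N : RMod L} (D : gobj M.X ⟶ gobj N.X)
    (h1 : ∀ g m, D.lin (gact M.X g m) = gact N.X g (D.lin m))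
    (h2 : ∀ m a, D.lin (ract M m a) = ract N (D.lin m) a) : M ⟶ N where
  hom := centerHom D h1
  comm := by
    refine fmap_injective ?_
    have h : fact M ≫ D = tensorMap D (𝟙 (gobj L.X)) ≫ fact N := by
      ext1
      exact ext_tm h2
    exact h

/-- The morphism from the regular module given by an equivariant linear map. -/
def regHom (D : gobj L.X ⟶ gobj M.X)
    (h1 : ∀ g a, D.lin (gact L.X g a) = gact M.X g (D.lin a))
    (h2 : ∀ a b, D.lin ((equivMul L).mul a b) = ract M (D.lin a) b) : RMod.regular L ⟶ M :=
  rmodHom (M := RMod.regular L) D h1 h2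

theorem rmod_hom_ext {M N : RMod L} {f g : M ⟶ N}
    (h : ∀ m, (fmap f.hom).lin m = (fmap g.hom).lin m) :
    f = g := by
  refine RMod.hom_ext (fmap_injective ?_)
  ext1
  exact LinearMap.ext h

/-- A module is the direct sum of copies of the regular module if the sum of the underlying maps is
bijective. -/
theorem nonempty_isColimit {n : ℕ} (i : Fin n → (RMod.regular L ⟶ M))
    (hinj : ∀ l : Fin n → gobj L.X, ∑ j, (regMap (i j)).lin (l j) = 0 → l = 0)
    (hsurj : ∀ m, ∃ l : Fin n → gobj L.X, ∑ j, (regMap (i j)).lin (l j) = m) :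
    Nonempty (IsColimit (Cofan.mk M i)) := by
  let Φ₀ : (Fin n → gobj L.X) →ₗ[k] gobj M.X :=
    ∑ j, (regMap (i j)).lin ∘ₗ LinearMap.proj j
  have hΦ₀ : ∀ l, Φ₀ l = ∑ j, (regMap (i j)).lin (l j) := fun l => by
    simp [Φ₀, LinearMap.sum_apply]
  let Φ : (Fin n → gobj L.X) ≃ₗ[k] gobj M.X := LinearEquiv.ofBijective Φ₀
    ⟨(injective_iff_map_eq_zero _).2 fun l hl => hinj l (by rw [← hΦ₀, hl]),
      fun m => (hsurj m).imp fun l hl => by rw [hΦ₀, hl]⟩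
  have hΦ : ∀ l, Φ l = ∑ j, (regMap (i j)).lin (l j) := hΦ₀
  -- Morphisms out of `M` are defined on coordinates. Degrees, equivariance and linearity are
  -- inherited because the maps `i j` respect them.
  have key : ∀ (N : RMod L) (s : Fin n → (RMod.regular L ⟶ N)),
      ∃ D : M ⟶ N, ∀ l : Fin n → gobj L.X, (fmap D.hom).lin (∑ j, (regMap (i j)).lin (l j)) =
        ∑ j, (regMap (s j)).lin (l j) := by
    intro N s
    let D : gobj M.X →ₗ[k] gobj N.X := (∑ j, (regMap (s j)).lin ∘ₗ LinearMap.proj j) ∘ₗ Φ.symm.toLinearMap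
    have hD : ∀ l, D (Φ l) = ∑ j, (regMap (s j)).lin (l j) := fun l => by
      simp [D, LinearMap.sum_apply]
    have hex : ∀ m, ∃ l, m = Φ l := fun m => ⟨Φ.symm m, by simp⟩
    refine ⟨rmodHom ⟨D, fun g m => ?_⟩ (fun g m => ?_) (fun m a => ?_), fun l => ?_⟩
    · obtain ⟨l, rfl⟩ := hex m
      have h1 : (gobj M.X).proj g (Φ l) = Φ fun j => (gobj L.X).proj g (l j) := by
        rw [hΦ, hΦ, map_sum]
        exact Finset.sum_congr rfl fun j _ => ((regMap (i j)).comm g (l j)).symm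
      rw [h1, hD, hD, map_sum]
      exact Finset.sum_congr rfl fun j _ => (regMap (s j)).comm g (l j)
    · obtain ⟨l, rfl⟩ := hex m
      have h1 : gact M.X g (Φ l) = Φ fun j => gact L.X g (l j) := by
        rw [hΦ, hΦ, map_sum]
        exact Finset.sum_congr rfl fun j _ => (regMap_gact (i j) g (l j)).symm
      change D _ = gact N.X g (D _)
      rw [h1, hD, hD, map_sum]
      exact Finset.sum_congr rfl fun j _ => regMap_gact (s j) g (l j)
    · obtain ⟨l, rfl⟩ := hex m
      obtain ⟨l', hl'⟩ : ∃ l' : Fin n → gobj L.X, ∀ j, l' j = (equivMul L).mul (l j) a :=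
        ⟨_, fun _ => rfl⟩
      have h1 : ract M (Φ l) a = Φ l' := by
        rw [hΦ, hΦ, map_sum, LinearMap.sum_apply]
        exact Finset.sum_congr rfl fun j _ =>
          (regMap_mul (i j) (l j) a).symm.trans (congrArg _ (hl' j).symm)
      change D _ = ract N (D _) a
      rw [h1, hD, hD, map_sum, LinearMap.sum_apply]
      exact Finset.sum_congr rfl fun j _ => (congrArg _ (hl' j)).trans (regMap_mul (s j) (l j) a)
    · rw [← hΦ, ← hD]; rfl
  have hsingle : ∀ (N : RMod L) (s : Fin n → (RMod.regular L ⟶ N)) (j : Fin n) (a : gobj L.X),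
      ∑ j', (regMap (s j')).lin (Pi.single (M := fun _ => (gobj L.X).carrier) j a j') =
        (regMap (s j)).lin a := by
    intro N s j a
    rw [Finset.sum_eq_single j]
    · rw [Pi.single_eq_same]
    · intro b _ hb; rw [Pi.single_eq_of_ne hb, map_zero]
    · simp
  choose D hD using key
  have hfac : ∀ (N : RMod L) (s : Fin n → (RMod.regular L ⟶ N)) (j : Fin n) (a : gobj L.X),
      (fmap (D N s).hom).lin ((regMap (i j)).lin a) = (regMap (s j)).lin a := fun N s j a =>
    (congrArg _ (hsingle M i j a)).symm.trans ((hD N s _).trans (hsingle N s j a))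
  refine ⟨Cofan.IsColimit.mk _ (fun s => D s.pt fun j => s.inj j) (fun s j => ?_) fun s m hm => ?_⟩
  · refine rmod_hom_ext fun a => ?_
    exact hfac s.pt (fun j => s.inj j) j a
  · refine rmod_hom_ext fun a => ?_
    obtain ⟨l, rfl⟩ := hsurj a
    refine Eq.trans ?_ (hD s.pt (fun j => s.inj j) l).symm
    refine (map_sum (fmap m.hom).lin _ _).trans (Finset.sum_congr rfl fun j _ => ?_)
    exact LinearMap.congr_fun (congrArg Hom.lin (congrArg fmap (congrArg RMod.Hom.hom (hm j)))) (l j)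

end

end CatAlg

namespace Cobounding

open GrVec CatAlg

variable {k G : Type u} [Field k] [Group G] [Fintype G] {α : Cocycle₃ k G} {H : Subgroup G}
  (γ : Cobounding α H)

/-- The action of `L(H, γ)` on a module, on elements. -/
def lact (M : RMod γ.lagrangian) : (toProj M.X).X →ₗ[k] γ.LSpace →ₗ[k] (toProj M.X).X := ract M

theorem localAction {M : RMod γ.lagrangian} (hM : M.IsLocal) :
    γ.LocalAction (toProj M.X) (γ.lact M) where
  deg _ _ _ _ hm ha := ract_deg M hm ha
  one m := (congrArg (ract M m) γ.one_lagrangian.symm).trans (ract_one M m)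
  mul _ _ _ m a b hm ha hb :=
    (congrArg (ract M m) (γ.mul_lagrangian a b).symm).trans (ract_mul M hm ha hb)
  act g f h m a hm ha := (ract_gact M g hm ha).trans
    (congrArg (fun b => (α.one g f h).val • ract M (gact M.X g m) b) (γ.gact_lagrangian g a))
  monodromy f h m a hm ha := (ract_monodromy hM hm ha).trans
    (congrArg (ract M (gact M.X (f * h * f⁻¹) m)) (γ.gact_lagrangian f a))

theorem localModulesFree_lagrangian [CharZero k] : LocalModulesFree γ.lagrangian := by
  intro M hM
  have hr := γ.localAction hM
  obtain ⟨n, m, hm, hinj, hsurj⟩ := hr.exists_basis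
  refine ⟨n, fun j => regHom (L := γ.lagrangian)
    ⟨ract M (m j), comm_of_hasDeg (V := gobj γ.lagrangian.X) _ fun g a ha => ?_⟩
    (fun g a => ?_) (fun a b => ?_), nonempty_isColimit _ hinj hsurj⟩
  · have := ract_deg M (hm j).1 ha
    rwa [one_mul] at this
  · exact (congrArg (ract M (m j)) (γ.gact_lagrangian g a)).trans (hr.act_invariant (hm j) g a).symm
  · exact (congrArg (ract M (m j)) (γ.mul_lagrangian a b)).trans (hr.mul_invariant (hm j) a b).symm

theorem isLagrangian_lagrangian [CharZero k] : IsLagrangian γ.lagrangian :=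
  ⟨γ.isFullCentre_zeta.commutative, γ.isSeparableAlgebra_lagrangian, γ.isIndecomposable_lagrangian,
    γ.localModulesFree_lagrangian⟩

end Cobounding

/-! ### Every Lagrangian algebra is of the form `L(H, γ)` -/

namespace CatAlg

open GrVec Limits

variable {k G : Type u} [Field k] [Group G] [Fintype G] {α : Cocycle₃ k G}

/-- In a commutative algebra of the centre an element of degree 1 commutes with everything, so a
primitive idempotent `q` is central. Thus `v ↦ qv` is a homomorphism onto `qL = qLq`, a twisted
group algebra, and commutativity of `L` becomes centrality of this homomorphism. -/
theorem exists_isCentral_twisted [IsAlgClosed k] {L : Mon (Center (GrVec α))}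
    (hc : (β_ L.X L.X).hom ≫ MonObj.mul (X := L.X) = MonObj.mul (X := L.X))
    (hs : IsSeparableAlgebra ((Center.forget (GrVec α)).mapMon.obj L)) (h0 : ¬ IsZero L.X) :
    ∃ (H : Subgroup G) (γ : Cobounding α H)
      (π : (Center.forget (GrVec α)).mapMon.obj L ⟶ γ.twistedGroupAlgebra),
      IsCentral γ.twistedGroupAlgebra L.X (fhom π) := by
  obtain ⟨m, hm⟩ : ∃ m : GradedMul (gobj L.X), m = (equivMul L).toGradedMul := ⟨_, rfl⟩
  have hcomm : ∀ g (a b : gobj L.X), (gobj L.X).HasDeg g a →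
      m.mul a b = m.mul (gact L.X g b) a := by
    rw [hm]; exact commutative_iff.1 hc
  have hms : m.IsSeparable := by rw [hm]; exact hs
  obtain ⟨q, hq⟩ : ∃ q, m.IsPrimitive q := by
    rw [hm]
    exact exists_isPrimitive hs fun h => h0 (isZero_center_iff.2 (isZero_iff.1 h))
  have hmul : ∀ a b : gobj L.X, (fmul L).lin (tm a b) = m.mul a b := fun a b => by rw [hm]; rfl
  have hone : (fone L).lin (unitOne : unit α) = m.one := by rw [hm]; rfl
  have hqc : m.IsCentralIdem q := ⟨hq.deg, hq.idem, fun a => by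
    rw [hcomm 1 q a hq.deg, gact_one]⟩
  obtain ⟨H, γ, inc, ret, h1, h2, h3, h4⟩ := hq.exists_twistedGroupAlgebra hms
  have hinj : ∀ {a b : γ.twistedX}, inc.lin a = inc.lin b → a = b := fun {a b} h => by
    rw [← h1 a, h, h1]
  have h5 : ∀ v, inc.lin (ret.lin v) = m.mul q v := fun v => by
    rw [h4, ← hqc.comm, m.mul_assoc_left hq.deg, hq.idem]
  have hretm : ∀ a b, ret.lin (m.mul a b) = γ.twistedMul.mul (ret.lin a) (ret.lin b) :=
    fun a b => hinj (by rw [h2, h5, h5, h5, hqc.mul_mul])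
  have hret1 : ret.lin m.one = γ.twistedMul.one := hinj (by rw [h5, h3, m.mul_one])
  have hr : ∀ a, m.mul (inc.lin a) q = inc.lin a := fun a => by
    rw [← h3, ← h2, γ.twistedMul.mul_one]
  refine ⟨H, γ, homOfForget (A := γ.twistedGroupAlgebra) ret ?_ ?_, ?_⟩
  · refine unit_hom_ext ?_
    exact (congrArg ret.lin hone).trans (hret1.trans (gradedMul_toMon_one γ.twistedMul).symm)
  · ext1
    refine ext_tm fun a b => ?_
    exact (congrArg ret.lin (hmul a b)).trans ((hretm a b).trans
      (gradedMul_toMon_mul γ.twistedMul _ _).symm)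
  · have hcen : ∀ (g : G) (a : γ.twistedX) (y : gobj L.X), γ.twistedX.HasDeg g a →
        γ.twistedMul.mul a (ret.lin y) = γ.twistedMul.mul (ret.lin (gact L.X g y)) a := by
      intro g a y ha
      refine hinj ?_
      rw [h2, h2, h5, h5, m.mul_assoc_mid hq.deg, hr, hqc.comm, ← m.mul_assoc_mid hq.deg,
        hqc.comm, hr]
      exact hcomm g (inc.lin a) y (inc.hasDeg ha)
    exact isCentral_iff_elements.2 fun g a y ha =>
      (gradedMul_toMon_mul γ.twistedMul a (ret.lin y)).trans ((hcen g a y ha).trans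
        (gradedMul_toMon_mul γ.twistedMul (ret.lin (gact L.X g y)) a).symm)

/-- Multiplication by a scalar on the regular module. -/
def regScalar (L : Mon (Center (GrVec α))) (c : k) : RMod.regular L ⟶ RMod.regular L :=
  regHom (L := L) (M := RMod.regular L)
    ⟨(c • LinearMap.id : gobj L.X →ₗ[k] gobj L.X), fun g v => (map_smul ((gobj L.X).proj g) c v).symm⟩
    (fun g a => (map_smul (gact L.X g) c a).symm)
    (fun a b => (LinearMap.congr_fun (map_smul (equivMul L).mul c a) b).symm)

/-- The zero morphism of modules. -/
def rmodZero {L : Mon (Center (GrVec α))} (M N : RMod L) : M ⟶ N :=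
  rmodHom 0 (fun g _ => (map_zero (gact N.X g)).symm)
    (fun _ a => (LinearMap.congr_fun (map_zero (ract N)) a).symm)

end CatAlg

namespace Cobounding

open GrVec CatAlg Limits

variable {k G : Type u} [Field k] [Group G] [Fintype G] {α : Cocycle₃ k G} {H : Subgroup G}
  (γ : Cobounding α H)

theorem one_lagrangian_ne_zero : (equivMul γ.lagrangian).one ≠ 0 := fun h =>
  γ.LOne_ne_zero (γ.one_lagrangian.symm.trans h)

/-- A homomorphism to `L(H, γ)` from an algebra whose local modules are free is invertible. -/
theorem nonempty_iso_lagrangian {L : Mon (Center (GrVec α))} (hL : LocalModulesFree L)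
    (φ : L ⟶ γ.lagrangian) : Nonempty (L ≅ γ.lagrangian) := by
  obtain ⟨E, hE⟩ : ∃ E, E = γ.lagrangian := ⟨_, rfl⟩
  have hcomm : (β_ E.X E.X).hom ≫ MonObj.mul (X := E.X) = MonObj.mul (X := E.X) := by
    rw [hE]; exact γ.isFullCentre_zeta.commutative
  have hunit : ∀ u : 𝟙_ (Center (GrVec α)) ⟶ E.X,
      ∃ c, u = centerScalar α c ≫ MonObj.one (X := E.X) := by
    rw [hE]; exact γ.exists_eq_centerScalar
  have h10 : (equivMul E).one ≠ 0 := by rw [hE]; exact γ.one_lagrangian_ne_zero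
  rw [← hE] at φ ⊢
  clear hE
  -- Commutativity makes the regular module of `E` local. Its restriction along `φ` is local too, so
  -- it is a direct sum of copies of `L`.
  have hloc : (RMod.regular E).IsLocal := by
    have : (β_ E.X E.X).hom ≫ (β_ E.X E.X).hom ≫ MonObj.mul (X := E.X) = MonObj.mul (X := E.X) := by
      rw [hcomm, hcomm]
    exact this
  obtain ⟨n, i, ⟨hi⟩⟩ := hL _ (hloc.restrict φ)
  -- A morphism from the regular module is determined by the image of the unit. This is a morphism
  -- from the unit object to `E`, thus a scalar, so every injection of the direct sum is a multiple
  -- of `φ`.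
  have hc : ∀ f : RMod.regular L ⟶ RMod.restrict φ (RMod.regular E), ∃ c : k, ∀ a : gobj L.X,
      (regMap f).lin a = c • (fmap φ.hom).lin a := by
    intro f
    obtain ⟨c, hc⟩ := hunit (MonObj.one (X := L.X) ≫ f.hom)
    have h1 : (regMap f).lin (equivMul L).one = c • (equivMul E).one := by
      have h2 := LinearMap.congr_fun (congrArg Hom.lin (congrArg fmap hc)) (unitOne : unit α)
      have h3 : (ofUnit (c • unitOne : unit α) (unit_hasDeg _)).lin unitOne =
        (c • unitOne : unit α) := ofUnit_one _ _
      exact h2.trans ((congrArg (fone E).lin h3).trans (map_smul (fone E).lin c unitOne))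
    refine ⟨c, fun a => ?_⟩
    have h3 := regMap_mul f (equivMul L).one a
    have h4 : (equivMul L).mul (equivMul L).one a = a := (equivMul L).one_mul a
    have h5 : (equivMul E).mul (c • (equivMul E).one) ((fmap φ.hom).lin a) =
        c • (fmap φ.hom).lin a :=
      (LinearMap.congr_fun (map_smul (equivMul E).mul c _) _).trans
        (congrArg (c • ·) ((equivMul E).one_mul ((fmap φ.hom).lin a)))
    exact (congrArg (regMap f).lin h4).symm.trans (h3.trans
      ((congrArg (fun x => (equivMul E).mul x ((fmap φ.hom).lin a)) h1).trans h5))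
  choose c hc using fun j => hc (i j)
  -- If all injections vanished, the identity of `E` would be zero.
  have hj : ∃ j, c j ≠ 0 := by
    by_contra! hall
    have h1 : 𝟙 (RMod.restrict φ (RMod.regular E)) = rmodZero _ _ := by
      refine Cofan.IsColimit.hom_ext hi _ _ fun j => rmod_hom_ext fun a => ?_
      have h2 : ∀ a : gobj L.X, (regMap (i j)).lin a = 0 := fun a => by
        rw [hc, hall, zero_smul]; rfl
      exact h2 a
    refine h10 ?_
    have h2 : fmap (RMod.Hom.hom (𝟙 (RMod.restrict φ (RMod.regular E)))) =
      fmap (rmodZero (RMod.restrict φ (RMod.regular E)) (RMod.restrict φ (RMod.regular E))).hom :=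
      congrArg fmap (congrArg RMod.Hom.hom h1)
    exact LinearMap.congr_fun (congrArg Hom.lin h2) (equivMul E).one
  obtain ⟨j, hj⟩ := hj
  -- The map `d` is prescribed by `c j` on each summand because the injections are `c j • φ`.
  -- Dividing by one non-zero `c j` gives `φ ≫ d = 1`, and the other composite is the identity on
  -- every summand.
  obtain ⟨d, hd⟩ : ∃ d : RMod.restrict φ (RMod.regular E) ⟶ RMod.regular L,
      ∀ j, i j ≫ d = regScalar L (c j) :=
    ⟨Cofan.IsColimit.desc hi fun j => regScalar L (c j), fun j => Cofan.IsColimit.fac hi _ j⟩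
  obtain ⟨D, hD⟩ : ∃ D : E.X ⟶ L.X, D = d.hom := ⟨_, rfl⟩
  have hd' : ∀ (j : Fin n) (a : gobj L.X), (fmap D).lin ((regMap (i j)).lin a) = c j • a :=
    fun j a => by
      rw [hD]
      exact LinearMap.congr_fun (congrArg Hom.lin (congrArg fmap (congrArg RMod.Hom.hom (hd j)))) a
  have e1 : φ.hom ≫ D = 𝟙 L.X := by
    refine fmap_injective (hom_ext (LinearMap.ext fun a => ?_))
    have h1 := hd' j a
    rw [hc, map_smul] at h1
    exact smul_right_injective _ hj h1
  have e2 : D ≫ φ.hom = 𝟙 E.X := by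
    have h1 : d ≫ RMod.regularRestrict φ = 𝟙 (RMod.restrict φ (RMod.regular E)) := by
      refine Cofan.IsColimit.hom_ext hi _ _ fun j => rmod_hom_ext fun a => ?_
      have h2 : ∀ a : gobj L.X, (fmap φ.hom).lin ((fmap D).lin ((regMap (i j)).lin a)) =
          (regMap (i j)).lin a := fun a => by rw [hd', map_smul, hc]
      rw [hD] at h2
      exact h2 a
    rw [hD]
    exact congrArg RMod.Hom.hom h1
  exact ⟨Mon.mkIso' ⟨φ.hom, D, e1, e2⟩⟩

end Cobounding

namespace CatAlg

variable {k G : Type u} [Field k] [Group G] [Fintype G] {α : Cocycle₃ k G}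

theorem exists_iso_lagrangian [IsAlgClosed k] {L : Mon (Center (GrVec α))} (hL : IsLagrangian L) :
    ∃ (H : Subgroup G) (γ : Cobounding α H), Nonempty (L ≅ γ.lagrangian) := by
  obtain ⟨H, γ, π, hπ⟩ := exists_isCentral_twisted hL.1 hL.2.1 hL.2.2.1.1
  obtain ⟨φ, -⟩ := γ.isFullCentre_zeta.exists_hom π hπ
  exact ⟨H, γ, γ.nonempty_iso_lagrangian hL.2.2.2 φ⟩

end CatAlg

/-! ### Isomorphic full centres -/

namespace CatAlg

section

variable {C : Type u} [Category.{v} C] [MonoidalCategory C]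

theorem isEquivalence_tensorRight {x x' : C} (e : x ⊗ x' ≅ 𝟙_ C) (e' : x' ⊗ x ≅ 𝟙_ C) :
    (tensorRight x).IsEquivalence :=
  (CategoryTheory.Equivalence.mk (tensorRight x) (tensorRight x')
    (((tensorRightTensor x x').symm ≪≫ (tensoringRight C).mapIso e ≪≫ rightUnitorNatIso C).symm)
    ((tensorRightTensor x' x).symm ≪≫ (tensoringRight C).mapIso e' ≪≫
      rightUnitorNatIso C)).isEquivalence_functor

end

open GrVec

variable {k G : Type u} [Field k] [Group G] [Fintype G] {α : Cocycle₃ k G}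

/-- The tensor product of one-dimensional spaces of inverse degrees. -/
def lineTensor {x y : G} (h : x * y = 1) : tensor (line α x) (line α y) ≅ unit α :=
  mkIso (V := tensor (line α x) (line α y)) (W := unit α) (TensorProduct.lid k k) fun g t ht => by
    by_cases hg : g = 1
    · rw [hg]; exact unit_hasDeg _
    · have h1 : (tensor (line α x) (line α y)).HasDeg 1 t := by
        rw [ridLine_tm' t, ← h]
        exact (line_hasDeg _).tm (line_hasDeg _)
      rw [ht.eq_zero h1 hg]
      exact (congrArg _ (map_zero (TensorProduct.lid k k))).trans
        ((map_zero _).trans (map_zero (TensorProduct.lid k k)).symm)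

theorem isEquivalence_tensorRight_line (x : G) :
    (tensorRight (line α x)).IsEquivalence :=
  isEquivalence_tensorRight (x' := line α x⁻¹) (lineTensor (mul_inv_cancel x))
    (lineTensor (inv_mul_cancel x))

/-- If the kernels of two split homomorphisms from an algebra in the centre are exchanged by the
action of a group element, then the two quotients have equivalent module categories. -/
theorem moduleCategoriesEquivalent_of_ker {L : Mon (Center (GrVec α))} {B B' : Mon (GrVec α)}
    (ζ : (Center.forget (GrVec α)).mapMon.obj L ⟶ B)
    (ζ' : (Center.forget (GrVec α)).mapMon.obj L ⟶ B')
    (s : B.X ⟶ gobj L.X) (hs : s ≫ fhom ζ = 𝟙 B.X)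
    (s' : B'.X ⟶ gobj L.X) (hs' : s' ≫ fhom ζ' = 𝟙 B'.X) (y : G)
    (h : ∀ a : gobj L.X, (fhom ζ).lin (gact L.X y a) = 0 ↔ (fhom ζ').lin a = 0) :
    ModuleCategoriesEquivalent B B' := by
  have hs₁ : ∀ b, (fhom ζ).lin (s.lin b) = b := fun b =>
    LinearMap.congr_fun (congrArg Hom.lin hs) b
  have hs₁' : ∀ b, (fhom ζ').lin (s'.lin b) = b := fun b =>
    LinearMap.congr_fun (congrArg Hom.lin hs') b
  have h₁ : ∀ a b : gobj L.X, (fhom ζ).lin (gact L.X y a) = (fhom ζ).lin (gact L.X y b) ↔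
      (fhom ζ').lin a = (fhom ζ').lin b := fun a b => by
    rw [← sub_eq_zero, ← map_sub, ← map_sub, h, map_sub, sub_eq_zero]
  refine moduleCategoriesEquivalent_of_halfBraiding ζ ζ' s hs s' hs' (line α y)
    (isEquivalence_tensorRight_line y) ?_ ?_
  · have key : tensorMap (fhom ζ ≫ s) (𝟙 (line α y)) ≫ ((fbraid L.X).β (line α y)).hom ≫
        tensorMap (𝟙 (line α y)) (fhom ζ') =
        ((fbraid L.X).β (line α y)).hom ≫ tensorMap (𝟙 (line α y)) (fhom ζ') := by
      ext1
      refine ext_tm fun a u => ?_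
      obtain ⟨a, rfl⟩ := gact_surjective L.X y a
      -- The element `b` is chosen so that `y.b` is the representative of the class of `y.a` given
      -- by `s`; then `a` and `b` have the same image under `ζ'`.
      obtain ⟨b, hb⟩ := gact_surjective L.X y (s.lin ((fhom ζ).lin (gact L.X y a)))
      have e1 := braid_tm L.X (line_hasDeg u) a
      have e2 := braid_tm L.X (line_hasDeg u) b
      rw [hb] at e2
      have e3 : (fhom ζ').lin b = (fhom ζ').lin a := (h₁ b a).1 (by rw [hb, hs₁])
      have e4 := (congrArg (tensorMap (𝟙 (line α y)) (fhom ζ')).lin e1)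
      have e5 := (congrArg (tensorMap (𝟙 (line α y)) (fhom ζ')).lin e2)
      refine e5.trans (Eq.trans ?_ e4.symm)
      rw [tensorMap_tm, tensorMap_tm, e3]
    exact key
  · have key : tensorMap (𝟙 (line α y)) (fhom ζ' ≫ s') ≫ zmap L.X (line α y) ≫
        tensorMap (fhom ζ) (𝟙 (line α y)) =
        zmap L.X (line α y) ≫ tensorMap (fhom ζ) (𝟙 (line α y)) := by
      ext1
      refine ext_tm fun u a => ?_
      have e3 := (h₁ (s'.lin ((fhom ζ').lin a)) a).2 (by rw [hs₁'])
      simp only [comp_lin, LinearMap.comp_apply, tensorMap_tm, id_lin, LinearMap.id_apply,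
        zmap_tm L.X (line_hasDeg u), e3]
    exact key

end CatAlg

/-! ### Kernels of homomorphisms out of `L(H, γ)`, and Morita equivalence from isomorphic centres.
-/

namespace Cobounding

open GrVec CatAlg

variable {k G : Type u} [Field k] [Group G] [Fintype G] {α : Cocycle₃ k G} {H : Subgroup G}
  (γ : Cobounding α H)

/-- Translation by `x⁻¹` brings the non-zero coefficient to the trivial coset, where `mul_elem_inv`
applies. Injectivity of the translation brings the result back to `xH`. -/
theorem exists_mul_eq_smul_idem {f : G} {a : γ.LSpace} (ha : γ.LX.HasDeg f a) {x : G} {t : H}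
    (hxt : a.1 x t ≠ 0) : ∃ (b : γ.LSpace) (c : k), c ≠ 0 ∧ γ.LMulLin a b = c • γ.idem x := by
  have hf := γ.LX_hasDeg.1 ha x t hxt
  have h1 : γ.LX.HasDeg (t : G) (γ.LAct x⁻¹ a) := by
    have := γ.LAct_hasDeg x⁻¹ ha
    have e : x⁻¹ * f * x⁻¹⁻¹ = t := by rw [← hf]; group
    rwa [e] at this
  have h2 := γ.LAct_hasDeg x (γ.elem_deg t⁻¹)
  have h3 := γ.LAct_mul x⁻¹ x _ _ (γ.LX_hasDeg.1 (γ.elem_deg t⁻¹))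
  rw [inv_mul_cancel] at h3
  have h4 : γ.LAct 1 (γ.elem t⁻¹) = γ.elem t⁻¹ := γ.LRep.act_one (γ.elem t⁻¹)
  have h5 := γ.mul_elem_inv h1
  rw [← h4, h3, map_smul, LAct_inv_apply_one] at h5
  have h6 := γ.LAct_LMulLin x⁻¹ _ _ _ _ (γ.LX_hasDeg.1 ha) (γ.LX_hasDeg.1 h2)
  have h7 := γ.LAct_idem x⁻¹ x
  rw [inv_mul_cancel] at h7
  rw [← h7] at h5
  have h8 := (eq_inv_smul_iff₀ (Units.ne_zero _)).2 h5
  rw [h8, smul_smul, smul_smul, ← map_smul] at h6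
  exact ⟨_, _, by simp [hxt], γ.LRep.act_injective x⁻¹ h6⟩

/-- The idempotents have degree 1, so their images are scalars, and some `idem x` has non-zero
image, since together they sum to `|H|` times the unit. This image is then 1. If `a(x) = 0` then `a
· idem x = 0`, whence `ψ(a) = 0`. If `a(x) ≠ 0`, some homogeneous component of `a` divides a
non-zero multiple of `idem x` and cannot be in the kernel, while the kernel is graded. -/
theorem exists_eq_zero_iff [CharZero k] {B : GrVec α} (m : GradedMul B) (h0 : m.one ≠ 0)
    (hm : ∀ b, B.HasDeg 1 b → ∃ c : k, b = c • m.one) (ψ : γ.LX ⟶ B)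
    (h1 : ψ.lin γ.LMul.one = m.one)
    (h2 : ∀ a b, ψ.lin (γ.LMul.mul a b) = m.mul (ψ.lin a) (ψ.lin b)) :
    ∃ x, ∀ a : γ.LSpace, a.1 x = 0 ↔ ψ.lin a = 0 := by
  classical
  obtain ⟨p, hp⟩ : ∃ p : γ.LSpace →ₗ[k] B, p = ψ.lin := ⟨_, rfl⟩
  have hp1 : p γ.LOne = m.one := by rw [hp]; exact h1
  have hpm : ∀ a b : γ.LSpace, p (γ.LMulLin a b) = m.mul (p a) (p b) := by rw [hp]; exact h2
  have hpd : ∀ x, ∃ c : k, p (γ.idem x) = c • m.one := fun x => by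
    rw [hp]; exact hm _ (ψ.hasDeg (γ.idem_deg x))
  have hpr : ∀ a : γ.LSpace, p a = 0 → ∀ (x : G) (t : H), ∃ a' : γ.LSpace, γ.LX.HasDeg (x * t * x⁻¹) a' ∧
      a'.1 x t = a.1 x t ∧ p a' = 0 := fun a ha x t => by
    refine ⟨γ.LX.proj (x * t * x⁻¹) a, γ.LX.hasDeg_proj _ _, if_pos rfl, ?_⟩
    rw [hp] at ha ⊢
    exact (ψ.comm _ a).trans ((congrArg _ ha).trans (map_zero _))
  obtain ⟨x, hx⟩ : ∃ x, p (γ.idem x) ≠ 0 := by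
    by_contra! hall
    have h3 := congrArg p γ.sum_idem
    rw [map_sum, map_smul, hp1, Finset.sum_eq_zero fun x _ => hall x] at h3
    rcases smul_eq_zero.1 h3.symm with h4 | h4
    · exact Fintype.card_ne_zero (Nat.cast_eq_zero.1 h4)
    · exact h0 h4
  have hx1 : p (γ.idem x) = m.one := by
    obtain ⟨c, hc⟩ := hpd x
    have h3 := hpm (γ.idem x) (γ.idem x)
    rw [γ.idem_mul_idem_self, hc, map_smul, map_smul, LinearMap.smul_apply, m.one_mul, smul_smul] at h3
    have h4 : c * c = c := (smul_left_injective k h0 h3).symm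
    have hc0 : c ≠ 0 := by rintro rfl; rw [zero_smul] at hc; exact hx hc
    have h5 : c = 1 := mul_left_cancel₀ hc0 (h4.trans (mul_one c).symm)
    rw [hc, h5, one_smul]
  refine ⟨x, fun a => ?_⟩
  have hgoal : a.1 x = 0 ↔ p a = 0 := by
    constructor
    · intro ha
      have h3 : γ.LMulLin a (γ.idem x) = 0 := by
        apply Subtype.ext
        funext y t
        rw [mul_idem_apply]
        split
        · rename_i hy
          have h4 := a.2 x ⟨x⁻¹ * y, hy⟩ (⟨x⁻¹ * y, hy⟩ * t * ⟨x⁻¹ * y, hy⟩⁻¹)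
          rw [ha] at h4
          have e : (⟨x⁻¹ * y, hy⟩⁻¹ * (⟨x⁻¹ * y, hy⟩ * t * ⟨x⁻¹ * y, hy⟩⁻¹) * ⟨x⁻¹ * y, hy⟩ : H) = t := by
            group
          rw [e, mul_inv_cancel_left, Pi.zero_apply, mul_zero] at h4
          exact h4
        · rfl
      have h5 := hpm a (γ.idem x)
      rw [h3, hx1, m.mul_one, map_zero] at h5
      exact h5.symm
    · intro ha
      funext t
      by_contra hne
      obtain ⟨a', ha', hxt, hpa⟩ := hpr a ha x t
      obtain ⟨b, c, hc, hb⟩ := γ.exists_mul_eq_smul_idem ha' (x := x) (t := t) (by rwa [hxt])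
      have h3 := congrArg p hb
      rw [hpm, hpa, map_zero, LinearMap.zero_apply, map_smul, hx1] at h3
      exact (smul_ne_zero hc h0) h3.symm
  rw [hp] at hgoal
  exact hgoal

/-- The section `e_t ↦ E_t` of the evaluation. -/
def evalSection : γ.twistedX ⟶ γ.LX where
  lin := (Fintype.linearCombination k γ.elem : (H → k) →ₗ[k] γ.LSpace)
  comm := comm_of_hasDeg (V := γ.twistedX) (W := γ.LX) _ fun g a ha => by
    classical
    have key : ∀ a : H → k, (∀ t : H, a t ≠ 0 → (t : G) = g) →
        γ.LX.HasDeg g (Fintype.linearCombination k γ.elem a) := by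
      intro a ha
      rw [Fintype.linearCombination_apply]
      refine HasDeg.sum (V := γ.LX) fun t _ => ?_
      by_cases h0 : a t = 0
      · rw [h0, zero_smul]; exact HasDeg.zero _ _
      · rw [← ha t h0]; exact (γ.elem_deg t).smul _
    exact key a (γ.twistedX_hasDeg.1 ha)

theorem evalSection_evalHom : γ.evalSection ≫ γ.evalHom = 𝟙 γ.twistedX := by
  classical
  refine hom_ext (LinearMap.ext fun a => ?_)
  have key : ∀ a : H → k, (Fintype.linearCombination k γ.elem a).1 1 = a := by
    intro a
    rw [Fintype.linearCombination_apply, Submodule.coe_sum, Finset.sum_apply]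
    funext t
    simp [elem_apply_one, Finset.sum_apply, Pi.single_apply]
  exact key a

theorem moduleCategoriesEquivalent_of_iso [CharZero k] {H' : Subgroup G} (γ' : Cobounding α H')
    (e : γ.lagrangian ≅ γ'.lagrangian) :
    ModuleCategoriesEquivalent γ.twistedGroupAlgebra γ'.twistedGroupAlgebra := by
  have e1 : fmap e.inv.hom ≫ fmap e.hom.hom = 𝟙 γ'.LX :=
    congrArg fmap (congrArg Mon.Hom.hom e.inv_hom_id)
  obtain ⟨ζ', hζ'⟩ : ∃ ζ' : (Center.forget (GrVec α)).mapMon.obj γ.lagrangian ⟶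
      γ'.twistedGroupAlgebra, fhom ζ' = fmap e.hom.hom ≫ fhom γ'.zeta :=
    ⟨(Center.forget (GrVec α)).mapMon.map e.hom ≫ γ'.zeta, rfl⟩
  have h1 : (fhom ζ').lin (equivMul γ.lagrangian).one = γ'.twistedMul.one :=
    (LinearMap.congr_fun (congrArg Hom.lin (fone_fhom ζ')) unitOne).trans
      (gradedMul_toMon_one γ'.twistedMul)
  have h2 : ∀ a b, (fhom ζ').lin ((equivMul γ.lagrangian).mul a b) =
      γ'.twistedMul.mul ((fhom ζ').lin a) ((fhom ζ').lin b) := fun a b =>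
    (LinearMap.congr_fun (congrArg Hom.lin (fmul_fhom ζ')) (tm a b)).trans
      (gradedMul_toMon_mul γ'.twistedMul _ _)
  obtain ⟨x, hx⟩ := γ.exists_eq_zero_iff γ'.twistedMul γ'.twistedMul_one_ne_zero
    (fun b hb => γ'.twisted_hasDeg_one hb) (fhom ζ')
    ((congrArg (fhom ζ').lin γ.one_lagrangian.symm).trans h1)
    (fun a b => (congrArg (fhom ζ').lin (γ.mul_lagrangian a b).symm).trans (h2 a b))
  -- The element is `x⁻¹` because `ζ(x⁻¹.a) = a(x)`, and `ζ'` kills exactly the `a` with `a(x) = 0`.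
  refine moduleCategoriesEquivalent_of_ker γ.zeta ζ' γ.evalSection γ.evalSection_evalHom
    (γ'.evalSection ≫ fmap e.inv.hom) ?_ x⁻¹ fun a => ?_
  · rw [hζ']
    have key : ∀ {P Q R : GrVec α} (s : P ⟶ Q) (i : Q ⟶ R) (j : R ⟶ Q) (v : Q ⟶ P), i ≫ j = 𝟙 Q →
        s ≫ v = 𝟙 P → (s ≫ i) ≫ j ≫ v = 𝟙 P := fun s i j v h h' => by
      rw [Category.assoc, reassoc_of% h, h']
    exact key γ'.evalSection _ _ γ'.evalHom e1 γ'.evalSection_evalHom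
  · refine Iff.trans ?_ (hx a)
    have key : ∀ a : γ.LSpace, (γ.LAct x⁻¹ a).1 1 = a.1 x := fun a =>
      funext fun t => γ.LAct_inv_apply_one x t a
    have h3 : (fhom γ.zeta).lin (gact γ.lagrangian.X x⁻¹ a) = (γ.LAct x⁻¹ a).1 1 :=
      congrArg γ.evalHom.lin (γ.gact_lagrangian x⁻¹ a)
    have h4 := h3.trans (key a)
    exact ⟨fun h => h4.symm.trans h, fun h => h4.trans h⟩

end Cobounding

end

/-! ### The main theorem. -/

theorem mainTheorem6 {k G : Type u} [Field k] [IsAlgClosed k] [CharZero k] [Group G] [Fintype G]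
    (α : Cocycle₃ k G) :
    -- the full centre of `k[H, γ]` is the Lagrangian algebra `L(H, γ)`
    (∀ (H : Subgroup G) (γ : Cobounding α H),
      IsSeparableAlgebra γ.twistedGroupAlgebra ∧ CatAlg.IsIndecomposable γ.twistedGroupAlgebra ∧
        IsLagrangian γ.lagrangian ∧
        CatAlg.IsFullCentre γ.twistedGroupAlgebra γ.lagrangian γ.zeta) ∧
    -- indecomposable separable algebras have full centres
    (∀ A : Mon (GrVec α), IsSeparableAlgebra A → CatAlg.IsIndecomposable A →
      ∃ (L : Mon (Center (GrVec α))) (ζ : (Center.forget (GrVec α)).mapMon.obj L ⟶ A),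
        CatAlg.IsFullCentre A L ζ) ∧
    -- Lagrangian algebras are precisely the full centres of indecomposable separable algebras
    (∀ L : Mon (Center (GrVec α)), IsLagrangian L ↔
      ∃ (A : Mon (GrVec α)) (ζ : (Center.forget (GrVec α)).mapMon.obj L ⟶ A),
        IsSeparableAlgebra A ∧ CatAlg.IsIndecomposable A ∧ CatAlg.IsFullCentre A L ζ) ∧
    -- up to isomorphism, the Lagrangian algebras are the algebras `L(H, γ)`
    (∀ L : Mon (Center (GrVec α)), IsLagrangian L →
      ∃ (H : Subgroup G) (γ : Cobounding α H), Nonempty (L ≅ γ.lagrangian)) ∧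
    -- full centres are isomorphic if and only if the module categories are equivalent
    (∀ (A A' : Mon (GrVec α)) (L L' : Mon (Center (GrVec α)))
      (ζ : (Center.forget (GrVec α)).mapMon.obj L ⟶ A)
      (ζ' : (Center.forget (GrVec α)).mapMon.obj L' ⟶ A'),
      IsSeparableAlgebra A → CatAlg.IsIndecomposable A →
      IsSeparableAlgebra A' → CatAlg.IsIndecomposable A' →
      CatAlg.IsFullCentre A L ζ → CatAlg.IsFullCentre A' L' ζ' →
      (Nonempty (L ≅ L') ↔ CatAlg.ModuleCategoriesEquivalent A A')) := by
  have hH : ∀ (H : Subgroup G) (γ : Cobounding α H),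
      IsSeparableAlgebra γ.twistedGroupAlgebra ∧ CatAlg.IsIndecomposable γ.twistedGroupAlgebra ∧
        IsLagrangian γ.lagrangian ∧
        CatAlg.IsFullCentre γ.twistedGroupAlgebra γ.lagrangian γ.zeta := fun H γ =>
    ⟨γ.isSeparableAlgebra_twisted, γ.isIndecomposable_twisted, γ.isLagrangian_lagrangian,
      γ.isFullCentre_zeta⟩
  refine ⟨hH, fun A hs hA => ?_, fun L => ⟨fun hL => ?_, ?_⟩,
    fun L hL => CatAlg.exists_iso_lagrangian hL, ?_⟩
  · obtain ⟨H, γ, h⟩ := CatAlg.exists_moduleCategoriesEquivalent hs hA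
    exact ⟨γ.lagrangian, γ.isFullCentre_zeta.transport h.symm⟩
  · obtain ⟨H, γ, ⟨e⟩⟩ := CatAlg.exists_iso_lagrangian hL
    obtain ⟨ζ, hζ⟩ := γ.isFullCentre_zeta.of_iso e
    exact ⟨γ.twistedGroupAlgebra, ζ, γ.isSeparableAlgebra_twisted, γ.isIndecomposable_twisted, hζ⟩
  · rintro ⟨A, ζ, hs, hA, hζ⟩
    obtain ⟨H, γ, h⟩ := CatAlg.exists_moduleCategoriesEquivalent hs hA
    -- The full centre of `A` is also one of the Morita equivalent `k[H, γ]`, so by uniqueness it is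
    -- `L(H, γ)`, and being Lagrangian passes along the isomorphism.
    obtain ⟨ζ', hζ'⟩ := hζ.transport h
    obtain ⟨e⟩ := γ.isFullCentre_zeta.unique hζ'
    exact CatAlg.isLagrangian_of_iso γ.isLagrangian_lagrangian e
  · intro A A' L L' ζ ζ' hs hA hs' hA' hζ hζ'
    constructor
    · rintro ⟨e⟩
      -- Both algebras are replaced by Morita equivalent twisted group algebras. The full centres
      -- stay the same, so `e` becomes an isomorphism from `L(H, γ)` to `L(H', γ')`.
      obtain ⟨H, γ, h⟩ := CatAlg.exists_moduleCategoriesEquivalent hs hA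
      obtain ⟨H', γ', h'⟩ := CatAlg.exists_moduleCategoriesEquivalent hs' hA'
      obtain ⟨ξ, hξ⟩ := hζ.transport h
      obtain ⟨ξ', hξ'⟩ := hζ'.transport h'
      obtain ⟨i⟩ := γ.isFullCentre_zeta.unique hξ
      obtain ⟨i'⟩ := hξ'.unique γ'.isFullCentre_zeta
      exact (h.trans (γ.moduleCategoriesEquivalent_of_iso γ' (i ≪≫ e ≪≫ i'))).trans h'.symm
    · intro h
      obtain ⟨ξ, hξ⟩ := hζ.transport h
      exact hξ.unique hζ'
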